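/- Let $M$ be a (non-empty, Hausdorff, second countable) smooth manifold of dimension $n\ge 2$. A *strongly convex cone structure* on $M$ is a subset $C\subset TM$ such that each $C_p=C\cap T_pM$ is a closed convex subset of $T_pM\setminus\{0\}$ with non-empty interior, invariant under positive scalars and containing no pair $v,-v$, whose boundary in $T_pM\setminus\{0\}$ is a smooth hypersurface with positive semidefinite second fundamental form (with respect to the outward direction) having kernel $\mathbb R v$ at each $v\in\partial C_p$, and such that the boundary $\partial C$ of $C$ in $TM\setminus\{0\}$ is an embedded smooth hypersurface transverse to the fibres. It is *strongly causal* if every neighbourhood of every point $p\in M$ contains an open neighbourhood $V$ of $p$ such that every smooth curve with velocities in $C$ and end points in $V$ stays in $V$. Let $C^*=\{u\in T^*M\mid u(w)\ge 0\ \forall w\in C_{p(u)}\}$, where $p(u)\in M$ is the base point of $u$, let $\partial C^*$ be the boundary of $C^*$ in $T^*M\setminus\{0\}$, and let $\lambda$ be the Liouville form of $T^*M$, $\lambda_u(w)=u(d\tau(w))$ with $\tau:T^*M\to M$ the projection. A Lorentz–Finsler metric $L$ defining $C$ is a smooth, positively $2$-homogeneous function on an open conic neighbourhood of $\partial C$ in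 $TM\setminus\{0\}$ whose fundamental tensors $g_v$ (the fibrewise Hessians of $L$) have signature $(-,+,\dots,+)$ and whose zero set is $\partial C$. The space $\mathcal N_C$ of unparametrized inextensible cone geodesics is the quotient of $\partial C^*$, with the quotient topology, by the equivalence relation generated by: $u\sim u'$ if for some such $L$ there are a geodesic $\gamma$ of $L$ with $\gamma'\in\partial C$ and parameters $s,s'$ such that $u$ and $u'$ are real multiples of $g_{\gamma'(s)}(\gamma'(s),\cdot)$ and $g_{\gamma'(s')}(\gamma'(s'),\cdot)$, respectively. Let $\pi:\partial C^*\to\mathcal N_C$ be the projection. **Proposition.** Let $C$ be a strongly causal strongly convex cone structure on $M$, and suppose that $\mathcal N_C$ carries the structure of a smooth Hausdorff manifold (compatible with its topology) for which $\pi$ is a smooth submersion. Then $$\xi_C:=d\pi(\ker\lambda\cap T\partial C^*)$$ is a contact structure on $\mathcal N_C$, cooriented by $\lambda$: there is a smooth $1$-form $\alpha$ on $\mathcal N_C$ with $\ker\alpha=\xi_C$ such that $\dim\mathcal N_C=2m+1$ is odd and $\alpha\wedge(d\alpha)^m$ is a volume form, and such that for all $w\in T\partial C^*$ one has $\alpha(d\pi(w))>0$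 if and only if $\lambda(w)>0$. -/

import Mathlib

open Set Bundle Topology
open scoped Manifold ContDiff

noncomputable section

namespace ConeStr

/-! ### Tangent and cotangent bundle, velocities, Liouville form -/

section Bundles

variable (E : Type*) [NormedAddCommGroup E] [NormedSpace ℝ E]
  (M : Type*) [TopologicalSpace M] [ChartedSpace E M] [IsManifold 𝓘(ℝ, E) ∞ M]

/-- The cotangent bundle `T*M`, as the bundle of continuous linear maps from the tangent bundle
to the trivial line bundle. -/
abbrev CotangentBundle : Type _ :=
  TotalSpace (E →L[ℝ] ℝ) (fun p : M => TangentSpace 𝓘(ℝ, E) p →L[ℝ] Trivial M ℝ p)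

/-- The model with corners of `T*M`. -/
abbrev cotangentModel : ModelWithCorners ℝ (E × (E →L[ℝ] ℝ)) (ModelProd E (E →L[ℝ] ℝ)) :=
  𝓘(ℝ, E).prod 𝓘(ℝ, E →L[ℝ] ℝ)

variable {E M}

/-- The value of a covector `u ∈ T*M` over `p` on a tangent vector `w ∈ T_pM`. -/
def pairing (u : CotangentBundle E M) (w : TangentSpace 𝓘(ℝ, E) u.proj) : ℝ := u.2 w

/-- The Liouville form `λ` of `T*M`, as a function on `T(T*M)`: for `w ∈ T_u T*M`,
`λ_u(w) = u (dπ w)` where `π : T*M → M` is the projection. -/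
def liouville (w : TangentBundle (cotangentModel E) (CotangentBundle E M)) : ℝ :=
  pairing w.proj (mfderiv (cotangentModel E) 𝓘(ℝ, E)
    (fun u : CotangentBundle E M => u.proj) w.proj w.2)

end Bundles

section Velocity

variable {E' H' : Type*} [NormedAddCommGroup E'] [NormedSpace ℝ E'] [TopologicalSpace H']
  (I : ModelWithCorners ℝ E' H') {X : Type*} [TopologicalSpace X] [ChartedSpace H' X]

/-- The velocity `γ'(t)` of a curve `γ : ℝ → X`, as a point of `TX`. -/
def velocity (γ : ℝ → X) (t : ℝ) : TangentBundle I X :=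
  ⟨γ t, mfderiv 𝓘(ℝ, ℝ) I γ t (1 : ℝ)⟩

/-- The (one-sided at end points) velocity at `t ∈ s` of a curve defined on `s ⊆ ℝ`. -/
def velocityWithin (γ : ℝ → X) (s : Set ℝ) (t : ℝ) : TangentBundle I X :=
  ⟨γ t, mfderivWithin 𝓘(ℝ, ℝ) I γ s t (1 : ℝ)⟩

end Velocity

/-! ### Cones in a vector space -/

section Cones

variable {E : Type*} [NormedAddCommGroup E] [NormedSpace ℝ E]

/-- A closed cone: a closed subset of `E \ {0}` that is invariant under positive scalars and
contains no pair `v, -v`. -/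
structure IsClosedCone (K : Set E) : Prop where
  zero_notMem : (0 : E) ∉ K
  closed : ∀ v ∈ closure K, v ≠ 0 → v ∈ K
  smul_mem : ∀ v ∈ K, ∀ r : ℝ, 0 < r → r • v ∈ K
  neg_notMem : ∀ v ∈ K, -v ∉ K

/-- A proper cone: a closed cone that is convex and has non-empty interior. -/
structure IsProperCone (K : Set E) : Prop extends IsClosedCone K where
  convex : Convex ℝ K
  interior_nonempty : (interior K).Nonempty

/-- A strongly convex cone: a proper cone `K` whose boundary in `E \ {0}` is a smooth hypersurface,
given near each of its points `v` as the zero set of a function `ρ` with `dρ_v ≠ 0` which is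
nonpositive exactly on `K` (so that `dρ` points outward); the second fundamental form of the
boundary at `v`, which is the Hessian of `ρ` on `ker dρ_v` up to a positive factor, is positive
semidefinite and its kernel is the line spanned by `v`. -/
structure IsStronglyConvexCone (K : Set E) : Prop extends IsProperCone K where
  boundary : ∀ v ∈ frontier K, v ≠ 0 → ∃ (W : Set E) (ρ : E → ℝ), IsOpen W ∧ v ∈ W ∧
    ContDiffOn ℝ ∞ ρ W ∧ (∀ x ∈ W, x ∈ K ↔ ρ x ≤ 0) ∧ fderiv ℝ ρ v ≠ 0 ∧
    (∀ w, fderiv ℝ ρ v w = 0 → 0 ≤ fderiv ℝ (fderiv ℝ ρ) v w w) ∧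
    (∀ w, fderiv ℝ ρ v w = 0 →
      ((∀ w', fderiv ℝ ρ v w' = 0 → fderiv ℝ (fderiv ℝ ρ) v w w' = 0) ↔
        ∃ r : ℝ, w = r • v))

/-- A symmetric bilinear form of signature `(-,+,…,+)`: there is a vector `e` with `B(e,e) < 0`,
and `B` is positive definite on the `B`-orthogonal complement of `e`. -/
def IsLorentzForm (B : E →L[ℝ] E →L[ℝ] ℝ) : Prop :=
  (∀ v w, B v w = B w v) ∧ ∃ e, B e e < 0 ∧ ∀ w, B e w = 0 → w ≠ 0 → 0 < B w w

end Cones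

/-! ### Cone structures and causality -/

section ConeStructures

variable {E : Type*} [NormedAddCommGroup E] [NormedSpace ℝ E]
  {M : Type*} [TopologicalSpace M] [ChartedSpace E M] [IsManifold 𝓘(ℝ, E) ∞ M]

/-- The part `C_p = C ∩ T_pM` of `C ⊆ TM`; recall that `T_pM` is `E` as a vector space. -/
def fibre (C : Set (TangentBundle 𝓘(ℝ, E) M)) (p : M) : Set E :=
  {y | (⟨p, y⟩ : TangentBundle 𝓘(ℝ, E) M) ∈ C}

/-- The boundary `∂C` of `C` in `TM` minus the zero section. -/
def boundary (C : Set (TangentBundle 𝓘(ℝ, E) M)) : Set (TangentBundle 𝓘(ℝ, E) M) :=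
  {v | v ∈ frontier C ∧ v.2 ≠ 0}

/-- A strongly convex cone structure: every `C_p` is a strongly convex cone, and `∂C` is an embedded
smooth hypersurface of `TM` transverse to the fibres, i.e. it is given near each of its points as
the zero set of a smooth function whose derivative along the fibre does not vanish. -/
structure IsStronglyConvexConeStructure (C : Set (TangentBundle 𝓘(ℝ, E) M)) : Prop where
  fibre_cone : ∀ p : M, IsStronglyConvexCone (fibre C p)
  boundary_hypersurface : ∀ v ∈ boundary C,
    ∃ (W : Set (TangentBundle 𝓘(ℝ, E) M)) (ρ : TangentBundle 𝓘(ℝ, E) M → ℝ),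
      IsOpen W ∧ v ∈ W ∧ ContMDiffOn 𝓘(ℝ, E).tangent 𝓘(ℝ, ℝ) ∞ ρ W ∧
      (∀ x ∈ W, x ∈ boundary C ↔ ρ x = 0) ∧
      fderiv ℝ (fun y : E => ρ ⟨v.proj, y⟩) v.2 ≠ 0

/-- A future pointing causal curve on `[a, b]`: a smooth curve all of whose velocities are
in `C`. -/
def IsCausalCurve (C : Set (TangentBundle 𝓘(ℝ, E) M)) (γ : ℝ → M) (a b : ℝ) : Prop :=
  ContMDiffOn 𝓘(ℝ, ℝ) 𝓘(ℝ, E) ∞ γ (Icc a b) ∧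
    ∀ t ∈ Icc a b, velocityWithin 𝓘(ℝ, E) γ (Icc a b) t ∈ C

/-- `V` is causally convex: causal curves with end points in `V` stay in `V`. -/
def IsCausallyConvex (C : Set (TangentBundle 𝓘(ℝ, E) M)) (V : Set M) : Prop :=
  ∀ (γ : ℝ → M) (a b : ℝ), a < b → IsCausalCurve C γ a b → γ a ∈ V → γ b ∈ V →
    ∀ t ∈ Icc a b, γ t ∈ V

/-- Strong causality: every point has arbitrarily small causally convex open neighbourhoods. -/
def IsStronglyCausal (C : Set (TangentBundle 𝓘(ℝ, E) M)) : Prop :=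
  ∀ (p : M) (U : Set M), IsOpen U → p ∈ U →
    ∃ V : Set M, IsOpen V ∧ p ∈ V ∧ V ⊆ U ∧ IsCausallyConvex C V

/-- The dual cone structure `C* = {u ∈ T*M | u(w) ≥ 0 for all w ∈ C}`. -/
def dualCone (C : Set (TangentBundle 𝓘(ℝ, E) M)) : Set (CotangentBundle E M) :=
  {u | ∀ w : TangentSpace 𝓘(ℝ, E) u.proj,
    (⟨u.proj, w⟩ : TangentBundle 𝓘(ℝ, E) M) ∈ C → 0 ≤ pairing u w}

/-- The boundary `∂C*` of `C*` in `T*M` minus the zero section. -/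
def dualBoundary (C : Set (TangentBundle 𝓘(ℝ, E) M)) : Set (CotangentBundle E M) :=
  {u | u ∈ frontier (dualCone C) ∧ u.2 ≠ 0}

/-! ### Lorentz-Finsler metrics and their null geodesics -/

/-- The fundamental tensor `g_v(w, w') = ∂²/∂s∂t L(v + s w + t w')` (at `s = t = 0`) of `L`. -/
def fundamentalTensor (L : TangentBundle 𝓘(ℝ, E) M → ℝ) (v : TangentBundle 𝓘(ℝ, E) M) :
    E →L[ℝ] E →L[ℝ] ℝ :=
  fderiv ℝ (fderiv ℝ (fun y : E => L ⟨v.proj, y⟩)) v.2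

/-- `L` is a Lorentz-Finsler metric defining the cone structure `C`: it is defined on an open conic
neighbourhood `A` of `∂C` in `TM`, is smooth and positively homogeneous of degree two, its
fundamental tensor has signature `(-,+,…,+)`, and its zero set is `∂C`. -/
structure IsLorentzFinslerMetric (C : Set (TangentBundle 𝓘(ℝ, E) M))
    (A : Set (TangentBundle 𝓘(ℝ, E) M)) (L : TangentBundle 𝓘(ℝ, E) M → ℝ) : Prop where
  isOpen : IsOpen A
  conic : ∀ (p : M) (y : E) (r : ℝ), 0 < r → (⟨p, y⟩ : TangentBundle 𝓘(ℝ, E) M) ∈ A →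
    (⟨p, r • y⟩ : TangentBundle 𝓘(ℝ, E) M) ∈ A
  smooth : ContMDiffOn 𝓘(ℝ, E).tangent 𝓘(ℝ, ℝ) ∞ L A
  homogeneous : ∀ (p : M) (y : E) (r : ℝ), 0 < r → (⟨p, y⟩ : TangentBundle 𝓘(ℝ, E) M) ∈ A →
    L ⟨p, r • y⟩ = r ^ 2 * L ⟨p, y⟩
  lorentz : ∀ v ∈ A, IsLorentzForm (fundamentalTensor L v)
  boundary_eq : boundary C = {v | v ∈ A ∧ L v = 0}

/-- The Lagrangian `L` in the coordinates `(x, y)` of `TM` induced by the chart of `M`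
at `x₀`. -/
def localLagrangian (L : TangentBundle 𝓘(ℝ, E) M → ℝ) (x₀ : M) : E × E → ℝ :=
  fun z => L ((extChartAt 𝓘(ℝ, E).tangent (⟨x₀, 0⟩ : TangentBundle 𝓘(ℝ, E) M)).symm z)

/-- The coordinates `(x(t), x'(t))` of the velocity of a curve. -/
def localVelocity (γ : ℝ → M) (x₀ : M) (t : ℝ) : E × E :=
  extChartAt 𝓘(ℝ, E).tangent (⟨x₀, 0⟩ : TangentBundle 𝓘(ℝ, E) M) (velocity 𝓘(ℝ, E) γ t)

/-- A future pointing null geodesic of `L` on the interval `(a, b)`: a smooth curve with velocities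
in `∂C` that satisfies the geodesic equation of `L`, i.e. the Euler-Lagrange equation
`d/dt (∂L/∂y (x, x')) = ∂L/∂x (x, x')` of the energy `½ ∫ L(γ')`, in the charts of `M`. -/
structure IsNullGeodesic (C : Set (TangentBundle 𝓘(ℝ, E) M))
    (L : TangentBundle 𝓘(ℝ, E) M → ℝ) (γ : ℝ → M) (a b : ℝ) : Prop where
  smooth : ContMDiffOn 𝓘(ℝ, ℝ) 𝓘(ℝ, E) ∞ γ (Ioo a b)
  null : ∀ t ∈ Ioo a b, velocity 𝓘(ℝ, E) γ t ∈ boundary C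
  eulerLagrange : ∀ t ∈ Ioo a b, ∀ x₀ : M, γ t ∈ (chartAt E x₀).source →
    HasDerivAt
      (fun s => (fderiv ℝ (localLagrangian L x₀) (localVelocity γ x₀ s)).comp
        (ContinuousLinearMap.inr ℝ E E))
      ((fderiv ℝ (localLagrangian L x₀) (localVelocity γ x₀ t)).comp
        (ContinuousLinearMap.inl ℝ E E)) t

/-- The Legendre transform `v ↦ g_v(v, ·)` of `L`, followed by multiplication with `r`. -/
def legendre (L : TangentBundle 𝓘(ℝ, E) M → ℝ) (r : ℝ) (v : TangentBundle 𝓘(ℝ, E) M) :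
    CotangentBundle E M :=
  ⟨v.proj, r • fundamentalTensor L v v.2⟩

/-! ### The space of cone geodesics -/

/-- Two covectors in `∂C*` lie on the same leaf of the foliation spanned by the push-forward of the
geodesic spray under the Legendre transform and by the fibrewise scalar multiplication: up to
scalar factors, they are Legendre transforms of velocities of one null geodesic, for some
Lorentz-Finsler metric defining `C`. The factor is allowed to be negative since, depending on
conventions, the Legendre transform maps `∂C` to `∂C*` or to `-∂C*`. -/
def SameConeGeodesic (C : Set (TangentBundle 𝓘(ℝ, E) M)) (u u' : dualBoundary C) : Prop :=
  ∃ (A : Set (TangentBundle 𝓘(ℝ, E) M)) (L : TangentBundle 𝓘(ℝ, E) M → ℝ) (γ : ℝ → M) (a b : ℝ),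
    IsLorentzFinslerMetric C A L ∧ IsNullGeodesic C L γ a b ∧
    ∃ s ∈ Ioo a b, ∃ s' ∈ Ioo a b, ∃ r r' : ℝ,
      (u : CotangentBundle E M) = legendre L r (velocity 𝓘(ℝ, E) γ s) ∧
      (u' : CotangentBundle E M) = legendre L r' (velocity 𝓘(ℝ, E) γ s')

/-- The space `𝒩_C` of unparametrized inextensible cone geodesics: the leaf space of `∂C*`, i.e.
its quotient by the equivalence relation generated by `SameConeGeodesic`, with the quotient
topology. -/
def GeodesicSpace (C : Set (TangentBundle 𝓘(ℝ, E) M)) : Type _ := Quot (SameConeGeodesic C)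

instance (C : Set (TangentBundle 𝓘(ℝ, E) M)) : TopologicalSpace (GeodesicSpace C) :=
  inferInstanceAs (TopologicalSpace (Quot (SameConeGeodesic C)))

/-- The projection `π : ∂C* → 𝒩_C`. -/
def geodesicProj (C : Set (TangentBundle 𝓘(ℝ, E) M)) (u : dualBoundary C) : GeodesicSpace C :=
  Quot.mk _ u

/-- A smooth curve in `∂C*`, i.e. a smooth curve in `T*M` with values in `∂C*`. The vectors
tangent to `∂C*` are the velocities of such curves. -/
def IsSmoothCurve {C : Set (TangentBundle 𝓘(ℝ, E) M)} (c : ℝ → dualBoundary C) : Prop :=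
  ContMDiff 𝓘(ℝ, ℝ) (cotangentModel E) ∞ (fun t => (c t : CotangentBundle E M))

variable {F : Type*} [NormedAddCommGroup F] [NormedSpace ℝ F]

/-- A map `f` from the hypersurface `∂C* ⊆ T*M` to a manifold `N` is a submersion: it is smooth,
i.e. it extends locally to a smooth map on an open subset of `T*M`, and its differential
`c'(0) ↦ (f ∘ c)'(0)` is surjective at every point. -/
structure IsSubmersion {C : Set (TangentBundle 𝓘(ℝ, E) M)}
    {N : Type*} [TopologicalSpace N] [ChartedSpace F N] (f : dualBoundary C → N) : Prop where
  smooth : ∀ u : dualBoundary C, ∃ (U : Set (CotangentBundle E M)) (g : CotangentBundle E M → N),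
    IsOpen U ∧ (u : CotangentBundle E M) ∈ U ∧ ContMDiffOn (cotangentModel E) 𝓘(ℝ, F) ∞ g U ∧
    ∀ u' : dualBoundary C, (u' : CotangentBundle E M) ∈ U → g u' = f u'
  surjective : ∀ (u : dualBoundary C) (y : TangentBundle 𝓘(ℝ, F) N), y.proj = f u →
    ∃ c : ℝ → dualBoundary C, IsSmoothCurve c ∧ c 0 = u ∧ velocity 𝓘(ℝ, F) (f ∘ c) 0 = y

/-- The distribution `ξ_C = dπ(ker λ ∩ T∂C*)` on `𝒩_C`, as a subset of `T𝒩_C`. -/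
def geodesicDistribution (C : Set (TangentBundle 𝓘(ℝ, E) M)) [ChartedSpace F (GeodesicSpace C)] :
    Set (TangentBundle 𝓘(ℝ, F) (GeodesicSpace C)) :=
  {y | ∃ c : ℝ → dualBoundary C, IsSmoothCurve c ∧
    liouville (velocity (cotangentModel E) (fun t => (c t : CotangentBundle E M)) 0) = 0 ∧
    y = velocity 𝓘(ℝ, F) (geodesicProj C ∘ c) 0}

end ConeStructures

/-! ### Contact structures -/

section Contact

variable {F : Type*} [NormedAddCommGroup F] [NormedSpace ℝ F]
  {N : Type*} [TopologicalSpace N] [ChartedSpace F N]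

/-- The coordinate expression `(φ⁻¹)^* α` of a one-form in the chart `φ` of `N` at `x`. -/
def localForm (α : ∀ x : N, TangentSpace 𝓘(ℝ, F) x →L[ℝ] ℝ) (x : N) (z : F) : F →L[ℝ] ℝ :=
  (α ((extChartAt 𝓘(ℝ, F) x).symm z)).comp
    (mfderiv 𝓘(ℝ, F) 𝓘(ℝ, F) (extChartAt 𝓘(ℝ, F) x).symm z)

/-- The exterior derivative `dα_x(v, w)`, computed in the chart of `N` at `x`, whose
differential at `x` is the identity of `T_xN = F`. -/
def extDer (α : ∀ x : N, TangentSpace 𝓘(ℝ, F) x →L[ℝ] ℝ) (x : N) (v w : F) : ℝ :=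
  fderiv ℝ (localForm α x) (extChartAt 𝓘(ℝ, F) x x) v w -
    fderiv ℝ (localForm α x) (extChartAt 𝓘(ℝ, F) x x) w v

/-- The value of `a ∧ b ∧ … ∧ b` (`m` factors `b`, alternating) on `2m + 1` vectors, up to a positive factor
that depends only on `m`. -/
def wedgePow {V : Type*} (m : ℕ) (a : V → ℝ) (b : V → V → ℝ) (v : Fin (2 * m + 1) → V) : ℝ :=
  ∑ σ : Equiv.Perm (Fin (2 * m + 1)), ((Equiv.Perm.sign σ : ℤ) : ℝ) * a (v (σ 0)) *
    ∏ i : Fin m, b (v (σ ⟨2 * i + 1, by omega⟩)) (v (σ ⟨2 * i + 2, by omega⟩))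

/-- A contact form on a manifold `N` of dimension `2m + 1`: a smooth one-form `α` such that
`α ∧ (dα)^m` is a volume form. -/
def IsContactForm [IsManifold 𝓘(ℝ, F) ∞ N] (α : ∀ x : N, TangentSpace 𝓘(ℝ, F) x →L[ℝ] ℝ) : Prop :=
  ContMDiff 𝓘(ℝ, F) (cotangentModel F) ∞ (fun x => (⟨x, α x⟩ : CotangentBundle F N)) ∧
  ∃ m : ℕ, Module.finrank ℝ F = 2 * m + 1 ∧
    ∀ x : N, ∃ v : Fin (2 * m + 1) → F, wedgePow m (fun w : F => α x w) (extDer α x) v ≠ 0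

end Contact

end ConeStr

end

open ConeStr

/-!
The idea is to identify the space `𝒩` of cone geodesics with the quotient of the hypersurface
`∂C*` of the symplectic manifold `T*M` by its characteristic foliation and the scaling of
covectors, and to push the Liouville form forward.

A strongly convex cone structure is defined by a Lorentz-Finsler metric `L` with `C = {L ≤ 0}`
near `∂C` (`exists_lorentzFinslerMetric`): relative to a vector field in the interior of `C`, let
`h(v)` be the height at which the line through `v` enters `C`, and take `L(v) = h(v) h(-v)`. The
Legendre transform of such a metric, with the sign that makes it nonnegative on `C`, is a
bijection `coLegendre L` from `∂C` to `∂C*` (`exists_eq_coLegendre`, `coLegendre_injective`). It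
maps the null geodesics of `L` to integral curves of the Hamiltonian vector field of the function
`H` that corresponds to `L`, and `∂C* = {H = 0}`. Any other metric defining `C` has a differential
proportional to that of `L` on `∂C`, hence the same null geodesics up to the parametrisation
(`eventually_sameOrbit`). So the classes of the relation generated by `SameConeGeodesic` are
exactly the orbits of the Hamiltonian flow on `∂C*` together with the scaling
(`geodesicProj_eq_of_sameOrbit`, `sameOrbit_of_geodesicProj_eq`).

If the projection `π` to `𝒩` is a submersion, then its fibres are tangent to the Hamiltonian and
to the radial vector field, which are linearly independent. Each fibre is the image of a subset of
the plane under a locally Lipschitz map, so its Hausdorff dimension is at most two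
(`dimH_geodesicProj_fibre_le`), and so is the dimension of the kernel of `dπ`
(`finrank_kerDiff_le`). Hence this kernel is spanned by these two vector fields
(`IsReduction.kerDiff_eq_span`), and `dim 𝒩 = 2 dim M - 3` is odd (`IsReduction.finrank_eq`).

The Liouville form `λ` vanishes on the kernel of `dπ`, so at each `u ∈ ∂C*` it induces a linear
form on the tangent space of `𝒩` at `π u` (`IsProjForm`). The Lie derivative of `λ` in the
Hamiltonian direction vanishes on `∂C*`, and the scaling multiplies `λ` with positive factors, so
the forms induced at the points of one fibre are positive multiples of each other
(`IsProjForm.exists_smul`). They form an open ray, and as `𝒩` is second countable, a partition of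
unity yields a smooth one-form `α` on `𝒩` with values in these rays (`exists_global_projForm`).
Its kernel is `dπ(ker λ)`, and it has the required coorientation.

The symplectic complement of `ker λ ∩ T∂C*` is spanned by the Hamiltonian and the radial vector
field (`IsReduction.fderiv_f_eq_zero`). So `dα` is nondegenerate on `ker α`, a condition that does
not depend on the choice of the positive factors (`nondegenerate_of_eventually_smul`), and a
symplectic basis of `ker α` shows that `α ∧ (dα)^m` does not vanish (`exists_wedgePow_ne_zero`).
-/

open Set Bundle Topology
open scoped Manifold ContDiff

noncomputable section

namespace ConeStr

set_option linter.unusedSectionVars false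

/-! ### Coordinates on the tangent and cotangent bundle -/

section Coordinates

variable {E : Type*} [NormedAddCommGroup E] [NormedSpace ℝ E]
  {M : Type*} [TopologicalSpace M] [ChartedSpace E M] [IsManifold 𝓘(ℝ, E) ∞ M]

/-- The derivative at `p` of the chart at `x₀`, with respect to the identification of `T_pM` with
`E` by the preferred chart at `p`. -/
def toCoord (x₀ p : M) : E →L[ℝ] E := tangentCoordChange 𝓘(ℝ, E) p x₀ p

/-- The inverse of `toCoord x₀ p`. -/
def ofCoord (x₀ p : M) : E →L[ℝ] E := tangentCoordChange 𝓘(ℝ, E) x₀ p p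

/-- The chart of `TM` induced by the chart of `M` at `x₀`. -/
abbrev tChart (x₀ : M) : PartialEquiv (TangentBundle 𝓘(ℝ, E) M) (E × E) :=
  extChartAt 𝓘(ℝ, E).tangent (⟨x₀, 0⟩ : TangentBundle 𝓘(ℝ, E) M)

/-- The chart of `T*M` induced by the chart of `M` at `x₀`. -/
abbrev cChart (x₀ : M) : PartialEquiv (CotangentBundle E M) (E × (E →L[ℝ] ℝ)) :=
  extChartAt (cotangentModel E) (⟨x₀, 0⟩ : CotangentBundle E M)

/-- The covector `u ∈ T_p*M`, with respect to the identification of `T_pM` with `E`. -/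
def covector (p : M) (u : E →L[ℝ] ℝ) : CotangentBundle E M := ⟨p, u⟩

/-- The linear form on `E` given by a covector. -/
def CotangentBundle.form (u : CotangentBundle E M) : E →L[ℝ] ℝ := u.2

theorem ofCoord_toCoord {x₀ p : M} (hp : p ∈ (chartAt E x₀).source) (y : E) :
    ofCoord x₀ p (toCoord x₀ p y) = y := by
  have hp' : p ∈ (extChartAt 𝓘(ℝ, E) x₀).source := by simpa using hp
  have hpp : p ∈ (extChartAt 𝓘(ℝ, E) p).source := by simp
  rw [ofCoord, toCoord, tangentCoordChange_comp ⟨⟨hpp, hp'⟩, hpp⟩, tangentCoordChange_self hpp]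

theorem toCoord_ofCoord {x₀ p : M} (hp : p ∈ (chartAt E x₀).source) (y : E) :
    toCoord x₀ p (ofCoord x₀ p y) = y := by
  have hp' : p ∈ (extChartAt 𝓘(ℝ, E) x₀).source := by simpa using hp
  have hpp : p ∈ (extChartAt 𝓘(ℝ, E) p).source := by simp
  rw [ofCoord, toCoord, tangentCoordChange_comp ⟨⟨hp', hpp⟩, hp'⟩, tangentCoordChange_self hp']

theorem toCoord_self (p : M) : toCoord p p = ContinuousLinearMap.id ℝ E := by
  ext y
  exact tangentCoordChange_self (by simp)

theorem ofCoord_self (p : M) : ofCoord p p = ContinuousLinearMap.id ℝ E := by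
  ext y
  exact tangentCoordChange_self (by simp)

theorem toCoord_eq_zero_iff {x₀ p : M} (hp : p ∈ (chartAt E x₀).source) {y : E} :
    toCoord x₀ p y = 0 ↔ y = 0 := by
  refine ⟨fun h => ?_, fun h => by rw [h, map_zero]⟩
  rw [← ofCoord_toCoord hp y, h, map_zero]

theorem toCoord_eq_mfderiv {x₀ p : M} (hp : p ∈ (chartAt E x₀).source) :
    toCoord (E := E) x₀ p = mfderiv 𝓘(ℝ, E) 𝓘(ℝ, E) (extChartAt 𝓘(ℝ, E) x₀) p := by
  rw [← TangentBundle.continuousLinearMapAt_trivializationAt hp,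
    TangentBundle.continuousLinearMapAt_trivializationAt_eq_core hp]
  rfl

theorem tChart_apply (x₀ p : M) (y : E) :
    tChart x₀ (⟨p, y⟩ : TangentBundle 𝓘(ℝ, E) M) = (extChartAt 𝓘(ℝ, E) x₀ p, toCoord x₀ p y) := by
  rfl

theorem mem_tChart_source {x₀ : M} {v : TangentBundle 𝓘(ℝ, E) M} :
    v ∈ (tChart x₀).source ↔ v.proj ∈ (chartAt E x₀).source := by
  rw [tChart, extChartAt_source, TangentBundle.mem_chart_source_iff]

theorem tChart_target (x₀ : M) :
    (tChart x₀ : PartialEquiv (TangentBundle 𝓘(ℝ, E) M) (E × E)).target =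
      (extChartAt 𝓘(ℝ, E) x₀).target ×ˢ univ := by
  ext z
  simp only [tChart, FiberBundle.extChartAt_target, TangentBundle.trivializationAt_baseSet,
    mem_prod, mem_univ, and_true, mem_inter_iff, mem_preimage, and_iff_left_iff_imp]
  intro h
  have := (extChartAt 𝓘(ℝ, E) x₀).map_target h
  simpa using this

theorem symm_mem_source {x₀ : M} {x : E} (hx : x ∈ (extChartAt 𝓘(ℝ, E) x₀).target) :
    (extChartAt 𝓘(ℝ, E) x₀).symm x ∈ (chartAt E x₀).source := by
  simpa using (extChartAt 𝓘(ℝ, E) x₀).map_target hx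

theorem tChart_symm_apply {x₀ : M} {x : E} (hx : x ∈ (extChartAt 𝓘(ℝ, E) x₀).target) (y : E) :
    (tChart x₀).symm (x, y) = (⟨(extChartAt 𝓘(ℝ, E) x₀).symm x,
      ofCoord (E := E) x₀ ((extChartAt 𝓘(ℝ, E) x₀).symm x) y⟩ : TangentBundle 𝓘(ℝ, E) M) := by
  have hs := symm_mem_source hx
  refine ((tChart x₀).eq_symm_apply ?_ ?_).2 ?_ |>.symm
  · exact mem_tChart_source.2 hs
  · rw [tChart_target]; exact ⟨hx, mem_univ _⟩
  · rw [tChart_apply, toCoord_ofCoord hs, (extChartAt 𝓘(ℝ, E) x₀).right_inv hx]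

theorem cChart_apply {x₀ p : M} (hp : p ∈ (chartAt E x₀).source) (u : E →L[ℝ] ℝ) :
    cChart x₀ (covector p u) = (extChartAt 𝓘(ℝ, E) x₀ p, u.comp (ofCoord x₀ p)) := by
  rw [cChart, FiberBundle.extChartAt]
  simp only [PartialEquiv.trans_apply, PartialEquiv.prod_coe, PartialEquiv.refl_coe, id]
  have : (trivializationAt (E →L[ℝ] ℝ) (fun p : M => TangentSpace 𝓘(ℝ, E) p →L[ℝ] Trivial M ℝ p) x₀)
      (covector p u) = (p, u.comp (ofCoord x₀ p)) := by
    rw [hom_trivializationAt, Trivialization.continuousLinearMap_apply]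
    refine Prod.ext rfl ?_
    have h1 : (trivializationAt E (TangentSpace 𝓘(ℝ, E)) x₀).symmL ℝ p = ofCoord (E := E) x₀ p :=
      TangentBundle.symmL_trivializationAt_eq_core hp
    have h2 : (trivializationAt ℝ (Trivial M ℝ) x₀).continuousLinearMapAt ℝ p =
        ContinuousLinearMap.id ℝ ℝ := Trivial.continuousLinearMapAt_trivialization ℝ M ℝ p
    ext y
    exact (congrFun (congrArg DFunLike.coe h2) _).trans
      (congrArg u (congrFun (congrArg DFunLike.coe h1) y))
  exact congrArg (fun q : M × (E →L[ℝ] ℝ) => (extChartAt 𝓘(ℝ, E) x₀ q.1, q.2)) this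

theorem mem_cChart_source {x₀ : M} {u : CotangentBundle E M} :
    u ∈ (cChart x₀).source ↔ u.proj ∈ (chartAt E x₀).source := by
  rw [cChart, FiberBundle.extChartAt]
  simp only [PartialEquiv.trans_source, mem_inter_iff, PartialEquiv.prod_source, mem_preimage,
    mem_prod, PartialEquiv.refl_source, mem_univ, and_true, extChartAt_source,
    hom_trivializationAt_source, TangentBundle.trivializationAt_baseSet]
  exact ⟨fun h => h.1.1, fun h => ⟨⟨h, mem_univ _⟩, h⟩⟩

theorem cChart_target (x₀ : M) :
    (cChart x₀ : PartialEquiv (CotangentBundle E M) (E × (E →L[ℝ] ℝ))).target =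
      (extChartAt 𝓘(ℝ, E) x₀).target ×ˢ univ := by
  ext z
  simp only [cChart, FiberBundle.extChartAt_target, hom_trivializationAt_baseSet,
    TangentBundle.trivializationAt_baseSet,
    mem_prod, mem_univ, and_true, mem_inter_iff, mem_preimage, and_iff_left_iff_imp]
  intro h
  exact ⟨symm_mem_source h, mem_univ _⟩

theorem cChart_symm_apply {x₀ : M} {x : E} (hx : x ∈ (extChartAt 𝓘(ℝ, E) x₀).target)
    (q : E →L[ℝ] ℝ) :
    (cChart x₀).symm (x, q) = covector ((extChartAt 𝓘(ℝ, E) x₀).symm x)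
      (q.comp (toCoord x₀ ((extChartAt 𝓘(ℝ, E) x₀).symm x))) := by
  have hs := symm_mem_source hx
  refine ((cChart x₀).eq_symm_apply ?_ ?_).2 ?_ |>.symm
  · exact mem_cChart_source.2 hs
  · rw [cChart_target]; exact ⟨hx, mem_univ _⟩
  · rw [cChart_apply hs, (extChartAt 𝓘(ℝ, E) x₀).right_inv hx]
    congr 1
    ext y
    exact congrArg q (toCoord_ofCoord hs y)

end Coordinates

section Coordinates

variable {E : Type*} [NormedAddCommGroup E] [NormedSpace ℝ E]
  {M : Type*} [TopologicalSpace M] [ChartedSpace E M] [IsManifold 𝓘(ℝ, E) ∞ M]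

/-- The vector part of a point of `TM`, as an element of `E`. -/
def vec (v : TangentBundle 𝓘(ℝ, E) M) : E := v.2

/-- The restriction of a function on `TM` to `T_pM = E`. -/
def onFibre (f : TangentBundle 𝓘(ℝ, E) M → ℝ) (p : M) : E → ℝ := fun y => f ⟨p, y⟩

theorem isOpen_tChart_target (x₀ : M) :
    IsOpen (tChart x₀ : PartialEquiv (TangentBundle 𝓘(ℝ, E) M) (E × E)).target := by
  rw [tChart_target]
  exact (isOpen_extChartAt_target x₀).prod isOpen_univ

theorem hasDerivAt_chart {γ : ℝ → M} {t : ℝ} {x₀ : M}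
    (hγ : MDifferentiableAt 𝓘(ℝ, ℝ) 𝓘(ℝ, E) γ t) (ht : γ t ∈ (chartAt E x₀).source) :
    HasDerivAt (fun s => extChartAt 𝓘(ℝ, E) x₀ (γ s))
      (toCoord x₀ (γ t) (velocity 𝓘(ℝ, E) γ t).2) t := by
  have h1 : MDifferentiableAt 𝓘(ℝ, E) 𝓘(ℝ, E) (extChartAt 𝓘(ℝ, E) x₀) (γ t) :=
    mdifferentiableAt_extChartAt ht
  have h2 := h1.hasMFDerivAt.comp t hγ.hasMFDerivAt
  let A : E →L[ℝ] E := mfderiv 𝓘(ℝ, E) 𝓘(ℝ, E) (extChartAt 𝓘(ℝ, E) x₀) (γ t)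
  let B : ℝ →L[ℝ] E := mfderiv 𝓘(ℝ, ℝ) 𝓘(ℝ, E) γ t
  have h3 : HasFDerivAt (fun s => extChartAt 𝓘(ℝ, E) x₀ (γ s)) (A.comp B) t :=
    hasMFDerivAt_iff_hasFDerivAt.1 h2
  rw [toCoord_eq_mfderiv ht]
  exact h3.hasDerivAt

theorem localVelocity_eq {γ : ℝ → M} {t : ℝ} {x₀ : M}
    (hγ : MDifferentiableAt 𝓘(ℝ, ℝ) 𝓘(ℝ, E) γ t) (ht : γ t ∈ (chartAt E x₀).source) :
    localVelocity γ x₀ t =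
      (extChartAt 𝓘(ℝ, E) x₀ (γ t), deriv (fun s => extChartAt 𝓘(ℝ, E) x₀ (γ s)) t) := by
  rw [(hasDerivAt_chart hγ ht).deriv]
  rfl

theorem tChart_symm_localVelocity {γ : ℝ → M} {t : ℝ} {x₀ : M}
    (ht : γ t ∈ (chartAt E x₀).source) :
    (tChart x₀).symm (localVelocity γ x₀ t) = velocity 𝓘(ℝ, E) γ t :=
  (tChart x₀).left_inv (mem_tChart_source.2 ht)

theorem liouville_velocity {c : ℝ → CotangentBundle E M} {t : ℝ} {x₀ : M}
    (hc : MDifferentiableAt 𝓘(ℝ, ℝ) (cotangentModel E) c t)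
    (ht : (c t).proj ∈ (chartAt E x₀).source) :
    liouville (velocity (cotangentModel E) c t) =
      (cChart x₀ (c t)).2 (deriv (fun s => (cChart x₀ (c s)).1) t) := by
  have hp : MDifferentiableAt (cotangentModel E) 𝓘(ℝ, E)
      (fun u : CotangentBundle E M => u.proj) (c t) :=
    (contMDiffAt_proj (n := 1) (IB := 𝓘(ℝ, E)) (F := E →L[ℝ] ℝ)
      (fun p : M => TangentSpace 𝓘(ℝ, E) p →L[ℝ] Trivial M ℝ p)).mdifferentiableAt one_ne_zero
  have hq : MDifferentiableAt 𝓘(ℝ, ℝ) 𝓘(ℝ, E) (fun s => (c s).proj) t := hp.comp t hc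
  have h1 : mfderiv 𝓘(ℝ, ℝ) 𝓘(ℝ, E) (fun s => (c s).proj) t =
      (mfderiv (cotangentModel E) 𝓘(ℝ, E) (fun u : CotangentBundle E M => u.proj) (c t)).comp
        (mfderiv 𝓘(ℝ, ℝ) (cotangentModel E) c t) :=
    mfderiv_comp t hp hc
  have h2 := hasDerivAt_chart hq ht
  have h3 : (fun s => (cChart x₀ (c s)).1) = fun s => extChartAt 𝓘(ℝ, E) x₀ (c s).proj := by
    funext s
    rw [cChart, FiberBundle.extChartAt]
    rfl
  rw [h3, h2.deriv]
  have h4 : cChart x₀ (c t) = _ := cChart_apply ht (c t).2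
  rw [h4]
  refine Eq.trans ?_ (congrArg (c t).2 (ofCoord_toCoord ht _).symm)
  exact congrArg (c t).2 (congrFun (congrArg DFunLike.coe h1.symm) (1 : ℝ))

theorem localLagrangian_apply (L : TangentBundle 𝓘(ℝ, E) M → ℝ) {x₀ p : M}
    (hp : p ∈ (chartAt E x₀).source) (y : E) :
    localLagrangian L x₀ (extChartAt 𝓘(ℝ, E) x₀ p, toCoord x₀ p y) = L ⟨p, y⟩ := by
  rw [← tChart_apply, localLagrangian, (tChart x₀).left_inv (mem_tChart_source.2 hp)]

theorem contDiffAt_localLagrangian {A : Set (TangentBundle 𝓘(ℝ, E) M)} (hA : IsOpen A)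
    {L : TangentBundle 𝓘(ℝ, E) M → ℝ} (hL : ContMDiffOn 𝓘(ℝ, E).tangent 𝓘(ℝ, ℝ) ∞ L A)
    {x₀ : M} {z : E × E} (hz : z ∈ (tChart x₀).target) (hzA : (tChart x₀).symm z ∈ A) :
    ContDiffAt ℝ ∞ (localLagrangian L x₀) z := by
  have h1 : ContMDiffAt 𝓘(ℝ, E).tangent 𝓘(ℝ, ℝ) ∞ L ((tChart x₀).symm z) :=
    hL.contMDiffAt (hA.mem_nhds hzA)
  have h2 : ContMDiffAt 𝓘(ℝ, E × E) 𝓘(ℝ, E).tangent ∞ (tChart x₀).symm z := by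
    have := (contMDiffOn_extChartAt_symm (I := 𝓘(ℝ, E).tangent) (n := ∞)
      (⟨x₀, 0⟩ : TangentBundle 𝓘(ℝ, E) M)).contMDiffAt ((isOpen_tChart_target x₀).mem_nhds hz)
    rwa [ModelWithCorners.tangent, ← modelWithCornersSelf_prod] at *
  exact contMDiffAt_iff_contDiffAt.1 (h1.comp z h2)

theorem hasFDerivAt_fibre {A : Set (TangentBundle 𝓘(ℝ, E) M)} (hA : IsOpen A)
    {L : TangentBundle 𝓘(ℝ, E) M → ℝ} (hL : ContMDiffOn 𝓘(ℝ, E).tangent 𝓘(ℝ, ℝ) ∞ L A)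
    {x₀ p : M} (hp : p ∈ (chartAt E x₀).source) {y : E}
    (hy : (⟨p, y⟩ : TangentBundle 𝓘(ℝ, E) M) ∈ A) :
    HasFDerivAt (onFibre L p)
      (((fderiv ℝ (localLagrangian L x₀) (extChartAt 𝓘(ℝ, E) x₀ p, toCoord x₀ p y)).comp
        (ContinuousLinearMap.inr ℝ E E)).comp (toCoord x₀ p)) y := by
  have h0 : tChart x₀ (⟨p, y⟩ : TangentBundle 𝓘(ℝ, E) M) ∈ (tChart x₀).target :=
    (tChart x₀).map_source (mem_tChart_source.2 hp)
  have h1 := (contDiffAt_localLagrangian hA hL h0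
    (by rwa [(tChart x₀).left_inv (mem_tChart_source.2 hp)])).differentiableAt (by simp)
  have h2 : HasFDerivAt (fun y : E => (extChartAt 𝓘(ℝ, E) x₀ p, toCoord x₀ p y))
      ((ContinuousLinearMap.inr ℝ E E).comp (toCoord x₀ p)) y :=
    (hasFDerivAt_prodMk_right _ _).comp y (toCoord x₀ p).hasFDerivAt
  have h3 := h1.hasFDerivAt.comp y h2
  refine h3.congr_of_eventuallyEq (Filter.Eventually.of_forall fun y' => ?_)
  exact (localLagrangian_apply L hp y').symm

end Coordinates

/-! ### Topology of cone structures -/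

section Sides

/-- A connected set that avoids the frontier of `D` lies on one side of it. -/
theorem mem_of_isPreconnected {X : Type*} [TopologicalSpace X] {S D : Set X}
    (hS : IsPreconnected S) (h : ∀ z ∈ S, z ∉ frontier D) {a b : X} (ha : a ∈ S) (hb : b ∈ S)
    (haD : a ∈ D) : b ∈ D := by
  by_contra hbD
  have key : ∀ z ∈ S, z ∈ interior D ∨ z ∈ interior Dᶜ := fun z hz => by
    have := h z hz
    rw [frontier_eq_closure_inter_closure, mem_inter_iff, not_and_or] at this
    rcases this with h1 | h1
    · right; rwa [interior_compl]
    · left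
      rw [← mem_compl_iff, ← interior_compl, compl_compl] at h1
      exact h1
  obtain ⟨x, -, hx1, hx2⟩ := hS _ _ isOpen_interior isOpen_interior (fun z hz => key z hz)
    ⟨a, ha, (key a ha).resolve_right fun h' => interior_subset h' haD⟩
    ⟨b, hb, (key b hb).resolve_left fun h' => hbD (interior_subset h')⟩
  exact interior_subset hx2 (interior_subset hx1)

theorem frequently_pos_of_fderiv_ne_zero {X : Type*} [NormedAddCommGroup X] [NormedSpace ℝ X]
    {f : X → ℝ} {x : X} (h0 : f x = 0) (h : fderiv ℝ f x ≠ 0) : ∃ᶠ y in 𝓝 x, 0 < f y := by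
  intro hc
  have hm : IsLocalMax f x := by
    filter_upwards [hc] with y hy
    rw [h0]; exact not_lt.1 hy
  exact h hm.fderiv_eq_zero

/-- Near a point where `ρ` vanishes with nonzero differential, the side `ρ > 0` lies either in `D`
or in its complement, if the frontier of `D` is contained in the zero set of `ρ`. The reason is that
every point of this side is joined to one fixed ball by a short translation along which `ρ`
increases. -/
theorem side_subset_or_disjoint {X : Type*} [NormedAddCommGroup X] [NormedSpace ℝ X] {D W : Set X}
    {ρ : X → ℝ} {w η : X} (hW : W ∈ 𝓝 w) (hρ : ContDiffAt ℝ 1 ρ w) (h0 : ρ w = 0)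
    (hη : 0 < fderiv ℝ ρ w η) (hfr : ∀ z ∈ W, z ∈ frontier D → ρ z = 0) :
    (∀ᶠ z in 𝓝 w, 0 < ρ z → z ∈ D) ∨ (∀ᶠ z in 𝓝 w, 0 < ρ z → z ∉ D) := by
  have hcont : ContinuousAt (fun z => fderiv ℝ ρ z η) w :=
    (hρ.continuousAt_fderiv one_ne_zero).clm_apply continuousAt_const
  have h1 : ∀ᶠ z in 𝓝 w, z ∈ W ∧ DifferentiableAt ℝ ρ z ∧ 0 < fderiv ℝ ρ z η := by
    have hd : ∀ᶠ z in 𝓝 w, DifferentiableAt ℝ ρ z :=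
      (hρ.eventually (by simp)).mono fun z hz => hz.differentiableAt one_ne_zero
    exact (Filter.eventually_mem_set.2 hW).and (hd.and (hcont.eventually (lt_mem_nhds hη)))
  obtain ⟨r, hr, hball⟩ := Metric.eventually_nhds_iff_ball.1 h1
  -- the translation by `s • η` moves `w` to a nearby point with `ρ > 0`
  obtain ⟨s, hs, hsr⟩ : ∃ s : ℝ, 0 < s ∧ s * ‖η‖ < r / 2 := by
    refine ⟨r / 2 / (‖η‖ + 1), by positivity, ?_⟩
    rw [div_mul_eq_mul_div, div_lt_iff₀ (by positivity)]
    nlinarith [norm_nonneg η]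
  have hmem : ∀ z ∈ Metric.ball w (r / 2), ∀ t ∈ Icc (0 : ℝ) s, z + t • η ∈ Metric.ball w r := by
    intro z hz t ht
    rw [mem_ball_iff_norm] at hz ⊢
    have : ‖t • η‖ ≤ s * ‖η‖ := by
      rw [norm_smul, Real.norm_of_nonneg ht.1]
      exact mul_le_mul_of_nonneg_right ht.2 (norm_nonneg _)
    calc ‖z + t • η - w‖ = ‖(z - w) + t • η‖ := by congr 1; abel
      _ ≤ ‖z - w‖ + ‖t • η‖ := norm_add_le _ _
      _ < r := by linarith
  have hmono : ∀ z ∈ Metric.ball w (r / 2),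
      StrictMonoOn (fun t : ℝ => ρ (z + t • η)) (Icc 0 s) := by
    intro z hz
    have hd : ∀ t ∈ Icc (0 : ℝ) s, HasDerivAt (fun t : ℝ => ρ (z + t • η))
        (fderiv ℝ ρ (z + t • η) η) t := by
      intro t ht
      have hl : HasDerivAt (fun t : ℝ => z + t • η) η t := by
        simpa using ((hasDerivAt_id t).smul_const η).const_add z
      exact (hball _ (hmem z hz t ht)).2.1.hasFDerivAt.comp_hasDerivAt t hl
    refine strictMonoOn_of_hasDerivWithinAt_pos (convex_Icc 0 s)
      (fun t ht => (hd t ht).continuousAt.continuousWithinAt)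
      (fun t ht => (hd t (interior_subset ht)).hasDerivWithinAt)
      (fun t ht => (hball _ (hmem z hz t (interior_subset ht))).2.2)
  have hw : w ∈ Metric.ball w (r / 2) := Metric.mem_ball_self (by linarith)
  have h0s : (0 : ℝ) ∈ Icc 0 s := ⟨le_rfl, hs.le⟩
  have hss : s ∈ Icc 0 s := ⟨hs.le, le_rfl⟩
  have hpos : 0 < ρ (w + s • η) := by
    have := hmono w hw h0s hss hs
    simpa [h0] using this
  have hnear : ∀ᶠ z in 𝓝 (w + s • η), 0 < ρ z :=
    (hball _ (hmem w hw s hss)).2.1.continuousAt.eventually (lt_mem_nhds hpos)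
  obtain ⟨δ, hδ, hδball⟩ := Metric.eventually_nhds_iff_ball.1
    (hnear.and (Metric.isOpen_ball.mem_nhds (hmem w hw s hss)))
  -- a nearby point `z` with `ρ z > 0` is joined to the ball around `w + s • η` by the segment in
  -- the direction of `η`
  have hjoin : ∀ z ∈ Metric.ball w (min δ (r / 2)), 0 < ρ z → (z ∈ D ↔ w + s • η ∈ D) := by
    intro z hz hzρ
    have hz2 : z ∈ Metric.ball w (r / 2) := Metric.ball_subset_ball (min_le_right _ _) hz
    let S : Set X := (fun t : ℝ => z + t • η) '' Icc 0 s ∪ Metric.ball (w + s • η) δ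
    have hSpre : IsPreconnected S := by
      refine IsPreconnected.union (z + s • η) ⟨s, hss, rfl⟩ ?_
        (isPreconnected_Icc.image _ (by fun_prop)) (convex_ball _ _).isPreconnected
      have : z ∈ Metric.ball w δ := Metric.ball_subset_ball (min_le_left _ _) hz
      simpa [mem_ball_iff_norm] using this
    have hSfr : ∀ x ∈ S, x ∉ frontier D := by
      rintro x (⟨t, ht, rfl⟩ | hx) hxf
      · have hx0 := hfr _ (hball _ (hmem z hz2 t ht)).1 hxf
        have : ρ (z + (0 : ℝ) • η) ≤ ρ (z + t • η) := (hmono z hz2).monotoneOn h0s ht ht.1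
        rw [zero_smul, add_zero] at this
        linarith
      · have := hδball x hx
        have hx0 := hfr _ (hball _ this.2).1 hxf
        linarith [this.1]
    have hzS : z ∈ S := Or.inl ⟨0, h0s, by simp⟩
    have hwS : w + s • η ∈ S := Or.inr (Metric.mem_ball_self hδ)
    exact ⟨mem_of_isPreconnected hSpre hSfr hzS hwS, mem_of_isPreconnected hSpre hSfr hwS hzS⟩
  have hm : Metric.ball w (min δ (r / 2)) ∈ 𝓝 w := Metric.ball_mem_nhds _ (by positivity)
  by_cases hD : w + s • η ∈ D
  · left
    filter_upwards [hm] with z hz hzρ using (hjoin z hz hzρ).2 hD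
  · right
    filter_upwards [hm] with z hz hzρ h using hD ((hjoin z hz hzρ).1 h)

end Sides

section ConeTopology

variable {E : Type*} [NormedAddCommGroup E] [NormedSpace ℝ E]
  {M : Type*} [TopologicalSpace M] [ChartedSpace E M] [IsManifold 𝓘(ℝ, E) ∞ M]

theorem continuous_fibre (p : M) :
    Continuous (fun y : E => (⟨p, y⟩ : TangentBundle 𝓘(ℝ, E) M)) :=
  FiberBundle.continuous_totalSpaceMk E (TangentSpace 𝓘(ℝ, E)) p

theorem continuousAt_tChart {x₀ : M} {v : TangentBundle 𝓘(ℝ, E) M}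
    (hv : v.proj ∈ (chartAt E x₀).source) : ContinuousAt (tChart x₀) v :=
  continuousAt_extChartAt' (I := 𝓘(ℝ, E).tangent) (mem_tChart_source.2 hv)

theorem continuousAt_tChart_symm {x₀ : M} {z : E × E}
    (hz : z ∈ (tChart x₀ : PartialEquiv (TangentBundle 𝓘(ℝ, E) M) (E × E)).target) :
    ContinuousAt (tChart x₀ : PartialEquiv (TangentBundle 𝓘(ℝ, E) M) (E × E)).symm z :=
  continuousAt_extChartAt_symm'' (I := 𝓘(ℝ, E).tangent) hz

theorem eventually_ne_zero {v : TangentBundle 𝓘(ℝ, E) M} (hv : vec v ≠ 0) :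
    ∀ᶠ z : TangentBundle 𝓘(ℝ, E) M in 𝓝 v, vec z ≠ 0 := by
  have hs : v.proj ∈ (chartAt E v.proj).source := mem_chart_source E v.proj
  have h1 : (tChart v.proj v).2 ≠ 0 := by
    intro h
    exact hv ((toCoord_eq_zero_iff hs).1 h)
  have h2 := ((continuous_snd.continuousAt).comp (continuousAt_tChart hs)).eventually
    (isOpen_ne.mem_nhds h1)
  filter_upwards [h2] with z hz h
  apply hz
  change toCoord v.proj z.proj (vec z) = 0
  rw [h, map_zero]

/-- The sides of `∂C`: near each of its points, `C` is the sublevel set `ρ ≤ 0` of a defining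
function of `∂C`. -/
theorem exists_sublevel {C : Set (TangentBundle 𝓘(ℝ, E) M)}
    (hC : IsStronglyConvexConeStructure C) {v : TangentBundle 𝓘(ℝ, E) M} (hv : v ∈ boundary C) :
    ∃ (W : Set (TangentBundle 𝓘(ℝ, E) M)) (ρ : TangentBundle 𝓘(ℝ, E) M → ℝ),
      IsOpen W ∧ v ∈ W ∧ ContMDiffOn 𝓘(ℝ, E).tangent 𝓘(ℝ, ℝ) ∞ ρ W ∧
      (∀ x ∈ W, x ∈ C ↔ ρ x ≤ 0) ∧ ρ v = 0 ∧ fderiv ℝ (onFibre ρ v.proj) (vec v) ≠ 0 := by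
  obtain ⟨W, ρ, hWo, hvW, hρ, hzero, hd⟩ := hC.boundary_hypersurface v hv
  have hv0 : ρ v = 0 := (hzero v hvW).1 hv
  have hs : v.proj ∈ (chartAt E v.proj).source := mem_chart_source E v.proj
  have hvt : tChart v.proj v ∈ (tChart v.proj).target :=
    (tChart v.proj).map_source (mem_tChart_source.2 hs)
  have hsymm : (tChart v.proj).symm (tChart v.proj v) = v :=
    (tChart v.proj).left_inv (mem_tChart_source.2 hs)
  have hcd : ContDiffAt ℝ ∞ (localLagrangian ρ v.proj) (tChart v.proj v) :=
    contDiffAt_localLagrangian hWo hρ hvt (by rwa [hsymm])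
  obtain ⟨η, hη⟩ : ∃ η : E, 0 < fderiv ℝ (onFibre ρ v.proj) (vec v) η := by
    by_contra hcon
    push Not at hcon
    apply hd
    ext η
    refine le_antisymm (hcon η) ?_
    have := hcon (-η)
    rw [map_neg] at this
    exact neg_nonpos.1 this
  have hηρ : 0 < fderiv ℝ (localLagrangian ρ v.proj) (tChart v.proj v) (0, η) := by
    have h1 := (hasFDerivAt_fibre hWo hρ hs (y := vec v) hvW).fderiv
    rw [h1] at hη
    rw [toCoord_self] at hη
    have h2 : tChart v.proj v = (extChartAt 𝓘(ℝ, E) v.proj v.proj, vec v) :=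
      Prod.ext rfl (congrFun (congrArg DFunLike.coe (toCoord_self v.proj)) (vec v))
    rw [h2]
    exact hη
  have hfr : ∀ z ∈ (tChart v.proj).target ∩ (tChart v.proj).symm ⁻¹' W ∩
      {z | vec ((tChart v.proj).symm z) ≠ 0},
      z ∈ frontier ((tChart v.proj).symm ⁻¹' C) → localLagrangian ρ v.proj z = 0 := by
    rintro z ⟨⟨hz, hzW⟩, hzne⟩ hzf
    refine (hzero _ hzW).1 ⟨?_, hzne⟩
    rw [frontier_eq_closure_inter_closure] at hzf ⊢
    have hc := continuousAt_tChart_symm hz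
    exact ⟨closure_mono (image_preimage_subset _ _) (mem_closure_image hc hzf.1),
      closure_mono (image_preimage_subset _ Cᶜ) (mem_closure_image hc hzf.2)⟩
  have hnhds : (tChart v.proj).target ∩ (tChart v.proj).symm ⁻¹' W ∩
      {z | vec ((tChart v.proj).symm z) ≠ 0} ∈ 𝓝 (tChart v.proj v) := by
    have hc := continuousAt_tChart_symm hvt
    refine Filter.inter_mem (Filter.inter_mem ((isOpen_tChart_target _).mem_nhds hvt) ?_) ?_
    · exact hc.preimage_mem_nhds (by rw [hsymm]; exact hWo.mem_nhds hvW)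
    · have := eventually_ne_zero (v := v) hv.2
      rw [← hsymm] at this
      exact hc.eventually this
  have hv0' : localLagrangian ρ v.proj (tChart v.proj v) = 0 := by
    rw [localLagrangian, hsymm, hv0]
  -- apply the dichotomy to both sides `ρ > 0` and `ρ < 0` of the hypersurface
  have hside₁ := side_subset_or_disjoint hnhds (hcd.of_le (by simp)) hv0' hηρ hfr
  have hside₂ := side_subset_or_disjoint (η := -(0, η)) hnhds (hcd.neg.of_le (by simp))
    (by rw [hv0', neg_zero]) (by
      rw [show (fun z => -localLagrangian ρ v.proj z) = -localLagrangian ρ v.proj from rfl,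
        fderiv_neg, map_neg, _root_.neg_apply, neg_neg]
      exact hηρ) (fun z hz hzf => by rw [hfr z hz hzf, neg_zero])
  have hgood : ∀ᶠ z in 𝓝 (tChart v.proj v), 0 < fderiv ℝ (localLagrangian ρ v.proj) z (0, η) :=
    ((hcd.continuousAt_fderiv (by simp)).clm_apply continuousAt_const).eventually
      (lt_mem_nhds hηρ)
  have hvert : ∀ᶠ z in 𝓝 v, z ∈ W ∧ vec z ≠ 0 ∧
      fderiv ℝ (onFibre ρ z.proj) (vec z) ≠ 0 := by
    have hsrc : ∀ᶠ z in 𝓝 v, z.proj ∈ (chartAt E v.proj).source :=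
      (FiberBundle.continuous_proj E (TangentSpace 𝓘(ℝ, E))).continuousAt.eventually
        ((chartAt E v.proj).open_source.mem_nhds hs)
    filter_upwards [hWo.mem_nhds hvW, eventually_ne_zero (v := v) hv.2, hsrc,
      (continuousAt_tChart hs).eventually hgood] with z hzW hzne hzs hz
    refine ⟨hzW, hzne, fun h => ?_⟩
    have h1 := (hasFDerivAt_fibre hWo hρ hzs (y := vec z) hzW).fderiv
    rw [h1] at h
    have h2 := congrFun (congrArg DFunLike.coe h) (ofCoord v.proj z.proj η)
    simp only [ContinuousLinearMap.comp_apply, toCoord_ofCoord hzs,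
      ContinuousLinearMap.inr_apply, _root_.zero_apply] at h2
    exact hz.ne' h2
  have transfer : ∀ {P : TangentBundle 𝓘(ℝ, E) M → Prop},
      (∀ᶠ z in 𝓝 (tChart v.proj v), P ((tChart v.proj).symm z)) → ∀ᶠ z in 𝓝 v, P z := by
    intro P hP
    have hsrc : ∀ᶠ z in 𝓝 v, z.proj ∈ (chartAt E v.proj).source :=
      (FiberBundle.continuous_proj E (TangentSpace 𝓘(ℝ, E))).continuousAt.eventually
        ((chartAt E v.proj).open_source.mem_nhds hs)
    filter_upwards [(continuousAt_tChart hs).eventually hP, hsrc] with z hz hzs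
    rwa [(tChart v.proj).left_inv (mem_tChart_source.2 hzs)] at hz
  have hpos : (∀ᶠ z in 𝓝 v, 0 < ρ z → z ∈ C) ∨ (∀ᶠ z in 𝓝 v, 0 < ρ z → z ∉ C) :=
    hside₁.imp (fun h => transfer (P := fun z => 0 < ρ z → z ∈ C) h)
      (fun h => transfer (P := fun z => 0 < ρ z → z ∉ C) h)
  have hneg : (∀ᶠ z in 𝓝 v, ρ z < 0 → z ∈ C) ∨ (∀ᶠ z in 𝓝 v, ρ z < 0 → z ∉ C) :=
    hside₂.imp (fun h => transfer (P := fun z => ρ z < 0 → z ∈ C)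
        (h.mono fun z hz hz' => hz (neg_pos.2 hz')))
      (fun h => transfer (P := fun z => ρ z < 0 → z ∉ C)
        (h.mono fun z hz hz' => hz (neg_pos.2 hz')))
  have hfreq : ∀ z : TangentBundle 𝓘(ℝ, E) M, ρ z = 0 →
      fderiv ℝ (onFibre ρ z.proj) (vec z) ≠ 0 →
      (∃ᶠ y : E in 𝓝 (vec z), 0 < ρ ⟨z.proj, y⟩) ∧ (∃ᶠ y : E in 𝓝 (vec z), ρ ⟨z.proj, y⟩ < 0) := by
    intro z hz hzd
    refine ⟨frequently_pos_of_fderiv_ne_zero hz hzd, ?_⟩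
    have := frequently_pos_of_fderiv_ne_zero (f := -onFibre ρ z.proj) (x := vec z)
      (neg_eq_zero.2 hz) (by rw [fderiv_neg]; exact neg_ne_zero.2 hzd)
    exact this.mono fun y hy => neg_pos.1 hy
  -- zeros of `ρ` next to points of `C` in the same fibre belong to `C`
  have hclosed : ∀ {s : ℝ → Prop}, (∀ z : TangentBundle 𝓘(ℝ, E) M, ρ z = 0 →
      fderiv ℝ (onFibre ρ z.proj) (vec z) ≠ 0 → ∃ᶠ y : E in 𝓝 (vec z), s (onFibre ρ z.proj y)) →
      (∀ᶠ z in 𝓝 v, s (ρ z) → z ∈ C) → ∀ᶠ z in 𝓝 v, ρ z = 0 → z ∈ C := by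
    intro s hfs hs'
    filter_upwards [hs'.eventually_nhds, hvert] with z hz ⟨_, hzne, hzd⟩ hz0
    have h1 := (hfs z hz0 hzd).and_eventually ((continuous_fibre z.proj).continuousAt.eventually hz)
    have h2 : vec z ∈ closure (fibre C z.proj) :=
      mem_closure_iff_frequently.2 (h1.mono fun y hy => hy.2 hy.1)
    exact (hC.fibre_cone z.proj).closed _ h2 hzne
  have finish : ∀ ρ' : TangentBundle 𝓘(ℝ, E) M → ℝ,
      ContMDiffOn 𝓘(ℝ, E).tangent 𝓘(ℝ, ℝ) ∞ ρ' W → ρ' v = 0 →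
      fderiv ℝ (onFibre ρ' v.proj) (vec v) ≠ 0 →
      (∀ᶠ z in 𝓝 v, 0 < ρ' z → z ∉ C) → (∀ᶠ z in 𝓝 v, ρ' z < 0 → z ∈ C) →
      (∀ᶠ z in 𝓝 v, ρ' z = 0 → z ∈ C) →
      ∃ (W : Set (TangentBundle 𝓘(ℝ, E) M)) (ρ : TangentBundle 𝓘(ℝ, E) M → ℝ),
      IsOpen W ∧ v ∈ W ∧ ContMDiffOn 𝓘(ℝ, E).tangent 𝓘(ℝ, ℝ) ∞ ρ W ∧
      (∀ x ∈ W, x ∈ C ↔ ρ x ≤ 0) ∧ ρ v = 0 ∧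
      fderiv ℝ (onFibre ρ v.proj) (vec v) ≠ 0 := by
    intro ρ' hρ' h0' hd' hp hn hz
    obtain ⟨V, hV, hVo, hvV⟩ := eventually_nhds_iff.1
      (((hp.and hn).and hz).and (hWo.mem_nhds hvW))
    refine ⟨V, ρ', hVo, hvV, hρ'.mono fun z hz => (hV z hz).2, fun x hx => ⟨fun hxC => ?_,
      fun hxρ => ?_⟩, h0', hd'⟩
    · by_contra hlt
      exact (hV x hx).1.1.1 (not_le.1 hlt) hxC
    · rcases hxρ.lt_or_eq with h | h
      · exact (hV x hx).1.1.2 h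
      · exact (hV x hx).1.2 h
  rcases hpos with hp | hp <;> rcases hneg with hn | hn
  · -- both sides in `C`: then `v` is an interior point
    exfalso
    have hz := hclosed (s := fun r => 0 < r) (fun z h h' => (hfreq z h h').1) hp
    have : v ∈ interior C := by
      rw [mem_interior_iff_mem_nhds]
      filter_upwards [hp, hn, hz] with z h1 h2 h3
      rcases lt_trichotomy (ρ z) 0 with h | h | h
      exacts [h2 h, h3 h, h1 h]
    exact hv.1.2 this
  -- `C` is the side `ρ ≥ 0`, so that `-ρ` is the function sought
  · refine finish (fun z => -ρ z) (fun z hz => (hρ z hz).neg) (by simp [hv0]) ?_ ?_ ?_ ?_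
    · rw [show onFibre (fun z => -ρ z) v.proj = -onFibre ρ v.proj from rfl, fderiv_neg]
      exact neg_ne_zero.2 hd
    · exact hn.mono fun z hz h => hz (neg_pos.1 h)
    · exact hp.mono fun z hz h => hz (neg_lt_zero.1 h)
    · exact (hclosed (s := fun r => 0 < r) (fun z h h' => (hfreq z h h').1) hp).mono
        fun z hz h => hz (neg_eq_zero.1 h)
  · exact finish ρ hρ hv0 hd hp hn
      (hclosed (s := fun r => r < 0) (fun z h h' => (hfreq z h h').2) hn)
  · -- both sides outside of `C`: then `C` would have fibres without interior
    exfalso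
    have hboth : ∀ᶠ z in 𝓝 v, z ∈ C → ρ z = 0 := by
      filter_upwards [hp, hn] with z h1 h2 hzC
      rcases lt_trichotomy (ρ z) 0 with h | h | h
      exacts [absurd hzC (h2 h), h, absurd hzC (h1 h)]
    obtain ⟨z, hzC, hz⟩ := (mem_closure_iff_frequently.1 hv.1.1).and_eventually
      (hboth.and hvert).eventually_nhds |>.exists
    have hcone := hC.fibre_cone z.proj
    have h1 : vec z ∈ closure (interior (fibre C z.proj)) := by
      rw [hcone.convex.closure_interior_eq_closure_of_nonempty_interior hcone.interior_nonempty]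
      exact subset_closure hzC
    obtain ⟨y, hyi, hy⟩ := ((mem_closure_iff_frequently.1 h1).and_eventually
      ((continuous_fibre z.proj).continuousAt.eventually hz).eventually_nhds).exists
    have hint : ∀ y' ∈ interior (fibre C z.proj),
        (⟨z.proj, y'⟩ : TangentBundle 𝓘(ℝ, E) M) ∈ C :=
      fun y' hy' => (interior_subset hy' : y' ∈ fibre C z.proj)
    have hzero' : onFibre ρ z.proj =ᶠ[𝓝 y] fun _ => 0 := by
      filter_upwards [hy, isOpen_interior.mem_nhds hyi] with y' h1 h2
      exact h1.1 (hint y' h2)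
    apply hy.self_of_nhds.2.2.2
    exact hzero'.fderiv_eq.trans (fderiv_const_apply 0)

end ConeTopology

section ConeTopology

variable {E : Type*} [NormedAddCommGroup E] [NormedSpace ℝ E]
  {M : Type*} [TopologicalSpace M] [ChartedSpace E M] [IsManifold 𝓘(ℝ, E) ∞ M]
  {C : Set (TangentBundle 𝓘(ℝ, E) M)}

theorem mem_of_mem_closure (hC : IsStronglyConvexConeStructure C)
    {v : TangentBundle 𝓘(ℝ, E) M} (hv : v ∈ closure C) (hv0 : vec v ≠ 0) : v ∈ C := by
  by_contra hvC
  have hb : v ∈ boundary C := ⟨⟨hv, fun h => hvC (interior_subset h)⟩, hv0⟩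
  obtain ⟨W, ρ, -, hvW, -, hWC, hρ, -⟩ := exists_sublevel hC hb
  exact hvC ((hWC v hvW).2 hρ.le)

theorem mem_of_mem_boundary (hC : IsStronglyConvexConeStructure C)
    {v : TangentBundle 𝓘(ℝ, E) M} (hv : v ∈ boundary C) : v ∈ C :=
  mem_of_mem_closure hC hv.1.1 hv.2

theorem mem_boundary_iff (hC : IsStronglyConvexConeStructure C) {v : TangentBundle 𝓘(ℝ, E) M} :
    v ∈ boundary C ↔ vec v ∈ frontier (fibre C v.proj) ∧ vec v ≠ 0 := by
  constructor
  · intro hv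
    have hvC := mem_of_mem_boundary hC hv
    refine ⟨⟨subset_closure hvC, fun hi => ?_⟩, hv.2⟩
    obtain ⟨W, ρ, hWo, hvW, -, hWC, hρ, hd⟩ := exists_sublevel hC hv
    have h1 : ∃ᶠ y : E in 𝓝 (vec v), 0 < onFibre ρ v.proj y :=
      frequently_pos_of_fderiv_ne_zero hρ hd
    obtain ⟨y, hy, hyi, hyW⟩ := (h1.and_eventually
      ((Filter.eventually_mem_set.2 (isOpen_interior.mem_nhds hi)).and
      ((continuous_fibre v.proj).continuousAt.eventually (hWo.mem_nhds hvW)))).exists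
    have : y ∈ fibre C v.proj := interior_subset hyi
    exact absurd ((hWC _ hyW).1 this) (not_le.2 hy)
  · rintro ⟨hf, h0⟩
    have hvC : v ∈ C := (hC.fibre_cone v.proj).closed _ hf.1 h0
    refine ⟨⟨subset_closure hvC, fun hi => hf.2 ?_⟩, h0⟩
    rw [mem_interior_iff_mem_nhds] at hi ⊢
    exact (continuous_fibre v.proj).continuousAt.preimage_mem_nhds hi

theorem mem_interior_of_fibre (hC : IsStronglyConvexConeStructure C) {p : M} {y : E}
    (hy : y ∈ interior (fibre C p)) : (⟨p, y⟩ : TangentBundle 𝓘(ℝ, E) M) ∈ interior C := by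
  by_contra hi
  have hyC : y ∈ fibre C p := interior_subset hy
  have h0 : y ≠ 0 := fun h => (hC.fibre_cone p).zero_notMem (h ▸ hyC)
  have hb : (⟨p, y⟩ : TangentBundle 𝓘(ℝ, E) M) ∈ boundary C :=
    ⟨⟨subset_closure hyC, hi⟩, h0⟩
  exact ((mem_boundary_iff hC).1 hb).1.2 hy

theorem continuousAt_cChart {x₀ : M} {u : CotangentBundle E M}
    (hu : u.proj ∈ (chartAt E x₀).source) : ContinuousAt (cChart x₀) u :=
  continuousAt_extChartAt' (I := cotangentModel E) (mem_cChart_source.2 hu)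

theorem continuousAt_cChart_symm {x₀ : M} {z : E × (E →L[ℝ] ℝ)}
    (hz : z.1 ∈ (extChartAt 𝓘(ℝ, E) x₀).target) :
    ContinuousAt (cChart x₀ : PartialEquiv (CotangentBundle E M) _).symm z :=
  continuousAt_extChartAt_symm'' (I := cotangentModel E)
    (by rw [cChart_target]; exact ⟨hz, mem_univ _⟩)

theorem continuous_covector (p : M) : Continuous (fun u : E →L[ℝ] ℝ => covector p u) :=
  FiberBundle.continuous_totalSpaceMk (E →L[ℝ] ℝ)
    (fun p : M => TangentSpace 𝓘(ℝ, E) p →L[ℝ] Trivial M ℝ p) p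

theorem mem_dualCone_iff {u : CotangentBundle E M} :
    u ∈ dualCone C ↔ ∀ y ∈ fibre C u.proj, 0 ≤ u.form y := Iff.rfl

/-- Positivity of a covector on a compact set of directions in `C` persists for nearby
covectors, since `C` is closed away from the zero section. -/
theorem eventually_pos_on_compact (hC : IsStronglyConvexConeStructure C) {x₀ : M}
    {z₀ : E × (E →L[ℝ] ℝ)} (hz₀ : z₀.1 ∈ (extChartAt 𝓘(ℝ, E) x₀).target) {S : Set E}
    (hS : IsCompact S) (hS0 : (0 : E) ∉ S)
    (h : ∀ y ∈ S, (tChart x₀).symm (z₀.1, y) ∈ C → 0 < z₀.2 y) :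
    ∀ᶠ z in 𝓝 z₀, ∀ y ∈ S, (tChart x₀).symm (z.1, y) ∈ C → 0 < z.2 y := by
  refine hS.eventually_forall_of_forall_eventually fun y hy => ?_
  have hyt : (z₀.1, y) ∈ (tChart x₀ : PartialEquiv (TangentBundle 𝓘(ℝ, E) M) (E × E)).target := by
    rw [tChart_target]; exact ⟨hz₀, mem_univ _⟩
  by_cases hyC : (tChart x₀).symm (z₀.1, y) ∈ C
  · have hc : Continuous fun w : (E × (E →L[ℝ] ℝ)) × E => w.1.2 w.2 := by fun_prop
    exact (hc.continuousAt.eventually (lt_mem_nhds (h y hy hyC))).mono fun w hw _ => hw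
  · have hne : vec ((tChart x₀).symm (z₀.1, y)) ≠ 0 := by
      rw [tChart_symm_apply hz₀]
      intro h0
      have h0' : ofCoord x₀ ((extChartAt 𝓘(ℝ, E) x₀).symm z₀.1) y = 0 := h0
      have := toCoord_ofCoord (symm_mem_source hz₀) y
      rw [h0', map_zero] at this
      exact hS0 (this ▸ hy)
    have hcl : (tChart x₀).symm (z₀.1, y) ∈ (closure C)ᶜ := fun hcl =>
      hyC (mem_of_mem_closure hC hcl hne)
    have hg : ContinuousAt (fun w : (E × (E →L[ℝ] ℝ)) × E => (w.1.1, w.2)) (z₀, y) := by fun_prop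
    have hf : ContinuousAt (fun w : (E × (E →L[ℝ] ℝ)) × E =>
        (tChart x₀ : PartialEquiv (TangentBundle 𝓘(ℝ, E) M) (E × E)).symm (w.1.1, w.2)) (z₀, y) :=
      ContinuousAt.comp (f := fun w : (E × (E →L[ℝ] ℝ)) × E => (w.1.1, w.2))
        (x := (z₀, y)) (continuousAt_tChart_symm hyt) hg
    filter_upwards [hf.preimage_mem_nhds (isClosed_closure.isOpen_compl.mem_nhds hcl)] with w hw hwC
    exact absurd (subset_closure hwC) hw

theorem cChart_eq {x₀ : M} {u : CotangentBundle E M} (hu : u.proj ∈ (chartAt E x₀).source) :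
    cChart x₀ u = (extChartAt 𝓘(ℝ, E) x₀ u.proj, u.form.comp (ofCoord x₀ u.proj)) :=
  cChart_apply hu u.form

theorem tChart_symm_extChartAt {x₀ p : M} (hp : p ∈ (chartAt E x₀).source) (y : E) :
    (tChart x₀).symm (extChartAt 𝓘(ℝ, E) x₀ p, y) =
      (⟨p, ofCoord (E := E) x₀ p y⟩ : TangentBundle 𝓘(ℝ, E) M) := by
  have h : extChartAt 𝓘(ℝ, E) x₀ p ∈ (extChartAt 𝓘(ℝ, E) x₀).target :=
    (extChartAt 𝓘(ℝ, E) x₀).map_source (by simpa using hp)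
  rw [tChart_symm_apply h, (extChartAt 𝓘(ℝ, E) x₀).left_inv (by simpa using hp)]

theorem eventually_proj_mem {x₀ : M} {u : CotangentBundle E M}
    (hu : u.proj ∈ (chartAt E x₀).source) : ∀ᶠ u' in 𝓝 u, u'.proj ∈ (chartAt E x₀).source :=
  (FiberBundle.continuous_proj (E →L[ℝ] ℝ)
    (fun p : M => TangentSpace 𝓘(ℝ, E) p →L[ℝ] Trivial M ℝ p)).continuousAt.eventually
    ((chartAt E x₀).open_source.mem_nhds hu)

/-- A covector belongs to `∂C*` if and only if it is nonzero, nonnegative on `C`, and vanishes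
somewhere on `C`. -/
theorem mem_dualBoundary_iff [FiniteDimensional ℝ E] (hC : IsStronglyConvexConeStructure C)
    {u : CotangentBundle E M} :
    u ∈ dualBoundary C ↔ u.form ≠ 0 ∧ (∀ y ∈ fibre C u.proj, 0 ≤ u.form y) ∧
      ∃ y ∈ fibre C u.proj, u.form y = 0 := by
  have hs : u.proj ∈ (chartAt E u.proj).source := mem_chart_source E u.proj
  have hz₀ : (cChart u.proj u).1 ∈ (extChartAt 𝓘(ℝ, E) u.proj).target := by
    rw [cChart_eq hs]; exact mem_extChartAt_target u.proj
  constructor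
  · rintro ⟨hu, hu0⟩
    have hnonneg : ∀ y ∈ fibre C u.proj, 0 ≤ u.form y := by
      have hcone := hC.fibre_cone u.proj
      have hint : ∀ y ∈ interior (fibre C u.proj), 0 ≤ u.form y := by
        intro y hy
        by_contra hneg
        -- if `u` is negative on an interior vector `y` of `C`, so are the covectors near `u` on
        -- the vectors with the same coordinates, which still belong to `C`
        have h1 : ∀ᶠ u' in 𝓝 u, (cChart u.proj u').2 y < 0 := by
          have hc : ContinuousAt (fun u' => (cChart u.proj u').2 y) u :=
            (continuous_snd.continuousAt.comp (continuousAt_cChart hs)).clm_apply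
              continuousAt_const
          refine hc.eventually (gt_mem_nhds ?_)
          change (cChart u.proj u).2 y < 0
          rw [cChart_eq hs, ofCoord_self]
          exact not_le.1 hneg
        have h2 : ∀ᶠ u' in 𝓝 u, (tChart u.proj).symm ((cChart u.proj u').1, y) ∈ interior C := by
          have hyt : ((cChart u.proj u).1, y) ∈
              (tChart u.proj : PartialEquiv (TangentBundle 𝓘(ℝ, E) M) (E × E)).target := by
            rw [tChart_target]; exact ⟨hz₀, mem_univ _⟩
          have hc : ContinuousAt (fun u' => ((cChart u.proj u').1, y)) u :=
            (continuous_fst.continuousAt.comp (continuousAt_cChart hs)).prodMk continuousAt_const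
          have hc2 := ContinuousAt.comp (f := fun u' => ((cChart u.proj u').1, y))
            (x := u) (continuousAt_tChart_symm hyt) hc
          refine hc2.eventually (isOpen_interior.mem_nhds ?_)
          change (tChart u.proj).symm ((cChart u.proj u).1, y) ∈ interior C
          rw [cChart_eq hs, tChart_symm_extChartAt hs, ofCoord_self]
          exact mem_interior_of_fibre hC hy
        obtain ⟨u', hu', h1', h2', hs'⟩ := ((mem_closure_iff_frequently.1 hu.1).and_eventually
          (h1.and (h2.and (eventually_proj_mem hs)))).exists
        rw [cChart_eq hs'] at h1' h2'
        rw [tChart_symm_extChartAt hs'] at h2'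
        have h3 := interior_subset h2'
        exact absurd (mem_dualCone_iff.1 hu' _ h3) (not_le.2 h1')
      intro y hy
      have h1 : y ∈ closure (interior (fibre C u.proj)) := by
        rw [hcone.convex.closure_interior_eq_closure_of_nonempty_interior hcone.interior_nonempty]
        exact subset_closure hy
      exact closure_minimal hint (isClosed_le continuous_const u.form.continuous) h1
    refine ⟨hu0, hnonneg, ?_⟩
    by_contra hcon
    push Not at hcon
    apply hu.2
    rw [mem_interior_iff_mem_nhds]
    -- a covector that is positive on the compact set of unit vectors in `C` is interior to `C*`
    have h1 := eventually_pos_on_compact hC hz₀ (isCompact_sphere (0 : E) 1) (by simp)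
      (fun y hy hyC => by
        rw [cChart_eq hs, tChart_symm_extChartAt hs, ofCoord_self] at hyC
        rw [cChart_eq hs, ofCoord_self]
        exact lt_of_le_of_ne (hnonneg y hyC) (hcon y hyC).symm)
    filter_upwards [(continuousAt_cChart hs).eventually h1, eventually_proj_mem hs] with u' hu' hs'
    rw [mem_dualCone_iff]
    intro y hy
    have hy0 : y ≠ 0 := fun h => (hC.fibre_cone u'.proj).zero_notMem (h ▸ hy)
    have hyc : toCoord u.proj u'.proj y ≠ 0 := fun h => hy0 ((toCoord_eq_zero_iff hs').1 h)
    have hn : 0 < ‖toCoord u.proj u'.proj y‖ := norm_pos_iff.2 hyc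
    have h2 := hu' (‖toCoord u.proj u'.proj y‖⁻¹ • toCoord u.proj u'.proj y)
      (by simp [norm_smul, hn.ne'])
    rw [cChart_eq hs', tChart_symm_extChartAt hs'] at h2
    simp only [ContinuousLinearMap.comp_apply, map_smul, ofCoord_toCoord hs'] at h2
    have h3 := h2 ((hC.fibre_cone u'.proj).smul_mem y hy _ (inv_pos.2 hn))
    exact (pos_of_mul_pos_right h3 (inv_pos.2 hn).le).le
  · rintro ⟨hu0, hnn, y, hyC, hy⟩
    refine ⟨⟨subset_closure (mem_dualCone_iff.2 hnn), fun hi => ?_⟩, hu0⟩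
    have hy0 : y ≠ 0 := fun h => (hC.fibre_cone u.proj).zero_notMem (h ▸ hyC)
    -- subtracting a covector that is positive on the null vector `y` leads out of `C*`
    obtain ⟨g, -, hg⟩ := exists_dual_vector ℝ y (norm_ne_zero_iff.2 hy0)
    have hc : Continuous fun t : ℝ => covector u.proj (u.form - t • g) :=
      (continuous_covector u.proj).comp (by fun_prop)
    have h1 : ∀ᶠ t : ℝ in 𝓝 0, covector u.proj (u.form - t • g) ∈ dualCone C := by
      refine hc.continuousAt.eventually (?_ : dualCone C ∈ 𝓝 _)
      change dualCone C ∈ 𝓝 (covector u.proj (u.form - (0 : ℝ) • g))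
      rw [zero_smul, sub_zero]
      exact mem_interior_iff_mem_nhds.1 hi
    obtain ⟨t, ht, ht0⟩ := ((h1.filter_mono nhdsWithin_le_nhds).and
      (self_mem_nhdsWithin : Ioi (0 : ℝ) ∈ 𝓝[>] 0)).exists
    have h2 : 0 ≤ (u.form - t • g) y := mem_dualCone_iff.1 ht y hyC
    simp only [_root_.sub_apply, _root_.smul_apply, hy, hg, smul_eq_mul] at h2
    have h3 : 0 < t * ‖y‖ := mul_pos ht0 (norm_pos_iff.2 hy0)
    simp at h2
    linarith

end ConeTopology

/-! ### Convex cones and their height functions -/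

section Height

variable {E : Type*} [NormedAddCommGroup E] [NormedSpace ℝ E] {K : Set E}

theorem IsProperCone.add_mem (hK : IsProperCone K) {x y : E} (hx : x ∈ K) (hy : y ∈ K) :
    x + y ∈ K := by
  have h := hK.convex (hK.smul_mem x hx 2 two_pos) (hK.smul_mem y hy 2 two_pos)
    (by norm_num : (0 : ℝ) ≤ 1 / 2) (by norm_num : (0 : ℝ) ≤ 1 / 2) (by norm_num)
  simpa [smul_smul] using h

theorem IsProperCone.isClosed_insert (hK : IsProperCone K) : IsClosed (insert 0 K) := by
  refine isClosed_of_closure_subset fun x hx => ?_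
  by_cases h0 : x = 0
  · exact Or.inl h0
  · rw [insert_eq, closure_union, closure_singleton] at hx
    rcases hx with h | h
    · exact absurd h h0
    · exact Or.inr (hK.closed x h h0)

theorem IsProperCone.add_mem_interior (hK : IsProperCone K) {x y : E} (hx : x ∈ interior K)
    (hy : y ∈ insert 0 K) : x + y ∈ interior K := by
  rcases hy with rfl | hy
  · rwa [add_zero]
  · rw [mem_interior_iff_mem_nhds] at hx ⊢
    have hc : ContinuousAt (fun z : E => z - y) (x + y) := by fun_prop
    have : K ∈ 𝓝 ((fun z : E => z - y) (x + y)) := by simpa using hx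
    filter_upwards [hc.preimage_mem_nhds this] with z hz
    have h := hK.add_mem hz hy
    simpa using h

theorem IsProperCone.smul_mem_interior (hK : IsProperCone K) {x : E} (hx : x ∈ interior K)
    {r : ℝ} (hr : 0 < r) : r • x ∈ interior K := by
  rw [mem_interior_iff_mem_nhds] at hx ⊢
  have hc : ContinuousAt (fun z : E => r⁻¹ • z) (r • x) := by fun_prop
  have : K ∈ 𝓝 ((fun z : E => r⁻¹ • z) (r • x)) := by simpa [smul_smul, hr.ne'] using hx
  filter_upwards [hc.preimage_mem_nhds this] with z hz
  have h := hK.smul_mem _ hz r hr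
  simpa [smul_smul, hr.ne'] using h

theorem IsProperCone.ne_zero (hK : IsProperCone K) {x : E} (hx : x ∈ K) : x ≠ 0 :=
  fun h => hK.zero_notMem (h ▸ hx)

/-- The height of the cone `K` over `w` in the direction `e`: the smallest `t` such that `w + t e`
lies in the closure of `K`. -/
def coneHeight (K : Set E) (e w : E) : ℝ := sInf {t : ℝ | w + t • e ∈ K}

variable (hK : IsProperCone K) {e : E} (he : e ∈ interior K)
include hK he

theorem height_set_nonempty (w : E) : {t : ℝ | w + t • e ∈ K}.Nonempty := by
  have hc : ContinuousAt (fun s : ℝ => s • w + e) 0 := by fun_prop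
  have h0 : K ∈ 𝓝 ((fun s : ℝ => s • w + e) 0) := by
    simpa using mem_interior_iff_mem_nhds.1 he
  obtain ⟨s, hs, hs0⟩ := (((hc.eventually h0).filter_mono nhdsWithin_le_nhds).and
    (self_mem_nhdsWithin : Ioi (0 : ℝ) ∈ 𝓝[>] 0)).exists
  have hs0 : 0 < s := hs0
  refine ⟨s⁻¹, ?_⟩
  have h := hK.smul_mem _ hs s⁻¹ (inv_pos.2 hs0)
  simpa [smul_smul, hs0.ne'] using h

theorem height_set_upward {w : E} {s t : ℝ} (hs : w + s • e ∈ insert 0 K) (hst : s < t) :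
    w + t • e ∈ interior K := by
  have h := hK.add_mem_interior (hK.smul_mem_interior he (sub_pos.2 hst)) hs
  convert h using 1
  module

theorem height_set_bddBelow (w : E) : BddBelow {t : ℝ | w + t • e ∈ K} := by
  by_contra hb
  have hall : ∀ t : ℝ, w + t • e ∈ K := by
    intro t
    rw [bddBelow_def] at hb
    push Not at hb
    obtain ⟨s, hs, hst⟩ := hb t
    exact interior_subset (height_set_upward hK he (Or.inr hs) hst)
  have heK : e ∈ K := interior_subset he
  have hcl : -e ∈ closure K := by
    have hc : ContinuousAt (fun s : ℝ => s • w - e) 0 := by fun_prop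
    have hmem : ∀ᶠ s : ℝ in 𝓝[>] 0, s • w - e ∈ K := by
      filter_upwards [self_mem_nhdsWithin] with s hs
      have hs : 0 < s := hs
      have h := hK.smul_mem _ (hall (-s⁻¹)) s hs
      simpa [smul_smul, hs.ne', sub_eq_add_neg] using h
    have ht : Filter.Tendsto (fun s : ℝ => s • w - e) (𝓝[>] 0) (𝓝 (-e)) := by
      have := hc.tendsto.mono_left (nhdsWithin_le_nhds (s := Ioi (0 : ℝ)))
      simpa using this
    exact mem_closure_of_tendsto ht hmem
  exact hK.neg_notMem e heK (hK.closed _ hcl (neg_ne_zero.2 (hK.ne_zero heK)))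

theorem mem_interior_iff_coneHeight_lt {w : E} {t : ℝ} :
    w + t • e ∈ interior K ↔ coneHeight K e w < t := by
  constructor
  · intro h
    have hc : ContinuousAt (fun s : ℝ => w + s • e) t := by fun_prop
    have h0 : K ∈ 𝓝 ((fun s : ℝ => w + s • e) t) := mem_interior_iff_mem_nhds.1 h
    obtain ⟨s, hs, hst⟩ := (((hc.eventually h0).filter_mono nhdsWithin_le_nhds).and
      (self_mem_nhdsWithin : Iio t ∈ 𝓝[<] t)).exists
    exact (csInf_le (height_set_bddBelow hK he w) hs).trans_lt hst
  · intro h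
    obtain ⟨s, hs, hst⟩ := exists_lt_of_csInf_lt (height_set_nonempty hK he w) h
    exact height_set_upward hK he (Or.inr hs) hst

theorem mem_insert_iff_coneHeight_le {w : E} {t : ℝ} :
    w + t • e ∈ insert 0 K ↔ coneHeight K e w ≤ t := by
  constructor
  · intro h
    refine le_of_forall_gt fun s hs => ?_
    exact (mem_interior_iff_coneHeight_lt hK he).1 (height_set_upward hK he h hs)
  · intro h
    have hc : Filter.Tendsto (fun s : ℝ => w + s • e) (𝓝[>] t) (𝓝 (w + t • e)) := by
      have hc : ContinuousAt (fun s : ℝ => w + s • e) t := by fun_prop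
      exact hc.tendsto.mono_left nhdsWithin_le_nhds
    refine hK.isClosed_insert.mem_of_tendsto hc ?_
    filter_upwards [self_mem_nhdsWithin] with s hs
    exact Or.inr (interior_subset ((mem_interior_iff_coneHeight_lt hK he).2 (h.trans_lt hs)))

theorem coneHeight_smul {r : ℝ} (hr : 0 < r) (w : E) :
    coneHeight K e (r • w) = r * coneHeight K e w := by
  refine eq_of_forall_ge_iff fun t => ?_
  have hmem : ∀ {x : E} {s : ℝ}, 0 < s → x ∈ insert 0 K → s • x ∈ insert 0 K := by
    rintro x s hs (rfl | hx)
    · exact Or.inl (smul_zero s)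
    · exact Or.inr (hK.smul_mem x hx s hs)
  rw [← mem_insert_iff_coneHeight_le hK he, ← le_div_iff₀' hr,
    ← mem_insert_iff_coneHeight_le hK he]
  constructor
  · intro h
    convert hmem (inv_pos.2 hr) h using 1
    rw [smul_add, smul_smul, smul_smul, inv_mul_cancel₀ hr.ne', one_smul, div_eq_inv_mul]
  · intro h
    convert hmem hr h using 1
    rw [smul_add, smul_smul, mul_div_cancel₀ _ hr.ne']

theorem coneHeight_neg_pos {w : E} (hw : w ∈ K) : 0 < coneHeight K e (-w) := by
  by_contra h
  have h1 := (mem_insert_iff_coneHeight_le hK he (w := -w) (t := 0)).2 (not_lt.1 h)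
  rw [zero_smul, add_zero] at h1
  rcases h1 with h1 | h1
  · exact hK.ne_zero hw (neg_eq_zero.1 h1)
  · exact hK.neg_notMem w hw h1

end Height

/-! ### Defining functions of a convex cone -/

section Defining

variable {E : Type*} [NormedAddCommGroup E] [NormedSpace ℝ E] {K : Set E}
  (hK : IsProperCone K) {f : E → ℝ} {v : E} (hv : v ∈ K) (hf : DifferentiableAt ℝ f v)
  (h0 : f v = 0) (hfK : ∀ᶠ y in 𝓝 v, y ∈ K ↔ f y ≤ 0)
include hf h0 hfK

/-- The differential of a defining function is nonpositive on directions pointing into the cone. -/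
theorem fderiv_nonpos_of_eventually_mem {w : E} (hw : ∀ᶠ s : ℝ in 𝓝[>] 0, v + s • w ∈ K) :
    fderiv ℝ f v w ≤ 0 := by
  have hl : HasDerivAt (fun s : ℝ => v + s • w) w 0 := by
    simpa using ((hasDerivAt_id (0 : ℝ)).smul_const w).const_add v
  have hf' : HasFDerivAt f (fderiv ℝ f v) (v + (0 : ℝ) • w) := by
    rw [zero_smul, add_zero]; exact hf.hasFDerivAt
  have hd : HasDerivAt (fun s : ℝ => f (v + s • w)) (fderiv ℝ f v w) 0 :=
    hf'.comp_hasDerivAt (0 : ℝ) hl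
  have hslope := hasDerivAt_iff_tendsto_slope.1 hd
  have hslope' := hslope.mono_left (nhdsWithin_mono (0 : ℝ)
    (fun s (hs : s ∈ Ioi (0 : ℝ)) => (ne_of_gt hs : s ∈ ({0}ᶜ : Set ℝ))))
  refine le_of_tendsto hslope' ?_
  have hc : Filter.Tendsto (fun s : ℝ => v + s • w) (𝓝[>] 0) (𝓝 v) := by
    have := hl.continuousAt.tendsto.mono_left (nhdsWithin_le_nhds (s := Ioi (0 : ℝ)))
    simpa using this
  filter_upwards [hw, hc.eventually hfK, self_mem_nhdsWithin] with s hs hs' hs0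
  have hs0 : 0 < s := hs0
  rw [slope_def_field]
  simp only [zero_smul, add_zero, h0, sub_zero]
  exact div_nonpos_of_nonpos_of_nonneg (hs'.1 hs) hs0.le

include hK hv

theorem fderiv_nonpos_of_mem {w : E} (hw : w ∈ K) : fderiv ℝ f v w ≤ 0 := by
  refine fderiv_nonpos_of_eventually_mem hf h0 hfK ?_
  filter_upwards [self_mem_nhdsWithin] with s hs
  exact hK.add_mem hv (hK.smul_mem w hw s hs)

theorem fderiv_neg_of_mem_interior (hd : fderiv ℝ f v ≠ 0) {e : E} (he : e ∈ interior K) :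
    fderiv ℝ f v e < 0 := by
  refine lt_of_le_of_ne (fderiv_nonpos_of_mem hK hv hf h0 hfK (interior_subset he)) fun h => hd ?_
  have hm : IsLocalMax (fderiv ℝ f v) e := by
    filter_upwards [mem_interior_iff_mem_nhds.1 he] with y hy
    rw [h]; exact fderiv_nonpos_of_mem hK hv hf h0 hfK hy
  have := hm.fderiv_eq_zero
  rwa [ContinuousLinearMap.fderiv] at this

end Defining

/-! ### Comparison of defining functions and Lorentz forms -/

section Comparison

variable {E : Type*} [NormedAddCommGroup E] [NormedSpace ℝ E]

theorem eventually_neg_of_fderiv_neg {f : E → ℝ} {v w : E} (hf : DifferentiableAt ℝ f v)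
    (h0 : f v = 0) (hw : fderiv ℝ f v w < 0) : ∀ᶠ s : ℝ in 𝓝[>] 0, f (v + s • w) < 0 := by
  have hl : HasDerivAt (fun s : ℝ => v + s • w) w 0 := by
    simpa using ((hasDerivAt_id (0 : ℝ)).smul_const w).const_add v
  have hf' : HasFDerivAt f (fderiv ℝ f v) (v + (0 : ℝ) • w) := by
    rw [zero_smul, add_zero]; exact hf.hasFDerivAt
  have hd : HasDerivAt (fun s : ℝ => f (v + s • w)) (fderiv ℝ f v w) 0 :=
    hf'.comp_hasDerivAt (0 : ℝ) hl
  have hslope := (hasDerivAt_iff_tendsto_slope.1 hd).mono_left (nhdsWithin_mono (0 : ℝ)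
    (fun s (hs : s ∈ Ioi (0 : ℝ)) => (ne_of_gt hs : s ∈ ({0}ᶜ : Set ℝ))))
  filter_upwards [hslope.eventually (gt_mem_nhds hw), self_mem_nhdsWithin] with s hs hs0
  have hs0 : 0 < s := hs0
  rw [slope_def_field] at hs
  simp only [zero_smul, add_zero, h0, sub_zero] at hs
  by_contra h
  exact absurd (div_nonneg (not_lt.1 h) hs0.le) (not_le.2 hs)

theorem exists_eq_one_of_ne_zero {l : E →L[ℝ] ℝ} (hl : l ≠ 0) : ∃ n, l n = 1 := by
  obtain ⟨n, hn⟩ : ∃ n, l n ≠ 0 := by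
    by_contra h
    push Not at h
    exact hl (ContinuousLinearMap.ext h)
  exact ⟨(l n)⁻¹ • n, by rw [map_smul, smul_eq_mul, inv_mul_cancel₀ hn]⟩

/-- A linear form that is nonpositive on the half space `l < 0` is a positive multiple of `l`. -/
theorem exists_eq_smul_of_nonpos {l k : E →L[ℝ] ℝ} (key : ∀ w, l w < 0 → k w ≤ 0) (hl : l ≠ 0)
    (hk : k ≠ 0) : ∃ c : ℝ, 0 < c ∧ k = c • l := by
  obtain ⟨n, hn⟩ := exists_eq_one_of_ne_zero hl
  have hker : ∀ w, l w = 0 → k w ≤ 0 := by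
    intro w hw
    by_contra hpos
    push Not at hpos
    have h1 : 0 < |k n| + 1 := by positivity
    have h2 := key (w - (k w / (|k n| + 1)) • n) (by
      rw [map_sub, map_smul, hw, hn, smul_eq_mul, mul_one, zero_sub]
      exact neg_neg_of_pos (div_pos hpos h1))
    rw [map_sub, map_smul, smul_eq_mul, div_mul_eq_mul_div, sub_nonpos, le_div_iff₀ h1] at h2
    nlinarith [le_abs_self (k n)]
  have hker' : ∀ w, l w = 0 → k w = 0 := fun w hw =>
    le_antisymm (hker w hw) (by
      have := hker (-w) (by rw [map_neg, hw, neg_zero])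
      rw [map_neg] at this
      linarith)
  have heq : k = (k n) • l := by
    ext w
    have := hker' (w - (l w) • n) (by simp [hn])
    rw [map_sub, map_smul, sub_eq_zero] at this
    rw [this, _root_.smul_apply, smul_eq_mul, smul_eq_mul, mul_comm]
  refine ⟨k n, lt_of_le_of_ne ?_ fun h => hk ?_, heq⟩
  · have := key (-n) (by rw [map_neg, hn]; norm_num)
    rw [map_neg] at this
    linarith
  · rw [heq, ← h, zero_smul]

/-- Two functions with the same sublevel set `≤ 0` have positively proportional differentials. -/
theorem exists_fderiv_eq_smul {f g : E → ℝ} {v : E} (hf : DifferentiableAt ℝ f v)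
    (hg : DifferentiableAt ℝ g v) (hf0 : f v = 0) (hg0 : g v = 0)
    (hfg : ∀ᶠ y in 𝓝 v, f y ≤ 0 ↔ g y ≤ 0) (hdf : fderiv ℝ f v ≠ 0) (hdg : fderiv ℝ g v ≠ 0) :
    ∃ c : ℝ, 0 < c ∧ fderiv ℝ g v = c • fderiv ℝ f v :=
  exists_eq_smul_of_nonpos (fun _ hw =>
    fderiv_nonpos_of_eventually_mem (K := {y | f y ≤ 0}) hg hg0 hfg
      ((eventually_neg_of_fderiv_neg hf hf0 hw).mono fun _ hs => hs.le)) hdf hdg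

/-- The second derivative of `f` along the parabola `v + t w + t² a`. -/
theorem deriv_deriv_parabola {f : E → ℝ} {v : E} (hf : ContDiffAt ℝ 2 f v) (w a : E) :
    ContinuousAt (fun t : ℝ => f (v + t • w + (t * t) • a)) 0 ∧
    deriv (fun t : ℝ => f (v + t • w + (t * t) • a)) 0 = fderiv ℝ f v w ∧
    deriv (deriv (fun t : ℝ => f (v + t • w + (t * t) • a))) 0 =
      fderiv ℝ (fderiv ℝ f) v w w + 2 * fderiv ℝ f v a := by
  set ψ : ℝ → E := fun t => v + t • w + (t * t) • a with hψ
  have hψ0 : ψ 0 = v := by simp [hψ]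
  have hψd : ∀ t, HasDerivAt ψ (w + (2 * t) • a) t := by
    intro t
    have h1 : HasDerivAt (fun t : ℝ => t • w) w t := by
      simpa using (hasDerivAt_id t).smul_const w
    have h2 : HasDerivAt (fun t : ℝ => (t * t) • a) ((2 * t) • a) t := by
      have := ((hasDerivAt_id' t).mul (hasDerivAt_id' t)).smul_const a
      rwa [one_mul, mul_one, ← two_mul] at this
    exact (h1.const_add v).add h2
  have hev : ∀ᶠ t in 𝓝 (0 : ℝ), DifferentiableAt ℝ f (ψ t) := by
    have hc : ContinuousAt ψ 0 := (hψd 0).continuousAt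
    rw [ContinuousAt, hψ0] at hc
    exact hc.eventually ((hf.eventually (by simp)).mono fun y hy =>
      hy.differentiableAt (by norm_num))
  have hd : ∀ᶠ t in 𝓝 (0 : ℝ), HasDerivAt (fun t => f (ψ t))
      (fderiv ℝ f (ψ t) (w + (2 * t) • a)) t :=
    hev.mono fun t ht => ht.hasFDerivAt.comp_hasDerivAt t (hψd t)
  have hderiv : deriv (fun t => f (ψ t)) =ᶠ[𝓝 0] fun t => fderiv ℝ f (ψ t) (w + (2 * t) • a) :=
    hd.mono fun t ht => ht.deriv
  refine ⟨hd.self_of_nhds.continuousAt, ?_, ?_⟩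
  · rw [hderiv.self_of_nhds]
    change fderiv ℝ f (ψ 0) (w + (2 * 0 : ℝ) • a) = _
    rw [hψ0]; simp
  · rw [hderiv.deriv_eq]
    have h1 : DifferentiableAt ℝ (fderiv ℝ f) (ψ 0) := by
      rw [hψ0]
      exact (hf.fderiv_right (m := 1) (by norm_num)).differentiableAt one_ne_zero
    have h2 : HasDerivAt (fun t => fderiv ℝ f (ψ t))
        (fderiv ℝ (fderiv ℝ f) (ψ 0) (w + (2 * 0 : ℝ) • a)) 0 :=
      h1.hasFDerivAt.comp_hasDerivAt (0 : ℝ) (hψd 0)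
    have h3 : HasDerivAt (fun t : ℝ => w + (2 * t) • a) ((2 : ℝ) • a) 0 := by
      have := (((hasDerivAt_id (0 : ℝ)).const_mul 2).smul_const a).const_add w
      simpa using this
    have h4 := (h2.clm_apply h3).deriv
    rw [h4]
    change fderiv ℝ (fderiv ℝ f) (ψ 0) (w + (2 * 0 : ℝ) • a) (w + (2 * 0 : ℝ) • a) +
      fderiv ℝ f (ψ 0) ((2 : ℝ) • a) = _
    rw [hψ0]
    simp

/-- On the common kernel of the differentials, the Hessian of one of two functions with the same
sublevel set `≤ 0` is not larger than the corresponding multiple of the Hessian of the other one: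
otherwise one function would be negative and the other one positive along a parabola. -/
theorem hessian_le_of_sublevel_eq {f g : E → ℝ} {v : E} (hf : ContDiffAt ℝ 2 f v)
    (hg : ContDiffAt ℝ 2 g v) (hf0 : f v = 0) (hg0 : g v = 0)
    (hfg : ∀ᶠ y in 𝓝 v, f y ≤ 0 ↔ g y ≤ 0) (hdf : fderiv ℝ f v ≠ 0) {c : ℝ} (hc : 0 < c)
    (hgf : fderiv ℝ g v = c • fderiv ℝ f v) {w : E} (hw : fderiv ℝ f v w = 0) :
    fderiv ℝ (fderiv ℝ g) v w w ≤ c * fderiv ℝ (fderiv ℝ f) v w w := by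
  by_contra hlt
  push Not at hlt
  obtain ⟨n, hn⟩ := exists_eq_one_of_ne_zero hdf
  set Qf := fderiv ℝ (fderiv ℝ f) v w w
  set Qg := fderiv ℝ (fderiv ℝ g) v w w
  -- `a` is chosen such that along the parabola `v + t w + t² a` the second derivative of `f` is
  -- `-δ < 0`, while that of `g` is `Qg - c Qf - c δ > 0`; so `f` has a maximum and `g` a minimum,
  -- and `g` vanishes near `0`, as `f ≤ 0` implies `g ≤ 0`
  set δ := (Qg - c * Qf) / (2 * c) with hδ
  have hδ0 : 0 < δ := div_pos (sub_pos.2 hlt) (by positivity)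
  have hδ1 : c * δ = (Qg - c * Qf) / 2 := by rw [hδ]; field_simp
  set a : E := (-(Qf + δ) / 2) • n
  have hfa : fderiv ℝ f v a = -(Qf + δ) / 2 := by simp [a, hn]
  obtain ⟨hcf, hdf1, hdf2⟩ := deriv_deriv_parabola hf w a
  obtain ⟨hcg, hdg1, hdg2⟩ := deriv_deriv_parabola hg w a
  have hmax := isLocalMax_of_deriv_deriv_neg (x₀ := (0 : ℝ)) (by rw [hdf2, hfa]; linarith)
    (hdf1.trans hw) hcf
  have hgpos : 0 < Qg + 2 * fderiv ℝ g v a := by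
    rw [hgf, _root_.smul_apply, hfa, smul_eq_mul]
    nlinarith
  have hmin := isLocalMin_of_deriv_deriv_pos (x₀ := (0 : ℝ)) (by rw [hdg2]; exact hgpos)
    (by rw [hdg1, hgf, _root_.smul_apply, hw, smul_zero]) hcg
  have hψ : Filter.Tendsto (fun t : ℝ => v + t • w + (t * t) • a) (𝓝 0) (𝓝 v) := by
    have : Continuous fun t : ℝ => v + t • w + (t * t) • a := by fun_prop
    simpa using this.tendsto 0
  have hz : (fun t : ℝ => g (v + t • w + (t * t) • a)) =ᶠ[𝓝 0] fun _ => 0 := by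
    filter_upwards [hmax, hmin, hψ.eventually hfg] with t h1 h2 h3
    simp only [zero_smul, mul_zero, add_zero, hf0, hg0] at h1 h2
    exact le_antisymm (h3.1 h1) h2
  have : deriv (deriv (fun t : ℝ => g (v + t • w + (t * t) • a))) 0 = 0 := by
    have h1 := hz.deriv
    rw [h1.deriv_eq]
    simp
  rw [hdg2] at this
  linarith

/-- On the common kernel of the differentials, the Hessians of two functions with the same sublevel
set `≤ 0` are proportional with the same factor as the differentials. -/
theorem hessian_eq_of_sublevel_eq {f g : E → ℝ} {v : E} (hf : ContDiffAt ℝ 2 f v)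
    (hg : ContDiffAt ℝ 2 g v) (hf0 : f v = 0) (hg0 : g v = 0)
    (hfg : ∀ᶠ y in 𝓝 v, f y ≤ 0 ↔ g y ≤ 0) (hdf : fderiv ℝ f v ≠ 0) {c : ℝ} (hc : 0 < c)
    (hgf : fderiv ℝ g v = c • fderiv ℝ f v) {w w' : E} (hw : fderiv ℝ f v w = 0)
    (hw' : fderiv ℝ f v w' = 0) :
    fderiv ℝ (fderiv ℝ g) v w w' = c * fderiv ℝ (fderiv ℝ f) v w w' := by
  have hdiag : ∀ x, fderiv ℝ f v x = 0 →
      fderiv ℝ (fderiv ℝ g) v x x = c * fderiv ℝ (fderiv ℝ f) v x x := by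
    intro x hx
    refine le_antisymm (hessian_le_of_sublevel_eq hf hg hf0 hg0 hfg hdf hc hgf hx) ?_
    have hfg' : fderiv ℝ f v = c⁻¹ • fderiv ℝ g v := by
      rw [hgf, smul_smul, inv_mul_cancel₀ hc.ne', one_smul]
    have := hessian_le_of_sublevel_eq hg hf hg0 hf0 (hfg.mono fun y hy => hy.symm)
      (by rw [hgf]; exact smul_ne_zero hc.ne' hdf) (inv_pos.2 hc) hfg'
      (w := x) (by rw [hgf, _root_.smul_apply, hx, smul_zero])
    rwa [inv_mul_eq_div, le_div_iff₀' hc] at this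
  have hsf := (hf.isSymmSndFDerivAt (by simp)).eq w w'
  have hsg := (hg.isSymmSndFDerivAt (by simp)).eq w w'
  have h1 := hdiag (w + w') (by rw [map_add, hw, hw', add_zero])
  have h2 := hdiag w hw
  have h3 := hdiag w' hw'
  simp only [map_add, _root_.add_apply, mul_add] at h1
  rw [h2, h3, ← hsf, ← hsg] at h1
  linarith

/-- A symmetric form with a null vector `v` is Lorentzian if it is positive semidefinite on the
orthogonal complement of `v`, with kernel spanned by `v`. -/
theorem isLorentzForm_of_null {B : E →L[ℝ] E →L[ℝ] ℝ} (hsymm : ∀ v w, B v w = B w v) {v : E}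
    (hvv : B v v = 0) (hne : B v ≠ 0) (hpos : ∀ w, B v w = 0 → 0 ≤ B w w)
    (hker : ∀ w, B v w = 0 → (∀ w', B v w' = 0 → B w w' = 0) → ∃ r : ℝ, w = r • v) :
    IsLorentzForm B := by
  -- a semidefinite form vanishes on a vector only if this vector is in the kernel
  have hnull : ∀ w, B v w = 0 → B w w ≤ 0 → ∃ r : ℝ, w = r • v := by
    intro w hw hww
    have hww0 : B w w = 0 := le_antisymm hww (hpos w hw)
    refine hker w hw fun w' hw' => ?_
    by_contra hb
    have hq : ∀ t : ℝ, 0 ≤ 2 * t * B w w' + B w' w' := by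
      intro t
      have := hpos (t • w + w') (by simp [hw, hw'])
      simp only [map_add, map_smul, _root_.add_apply, _root_.smul_apply, smul_eq_mul, hww0,
        hsymm w' w] at this
      linarith
    have h1 := hq (-(B w' w' + 1) / (2 * B w w'))
    have h2 : 2 * (-(B w' w' + 1) / (2 * B w w')) * B w w' = -(B w' w' + 1) := by
      field_simp
    rw [h2] at h1
    linarith
  obtain ⟨n, hn⟩ := exists_eq_one_of_ne_zero hne
  -- `v - s • n` is timelike for small `s > 0`, as `B (v - s • n) (v - s • n) = -2 s + s² B n n`
  have hs0 : 0 < 1 / (|B n n| + 1) := by positivity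
  set s : ℝ := 1 / (|B n n| + 1) with hs
  have hs1 : s * B n n < 1 := by
    rw [hs, one_div, inv_mul_lt_iff₀ (by positivity)]
    linarith [le_abs_self (B n n)]
  refine ⟨hsymm, v - s • n, ?_, ?_⟩
  · simp only [map_sub, map_smul, _root_.sub_apply, _root_.smul_apply, smul_eq_mul, hvv, hn,
      hsymm n v]
    nlinarith
  · intro w hw hw0
    by_contra hle
    push Not at hle
    set e := v - s • n with he
    have hee : B e e < 0 := by
      simp only [he, map_sub, map_smul, _root_.sub_apply, _root_.smul_apply, smul_eq_mul, hvv, hn,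
        hsymm n v]
      nlinarith
    have hve : B v e = -s := by simp [he, hvv, hn]
    -- the plane spanned by `e` and `w` meets the complement of `v`
    set z := (B v w / s) • e + w with hz
    have hvz : B v z = 0 := by
      simp only [hz, map_add, map_smul, smul_eq_mul, hve]
      field_simp
      ring
    have hzz : B z z = (B v w / s) ^ 2 * B e e + B w w := by
      simp only [hz, map_add, map_smul, _root_.add_apply, _root_.smul_apply, smul_eq_mul, hw,
        hsymm w e]
      ring
    obtain ⟨r, hr⟩ := hnull z hvz (by rw [hzz]; nlinarith [sq_nonneg (B v w / s)])
    have hzz0 : B z z = 0 := by rw [hr]; simp [hvv]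
    have hvw : B v w / s = 0 := by
      by_contra h
      have : 0 < (B v w / s) ^ 2 := by positivity
      nlinarith
    rw [hz, hvw, zero_smul, zero_add] at hr
    have hr0 : r ≠ 0 := fun h => hw0 (by rw [hr, h, zero_smul])
    rw [hr, map_smul, hsymm e v, hve, smul_eq_mul] at hw
    rcases mul_eq_zero.1 hw with h | h
    · exact hr0 h
    · linarith

theorem IsLorentzForm.nondegenerate {B : E →L[ℝ] E →L[ℝ] ℝ} (hB : IsLorentzForm B) {w : E}
    (hw : B w = 0) : w = 0 := by
  obtain ⟨hs, e, -, hpos⟩ := hB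
  by_contra h0
  have := hpos w (by rw [hs, hw]; rfl) h0
  rw [hw] at this
  exact lt_irrefl _ this

/-- Being a Lorentz form is an open condition on symmetric forms. -/
theorem IsLorentzForm.eventually [FiniteDimensional ℝ E] {B : E →L[ℝ] E →L[ℝ] ℝ}
    (hB : IsLorentzForm B) : ∀ᶠ B' in 𝓝 B, (∀ v w, B' v w = B' w v) → IsLorentzForm B' := by
  obtain ⟨hs, e, he, hpos⟩ := hB
  -- adding a large multiple of `B(e, ·)²` makes the form positive definite
  set c : ℝ := 2 / |B e e| with hc
  have hee : |B e e| = -B e e := abs_of_neg he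
  have hdef : ∀ w ∈ Metric.sphere (0 : E) 1, 0 < B w w + c * (B e w) ^ 2 := by
    intro w hw
    have hw0 : w ≠ 0 := by rintro rfl; simp at hw
    set a := B e w / B e e with ha
    set y := w - a • e with hy
    have hey : B e y = 0 := by
      simp only [hy, map_sub, map_smul, smul_eq_mul, ha]
      field_simp [he.ne]
      ring
    have haw : B e w = a * B e e := by rw [ha]; field_simp [he.ne]
    have hww : B w w = B y y + a ^ 2 * B e e := by
      have hwy : w = y + a • e := by rw [hy]; abel
      rw [hwy]
      simp only [map_add, map_smul, _root_.add_apply, _root_.smul_apply, smul_eq_mul, hey, hs y e]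
      ring
    have hce : c * (B e w) ^ 2 = -2 * (a ^ 2 * B e e) := by
      rw [haw, hc, hee]
      field_simp [he.ne]
    rw [hww, hce]
    by_cases hy0 : y = 0
    · have ha0 : a ≠ 0 := by
        intro h
        apply hw0
        rw [h, zero_smul, sub_zero] at hy
        rw [← hy, hy0]
      have : 0 < a ^ 2 := by positivity
      rw [hy0]
      simp only [map_zero]
      nlinarith
    · have := hpos y hey hy0
      nlinarith [sq_nonneg a]
  have h1 : ∀ᶠ B' in 𝓝 B, ∀ w ∈ Metric.sphere (0 : E) 1, 0 < B' w w + c * (B' e w) ^ 2 := by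
    refine (isCompact_sphere (0 : E) 1).eventually_forall_of_forall_eventually fun w hw => ?_
    have hcont : Continuous fun q : (E →L[ℝ] E →L[ℝ] ℝ) × E =>
        q.1 q.2 q.2 + c * (q.1 e q.2) ^ 2 :=
      ((continuous_fst.clm_apply continuous_snd).clm_apply continuous_snd).add (continuous_const.mul
        (((continuous_fst.clm_apply continuous_const).clm_apply continuous_snd).pow 2))
    exact hcont.continuousAt.eventually (lt_mem_nhds (hdef w hw))
  have h2 : ∀ᶠ B' in 𝓝 B, B' e e < 0 := by
    have hcont : Continuous fun B' : E →L[ℝ] E →L[ℝ] ℝ => B' e e := by fun_prop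
    exact hcont.continuousAt.eventually (gt_mem_nhds he)
  filter_upwards [h1, h2] with B' h1 h2 hs'
  refine ⟨hs', e, h2, fun w hw hw0 => ?_⟩
  have hn : 0 < ‖w‖ := norm_pos_iff.2 hw0
  have := h1 (‖w‖⁻¹ • w) (by simp [norm_smul, hn.ne'])
  simp only [map_smul, _root_.smul_apply, smul_eq_mul, hw, mul_zero, ne_eq, OfNat.ofNat_ne_zero,
    not_false_eq_true, zero_pow, add_zero] at this
  have h3 : 0 < ‖w‖⁻¹ := inv_pos.2 hn
  exact pos_of_mul_pos_right (pos_of_mul_pos_right this h3.le) h3.le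

end Comparison

/-! ### The height function of a cone structure -/

section HeightFunction

variable {E : Type*} [NormedAddCommGroup E] [NormedSpace ℝ E]
  {M : Type*} [TopologicalSpace M] [ChartedSpace E M] [IsManifold 𝓘(ℝ, E) ∞ M]
  {C : Set (TangentBundle 𝓘(ℝ, E) M)}

theorem mem_interior_fibre {p : M} {y : E}
    (h : (⟨p, y⟩ : TangentBundle 𝓘(ℝ, E) M) ∈ interior C) : y ∈ interior (fibre C p) :=
  preimage_interior_subset_interior_preimage (continuous_fibre p) h

/-- There is a smooth vector field with values in the interior of a cone structure. -/
theorem exists_interior_section [FiniteDimensional ℝ E] [T2Space M] [SecondCountableTopology M]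
    (hC : IsStronglyConvexConeStructure C) :
    ∃ e : Cₛ^∞⟮𝓘(ℝ, E); E, (TangentSpace 𝓘(ℝ, E) : M → Type _)⟯,
      ∀ p : M, (e p : E) ∈ interior (fibre C p) := by
  have : LocallyCompactSpace M := ChartedSpace.locallyCompactSpace E M
  refine exists_contMDiffSection_forall_mem_convex_of_local 𝓘(ℝ, E) (TangentSpace 𝓘(ℝ, E))
    (fun p => (interior (fibre C p) : Set E))
    (fun p => ((hC.fibre_cone p).convex.interior : Convex ℝ (interior (fibre C p)))) fun x₀ => ?_
  obtain ⟨y₀, hy₀⟩ := (hC.fibre_cone x₀).interior_nonempty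
  -- a section that is constant in the chart at `x₀`
  let s : M → TangentBundle 𝓘(ℝ, E) M := fun p =>
    (tChart x₀).symm (extChartAt 𝓘(ℝ, E) x₀ p, y₀)
  have hsm : ContMDiffOn 𝓘(ℝ, E) 𝓘(ℝ, E).tangent ∞ s (chartAt E x₀).source := by
    have h1 : ContMDiffOn 𝓘(ℝ, E) 𝓘(ℝ, E × E) ∞
        (fun p => (extChartAt 𝓘(ℝ, E) x₀ p, y₀)) (chartAt E x₀).source :=
      contMDiffOn_extChartAt.prodMk_space contMDiffOn_const
    have h2 := contMDiffOn_extChartAt_symm (I := 𝓘(ℝ, E).tangent) (n := ∞)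
      (⟨x₀, 0⟩ : TangentBundle 𝓘(ℝ, E) M)
    rw [ModelWithCorners.tangent, ← modelWithCornersSelf_prod] at h2 ⊢
    refine h2.comp h1 fun p hp => ?_
    rw [modelWithCornersSelf_prod]
    change _ ∈ (tChart x₀ : PartialEquiv (TangentBundle 𝓘(ℝ, E) M) (E × E)).target
    rw [tChart_target]
    exact ⟨(extChartAt 𝓘(ℝ, E) x₀).map_source (by rwa [extChartAt_source]), mem_univ _⟩
  have hs : ∀ p ∈ (chartAt E x₀).source,
      s p = ⟨p, ofCoord (E := E) x₀ p y₀⟩ := fun p hp => tChart_symm_extChartAt hp y₀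
  have hx₀ : s x₀ ∈ interior C := by
    rw [hs x₀ (mem_chart_source E x₀), ofCoord_self]
    exact mem_interior_of_fibre hC hy₀
  have hev : ∀ᶠ p in 𝓝 x₀, s p ∈ interior C ∧ p ∈ (chartAt E x₀).source :=
    ((hsm.contMDiffAt (chart_source_mem_nhds E x₀)).continuousAt.eventually
      (isOpen_interior.mem_nhds hx₀)).and (chart_source_mem_nhds E x₀)
  refine ⟨_, hev, fun p => ofCoord (E := E) x₀ p y₀, ?_, fun p hp => ?_⟩
  · exact (hsm.mono fun p hp => hp.2).congr fun p hp => (hs p hp.2).symm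
  · have h1 := hp.1
    rw [hs p hp.2] at h1
    exact mem_interior_fibre (y := (ofCoord (E := E) x₀ p y₀ : E)) h1

/-- The height of a cone structure `C` over `v ∈ TM` in the direction of a vector field. -/
def heightFun (C : Set (TangentBundle 𝓘(ℝ, E) M)) (e : M → E) (v : TangentBundle 𝓘(ℝ, E) M) : ℝ :=
  coneHeight (fibre C v.proj) (e v.proj) (vec v)

variable (hC : IsStronglyConvexConeStructure C) {e : M → E}
  (he : ∀ p : M, e p ∈ interior (fibre C p))
include hC he

theorem mem_interior_iff_heightFun_lt {p : M} {y : E} {t : ℝ} :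
    (⟨p, y + t • e p⟩ : TangentBundle 𝓘(ℝ, E) M) ∈ interior C ↔ heightFun C e ⟨p, y⟩ < t := by
  refine Iff.trans ?_ (mem_interior_iff_coneHeight_lt (hC.fibre_cone p).toIsProperCone (he p))
  exact ⟨fun h => mem_interior_fibre h, fun h => mem_interior_of_fibre hC h⟩

theorem mem_iff_heightFun_le {p : M} {y : E} {t : ℝ} (h0 : y + t • e p ≠ 0) :
    (⟨p, y + t • e p⟩ : TangentBundle 𝓘(ℝ, E) M) ∈ C ↔ heightFun C e ⟨p, y⟩ ≤ t := by
  refine Iff.trans ?_ (mem_insert_iff_coneHeight_le (hC.fibre_cone p).toIsProperCone (he p))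
  exact ⟨fun h => Or.inr h, fun h => h.resolve_left h0⟩

/-- The boundary point over `v` in the direction of the vector field. -/
theorem heightFun_boundary {p : M} {y : E} {t : ℝ} (h0 : y + t • e p ≠ 0) :
    (⟨p, y + t • e p⟩ : TangentBundle 𝓘(ℝ, E) M) ∈ boundary C ↔ heightFun C e ⟨p, y⟩ = t := by
  constructor
  · intro h
    refine le_antisymm ((mem_iff_heightFun_le hC he h0).1 (mem_of_mem_boundary hC h)) ?_
    exact not_lt.1 fun hlt => h.1.2 ((mem_interior_iff_heightFun_lt hC he).2 hlt)
  · intro h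
    exact ⟨⟨subset_closure ((mem_iff_heightFun_le hC he h0).2 h.le), fun hi =>
      h.not_lt ((mem_interior_iff_heightFun_lt hC he).1 hi)⟩, h0⟩

/-- The vector field in the chart at `x₀`. -/
def localField (e : M → E) (x₀ : M) (x : E) : E :=
  toCoord x₀ ((extChartAt 𝓘(ℝ, E) x₀).symm x) (e ((extChartAt 𝓘(ℝ, E) x₀).symm x))

omit hC he in
theorem contDiffAt_localField
    (hsm : ContMDiff 𝓘(ℝ, E) 𝓘(ℝ, E).tangent ∞ (fun p => (⟨p, e p⟩ : TangentBundle 𝓘(ℝ, E) M)))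
    {x₀ : M} {x : E} (hx : x ∈ (extChartAt 𝓘(ℝ, E) x₀).target) :
    ContDiffAt ℝ ∞ (localField e x₀) x := by
  have h1 : ContMDiffAt 𝓘(ℝ, E) 𝓘(ℝ, E) ∞ (extChartAt 𝓘(ℝ, E) x₀).symm x :=
    (contMDiffOn_extChartAt_symm (I := 𝓘(ℝ, E)) (n := ∞) x₀).contMDiffAt
      ((isOpen_extChartAt_target x₀).mem_nhds hx)
  have h2 := hsm.contMDiffAt.comp x h1
  have h3 := contMDiffAt_extChartAt' (I := 𝓘(ℝ, E).tangent) (n := ∞)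
    (x := (⟨x₀, 0⟩ : TangentBundle 𝓘(ℝ, E) M))
    (x' := (⟨(extChartAt 𝓘(ℝ, E) x₀).symm x, e ((extChartAt 𝓘(ℝ, E) x₀).symm x)⟩ :
      TangentBundle 𝓘(ℝ, E) M)) (by
      have := (mem_tChart_source (v := (⟨(extChartAt 𝓘(ℝ, E) x₀).symm x,
        e ((extChartAt 𝓘(ℝ, E) x₀).symm x)⟩ : TangentBundle 𝓘(ℝ, E) M))).2
        (symm_mem_source hx : _ ∈ (chartAt E x₀).source)
      rwa [tChart, extChartAt_source] at this)
  exact contDiffAt_snd.comp x (contMDiffAt_iff_contDiffAt.1 (h3.comp x h2))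

omit hC he in
theorem tChart_symm_add_field {x₀ : M} {x : E} (hx : x ∈ (extChartAt 𝓘(ℝ, E) x₀).target) (y : E)
    (t : ℝ) : ((tChart x₀).symm (x, y + t • localField e x₀ x) : TangentBundle 𝓘(ℝ, E) M) =
      ⟨(extChartAt 𝓘(ℝ, E) x₀).symm x, (ofCoord (E := E) x₀ ((extChartAt 𝓘(ℝ, E) x₀).symm x) y +
        t • e ((extChartAt 𝓘(ℝ, E) x₀).symm x) : E)⟩ := by
  rw [tChart_symm_apply hx, localField, map_add, map_smul, ofCoord_toCoord (symm_mem_source hx)]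

/-- The height function is continuous off the span of the vector field: the conditions `height < t`
and `height > t` say that `v + t e` lies in the interior of `C`, respectively outside of its
closure. -/
theorem continuousAt_localHeight
    (hsm : ContMDiff 𝓘(ℝ, E) 𝓘(ℝ, E).tangent ∞ (fun p => (⟨p, e p⟩ : TangentBundle 𝓘(ℝ, E) M)))
    {x₀ : M} {z : E × E} (hz : z.1 ∈ (extChartAt 𝓘(ℝ, E) x₀).target)
    (hne : ∀ t : ℝ, z.2 + t • localField e x₀ z.1 ≠ 0) :
    ContinuousAt (fun z => heightFun C e ((tChart x₀).symm z)) z := by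
  have hmap : ∀ t : ℝ, ContinuousAt (fun z : E × E =>
      ((tChart x₀).symm (z.1, z.2 + t • localField e x₀ z.1) : TangentBundle 𝓘(ℝ, E) M)) z := by
    intro t
    have hg : ContinuousAt (fun z : E × E => (z.1, z.2 + t • localField e x₀ z.1)) z := by
      have h1 : ContinuousAt (fun z : E × E => localField e x₀ z.1) z :=
        ContinuousAt.comp (g := localField e x₀) (f := Prod.fst)
          (contDiffAt_localField hsm hz).continuousAt continuousAt_fst
      exact continuousAt_fst.prodMk (continuousAt_snd.add (h1.const_smul t))
    refine ContinuousAt.comp (g := (tChart x₀).symm)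
      (f := fun z : E × E => (z.1, z.2 + t • localField e x₀ z.1)) (continuousAt_tChart_symm ?_) hg
    rw [tChart_target]
    exact ⟨hz, mem_univ _⟩
  have htar : ∀ᶠ z' : E × E in 𝓝 z, z'.1 ∈ (extChartAt 𝓘(ℝ, E) x₀).target :=
    continuousAt_fst.eventually ((isOpen_extChartAt_target x₀).mem_nhds hz)
  rw [ContinuousAt, tendsto_order]
  constructor
  · intro t ht
    have hv0 : vec ((tChart x₀).symm (z.1, z.2 + t • localField e x₀ z.1) :
        TangentBundle 𝓘(ℝ, E) M) ≠ 0 := by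
      rw [tChart_symm_apply hz]
      intro h
      apply hne t
      have h' : ofCoord x₀ ((extChartAt 𝓘(ℝ, E) x₀).symm z.1)
        (z.2 + t • localField e x₀ z.1) = 0 := h
      rw [← toCoord_ofCoord (symm_mem_source hz) (z.2 + t • localField e x₀ z.1), h', map_zero]
    have hnC : ((tChart x₀).symm (z.1, z.2 + t • localField e x₀ z.1) :
        TangentBundle 𝓘(ℝ, E) M) ∈ (closure C)ᶜ := by
      intro hcl
      have h := mem_of_mem_closure hC hcl hv0
      rw [tChart_symm_add_field hz] at h hv0
      rw [mem_iff_heightFun_le hC he hv0, ← tChart_symm_apply hz] at h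
      exact absurd ht (not_lt.2 h)
    filter_upwards [(hmap t).eventually (isClosed_closure.isOpen_compl.mem_nhds hnC),
      (hmap t).eventually (eventually_ne_zero hv0), htar] with z' h1 h2 h3
    rw [tChart_symm_add_field h3] at h1 h2
    by_contra hle
    refine h1 (subset_closure ((mem_iff_heightFun_le hC he h2).2 ?_))
    rw [← tChart_symm_apply h3]
    exact not_lt.1 hle
  · intro t ht
    have hi : ((tChart x₀).symm (z.1, z.2 + t • localField e x₀ z.1) :
        TangentBundle 𝓘(ℝ, E) M) ∈ interior C := by
      rw [tChart_symm_add_field hz, mem_interior_iff_heightFun_lt hC he, ← tChart_symm_apply hz]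
      exact ht
    filter_upwards [(hmap t).eventually (isOpen_interior.mem_nhds hi), htar] with z' h1 h3
    have h1 : ((tChart x₀).symm (z'.1, z'.2 + t • localField e x₀ z'.1) :
        TangentBundle 𝓘(ℝ, E) M) ∈ interior C := h1
    rw [tChart_symm_add_field h3, mem_interior_iff_heightFun_lt hC he, ← tChart_symm_apply h3] at h1
    exact h1

/-- The height function is smooth off the span of the vector field, by the implicit function
theorem: the derivative of a defining function of `C` in the direction of an interior vector is
negative. -/
theorem contDiffAt_localHeight [CompleteSpace E]
    (hsm : ContMDiff 𝓘(ℝ, E) 𝓘(ℝ, E).tangent ∞ (fun p => (⟨p, e p⟩ : TangentBundle 𝓘(ℝ, E) M)))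
    {x₀ : M} {z : E × E} (hz : z.1 ∈ (extChartAt 𝓘(ℝ, E) x₀).target)
    (hne : ∀ t : ℝ, z.2 + t • localField e x₀ z.1 ≠ 0) :
    ContDiffAt ℝ ∞ (fun z => heightFun C e ((tChart x₀).symm z)) z := by
  have hcont := continuousAt_localHeight hC he hsm hz hne
  set T : E × E → ℝ := fun z => heightFun C e ((tChart x₀).symm z) with hT
  set p := (extChartAt 𝓘(ℝ, E) x₀).symm z.1 with hp
  have hps : p ∈ (chartAt E x₀).source := symm_mem_source hz
  have hxp : extChartAt 𝓘(ℝ, E) x₀ p = z.1 := (extChartAt 𝓘(ℝ, E) x₀).right_inv hz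
  have hof : ∀ z' : E × E, z'.1 ∈ (extChartAt 𝓘(ℝ, E) x₀).target → ∀ t : ℝ,
      z'.2 + t • localField e x₀ z'.1 ≠ 0 →
      (ofCoord x₀ ((extChartAt 𝓘(ℝ, E) x₀).symm z'.1) z'.2 +
        t • e ((extChartAt 𝓘(ℝ, E) x₀).symm z'.1) ≠ 0) := by
    intro z' hz' t h h'
    apply h
    rw [← toCoord_ofCoord (symm_mem_source hz') z'.2, localField, ← map_smul, ← map_add, h',
      map_zero]
  have hTeq : ∀ z' : E × E, z'.1 ∈ (extChartAt 𝓘(ℝ, E) x₀).target →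
      T z' = heightFun C e ⟨(extChartAt 𝓘(ℝ, E) x₀).symm z'.1,
        ofCoord (E := E) x₀ ((extChartAt 𝓘(ℝ, E) x₀).symm z'.1) z'.2⟩ := fun z' hz' => by
    rw [hT, ← tChart_symm_apply hz']
  set v : TangentBundle 𝓘(ℝ, E) M := ⟨p, (ofCoord (E := E) x₀ p z.2 + T z • e p : E)⟩ with hv
  have hvsymm : (tChart x₀).symm (z.1, z.2 + T z • localField e x₀ z.1) = v :=
    tChart_symm_add_field hz _ _
  have hvb : v ∈ boundary C :=
    (heightFun_boundary hC he (hof z hz _ (hne _))).2 (hTeq z hz).symm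
  obtain ⟨W, ρ, hWo, hvW, hρ, hsub, hρ0, hd⟩ := exists_sublevel hC hvb
  have htv : ∀ y : E × ℝ, (z.1, y.1) ∈
      (tChart x₀ : PartialEquiv (TangentBundle 𝓘(ℝ, E) M) (E × E)).target := by
    intro y; rw [tChart_target]; exact ⟨hz, mem_univ _⟩
  have hρs : ContDiffAt ℝ ∞ (localLagrangian ρ x₀) (z.1, z.2 + T z • localField e x₀ z.1) :=
    contDiffAt_localLagrangian hWo hρ (htv (_, 0)) (by rw [hvsymm]; exact hvW)
  -- the height is the solution `t` of the equation `G (z, t) = 0`, where `G` is a defining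
  -- function of `C` at the vector with coordinates `z.2 + t • e`
  set m : (E × E) × ℝ → E × E := fun q => (q.1.1, q.1.2 + q.2 • localField e x₀ q.1.1) with hm
  have hms : ContDiffAt ℝ ∞ m (z, T z) := by
    have h1 : ContDiffAt ℝ ∞ (fun q : (E × E) × ℝ => localField e x₀ q.1.1) (z, T z) :=
      ContDiffAt.comp (g := localField e x₀) (z, T z) (contDiffAt_localField hsm hz)
        (contDiffAt_fst.comp _ contDiffAt_fst)
    exact (contDiffAt_fst.comp _ contDiffAt_fst).prodMk
      ((contDiffAt_snd.comp _ contDiffAt_fst).add (contDiffAt_snd.smul h1))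
  set G : (E × E) × ℝ → ℝ := fun q => localLagrangian ρ x₀ (m q) with hG
  have hGs : ContDiffAt ℝ ∞ G (z, T z) :=
    ContDiffAt.comp (g := localLagrangian ρ x₀) (z, T z) hρs hms
  have hG0 : G (z, T z) = 0 := by
    simp only [hG, hm, localLagrangian]
    rw [hvsymm, hρ0]
  have hGt : HasDerivAt (fun t => G (z, t)) (fderiv ℝ (onFibre ρ p) (vec v) (e p)) (T z) := by
    have h1 : HasDerivAt (fun t : ℝ => (ofCoord x₀ p z.2 + t • e p : E)) (e p) (T z) := by
      simpa using ((hasDerivAt_id' (T z)).smul_const (e p)).const_add (ofCoord x₀ p z.2)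
    have h2 := (hasFDerivAt_fibre hWo hρ hps hvW).differentiableAt.hasFDerivAt.comp_hasDerivAt
      (T z) h1
    refine h2.congr_of_eventuallyEq (Filter.Eventually.of_forall fun t => ?_)
    simp only [hG, hm, localLagrangian]
    rw [tChart_symm_add_field hz]
    rfl
  have hfv : ∀ᶠ y in 𝓝 (vec v), y ∈ fibre C p ↔ onFibre ρ p y ≤ 0 :=
    ((continuous_fibre p).continuousAt.eventually (hWo.mem_nhds hvW)).mono fun y hy => hsub _ hy
  have hneg : fderiv ℝ (onFibre ρ p) (vec v) (e p) < 0 :=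
    fderiv_neg_of_mem_interior (hC.fibre_cone p).toIsProperCone (mem_of_mem_boundary hC hvb)
      (hasFDerivAt_fibre hWo hρ hps hvW).differentiableAt hρ0 hfv hd (he p)
  have hinv : (fderiv ℝ G (z, T z) ∘L .inr ℝ (E × E) ℝ).IsInvertible := by
    have h1 : fderiv ℝ G (z, T z) ∘L .inr ℝ (E × E) ℝ =
        ContinuousLinearMap.toSpanSingleton ℝ (fderiv ℝ (onFibre ρ p) (vec v) (e p)) := by
      have h2 := ((hGs.differentiableAt (by simp)).hasFDerivAt.comp (T z)
        (hasFDerivAt_prodMk_right z (T z)))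
      exact h2.unique hGt.hasFDerivAt
    rw [h1]
    refine ⟨ContinuousLinearEquiv.unitsEquivAut ℝ (Units.mk0 _ hneg.ne), ?_⟩
    ext
    simp
  have hev := hGs.eventually_apply_eq_iff_implicitFunction (by simp) hinv
  have hsmooth := hGs.contDiffAt_implicitFunction (by simp) hinv
  rw [hG0] at hev
  refine hsmooth.congr_of_eventuallyEq ?_
  have hpair : Filter.Tendsto (fun z' => (z', T z')) (𝓝 z) (𝓝 (z, T z)) :=
    Filter.tendsto_id.prodMk_nhds hcont
  have htar : ∀ᶠ z' : E × E in 𝓝 z, z'.1 ∈ (extChartAt 𝓘(ℝ, E) x₀).target :=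
    continuousAt_fst.eventually ((isOpen_extChartAt_target x₀).mem_nhds hz)
  have hW' : ∀ᶠ q in 𝓝 (z, T z), (tChart x₀).symm (m q) ∈ W ∧ m q = m q := by
    have h1 : ContinuousAt (tChart x₀ : PartialEquiv (TangentBundle 𝓘(ℝ, E) M) (E × E)).symm
      (m (z, T z)) := continuousAt_tChart_symm (htv (_, 0))
    have h2 := ContinuousAt.comp (x := (z, T z)) h1 hms.continuousAt
    have h3 := h2.eventually (hWo.mem_nhds (by
      change (tChart x₀).symm (m (z, T z)) ∈ W
      rw [hm]; simp only; rw [hvsymm]; exact hvW))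
    exact h3.mono fun q hq => ⟨hq, rfl⟩
  have hnz : ∀ᶠ q in 𝓝 (z, T z), (m q).2 ≠ 0 :=
    (continuous_snd.continuousAt.comp hms.continuousAt).eventually
      (isOpen_ne.mem_nhds (hne (T z)))
  filter_upwards [hpair.eventually hev, hpair.eventually hW'.eventually_nhds,
    hpair.eventually hnz.eventually_nhds, htar] with z' h1 h2 h3 h4
  refine ((h1.1 ?_)).symm
  -- `G (z', ·)` vanishes at the height since it is nonpositive exactly above the height
  have hmem : ∀ᶠ t in 𝓝 (T z'), (G (z', t) ≤ 0 ↔ T z' ≤ t) := by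
    have hc : ContinuousAt (fun t : ℝ => (z', t)) (T z') := by fun_prop
    filter_upwards [hc.eventually h2, hc.eventually h3] with t ht ht3
    rw [hTeq z' h4, ← mem_iff_heightFun_le hC he (hof z' h4 t ht3), ← tChart_symm_add_field h4]
    exact (hsub _ ht.1).symm
  have hGc : ContinuousAt (fun t => G (z', t)) (T z') := by
    have hq : (tChart x₀).symm (m (z', T z')) ∈ W := h2.self_of_nhds.1
    have h5 : ContDiffAt ℝ ∞ (localLagrangian ρ x₀) (m (z', T z')) :=
      contDiffAt_localLagrangian hWo hρ (by rw [tChart_target]; exact ⟨h4, mem_univ _⟩) hq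
    have h6 : ContinuousAt (fun t : ℝ => m (z', t)) (T z') := by
      have : Continuous fun t : ℝ => m (z', t) := by
        simp only [hm]; fun_prop
      exact this.continuousAt
    exact ContinuousAt.comp (f := fun t : ℝ => m (z', t)) h5.continuousAt h6
  refine le_antisymm (hmem.self_of_nhds.2 le_rfl) ?_
  refine ge_of_tendsto (hGc.mono_left nhdsWithin_le_nhds : Filter.Tendsto _ (𝓝[<] (T z')) _) ?_
  filter_upwards [nhdsWithin_le_nhds hmem, self_mem_nhdsWithin] with t ht hlt
  by_contra hneg'
  exact absurd (ht.1 (not_le.1 hneg').le) (not_le.2 hlt)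

end HeightFunction

/-! ### Homogeneous functions and fundamental tensors -/

section Homogeneous

variable {E : Type*} [NormedAddCommGroup E] [NormedSpace ℝ E] {f : E → ℝ} {U : Set E}
  (hU : IsOpen U) (hf : ∀ y ∈ U, ContDiffAt ℝ 2 f y)
  (hom : ∀ y ∈ U, ∀ r : ℝ, 0 < r → f (r • y) = r ^ 2 * f y)
include hU hf hom

/-- Euler's identity for functions of degree two. -/
theorem fderiv_self_of_homogeneous {y : E} (hy : y ∈ U) : fderiv ℝ f y y = 2 * f y := by
  have h1 : HasDerivAt (fun r : ℝ => r • y) y 1 := by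
    simpa using (hasDerivAt_id' (1 : ℝ)).smul_const y
  have h2 : HasFDerivAt f (fderiv ℝ f y) ((1 : ℝ) • y) := by
    rw [one_smul]; exact ((hf y hy).differentiableAt (by simp)).hasFDerivAt
  have h3 := h2.comp_hasDerivAt (1 : ℝ) h1
  have h4 : HasDerivAt (fun r : ℝ => r ^ 2 * f y) (2 * f y) 1 := by
    simpa using (hasDerivAt_pow 2 (1 : ℝ)).mul_const (f y)
  refine h3.unique (h4.congr_of_eventuallyEq ?_)
  filter_upwards [lt_mem_nhds (zero_lt_one : (0 : ℝ) < 1)] with r hr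
  exact hom y hy r hr

theorem fderiv_smul_of_homogeneous {y : E} (hy : y ∈ U) {r : ℝ} (hr : 0 < r) (hry : r • y ∈ U) :
    fderiv ℝ f (r • y) = r • fderiv ℝ f y := by
  have h1 : HasFDerivAt (fun z : E => f (r • z)) ((fderiv ℝ f (r • y)).comp
      (r • ContinuousLinearMap.id ℝ E)) y :=
    ((hf _ hry).differentiableAt (by simp)).hasFDerivAt.comp y
      (r • ContinuousLinearMap.id ℝ E).hasFDerivAt
  have h2 : HasFDerivAt (fun z : E => r ^ 2 * f z) (r ^ 2 • fderiv ℝ f y) y :=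
    ((hf y hy).differentiableAt (by simp)).hasFDerivAt.const_mul _
  have h3 := h1.unique (h2.congr_of_eventuallyEq (by
    filter_upwards [hU.mem_nhds hy] with z hz
    exact hom z hz r hr))
  ext w
  have h4 := congrArg (fun l : E →L[ℝ] ℝ => l w) h3
  simp only [ContinuousLinearMap.comp_apply, _root_.smul_apply, ContinuousLinearMap.id_apply,
    map_smul, smul_eq_mul] at h4 ⊢
  have h5 : r * (fderiv ℝ f (r • y) w - r * fderiv ℝ f y w) = 0 := by linear_combination h4
  rcases mul_eq_zero.1 h5 with h | h
  · exact absurd h hr.ne'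
  · linarith

/-- The Legendre transform of a function of degree two is its differential. -/
theorem fderiv_fderiv_self_of_homogeneous (hcon : ∀ y ∈ U, ∀ r : ℝ, 0 < r → r • y ∈ U) {y : E}
    (hy : y ∈ U) : fderiv ℝ (fderiv ℝ f) y y = fderiv ℝ f y := by
  have h1 : HasDerivAt (fun r : ℝ => r • y) y 1 := by
    simpa using (hasDerivAt_id' (1 : ℝ)).smul_const y
  have h2 : HasFDerivAt (fderiv ℝ f) (fderiv ℝ (fderiv ℝ f) y) ((1 : ℝ) • y) := by
    rw [one_smul]
    exact (((hf y hy).fderiv_right (m := 1) (by norm_num)).differentiableAt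
      one_ne_zero).hasFDerivAt
  have h3 := h2.comp_hasDerivAt (1 : ℝ) h1
  have h4 : HasDerivAt (fun r : ℝ => r • fderiv ℝ f y) (fderiv ℝ f y) 1 := by
    simpa using (hasDerivAt_id' (1 : ℝ)).smul_const (fderiv ℝ f y)
  refine h3.unique (h4.congr_of_eventuallyEq ?_)
  filter_upwards [lt_mem_nhds (zero_lt_one : (0 : ℝ) < 1)] with r hr
  exact fderiv_smul_of_homogeneous hU hf hom hy hr (hcon y hy r hr)

end Homogeneous

section FundamentalTensor

variable {E : Type*} [NormedAddCommGroup E] [NormedSpace ℝ E]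
  {M : Type*} [TopologicalSpace M] [ChartedSpace E M] [IsManifold 𝓘(ℝ, E) ∞ M]

theorem contDiffAt_onFibre {A : Set (TangentBundle 𝓘(ℝ, E) M)} (hA : IsOpen A)
    {L : TangentBundle 𝓘(ℝ, E) M → ℝ} (hL : ContMDiffOn 𝓘(ℝ, E).tangent 𝓘(ℝ, ℝ) ∞ L A)
    {v : TangentBundle 𝓘(ℝ, E) M} (hv : v ∈ A) : ContDiffAt ℝ ∞ (onFibre L v.proj) (vec v) := by
  have hp : v.proj ∈ (chartAt E v.proj).source := mem_chart_source E v.proj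
  have h0 : tChart v.proj v ∈ (tChart v.proj).target :=
    (tChart v.proj).map_source (mem_tChart_source.2 hp)
  have h1 := contDiffAt_localLagrangian hA hL h0
    (by rwa [(tChart v.proj).left_inv (mem_tChart_source.2 hp)])
  have h2 : ContDiffAt ℝ ∞
      (fun y : E => (extChartAt 𝓘(ℝ, E) v.proj v.proj, toCoord v.proj v.proj y)) (vec v) :=
    contDiffAt_const.prodMk (toCoord v.proj v.proj).contDiff.contDiffAt
  refine (ContDiffAt.comp (g := localLagrangian L v.proj) (vec v) h1 h2).congr_of_eventuallyEq
    (Filter.Eventually.of_forall fun y' => ?_)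
  exact (localLagrangian_apply L hp y').symm

theorem contMDiffAt_of_chart {x₀ : M} {L : TangentBundle 𝓘(ℝ, E) M → ℝ}
    {v : TangentBundle 𝓘(ℝ, E) M} (hv : v.proj ∈ (chartAt E x₀).source)
    (h : ContDiffAt ℝ ∞ (localLagrangian L x₀) (tChart x₀ v)) :
    ContMDiffAt 𝓘(ℝ, E).tangent 𝓘(ℝ, ℝ) ∞ L v := by
  have h1 : ContMDiffAt 𝓘(ℝ, E).tangent 𝓘(ℝ, E × E) ∞ (tChart x₀) v :=
    contMDiffAt_extChartAt' (I := 𝓘(ℝ, E).tangent) (n := ∞)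
      (x := (⟨x₀, 0⟩ : TangentBundle 𝓘(ℝ, E) M)) (by
      have := mem_tChart_source.2 hv
      rwa [tChart, extChartAt_source] at this)
  have h2 := (contMDiffAt_iff_contDiffAt.2 h).comp v h1
  refine h2.congr_of_eventuallyEq ?_
  have h3 : (tChart x₀).source ∈ 𝓝 v :=
    (isOpen_extChartAt_source (I := 𝓘(ℝ, E).tangent)
      (⟨x₀, 0⟩ : TangentBundle 𝓘(ℝ, E) M)).mem_nhds (mem_tChart_source.2 hv)
  filter_upwards [h3] with w hw
  simp only [Function.comp, localLagrangian, (tChart x₀).left_inv hw]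

theorem tendsto_fibre_nhds {A : Set (TangentBundle 𝓘(ℝ, E) M)} (hA : IsOpen A) {p : M} {y : E}
    (hy : (⟨p, y⟩ : TangentBundle 𝓘(ℝ, E) M) ∈ A) :
    ∀ᶠ y' : E in 𝓝 y, (⟨p, y'⟩ : TangentBundle 𝓘(ℝ, E) M) ∈ A :=
  (continuous_fibre p).continuousAt.eventually (hA.mem_nhds hy)

/-- The fundamental tensor is the fibre part of the Hessian of the Lagrangian in coordinates. -/
theorem fundamentalTensor_apply {A : Set (TangentBundle 𝓘(ℝ, E) M)} (hA : IsOpen A)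
    {L : TangentBundle 𝓘(ℝ, E) M → ℝ} (hL : ContMDiffOn 𝓘(ℝ, E).tangent 𝓘(ℝ, ℝ) ∞ L A)
    {x₀ p : M} (hp : p ∈ (chartAt E x₀).source) {y : E}
    (hy : (⟨p, y⟩ : TangentBundle 𝓘(ℝ, E) M) ∈ A) (w w' : E) :
    fundamentalTensor L ⟨p, y⟩ w w' =
      fderiv ℝ (fderiv ℝ (localLagrangian L x₀)) (extChartAt 𝓘(ℝ, E) x₀ p, toCoord x₀ p y)
        (0, toCoord x₀ p w) (0, toCoord x₀ p w') := by
  set D := toCoord (E := E) x₀ p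
  set x := extChartAt 𝓘(ℝ, E) x₀ p
  have h0 : tChart x₀ (⟨p, y⟩ : TangentBundle 𝓘(ℝ, E) M) ∈ (tChart x₀).target :=
    (tChart x₀).map_source (mem_tChart_source.2 hp)
  have h1 : DifferentiableAt ℝ (fderiv ℝ (localLagrangian L x₀)) (x, D y) :=
    ((contDiffAt_localLagrangian hA hL h0
    (by rwa [(tChart x₀).left_inv (mem_tChart_source.2 hp)])).fderiv_right (m := 1)
      (by norm_cast)).differentiableAt one_ne_zero
  have h2 : HasFDerivAt (fun y : E => (x, D y)) ((ContinuousLinearMap.inr ℝ E E).comp D) y :=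
    (hasFDerivAt_prodMk_right _ _).comp y D.hasFDerivAt
  have h3 := h1.hasFDerivAt.comp y h2
  have h4 := ((h3.clm_comp (hasFDerivAt_const (ContinuousLinearMap.inr ℝ E E) y)).clm_comp
    (hasFDerivAt_const D y)).fderiv
  have h5 : fderiv ℝ (onFibre L p) =ᶠ[𝓝 y] fun y' =>
      ((fderiv ℝ (localLagrangian L x₀) (x, D y')).comp
        (ContinuousLinearMap.inr ℝ E E)).comp D := by
    filter_upwards [tendsto_fibre_nhds hA hy] with y' hy'
    exact (hasFDerivAt_fibre hA hL hp hy').fderiv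
  have h6 : fundamentalTensor L ⟨p, y⟩ = fderiv ℝ (fderiv ℝ (onFibre L p)) y := rfl
  rw [h6, h5.fderiv_eq]
  refine (congrArg (fun B : E →L[ℝ] E →L[ℝ] ℝ => B w w') h4).trans ?_
  simp

theorem IsLorentzForm.congr_equiv {B B' : E →L[ℝ] E →L[ℝ] ℝ} {D D' : E →L[ℝ] E}
    (h : IsLorentzForm B') (hB : ∀ w w', B w w' = B' (D w) (D w'))
    (hD : ∀ w, D' (D w) = w) (hD' : ∀ w, D (D' w) = w) : IsLorentzForm B := by
  obtain ⟨hs, e, he, hpos⟩ := h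
  refine ⟨fun v w => by rw [hB, hB, hs], D' e, by rwa [hB, hD'], fun w hw hw0 => ?_⟩
  rw [hB] at hw ⊢
  rw [hD'] at hw
  exact hpos _ hw fun h => hw0 (by rw [← hD w, h, map_zero])

/-- The fibre Hessian of a Lagrangian in coordinates. -/
def fibreHessian (l : E × E → ℝ) (z : E × E) : E →L[ℝ] E →L[ℝ] ℝ :=
  ((ContinuousLinearMap.compL ℝ E (E × E) ℝ).flip (ContinuousLinearMap.inr ℝ E E)).comp
    ((fderiv ℝ (fderiv ℝ l) z).comp (ContinuousLinearMap.inr ℝ E E))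

theorem fibreHessian_apply (l : E × E → ℝ) (z : E × E) (w w' : E) :
    fibreHessian l z w w' = fderiv ℝ (fderiv ℝ l) z (0, w) (0, w') := rfl

theorem continuousAt_fibreHessian {l : E × E → ℝ} {z : E × E} (hl : ContDiffAt ℝ ∞ l z) :
    ContinuousAt (fibreHessian l) z := by
  have h1 : ContinuousAt (fderiv ℝ (fderiv ℝ l)) z :=
    ((hl.fderiv_right (m := ∞) le_rfl).fderiv_right (m := 0) (by simp)).continuousAt
  exact continuousAt_const.clm_comp (h1.clm_comp continuousAt_const)

theorem fibreHessian_symm {l : E × E → ℝ} {z : E × E} (hl : ContDiffAt ℝ ∞ l z) (w w' : E) :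
    fibreHessian l z w w' = fibreHessian l z w' w :=
  ((hl.of_le (m := 2) (by norm_cast)).isSymmSndFDerivAt (by simp)).eq _ _

/-- The set where the fundamental tensor is Lorentzian is open. -/
theorem eventually_isLorentzForm [FiniteDimensional ℝ E] {A : Set (TangentBundle 𝓘(ℝ, E) M)}
    (hA : IsOpen A) {L : TangentBundle 𝓘(ℝ, E) M → ℝ}
    (hL : ContMDiffOn 𝓘(ℝ, E).tangent 𝓘(ℝ, ℝ) ∞ L A) {v : TangentBundle 𝓘(ℝ, E) M} (hv : v ∈ A)
    (h : IsLorentzForm (fundamentalTensor L v)) :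
    ∀ᶠ v' in 𝓝 v, IsLorentzForm (fundamentalTensor L v') := by
  set x₀ := v.proj with hx₀
  have hp : v.proj ∈ (chartAt E x₀).source := mem_chart_source E v.proj
  have hsm : ∀ v' : TangentBundle 𝓘(ℝ, E) M, v'.proj ∈ (chartAt E x₀).source → v' ∈ A →
      ContDiffAt ℝ ∞ (localLagrangian L x₀) (tChart x₀ v') := fun v' hv' hA' =>
    contDiffAt_localLagrangian hA hL ((tChart x₀).map_source (mem_tChart_source.2 hv'))
      (by rwa [(tChart x₀).left_inv (mem_tChart_source.2 hv')])
  have hB : ∀ v' : TangentBundle 𝓘(ℝ, E) M, v'.proj ∈ (chartAt E x₀).source → v' ∈ A →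
      ∀ w w', fundamentalTensor L v' w w' =
      fibreHessian (localLagrangian L x₀) (tChart x₀ v') (toCoord x₀ v'.proj w)
        (toCoord x₀ v'.proj w') :=
    fun v' hv' hA' w w' => fundamentalTensor_apply hA hL hv' (y := vec v') hA' w w'
  have h1 : IsLorentzForm (fibreHessian (localLagrangian L x₀) (tChart x₀ v)) :=
    h.congr_equiv (D := ofCoord (E := E) x₀ v.proj) (D' := toCoord x₀ v.proj)
      (fun w w' => by rw [hB v hp hv, toCoord_ofCoord hp, toCoord_ofCoord hp])
      (toCoord_ofCoord hp) (ofCoord_toCoord hp)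
  have h2 := ((continuousAt_fibreHessian (hsm v hp hv)).comp (continuousAt_tChart hp)).eventually
    h1.eventually
  have h3 : ∀ᶠ v' : TangentBundle 𝓘(ℝ, E) M in 𝓝 v, v'.proj ∈ (chartAt E x₀).source :=
    (FiberBundle.continuous_proj E (TangentSpace 𝓘(ℝ, E))).continuousAt.eventually
      ((chartAt E x₀).open_source.mem_nhds hp)
  filter_upwards [h2, h3, hA.mem_nhds hv] with v' h4 h5 h6
  exact (h4 (fibreHessian_symm (hsm v' h5 h6))).congr_equiv (hB v' h5 h6)
    (ofCoord_toCoord h5) (toCoord_ofCoord h5)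

end FundamentalTensor

/-! ### Existence of a Lorentz-Finsler metric -/

section Existence

variable {E : Type*} [NormedAddCommGroup E] [NormedSpace ℝ E] [FiniteDimensional ℝ E]
  {M : Type*} [TopologicalSpace M] [ChartedSpace E M] [IsManifold 𝓘(ℝ, E) ∞ M]
  {C : Set (TangentBundle 𝓘(ℝ, E) M)}

/-- The product of the heights of `v` and `-v`. -/
def heightProduct (C : Set (TangentBundle 𝓘(ℝ, E) M)) (e : M → E) (v : TangentBundle 𝓘(ℝ, E) M) :
    ℝ :=
  heightFun C e v * heightFun C e ⟨v.proj, (-vec v : E)⟩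

/-- The domain of the height product: the vectors that are not multiples of the vector field and
whose negative lies outside of the cone structure. -/
def heightDomain (C : Set (TangentBundle 𝓘(ℝ, E) M)) (e : M → E) :
    Set (TangentBundle 𝓘(ℝ, E) M) :=
  {v | (∀ t : ℝ, vec v + t • e v.proj ≠ 0) ∧ 0 < heightFun C e ⟨v.proj, (-vec v : E)⟩}

theorem coneHeight_add_smul {K : Set E} (hK : IsProperCone K) {e : E} (he : e ∈ interior K) (w : E)
    (t : ℝ) : coneHeight K e (w + t • e) = coneHeight K e w - t := by
  refine eq_of_forall_ge_iff fun s => ?_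
  rw [← mem_insert_iff_coneHeight_le hK he, sub_le_iff_le_add,
    ← mem_insert_iff_coneHeight_le hK he, add_assoc, ← add_smul, add_comm t s]

theorem coneHeight_zero {K : Set E} (hK : IsProperCone K) {e : E} (he : e ∈ interior K) :
    coneHeight K e 0 = 0 := by
  refine le_antisymm ((mem_insert_iff_coneHeight_le hK he).1 (Or.inl (by simp)))
    (not_lt.1 fun h => ?_)
  have h1 := (mem_interior_iff_coneHeight_lt hK he).2 h
  rw [zero_smul, add_zero] at h1
  exact hK.zero_notMem (interior_subset h1)

variable (hC : IsStronglyConvexConeStructure C) {e : M → E}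
  (he : ∀ p : M, e p ∈ interior (fibre C p))
include hC he

omit [FiniteDimensional ℝ E] in
theorem mem_iff_heightProduct_nonpos {v : TangentBundle 𝓘(ℝ, E) M} (hv : v ∈ heightDomain C e) :
    v ∈ C ↔ heightProduct C e v ≤ 0 := by
  have h0 : vec v + (0 : ℝ) • e v.proj ≠ 0 := hv.1 0
  have h1 := mem_iff_heightFun_le hC he h0
  rw [zero_smul, add_zero] at h1
  refine h1.trans ⟨fun h => mul_nonpos_of_nonpos_of_nonneg h hv.2.le, fun h => ?_⟩
  exact nonpos_of_mul_nonpos_left h hv.2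

theorem mem_boundary_iff_heightProduct {v : TangentBundle 𝓘(ℝ, E) M} :
    v ∈ boundary C ↔ v ∈ heightDomain C e ∧ heightProduct C e v = 0 := by
  constructor
  · intro hv
    have hT : heightFun C e v = 0 := by
      have h0 : vec v + (0 : ℝ) • e v.proj ≠ 0 := by rw [zero_smul, add_zero]; exact hv.2
      have h1 := heightFun_boundary hC he h0
      rw [zero_smul, add_zero] at h1
      exact h1.1 hv
    refine ⟨⟨fun t ht => hv.2 ?_, ?_⟩, ?_⟩
    · have h1 : heightFun C e ⟨v.proj, (vec v + t • e v.proj : E)⟩ = heightFun C e v - t :=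
        coneHeight_add_smul (hC.fibre_cone v.proj).toIsProperCone (he v.proj) _ t
      have h2 : heightFun C e ⟨v.proj, (0 : E)⟩ = 0 :=
        coneHeight_zero (hC.fibre_cone v.proj).toIsProperCone (he v.proj)
      rw [ht, h2, hT] at h1
      have h3 : t = 0 := by linarith
      rw [h3, zero_smul, add_zero] at ht
      exact ht
    · exact coneHeight_neg_pos (hC.fibre_cone v.proj).toIsProperCone (he v.proj)
        (mem_of_mem_boundary hC hv : v ∈ C)
    · rw [heightProduct, hT, zero_mul]
  · rintro ⟨hv, h⟩
    have h1 : heightFun C e v = 0 := (mul_eq_zero.1 h).resolve_right hv.2.ne'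
    have h2 := heightFun_boundary hC he (hv.1 0)
    rw [zero_smul, add_zero] at h2
    exact h2.2 h1

variable
    (hsm : ContMDiff 𝓘(ℝ, E) 𝓘(ℝ, E).tangent ∞ (fun p => (⟨p, e p⟩ : TangentBundle 𝓘(ℝ, E) M)))
include hsm

omit hC he in
theorem isOpen_not_multiple (he0 : ∀ p, e p ≠ 0) {x₀ : M} {z : E × E}
    (hz : z.1 ∈ (extChartAt 𝓘(ℝ, E) x₀).target) (hne : ∀ t : ℝ, z.2 + t • localField e x₀ z.1 ≠ 0) :
    ∀ᶠ z' : E × E in 𝓝 z, ∀ t : ℝ, z'.2 + t • localField e x₀ z'.1 ≠ 0 := by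
  have hloc : localField e x₀ z.1 ≠ 0 := by
    rw [localField, Ne, toCoord_eq_zero_iff (symm_mem_source hz)]
    exact he0 _
  have h1 : LinearIndependent ℝ ![localField e x₀ z.1, z.2] := by
    rw [LinearIndependent.pair_iff' hloc]
    intro a ha
    apply hne (-a)
    rw [← ha, neg_smul, add_neg_cancel]
  have h2 : ContinuousAt (fun z : E × E => ![localField e x₀ z.1, z.2]) z := by
    refine continuousAt_pi.2 fun i => ?_
    fin_cases i
    · exact ContinuousAt.comp (g := localField e x₀) (f := Prod.fst)
          (contDiffAt_localField hsm hz).continuousAt continuousAt_fst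
    · exact continuousAt_snd
  filter_upwards [h2.eventually (isOpen_setOfPred_linearIndependent.mem_nhds h1)] with z' h3 t ht
  have h4 := LinearIndependent.pair_iff.1 h3 t 1 (by rw [one_smul, add_comm]; exact ht)
  exact one_ne_zero h4.2

/-- The height product is smooth on its open domain. -/
theorem heightDomain_local {x₀ : M} {v : TangentBundle 𝓘(ℝ, E) M}
    (hp : v.proj ∈ (chartAt E x₀).source) (hv : v ∈ heightDomain C e) :
    heightDomain C e ∈ 𝓝 v ∧
    ContMDiffAt 𝓘(ℝ, E).tangent 𝓘(ℝ, ℝ) ∞ (heightProduct C e) v := by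
  set z := tChart x₀ v with hzdef
  have hz : z.1 ∈ (extChartAt 𝓘(ℝ, E) x₀).target := by
    have := (tChart x₀).map_source (mem_tChart_source.2 hp)
    rw [tChart_target] at this
    exact this.1
  have hloc : localField e x₀ z.1 = toCoord x₀ v.proj (e v.proj) := by
    have : (extChartAt 𝓘(ℝ, E) x₀).symm z.1 = v.proj :=
      (extChartAt 𝓘(ℝ, E) x₀).left_inv (by rwa [extChartAt_source])
    rw [localField, this]
  have hne : ∀ t : ℝ, z.2 + t • localField e x₀ z.1 ≠ 0 := by
    intro t ht
    rw [hloc, ← map_smul] at ht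
    have : toCoord x₀ v.proj (vec v) + toCoord x₀ v.proj (t • e v.proj) = 0 := ht
    rw [← map_add, toCoord_eq_zero_iff hp] at this
    exact hv.1 t this
  have hne' : ∀ t : ℝ, -z.2 + t • localField e x₀ z.1 ≠ 0 := by
    intro t ht
    apply hne (-t)
    rw [neg_smul, ← neg_eq_zero, neg_add, neg_neg]
    exact ht
  have hT := contDiffAt_localHeight hC he hsm hz hne
  have hT' := contDiffAt_localHeight hC he hsm (z := (z.1, -z.2)) hz hne'
  have hneg : ContDiffAt ℝ ∞ (fun z : E × E => (z.1, -z.2)) z :=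
    contDiffAt_fst.prodMk contDiffAt_snd.neg
  have hT'' := ContDiffAt.comp (g := fun z : E × E => heightFun C e ((tChart x₀).symm z))
    (f := fun z : E × E => (z.1, -z.2)) z hT' hneg
  have htar : ∀ᶠ z' : E × E in 𝓝 z, z'.1 ∈ (extChartAt 𝓘(ℝ, E) x₀).target :=
    continuousAt_fst.eventually ((isOpen_extChartAt_target x₀).mem_nhds hz)
  have hminus : ∀ z' : E × E, z'.1 ∈ (extChartAt 𝓘(ℝ, E) x₀).target →
      ((tChart x₀).symm (z'.1, -z'.2) : TangentBundle 𝓘(ℝ, E) M) =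
        ⟨((tChart x₀).symm z' : TangentBundle 𝓘(ℝ, E) M).proj,
          (-vec ((tChart x₀).symm z' : TangentBundle 𝓘(ℝ, E) M) : E)⟩ := by
    intro z' hz'
    rw [tChart_symm_apply hz', show z' = (z'.1, z'.2) from rfl, tChart_symm_apply hz', map_neg]
    rfl
  have hsymm : (tChart x₀).symm z = v := (tChart x₀).left_inv (mem_tChart_source.2 hp)
  constructor
  · have hpos : ∀ᶠ z' in 𝓝 z, 0 < heightFun C e ((tChart x₀).symm (z'.1, -z'.2)) := by
      refine hT''.continuousAt.eventually (lt_mem_nhds ?_)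
      change 0 < heightFun C e ((tChart x₀).symm (z.1, -z.2))
      rw [hminus z hz, hsymm]
      exact hv.2
    have hall := (isOpen_not_multiple hsm
      (fun p => (hC.fibre_cone p).ne_zero (interior_subset (he p))) hz hne).and (hpos.and htar)
    have hsrc : ∀ᶠ v' : TangentBundle 𝓘(ℝ, E) M in 𝓝 v, v'.proj ∈ (chartAt E x₀).source :=
      (FiberBundle.continuous_proj E (TangentSpace 𝓘(ℝ, E))).continuousAt.eventually
        ((chartAt E x₀).open_source.mem_nhds hp)
    filter_upwards [(continuousAt_tChart hp).eventually hall, hsrc] with v' h1 h2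
    obtain ⟨h3, h4, h5⟩ := h1
    have hs' : (tChart x₀).symm (tChart x₀ v') = v' :=
      (tChart x₀).left_inv (mem_tChart_source.2 h2)
    rw [hminus _ h5, hs'] at h4
    refine ⟨fun t ht => h3 t ?_, h4⟩
    have h6 : (extChartAt 𝓘(ℝ, E) x₀).symm (tChart x₀ v').1 = v'.proj :=
      (extChartAt 𝓘(ℝ, E) x₀).left_inv (by rwa [extChartAt_source])
    rw [localField, h6]
    change toCoord x₀ v'.proj (vec v') + _ = 0
    rw [← map_smul, ← map_add, ht, map_zero]
  · refine contMDiffAt_of_chart hp ((hT.mul hT'').congr_of_eventuallyEq ?_)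
    filter_upwards [htar] with z' hz'
    simp only [localLagrangian, heightProduct, Function.comp]
    rw [hminus z' hz']

/-- The fundamental tensor of the height product is Lorentzian on `∂C`, since the height product is
a defining function of the strongly convex cones `C_p`. -/
theorem isLorentzForm_heightProduct {v : TangentBundle 𝓘(ℝ, E) M} (hv : v ∈ boundary C) :
    IsLorentzForm (fundamentalTensor (heightProduct C e) v) := by
  have hopen : IsOpen (heightDomain C e) := isOpen_iff_mem_nhds.2 fun v hv =>
    (heightDomain_local hC he hsm (mem_chart_source E v.proj) hv).1
  have hL : ContMDiffOn 𝓘(ℝ, E).tangent 𝓘(ℝ, ℝ) ∞ (heightProduct C e) (heightDomain C e) :=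
    fun v hv => (heightDomain_local hC he hsm (mem_chart_source E v.proj) hv).2.contMDiffWithinAt
  obtain ⟨hvA, hv0⟩ := (mem_boundary_iff_heightProduct hC he).1 hv
  set p := v.proj with hp
  have hK := (hC.fibre_cone p).toIsProperCone
  set f : E → ℝ := onFibre (heightProduct C e) p with hf
  have hfe : ∀ y : E, f y = coneHeight (fibre C p) (e p) y * coneHeight (fibre C p) (e p) (-y) :=
    fun y => rfl
  set U : Set E := {y | (⟨p, y⟩ : TangentBundle 𝓘(ℝ, E) M) ∈ heightDomain C e} with hU
  have hUo : IsOpen U := hopen.preimage (continuous_fibre p)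
  have hfs : ∀ y ∈ U, ContDiffAt ℝ ∞ f y := fun y hy => contDiffAt_onFibre hopen hL (v := ⟨p, y⟩) hy
  have hfs2 : ∀ y ∈ U, ContDiffAt ℝ 2 f y := fun y hy => (hfs y hy).of_le (by norm_cast)
  have hcon : ∀ y ∈ U, ∀ r : ℝ, 0 < r → r • y ∈ U := by
    rintro y ⟨h1, h2⟩ r hr
    refine ⟨fun t ht => h1 (r⁻¹ * t) ?_, ?_⟩
    · have ht : r • y + t • e p = 0 := ht
      have := congrArg (fun x => r⁻¹ • x) ht
      change y + (r⁻¹ * t) • e p = 0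
      simpa [smul_smul, hr.ne'] using this
    · have h3 : coneHeight (fibre C p) (e p) (-(r • y)) =
          r * coneHeight (fibre C p) (e p) (-y) := by
        rw [← smul_neg, coneHeight_smul hK (he p) hr]
      change 0 < coneHeight (fibre C p) (e p) (-(r • y))
      rw [h3]
      exact mul_pos hr h2
  have hom : ∀ y ∈ U, ∀ r : ℝ, 0 < r → f (r • y) = r ^ 2 * f y := by
    intro y _ r hr
    rw [hfe, hfe, ← smul_neg, coneHeight_smul hK (he p) hr, coneHeight_smul hK (he p) hr]
    ring
  set y := vec v with hy
  have hyU : y ∈ U := hvA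
  have hf0 : f y = 0 := hv0
  have hT0 : coneHeight (fibre C p) (e p) y = 0 :=
    (mul_eq_zero.1 hv0).resolve_right hvA.2.ne'
  -- the differential is negative on the vector field
  have hde : fderiv ℝ f y (e p) < 0 := by
    have h1 : HasDerivAt (fun t : ℝ => y + t • e p) (e p) 0 := by
      simpa using ((hasDerivAt_id' (0 : ℝ)).smul_const (e p)).const_add y
    have h2 : HasFDerivAt f (fderiv ℝ f y) (y + (0 : ℝ) • e p) := by
      rw [zero_smul, add_zero]; exact ((hfs y hyU).differentiableAt (by simp)).hasFDerivAt
    have h3 := h2.comp_hasDerivAt (0 : ℝ) h1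
    have h4 : (f ∘ fun t : ℝ => y + t • e p) =
        fun t => -t * (coneHeight (fibre C p) (e p) (-y) + t) := by
      funext t
      have : -(y + t • e p) = -y + (-t) • e p := by module
      simp only [Function.comp, hfe]
      rw [this, coneHeight_add_smul hK (he p), coneHeight_add_smul hK (he p), hT0]
      ring
    have h5 : HasDerivAt (fun t : ℝ => -t * (coneHeight (fibre C p) (e p) (-y) + t))
        (-coneHeight (fibre C p) (e p) (-y)) 0 := by
      have h6 := (hasDerivAt_id' (0 : ℝ)).neg.mul
        ((hasDerivAt_id' (0 : ℝ)).const_add (coneHeight (fibre C p) (e p) (-y)))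
      refine h6.congr_deriv ?_
      simp
    rw [h4] at h3
    rw [h3.unique h5]
    exact neg_neg_of_pos hvA.2
  have hdf : fderiv ℝ f y ≠ 0 := fun h => by
    rw [h] at hde
    exact lt_irrefl _ hde
  have hB : fundamentalTensor (heightProduct C e) v = fderiv ℝ (fderiv ℝ f) y := rfl
  have heuler : fderiv ℝ (fderiv ℝ f) y y = fderiv ℝ f y :=
    fderiv_fderiv_self_of_homogeneous hUo hfs2 hom hcon hyU
  have hsymm : ∀ w w', fderiv ℝ (fderiv ℝ f) y w w' = fderiv ℝ (fderiv ℝ f) y w' w :=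
    fun w z => ((hfs2 y hyU).isSymmSndFDerivAt (by simp)).eq w z
  -- compare with a defining function `ρ` from the definition of a strongly convex cone: the
  -- differentials and the Hessians on their common kernel agree up to one positive factor
  obtain ⟨W, ρ, hWo, hyW, hρs, hρK, hdρ, hpos, hker⟩ := (hC.fibre_cone p).boundary y
    ((mem_boundary_iff hC).1 hv).1 hv.2
  have hyK : y ∈ fibre C p := mem_of_mem_boundary hC hv
  have hρ : ContDiffAt ℝ 2 ρ y := (hρs.contDiffAt (hWo.mem_nhds hyW)).of_le (by norm_cast)
  have hρ0 : ρ y = 0 := by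
    refine le_antisymm ((hρK y hyW).1 hyK) (not_lt.1 fun h => ?_)
    apply ((mem_boundary_iff hC).1 hv).1.2
    rw [mem_interior_iff_mem_nhds]
    filter_upwards [hρ.continuousAt.eventually (gt_mem_nhds h), hWo.mem_nhds hyW] with x h1 h2
    exact (hρK x h2).2 h1.le
  have hsub : ∀ᶠ x in 𝓝 y, ρ x ≤ 0 ↔ f x ≤ 0 := by
    filter_upwards [hWo.mem_nhds hyW, hUo.mem_nhds hyU] with x h1 h2
    rw [← hρK x h1]
    exact mem_iff_heightProduct_nonpos hC he h2
  obtain ⟨c, hc, hcf⟩ := exists_fderiv_eq_smul (hρ.differentiableAt (by simp))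
    ((hfs2 y hyU).differentiableAt (by simp)) hρ0 hf0 hsub hdρ hdf
  have hzero : ∀ w, fderiv ℝ f y w = 0 ↔ fderiv ℝ ρ y w = 0 := by
    intro w
    rw [hcf, _root_.smul_apply, smul_eq_zero]
    exact ⟨fun h => h.resolve_left hc.ne', Or.inr⟩
  have hhess : ∀ w w', fderiv ℝ ρ y w = 0 → fderiv ℝ ρ y w' = 0 →
      fderiv ℝ (fderiv ℝ f) y w w' = c * fderiv ℝ (fderiv ℝ ρ) y w w' := fun w w' hw hw' =>
    hessian_eq_of_sublevel_eq hρ (hfs2 y hyU) hρ0 hf0 hsub hdρ hc hcf hw hw'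
  rw [hB]
  refine isLorentzForm_of_null hsymm (v := y) ?_ ?_ ?_ ?_
  · rw [heuler, fderiv_self_of_homogeneous hUo hfs2 hom hyU, hf0, mul_zero]
  · rwa [heuler]
  · intro w hw
    rw [heuler, hzero] at hw
    rw [hhess w w hw hw]
    exact mul_nonneg hc.le (hpos w hw)
  · intro w hw hw'
    rw [heuler, hzero] at hw
    refine (hker w hw).1 fun w' h => ?_
    have h1 := hw' w' (by rw [heuler, hzero]; exact h)
    rw [hhess w w' hw h] at h1
    exact (mul_eq_zero.1 h1).resolve_left hc.ne'

omit he hsm in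
/-- Every strongly convex cone structure is defined by a Lorentz-Finsler metric, which is
nonpositive exactly on the cone structure. -/
theorem exists_lorentzFinslerMetric [T2Space M] [SecondCountableTopology M] :
    ∃ (A : Set (TangentBundle 𝓘(ℝ, E) M)) (L : TangentBundle 𝓘(ℝ, E) M → ℝ),
      IsLorentzFinslerMetric C A L ∧ ∀ v ∈ A, v ∈ C ↔ L v ≤ 0 := by
  obtain ⟨s, he⟩ := exists_interior_section hC
  set e : M → E := fun p => s p
  have hsm : ContMDiff 𝓘(ℝ, E) 𝓘(ℝ, E).tangent ∞
      (fun p => (⟨p, e p⟩ : TangentBundle 𝓘(ℝ, E) M)) := s.contMDiff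
  have hopen : IsOpen (heightDomain C e) := isOpen_iff_mem_nhds.2 fun v hv =>
    (heightDomain_local hC he hsm (mem_chart_source E v.proj) hv).1
  have hL : ContMDiffOn 𝓘(ℝ, E).tangent 𝓘(ℝ, ℝ) ∞ (heightProduct C e) (heightDomain C e) :=
    fun v hv => (heightDomain_local hC he hsm (mem_chart_source E v.proj) hv).2.contMDiffWithinAt
  set A : Set (TangentBundle 𝓘(ℝ, E) M) :=
    {v | v ∈ heightDomain C e ∧ IsLorentzForm (fundamentalTensor (heightProduct C e) v)} with hA
  have hcon : ∀ (p : M) (y : E) (r : ℝ), 0 < r → (⟨p, y⟩ : TangentBundle 𝓘(ℝ, E) M) ∈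
      heightDomain C e → (⟨p, r • y⟩ : TangentBundle 𝓘(ℝ, E) M) ∈ heightDomain C e := by
    rintro p y r hr ⟨h1, h2⟩
    refine ⟨fun t ht => h1 (r⁻¹ * t) ?_, ?_⟩
    · have ht : r • y + t • e p = 0 := ht
      have := congrArg (fun x => r⁻¹ • x) ht
      change y + (r⁻¹ * t) • e p = 0
      simpa [smul_smul, hr.ne'] using this
    · have h3 : coneHeight (fibre C p) (e p) (-(r • y)) =
          r * coneHeight (fibre C p) (e p) (-y) := by
        rw [← smul_neg, coneHeight_smul (hC.fibre_cone p).toIsProperCone (he p) hr]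
      change 0 < coneHeight (fibre C p) (e p) (-(r • y))
      rw [h3]
      exact mul_pos hr h2
  have hom : ∀ (p : M) (y : E) (r : ℝ), 0 < r →
      heightProduct C e ⟨p, r • y⟩ = r ^ 2 * heightProduct C e ⟨p, y⟩ := by
    intro p y r hr
    have hK := (hC.fibre_cone p).toIsProperCone
    change coneHeight (fibre C p) (e p) (r • y) * coneHeight (fibre C p) (e p) (-(r • y)) =
      r ^ 2 * (coneHeight (fibre C p) (e p) y * coneHeight (fibre C p) (e p) (-y))
    rw [← smul_neg, coneHeight_smul hK (he p) hr, coneHeight_smul hK (he p) hr]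
    ring
  refine ⟨A, heightProduct C e, ⟨?_, ?_, hL.mono fun v hv => hv.1, fun p y r hr _ => hom p y r hr,
    fun v hv => hv.2, ?_⟩, fun v hv => mem_iff_heightProduct_nonpos hC he hv.1⟩
  · rw [isOpen_iff_mem_nhds]
    rintro v ⟨h1, h2⟩
    exact Filter.inter_mem (hopen.mem_nhds h1) (eventually_isLorentzForm hopen hL h1 h2)
  · rintro p y r hr ⟨h1, h2⟩
    refine ⟨hcon p y r hr h1, ?_⟩
    -- the fundamental tensor is homogeneous of degree zero
    set f : E → ℝ := onFibre (heightProduct C e) p with hf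
    have hfs : ∀ y : E, (⟨p, y⟩ : TangentBundle 𝓘(ℝ, E) M) ∈ heightDomain C e →
        ContDiffAt ℝ 2 f y := fun y hy =>
      (contDiffAt_onFibre hopen hL (v := ⟨p, y⟩) hy).of_le (by norm_cast)
    have h3 : fderiv ℝ (fderiv ℝ f) (r • y) = fderiv ℝ (fderiv ℝ f) y := by
      have h4 : HasFDerivAt (fun z : E => fderiv ℝ f (r • z))
          ((fderiv ℝ (fderiv ℝ f) (r • y)).comp (r • ContinuousLinearMap.id ℝ E)) y :=
        (((hfs _ (hcon p y r hr h1)).fderiv_right (m := 1) (by norm_num)).differentiableAt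
          one_ne_zero).hasFDerivAt.comp y (r • ContinuousLinearMap.id ℝ E).hasFDerivAt
      have h5 : HasFDerivAt (fun z : E => r • fderiv ℝ f z)
          (r • fderiv ℝ (fderiv ℝ f) y) y :=
        (((hfs y h1).fderiv_right (m := 1) (by norm_num)).differentiableAt
          one_ne_zero).hasFDerivAt.const_smul r
      have h6 := h4.unique (h5.congr_of_eventuallyEq (by
        filter_upwards [tendsto_fibre_nhds hopen h1] with z hz
        exact fderiv_smul_of_homogeneous
          (U := {y : E | (⟨p, y⟩ : TangentBundle 𝓘(ℝ, E) M) ∈ heightDomain C e})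
          (hopen.preimage (continuous_fibre p)) hfs (fun y _ r hr => hom p y r hr) hz hr
          (hcon p z r hr hz)))
      ext w w'
      have h7 := congrArg (fun B : E →L[ℝ] E →L[ℝ] ℝ => B w w') h6
      simp only [ContinuousLinearMap.comp_apply, _root_.smul_apply, ContinuousLinearMap.id_apply,
        map_smul, smul_eq_mul] at h7
      exact mul_left_cancel₀ hr.ne' h7
    change IsLorentzForm (fderiv ℝ (fderiv ℝ f) (r • y))
    rw [h3]
    exact h2
  · ext v
    rw [mem_boundary_iff_heightProduct hC he]
    constructor
    · rintro ⟨h1, h2⟩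
      exact ⟨⟨h1, isLorentzForm_heightProduct hC he hsm
        ((mem_boundary_iff_heightProduct hC he).2 ⟨h1, h2⟩)⟩, h2⟩
    · rintro ⟨⟨h1, -⟩, h2⟩
      exact ⟨h1, h2⟩

end Existence

/-! ### The Legendre transform of a Lorentz-Finsler metric -/

section Legendre

variable {E : Type*} [NormedAddCommGroup E] [NormedSpace ℝ E]

theorem ne_zero_of_mem_interior_of_nonneg {K : Set E} {u : E →L[ℝ] ℝ} (hu : u ≠ 0)
    (hK : ∀ y ∈ K, 0 ≤ u y) {y : E} (hy : y ∈ interior K) : u y ≠ 0 := fun h => hu <| by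
  have hm : IsLocalMin u y := by
    filter_upwards [mem_interior_iff_mem_nhds.1 hy] with z hz
    rw [h]; exact hK z hz
  rw [← hm.fderiv_eq_zero, ContinuousLinearMap.fderiv]

/-- A Lorentz form is definite on the orthogonal complement of a null vector, up to this vector. -/
theorem IsLorentzForm.eq_smul_of_null {B : E →L[ℝ] E →L[ℝ] ℝ} (hB : IsLorentzForm B) {v w : E}
    (hv : v ≠ 0) (hvv : B v v = 0) (hvw : B v w = 0) (hww : B w w = 0) : ∃ r : ℝ, w = r • v := by
  obtain ⟨hs, e, -, hpos⟩ := hB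
  have hev : B e v ≠ 0 := fun h => (hpos v h hv).ne' hvv
  refine ⟨B e w / B e v, ?_⟩
  by_contra hne
  have h1 : B e (w - (B e w / B e v) • v) = 0 := by
    rw [map_sub, map_smul, smul_eq_mul, div_mul_cancel₀ _ hev, sub_self]
  refine (hpos _ h1 (sub_ne_zero.2 hne)).ne' ?_
  simp [hvv, hvw, hww, hs w v]

variable {M : Type*} [TopologicalSpace M] [ChartedSpace E M] [IsManifold 𝓘(ℝ, E) ∞ M]
  {C A : Set (TangentBundle 𝓘(ℝ, E) M)} {L : TangentBundle 𝓘(ℝ, E) M → ℝ}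

/-- Scalar multiplication on the tangent bundle. -/
def scale (r : ℝ) (v : TangentBundle 𝓘(ℝ, E) M) : TangentBundle 𝓘(ℝ, E) M :=
  ⟨v.proj, (r • vec v : E)⟩

theorem scale_one (v : TangentBundle 𝓘(ℝ, E) M) : scale 1 v = v := by
  rw [scale, one_smul]; rfl

theorem scale_scale (r s : ℝ) (v : TangentBundle 𝓘(ℝ, E) M) :
    scale r (scale s v) = scale (r * s) v := by
  rw [scale, scale, scale, mul_smul]; rfl

theorem scale_mem_boundary (hC : IsStronglyConvexConeStructure C)
    {v : TangentBundle 𝓘(ℝ, E) M} (hv : v ∈ boundary C) {r : ℝ} (hr : 0 < r) :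
    scale r v ∈ boundary C := by
  have hK := (hC.fibre_cone v.proj).toIsProperCone
  have hv0 : vec v ≠ 0 := hv.2
  have hne : r • vec v ≠ 0 := smul_ne_zero hr.ne' hv0
  refine (mem_boundary_iff hC).2 ⟨⟨?_, fun hi => ?_⟩, hne⟩
  · exact subset_closure (hK.smul_mem (vec v) (mem_of_mem_boundary hC hv) r hr)
  · have h1 : r • vec v ∈ interior (fibre C v.proj) := hi
    have h2 := hK.smul_mem_interior h1 (inv_pos.2 hr)
    rw [smul_smul, inv_mul_cancel₀ hr.ne', one_smul] at h2
    exact ((mem_boundary_iff hC).1 hv).1.2 h2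

variable (hL : IsLorentzFinslerMetric C A L)
include hL

theorem IsLorentzFinslerMetric.mem_of_boundary {v : TangentBundle 𝓘(ℝ, E) M}
    (hv : v ∈ boundary C) : v ∈ A ∧ L v = 0 := by
  rw [hL.boundary_eq] at hv
  exact hv

/-- The part of the domain of a Lorentz-Finsler metric in a tangent space. -/
theorem IsLorentzFinslerMetric.isOpen_fibre (p : M) : IsOpen (fibre A p) :=
  hL.isOpen.preimage (continuous_fibre p)

theorem IsLorentzFinslerMetric.contDiffAt_fibre (p : M) (y : E) (hy : y ∈ fibre A p) :
    ContDiffAt ℝ 2 (onFibre L p) y :=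
  (contDiffAt_onFibre hL.isOpen hL.smooth (v := ⟨p, y⟩) hy).of_le (by norm_cast)

theorem IsLorentzFinslerMetric.hom_fibre (p : M) (y : E) (hy : y ∈ fibre A p) (r : ℝ) (hr : 0 < r) :
    onFibre L p (r • y) = r ^ 2 * onFibre L p y := hL.homogeneous p y r hr hy

theorem IsLorentzFinslerMetric.fundamentalTensor_self {v : TangentBundle 𝓘(ℝ, E) M} (hv : v ∈ A) :
    fundamentalTensor L v (vec v) = fderiv ℝ (onFibre L v.proj) (vec v) :=
  fderiv_fderiv_self_of_homogeneous (hL.isOpen_fibre v.proj) (hL.contDiffAt_fibre v.proj)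
    (hL.hom_fibre v.proj) (fun y hy r hr => hL.conic v.proj y r hr hy) (y := vec v) hv

theorem IsLorentzFinslerMetric.fderiv_self {v : TangentBundle 𝓘(ℝ, E) M} (hv : v ∈ A) :
    fderiv ℝ (onFibre L v.proj) (vec v) (vec v) = 2 * L v :=
  fderiv_self_of_homogeneous (hL.isOpen_fibre v.proj) (hL.contDiffAt_fibre v.proj)
    (hL.hom_fibre v.proj) (y := vec v) hv

theorem IsLorentzFinslerMetric.fderiv_ne_zero {v : TangentBundle 𝓘(ℝ, E) M} (hv : v ∈ A)
    (hv0 : vec v ≠ 0) : fderiv ℝ (onFibre L v.proj) (vec v) ≠ 0 := fun h =>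
  hv0 ((hL.lorentz v hv).nondegenerate (by rw [hL.fundamentalTensor_self hv, h]))

omit hL in
/-- The covector `-dL_v`, where `dL` is the fibrewise differential. -/
def coLegendre (L : TangentBundle 𝓘(ℝ, E) M → ℝ) (v : TangentBundle 𝓘(ℝ, E) M) :
    CotangentBundle E M :=
  covector v.proj (-fderiv ℝ (onFibre L v.proj) (vec v))

theorem IsLorentzFinslerMetric.legendre_eq {v : TangentBundle 𝓘(ℝ, E) M} (hv : v ∈ A) (r : ℝ) :
    legendre L r v = covector v.proj (r • fderiv ℝ (onFibre L v.proj) (vec v)) := by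
  rw [← hL.fundamentalTensor_self hv]; rfl

theorem IsLorentzFinslerMetric.coLegendre_eq {v : TangentBundle 𝓘(ℝ, E) M} (hv : v ∈ A) :
    coLegendre L v = legendre L (-1) v := by
  rw [hL.legendre_eq hv, coLegendre, neg_one_smul]

theorem IsLorentzFinslerMetric.coLegendre_scale {v : TangentBundle 𝓘(ℝ, E) M} (hv : v ∈ A) {r : ℝ}
    (hr : 0 < r) : coLegendre L (scale r v) =
      covector v.proj (r • (coLegendre L v).form) := by
  have h1 := fderiv_smul_of_homogeneous (hL.isOpen_fibre v.proj) (hL.contDiffAt_fibre v.proj)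
    (hL.hom_fibre v.proj) (y := vec v) hv hr (hL.conic v.proj _ r hr hv)
  have h2 : coLegendre L (scale r v) =
    covector v.proj (-fderiv ℝ (onFibre L v.proj) (r • vec v)) := rfl
  rw [h2, h1, ← smul_neg]
  rfl

variable (hC : IsStronglyConvexConeStructure C) (hs : ∀ v ∈ A, v ∈ C ↔ L v ≤ 0)
include hC hs

omit hL in
theorem eventually_mem_iff (hA : IsOpen A) {v : TangentBundle 𝓘(ℝ, E) M} (hv : v ∈ A) :
    ∀ᶠ y in 𝓝 (vec v), y ∈ fibre C v.proj ↔ onFibre L v.proj y ≤ 0 :=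
  (tendsto_fibre_nhds hA (p := v.proj) (y := vec v) hv).mono fun _ hy => hs _ hy

theorem fderiv_nonpos_of_mem_cone {v : TangentBundle 𝓘(ℝ, E) M} (hv : v ∈ boundary C) {y : E}
    (hy : y ∈ fibre C v.proj) : fderiv ℝ (onFibre L v.proj) (vec v) y ≤ 0 := by
  obtain ⟨hA, h0⟩ := hL.mem_of_boundary hv
  exact fderiv_nonpos_of_mem (hC.fibre_cone v.proj).toIsProperCone (mem_of_mem_boundary hC hv)
    ((hL.contDiffAt_fibre _ (vec v) hA).differentiableAt (by simp)) h0
    (eventually_mem_iff hC hs hL.isOpen hA) hy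

theorem coLegendre_mem_dualBoundary [FiniteDimensional ℝ E] {v : TangentBundle 𝓘(ℝ, E) M}
    (hv : v ∈ boundary C) : coLegendre L v ∈ dualBoundary C := by
  obtain ⟨hA, h0⟩ := hL.mem_of_boundary hv
  refine (mem_dualBoundary_iff hC).2 ⟨?_, fun y hy => ?_, vec v, mem_of_mem_boundary hC hv, ?_⟩
  · exact neg_ne_zero.2 (hL.fderiv_ne_zero hA hv.2)
  · exact neg_nonneg.2 (fderiv_nonpos_of_mem_cone hL hC hs hv hy)
  · have := hL.fderiv_self hA
    rw [h0, mul_zero] at this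
    exact neg_eq_zero.2 this

omit hL hs in
theorem mem_boundary_of_null {p : M} {u : E →L[ℝ] ℝ} (hu : u ≠ 0)
    (hu' : ∀ y ∈ fibre C p, 0 ≤ u y) {y : E} (hy : y ∈ fibre C p) (huy : u y = 0) :
    (⟨p, y⟩ : TangentBundle 𝓘(ℝ, E) M) ∈ boundary C :=
  (mem_boundary_iff hC).2 ⟨⟨subset_closure hy, fun h =>
    ne_zero_of_mem_interior_of_nonneg hu hu' h huy⟩,
    (hC.fibre_cone p).ne_zero hy⟩

/-- A covector in `∂C*` is the Legendre transform of any of its null vectors in `C`, up to a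
positive factor. -/
theorem exists_coLegendre_eq [FiniteDimensional ℝ E] {u : CotangentBundle E M}
    (hu : u ∈ dualBoundary C) {y : E} (hy : y ∈ fibre C u.proj) (huy : u.form y = 0) :
    ∃ c : ℝ, 0 < c ∧ u.form = c • (coLegendre L ⟨u.proj, y⟩).form := by
  obtain ⟨hu0, hu', -⟩ := (mem_dualBoundary_iff hC).1 hu
  have hyb := mem_boundary_of_null hC hu0 hu' hy huy
  obtain ⟨hA, h0⟩ := hL.mem_of_boundary hyb
  have hdf := hL.fderiv_ne_zero hA (hC.fibre_cone u.proj |>.ne_zero hy)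
  have hd := (hL.contDiffAt_fibre _ y hA).differentiableAt (by simp)
  -- directions in which `L` decreases point into the cone, where `u` is nonnegative
  obtain ⟨c, hc, hcu⟩ := exists_eq_smul_of_nonpos (l := fderiv ℝ (onFibre L u.proj) y)
    (k := -u.form) (fun w hw => by
      have h1 := eventually_neg_of_fderiv_neg hd h0 hw
      have h2 : Filter.Tendsto (fun s : ℝ => y + s • w) (𝓝[>] 0) (𝓝 y) := by
        have : Continuous fun s : ℝ => y + s • w := by fun_prop
        simpa using (this.tendsto 0).mono_left nhdsWithin_le_nhds
      obtain ⟨s, hs1, hs2, hs3⟩ := (h1.and ((h2.eventually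
        (eventually_mem_iff hC hs hL.isOpen hA)).and self_mem_nhdsWithin)).exists
      have h3 := hu' _ (hs2.2 hs1.le)
      rw [map_add, map_smul, huy, zero_add, smul_eq_mul] at h3
      exact neg_nonpos.2 (nonneg_of_mul_nonneg_right h3 hs3)) hdf (neg_ne_zero.2 hu0)
  refine ⟨c, hc, ?_⟩
  have h4 : (coLegendre L ⟨u.proj, y⟩).form = -fderiv ℝ (onFibre L u.proj) y := rfl
  rw [h4, smul_neg, ← hcu, neg_neg]

theorem exists_coLegendre_eq' [FiniteDimensional ℝ E] {u : CotangentBundle E M}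
    (hu : u ∈ dualBoundary C) {y : E} (hy : y ∈ fibre C u.proj) (huy : u.form y = 0) :
    ∃ c : ℝ, 0 < c ∧ u = coLegendre L ⟨u.proj, (c • y : E)⟩ := by
  obtain ⟨c, hc, h⟩ := exists_coLegendre_eq hL hC hs hu hy huy
  obtain ⟨hu0, hu', -⟩ := (mem_dualBoundary_iff hC).1 hu
  have hA := (hL.mem_of_boundary (mem_boundary_of_null hC hu0 hu' hy huy)).1
  refine ⟨c, hc, ?_⟩
  have h1 := hL.coLegendre_scale hA hc
  rw [← h] at h1
  exact h1.symm

/-- The null vectors in `C` of a covector in `∂C*` form a single ray. -/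
theorem null_unique [FiniteDimensional ℝ E] {u : CotangentBundle E M}
    (hu : u ∈ dualBoundary C) {y w : E} (hy : y ∈ fibre C u.proj) (huy : u.form y = 0)
    (hw : w ∈ fibre C u.proj) (huw : u.form w = 0) : ∃ r : ℝ, 0 < r ∧ w = r • y := by
  have hK := (hC.fibre_cone u.proj).toIsProperCone
  obtain ⟨hu0, hu', -⟩ := (mem_dualBoundary_iff hC).1 hu
  set m := y + w with hm
  have hmK : m ∈ fibre C u.proj := hK.add_mem hy hw
  have hum : u.form m = 0 := by rw [hm, map_add, huy, huw, add_zero]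
  obtain ⟨hA, h0⟩ := hL.mem_of_boundary (mem_boundary_of_null hC hu0 hu' hmK hum)
  obtain ⟨c, hc, hcu⟩ := exists_coLegendre_eq hL hC hs hu hmK hum
  have hdw : fderiv ℝ (onFibre L u.proj) m w = 0 := by
    have h1 : u.form w = c * -(fderiv ℝ (onFibre L u.proj) m w) := by rw [hcu]; rfl
    rw [huw] at h1
    have := (mul_eq_zero.1 h1.symm).resolve_left hc.ne'
    linarith
  -- the metric vanishes on a segment through `m`, hence so does its Hessian
  have hzero : (fun t : ℝ => onFibre L u.proj (m + t • w + (t * t) • (0 : E))) =ᶠ[𝓝 0]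
      fun _ => 0 := by
    have h1 : ∀ᶠ t : ℝ in 𝓝 0, -1 < t := lt_mem_nhds (by norm_num)
    filter_upwards [h1] with t ht
    have h2 : m + t • w = y + (1 + t) • w := by rw [hm]; module
    rw [smul_zero, add_zero, h2]
    refine (hL.mem_of_boundary (mem_boundary_of_null hC hu0 hu' (hK.add_mem hy
      (hK.smul_mem w hw (1 + t) (by linarith))) ?_)).2
    rw [map_add, map_smul, huy, huw, smul_zero, add_zero]
  have hww : fundamentalTensor L ⟨u.proj, m⟩ w w = 0 := by
    have h1 := (deriv_deriv_parabola (hL.contDiffAt_fibre _ m hA) w 0).2.2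
    have h2 := hzero.deriv
    rw [h2.deriv_eq] at h1
    simp only [deriv_const', map_zero, mul_zero, add_zero] at h1
    rw [h1]
    rfl
  have hmm : fundamentalTensor L ⟨u.proj, m⟩ m m = 0 := by
    have h1 := hL.fundamentalTensor_self hA
    have h2 := hL.fderiv_self hA
    rw [h0, mul_zero] at h2
    exact (congrArg (fun l : E →L[ℝ] ℝ => l m) h1).trans h2
  have hmw : fundamentalTensor L ⟨u.proj, m⟩ m w = 0 :=
    (congrArg (fun l : E →L[ℝ] ℝ => l w) (hL.fundamentalTensor_self hA)).trans hdw
  obtain ⟨r, hr⟩ := (hL.lorentz _ hA).eq_smul_of_null (hK.ne_zero hmK) hmm hmw hww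
  have h3 : (1 - r) • w = r • y := by
    have h4 : w = r • y + r • w := by rw [← smul_add]; exact hr
    rw [sub_smul, one_smul, sub_eq_iff_eq_add]
    exact h4
  have h5 : (1 - r) ≠ 0 := by
    intro h
    have h6 : r = 1 := by linarith
    rw [h6, sub_self, zero_smul, one_smul] at h3
    exact hK.ne_zero hy h3.symm
  have h7 : w = (r / (1 - r)) • y := by
    rw [div_eq_inv_mul, mul_smul, ← h3, smul_smul, inv_mul_cancel₀ h5, one_smul]
  refine ⟨r / (1 - r), ?_, h7⟩
  rcases lt_trichotomy (r / (1 - r)) 0 with h | h | h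
  · exfalso
    have h8 := hK.smul_mem y hy (-(r / (1 - r))) (neg_pos.2 h)
    rw [neg_smul, ← h7] at h8
    exact hK.neg_notMem w hw h8
  · rw [h, zero_smul] at h7
    exact absurd h7 (hK.ne_zero hw)
  · exact h

theorem coLegendre_injective [FiniteDimensional ℝ E] {v w : TangentBundle 𝓘(ℝ, E) M}
    (hv : v ∈ boundary C) (hw : w ∈ boundary C) (h : coLegendre L v = coLegendre L w) : v = w := by
  obtain ⟨p, y⟩ := v
  obtain ⟨q, z⟩ := w
  have hpq : p = q := congrArg TotalSpace.proj h
  subst hpq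
  have hf : (coLegendre L ⟨p, y⟩).form = (coLegendre L ⟨p, z⟩).form := by rw [h]
  have hvA := (hL.mem_of_boundary hv)
  have hwA := (hL.mem_of_boundary hw)
  have h1 : ∀ {y : E}, (⟨p, y⟩ : TangentBundle 𝓘(ℝ, E) M) ∈ boundary C →
      (coLegendre L ⟨p, y⟩).form y = 0 := by
    intro y hy
    obtain ⟨hA, h0⟩ := hL.mem_of_boundary hy
    have := hL.fderiv_self hA
    rw [h0, mul_zero] at this
    exact neg_eq_zero.2 this
  obtain ⟨r, hr, hzy⟩ := null_unique hL hC hs (coLegendre_mem_dualBoundary hL hC hs hv) (y := y)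
    (w := z) (mem_of_mem_boundary hC hv) (h1 hv) (mem_of_mem_boundary hC hw)
    (by rw [hf]; exact h1 hw)
  have h2 : (coLegendre L ⟨p, z⟩).form = r • (coLegendre L ⟨p, y⟩).form := by
    have h3 := hL.coLegendre_scale hvA.1 hr
    have h4 : scale r (⟨p, y⟩ : TangentBundle 𝓘(ℝ, E) M) = ⟨p, z⟩ := by rw [hzy]; rfl
    rw [h4] at h3
    rw [h3]
    rfl
  have key : ∀ l l' : E →L[ℝ] ℝ, l = l' → l' = r • l → (r - 1) • l = 0 := by
    rintro l l' rfl h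
    ext x
    have h' := congrArg (fun k : E →L[ℝ] ℝ => k x) h
    simp only [_root_.smul_apply, smul_eq_mul, _root_.zero_apply] at h' ⊢
    linarith
  have h5 := key _ _ hf h2
  have h6 : (coLegendre L ⟨p, y⟩).form ≠ 0 :=
    ((mem_dualBoundary_iff hC).1 (coLegendre_mem_dualBoundary hL hC hs hv)).1
  have h7 : r = 1 := by
    have := (smul_eq_zero.1 h5).resolve_right h6
    linarith
  rw [hzy, h7]
  exact congrArg (fun z : E => (⟨p, z⟩ : TangentBundle 𝓘(ℝ, E) M)) (one_smul ℝ y).symm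

end Legendre

/-! ### Local inverses and integral curves -/

section LocalInverse

variable {X Y : Type*} [NormedAddCommGroup X] [NormedSpace ℝ X] [FiniteDimensional ℝ X]
  [NormedAddCommGroup Y] [NormedSpace ℝ Y] [FiniteDimensional ℝ Y]

/-- The inverse function theorem, for a smooth map on an open set: the local inverse is smooth on an
open set, and takes values in the given open set. -/
theorem exists_smooth_local_inverse {f : X → Y} {U : Set X} (hU : IsOpen U)
    (hf : ContDiffOn ℝ ∞ f U) {a : X} (ha : a ∈ U)
    (hinj : ∀ w, fderiv ℝ f a w = 0 → w = 0)
    (hdim : Module.finrank ℝ X = Module.finrank ℝ Y) :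
    ∃ (g : Y → X) (O : Set Y), IsOpen O ∧ f a ∈ O ∧ ContDiffOn ℝ ∞ g O ∧
      (∀ y ∈ O, f (g y) = y ∧ g y ∈ U) ∧ ∀ᶠ x in 𝓝 a, g (f x) = x ∧ f x ∈ O := by
  have hfa : ContDiffAt ℝ ∞ f a := hf.contDiffAt (hU.mem_nhds ha)
  let e : X ≃L[ℝ] Y := (LinearEquiv.ofInjectiveOfFinrankEq (fderiv ℝ f a).toLinearMap
    ((injective_iff_map_eq_zero _).2 hinj) hdim).toContinuousLinearEquiv
  have he : (e : X →L[ℝ] Y) = fderiv ℝ f a := by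
    ext x
    exact congrArg (fun l : X →ₗ[ℝ] Y => l x)
      (LinearEquiv.coe_ofInjectiveOfFinrankEq (fderiv ℝ f a).toLinearMap
        ((injective_iff_map_eq_zero _).2 hinj) hdim)
  have hfe : HasFDerivAt f (e : X →L[ℝ] Y) a := by
    rw [he]; exact (hfa.differentiableAt (by simp)).hasFDerivAt
  set φ := hfa.toOpenPartialHomeomorph f hfe (by simp) with hφ
  have hφf : ∀ x, φ x = f x := fun x => rfl
  set V : Set X := {x | x ∈ U ∧ fderiv ℝ f x ∈ range ((↑) : (X ≃L[ℝ] Y) → X →L[ℝ] Y)} with hV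
  have hVo : IsOpen V := by
    rw [isOpen_iff_mem_nhds]
    rintro x ⟨hxU, e', he'⟩
    have hc : ContinuousAt (fderiv ℝ f) x :=
      (hf.contDiffAt (hU.mem_nhds hxU)).continuousAt_fderiv (by simp)
    have h1 : range ((↑) : (X ≃L[ℝ] Y) → X →L[ℝ] Y) ∈ 𝓝 (fderiv ℝ f x) := by
      rw [← he']; exact ContinuousLinearEquiv.nhds e'
    exact Filter.inter_mem (hU.mem_nhds hxU) (hc.preimage_mem_nhds h1)
  have haV : a ∈ V := ⟨ha, e, he⟩
  have has : a ∈ φ.source := hfa.mem_toOpenPartialHomeomorph_source hfe (by simp)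
  refine ⟨φ.symm, φ.target ∩ φ.symm ⁻¹' V, φ.isOpen_inter_preimage_symm hVo, ⟨?_, ?_⟩, ?_, ?_, ?_⟩
  · exact φ.map_source has
  · have : φ.symm (f a) = a := φ.left_inv has
    rw [mem_preimage, this]
    exact haV
  · rintro y ⟨hy, hyU, e', he'⟩
    refine (φ.contDiffAt_symm hy (f₀' := e') ?_ ?_).contDiffWithinAt
    · have h1 : ContDiffAt ℝ ∞ f (φ.symm y) := hf.contDiffAt (hU.mem_nhds hyU)
      rw [he']
      exact (h1.differentiableAt (by simp)).hasFDerivAt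
    · exact hf.contDiffAt (hU.mem_nhds hyU)
  · exact fun y hy => ⟨φ.right_inv hy.1, hy.2.1⟩
  · filter_upwards [φ.open_source.mem_nhds has, hVo.mem_nhds haV] with x hx hxV
    have h1 : φ.symm (f x) = x := φ.left_inv hx
    refine ⟨h1, φ.map_source hx, ?_⟩
    rw [mem_preimage, h1]
    exact hxV

end LocalInverse

section IntegralCurves

variable {Z : Type*} [NormedAddCommGroup Z] [NormedSpace ℝ Z] [CompleteSpace Z]
  {O : Set Z} (hO : IsOpen O) {X : Z → Z} (hX : ContDiffOn ℝ ∞ X O)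
include hO hX

theorem exists_integral_curve {z : Z} (hz : z ∈ O) : ∃ (δ : ℝ → Z) (ε : ℝ), 0 < ε ∧ δ 0 = z ∧
    ∀ t ∈ Ioo (-ε) ε, δ t ∈ O ∧ HasDerivAt δ (X (δ t)) t := by
  obtain ⟨δ, h0, ε, hε, hδ⟩ :=
    ((hX.contDiffAt (hO.mem_nhds hz)).of_le (by norm_cast :
      (1 : WithTop ℕ∞) ≤ ∞)).exists_forall_mem_closedBall_exists_eq_forall_mem_Ioo_hasDerivAt₀ 0
  rw [zero_sub, zero_add] at hδ
  have hc : ContinuousAt δ 0 := (hδ 0 ⟨by linarith, hε⟩).continuousAt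
  have h1 : ∀ᶠ t in 𝓝 (0 : ℝ), δ t ∈ O := hc.eventually (hO.mem_nhds (by rwa [h0]))
  obtain ⟨η, hη, hball⟩ := Metric.eventually_nhds_iff_ball.1 h1
  refine ⟨δ, min ε η, lt_min hε hη, h0, fun t ht => ⟨hball t ?_, hδ t ?_⟩⟩
  · rw [Real.ball_eq_Ioo, zero_sub, zero_add]
    exact ⟨by linarith [ht.1, min_le_right ε η], by linarith [ht.2, min_le_right ε η]⟩
  · exact ⟨by linarith [ht.1, min_le_left ε η], by linarith [ht.2, min_le_left ε η]⟩

theorem contDiffOn_integral_curve {δ : ℝ → Z} {a b : ℝ}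
    (hδ : ∀ t ∈ Ioo a b, δ t ∈ O ∧ HasDerivAt δ (X (δ t)) t) : ContDiffOn ℝ ∞ δ (Ioo a b) := by
  intro t ht
  obtain ⟨a', ha1, ha2⟩ := exists_between ht.1
  obtain ⟨b', hb1, hb2⟩ := exists_between ht.2
  have hsub : Icc a' b' ⊆ Ioo a b := fun s hs =>
    ⟨lt_of_lt_of_le ha1 hs.1, lt_of_le_of_lt hs.2 hb2⟩
  have h1 : ContDiffOn ℝ ∞ δ (Icc a' b') := by
    refine ODE.contDiffOn_enat_Icc_of_hasDerivWithinAt (f := fun _ => X) (u := O) (n := ⊤) ?_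
      (fun s hs => (hδ s (hsub hs)).2.hasDerivWithinAt) fun s hs => (hδ s (hsub hs)).1
    exact hX.comp contDiffOn_snd fun q hq => hq.2
  exact (h1.contDiffAt (Icc_mem_nhds ha2 hb1)).contDiffWithinAt

/-- Local uniqueness of integral curves, up to a common change of speed. -/
theorem integral_curve_unique {k : ℝ → ℝ} {f g : ℝ → Z} {t₀ : ℝ} (hk : ContinuousAt k t₀)
    (hf : ∀ᶠ t in 𝓝 t₀, HasDerivAt f (k t • X (f t)) t)
    (hg : ∀ᶠ t in 𝓝 t₀, HasDerivAt g (k t • X (g t)) t) (h0 : f t₀ = g t₀) (hz : f t₀ ∈ O) :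
    f =ᶠ[𝓝 t₀] g := by
  obtain ⟨K, s, hs, hlip⟩ := ((hX.contDiffAt (hO.mem_nhds hz)).of_le (by norm_cast :
      (1 : WithTop ℕ∞) ≤ ∞)).exists_lipschitzOnWith
  have hb : ∀ᶠ t in 𝓝 t₀, ‖k t‖₊ < ‖k t₀‖₊ + 1 :=
    hk.nnnorm.eventually (gt_mem_nhds (by simp))
  have hfs : ∀ᶠ t in 𝓝 t₀, f t ∈ s := hf.self_of_nhds.continuousAt.eventually hs
  have hgs : ∀ᶠ t in 𝓝 t₀, g t ∈ s := hg.self_of_nhds.continuousAt.eventually (by rwa [← h0])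
  refine ODE_solution_unique_of_eventually (v := fun t z => k t • X z) (s := fun _ => s)
    (K := (‖k t₀‖₊ + 1) * K) ?_ (hf.and hfs) (hg.and hgs) h0
  filter_upwards [hb] with t ht
  intro x hx y hy
  rw [edist_smul₀, ENNReal.smul_def, smul_eq_mul, ENNReal.coe_mul, mul_assoc]
  exact mul_le_mul' (by exact_mod_cast ht.le) (hlip hx hy)

end IntegralCurves

/-! ### The local Legendre transform -/

section LocalLegendre

variable {E : Type*} [NormedAddCommGroup E] [NormedSpace ℝ E]

/-- The map `(x, y) ↦ (x, -∂l/∂y)`. -/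
def legendreMap (l : E × E → ℝ) (w : E × E) : E × (E →L[ℝ] ℝ) :=
  (w.1, -(fderiv ℝ l w).comp (ContinuousLinearMap.inr ℝ E E))

/-- The Hamiltonian vector field of `l ∘ g`, where `g` is a local inverse of `legendreMap l`. -/
def hamField (l : E × E → ℝ) (g : E × (E →L[ℝ] ℝ) → E × E) (z : E × (E →L[ℝ] ℝ)) :
    E × (E →L[ℝ] ℝ) :=
  ((g z).2, -(fderiv ℝ l (g z)).comp (ContinuousLinearMap.inl ℝ E E))

theorem contDiffOn_legendreMap {l : E × E → ℝ} {U : Set (E × E)} (hU : IsOpen U)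
    (hl : ContDiffOn ℝ ∞ l U) : ContDiffOn ℝ ∞ (legendreMap l) U := by
  have h1 : ContDiffOn ℝ ∞ (fderiv ℝ l) U := hl.fderiv_of_isOpen hU (by simp)
  exact contDiffOn_fst.prodMk (h1.clm_comp contDiffOn_const).neg

theorem finrank_dual [FiniteDimensional ℝ E] :
    Module.finrank ℝ (E →L[ℝ] ℝ) = Module.finrank ℝ E := by
  rw [← (LinearMap.toContinuousLinearMap (𝕜 := ℝ) (E := E) (F' := ℝ)).finrank_eq]
  exact Subspace.dual_finrank_eq

variable [FiniteDimensional ℝ E] {l : E × E → ℝ} {U : Set (E × E)} (hU : IsOpen U)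
  (hl : ContDiffOn ℝ ∞ l U)
include hU hl

theorem exists_legendre_inverse {w : E × E} (hw : w ∈ U)
    (hnd : ∀ η, fibreHessian l w η = 0 → η = 0) :
    ∃ (g : E × (E →L[ℝ] ℝ) → E × E) (O : Set (E × (E →L[ℝ] ℝ))), IsOpen O ∧
      legendreMap l w ∈ O ∧ ContDiffOn ℝ ∞ g O ∧ (∀ z ∈ O, legendreMap l (g z) = z ∧ g z ∈ U) ∧
      ∀ᶠ w' in 𝓝 w, g (legendreMap l w') = w' ∧ legendreMap l w' ∈ O := by
  refine exists_smooth_local_inverse hU (contDiffOn_legendreMap hU hl) hw ?_ (by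
    rw [Module.finrank_prod, Module.finrank_prod, finrank_dual])
  have h1 : DifferentiableAt ℝ (fderiv ℝ l) w :=
    ((hl.contDiffAt (hU.mem_nhds hw)).fderiv_right (m := 1) (by norm_cast)).differentiableAt
      one_ne_zero
  have h2 := (hasFDerivAt_fst (p := w) (𝕜 := ℝ)).prodMk
    (h1.hasFDerivAt.clm_comp (hasFDerivAt_const (ContinuousLinearMap.inr ℝ E E) w)).neg
  have h3 : HasFDerivAt (legendreMap l) _ w := h2
  rw [h3.fderiv]
  rintro ⟨ξ, η⟩ hw0
  have h4 := congrArg Prod.fst hw0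
  have h5 := congrArg Prod.snd hw0
  have hξ : ξ = 0 := h4
  subst hξ
  refine Prod.ext rfl (hnd η ?_)
  ext η'
  have h6 := congrArg (fun u : E →L[ℝ] ℝ => u η') h5
  rw [fibreHessian_apply]
  simpa using h6

variable {g : E × (E →L[ℝ] ℝ) → E × E} {O : Set (E × (E →L[ℝ] ℝ))} (hO : IsOpen O)
  (hg : ContDiffOn ℝ ∞ g O) (hgO : ∀ z ∈ O, legendreMap l (g z) = z ∧ g z ∈ U)
include hO hg hgO

omit [FiniteDimensional ℝ E] in
theorem contDiffOn_hamField : ContDiffOn ℝ ∞ (hamField l g) O := by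
  have h1 : ContDiffOn ℝ ∞ (fderiv ℝ l) U := hl.fderiv_of_isOpen hU (by simp)
  have h2 : ContDiffOn ℝ ∞ (fun z => fderiv ℝ l (g z)) O := h1.comp hg fun z hz => (hgO z hz).2
  exact (contDiff_snd.comp_contDiffOn hg).prodMk (h2.clm_comp contDiffOn_const).neg

omit [FiniteDimensional ℝ E] in
/-- The vector field `hamField` is the Hamiltonian vector field of `l ∘ g`. -/
theorem hasFDerivAt_hamiltonian (heuler : ∀ w ∈ U, fderiv ℝ l w (0, w.2) = 2 * l w)
    {z : E × (E →L[ℝ] ℝ)} (hz : z ∈ O) :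
    ∃ H' : E × (E →L[ℝ] ℝ) →L[ℝ] ℝ, HasFDerivAt (fun z => l (g z)) H' z ∧
      ∀ ζ, H' ζ = (hamField l g z).2 ζ.1 - ζ.2 (hamField l g z).1 := by
  have hg1 := ((hg.contDiffAt (hO.mem_nhds hz)).differentiableAt (by simp)).hasFDerivAt
  have hl1 := ((hl.contDiffAt (hU.mem_nhds (hgO z hz).2)).differentiableAt (by simp)).hasFDerivAt
  have hH := hl1.comp z hg1
  refine ⟨_, hH, fun ζ => ?_⟩
  -- the first component of `g` is the identity
  have hfst : HasFDerivAt (fun z => (g z).1)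
      ((ContinuousLinearMap.fst ℝ E E).comp (fderiv ℝ g z)) z := hg1.fst
  have hfst' : (ContinuousLinearMap.fst ℝ E E).comp (fderiv ℝ g z) =
      ContinuousLinearMap.fst ℝ E (E →L[ℝ] ℝ) := by
    refine hfst.unique (hasFDerivAt_fst.congr_of_eventuallyEq ?_)
    filter_upwards [hO.mem_nhds hz] with z' hz'
    exact congrArg Prod.fst (hgO z' hz').1
  have h1 : (fderiv ℝ g z ζ).1 = ζ.1 := congrArg (fun L : _ →L[ℝ] E => L ζ) hfst'
  -- differentiate the identity `z.2 (Y z) = -2 l (g z)`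
  have hE : HasFDerivAt (fun z : E × (E →L[ℝ] ℝ) => z.2 ((g z).2)) _ z :=
    (hasFDerivAt_snd (p := z) (𝕜 := ℝ)).clm_apply hg1.snd
  have hE' : (fun z : E × (E →L[ℝ] ℝ) => z.2 ((g z).2)) =ᶠ[𝓝 z] fun z => -2 * l (g z) := by
    filter_upwards [hO.mem_nhds hz] with z' hz'
    have h2 := congrArg Prod.snd (hgO z' hz').1
    rw [← h2]
    change -(fderiv ℝ l (g z') (0, (g z').2)) = _
    rw [heuler _ (hgO z' hz').2]
    ring
  have h3 := (hE.unique ((hH.const_mul (-2)).congr_of_eventuallyEq hE'))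
  have h4 := congrArg (fun L : _ →L[ℝ] ℝ => L ζ) h3
  have h5 := congrArg Prod.snd (hgO z hz).1
  simp only [_root_.add_apply, ContinuousLinearMap.comp_apply, ContinuousLinearMap.flip_apply,
    _root_.smul_apply, smul_eq_mul, ContinuousLinearMap.coe_snd'] at h4
  rw [← h5] at h4
  have h6 : fderiv ℝ l (g z) (fderiv ℝ g z ζ) =
      fderiv ℝ l (g z) (ζ.1, 0) + fderiv ℝ l (g z) (0, (fderiv ℝ g z ζ).2) := by
    rw [← map_add, Prod.mk_add_mk, add_zero, zero_add, ← h1]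
  change fderiv ℝ l (g z) (fderiv ℝ g z ζ) = -(fderiv ℝ l (g z) (ζ.1, 0)) - ζ.2 (g z).2
  change -(fderiv ℝ l (g z) (0, (fderiv ℝ g z ζ).2)) + ζ.2 (g z).2 =
    -2 * fderiv ℝ l (g z) (fderiv ℝ g z ζ) at h4
  linarith

end LocalLegendre

/-! ### The dual boundary as a level set of the Hamiltonian -/

section DualBoundary

variable {E : Type*} [NormedAddCommGroup E] [NormedSpace ℝ E]
  {M : Type*} [TopologicalSpace M] [ChartedSpace E M] [IsManifold 𝓘(ℝ, E) ∞ M]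
  {C A : Set (TangentBundle 𝓘(ℝ, E) M)} {L : TangentBundle 𝓘(ℝ, E) M → ℝ}

/-- The coordinate expression of a subset of `TM`. -/
def coordDomain (A : Set (TangentBundle 𝓘(ℝ, E) M)) (x₀ : M) : Set (E × E) :=
  (tChart x₀).target ∩ (tChart x₀).symm ⁻¹' A

theorem mem_coordDomain {x₀ : M} {v : TangentBundle 𝓘(ℝ, E) M}
    (hp : v.proj ∈ (chartAt E x₀).source) (hv : v ∈ A) : tChart x₀ v ∈ coordDomain A x₀ :=
  ⟨(tChart x₀).map_source (mem_tChart_source.2 hp), by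
    rw [mem_preimage, (tChart x₀).left_inv (mem_tChart_source.2 hp)]; exact hv⟩

theorem isOpen_coordDomain (hA : IsOpen A) (x₀ : M) : IsOpen (coordDomain A x₀) := by
  refine ContinuousOn.isOpen_inter_preimage (fun z hz => ?_) (isOpen_tChart_target x₀) hA
  exact (continuousAt_tChart_symm hz).continuousWithinAt

variable (hL : IsLorentzFinslerMetric C A L)
include hL

theorem IsLorentzFinslerMetric.contDiffOn_local (x₀ : M) :
    ContDiffOn ℝ ∞ (localLagrangian L x₀) (coordDomain A x₀) := fun _ hz =>
  (contDiffAt_localLagrangian hL.isOpen hL.smooth hz.1 hz.2).contDiffWithinAt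

/-- A point of the coordinate domain comes from a tangent vector. -/
theorem exists_of_mem_coordDomain {x₀ : M} {w : E × E} (hw : w ∈ coordDomain A x₀) :
    ∃ v ∈ A, v.proj ∈ (chartAt E x₀).source ∧ tChart x₀ v = w ∧ localLagrangian L x₀ w = L v :=
  ⟨(tChart x₀).symm w, hw.2, mem_tChart_source.1 ((tChart x₀).map_target hw.1),
    (tChart x₀).right_inv hw.1, rfl⟩

theorem cChart_coLegendre {x₀ : M} {v : TangentBundle 𝓘(ℝ, E) M}
    (hp : v.proj ∈ (chartAt E x₀).source) (hv : v ∈ A) :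
    cChart x₀ (coLegendre L v) = legendreMap (localLagrangian L x₀) (tChart x₀ v) := by
  rw [coLegendre, cChart_apply hp,
    (hasFDerivAt_fibre hL.isOpen hL.smooth hp (y := vec v) hv).fderiv]
  refine Prod.ext rfl ?_
  ext η
  change -(fderiv ℝ (localLagrangian L x₀) _ (0, toCoord x₀ v.proj (ofCoord x₀ v.proj η))) = _
  rw [toCoord_ofCoord hp]
  rfl

theorem IsLorentzFinslerMetric.euler_local {x₀ : M} {w : E × E} (hw : w ∈ coordDomain A x₀) :
    fderiv ℝ (localLagrangian L x₀) w (0, w.2) = 2 * localLagrangian L x₀ w := by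
  obtain ⟨v, hv, hp, rfl, hLv⟩ := exists_of_mem_coordDomain hL hw
  rw [hLv, ← hL.fderiv_self hv,
    (hasFDerivAt_fibre hL.isOpen hL.smooth hp (y := vec v) hv).fderiv]
  rfl

theorem IsLorentzFinslerMetric.nondegenerate_local {x₀ : M} {w : E × E}
    (hw : w ∈ coordDomain A x₀) {η : E} (hη : fibreHessian (localLagrangian L x₀) w η = 0) :
    η = 0 := by
  obtain ⟨v, hv, hp, rfl, -⟩ := exists_of_mem_coordDomain hL hw
  have h1 : ofCoord x₀ v.proj η = 0 := by
    refine (hL.lorentz v hv).nondegenerate ?_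
    ext w'
    have h2 := fundamentalTensor_apply hL.isOpen hL.smooth hp (y := vec v) hv
      (ofCoord x₀ v.proj η) w'
    rw [toCoord_ofCoord hp] at h2
    refine h2.trans ?_
    have h3 := congrArg (fun u : E →L[ℝ] ℝ => u (toCoord x₀ v.proj w')) hη
    exact h3
  rw [← toCoord_ofCoord hp η, h1, map_zero]

variable (hC : IsStronglyConvexConeStructure C) (hs : ∀ v ∈ A, v ∈ C ↔ L v ≤ 0)
include hC hs

/-- Covectors in `∂C*` near `coLegendre L v` are Legendre transforms of vectors near `v`: otherwise
null vectors of such covectors would stay away from the ray of `v`, where `coLegendre L v` is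
positive. -/
theorem eventually_exists_legendreMap_eq [FiniteDimensional ℝ E] {x₀ : M}
    {v : TangentBundle 𝓘(ℝ, E) M} (hv : v ∈ boundary C) (hp : v.proj ∈ (chartAt E x₀).source)
    {N : Set (E × E)} (hN : N ∈ 𝓝 (tChart x₀ v)) :
    ∀ᶠ z in 𝓝 (cChart x₀ (coLegendre L v)), (cChart x₀).symm z ∈ dualBoundary C →
      ∃ w ∈ N, (tChart x₀).symm w ∈ boundary C ∧
        legendreMap (localLagrangian L x₀) w = z := by
  obtain ⟨hvA, hv0⟩ := hL.mem_of_boundary hv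
  set l := localLagrangian L x₀ with hl
  set w₀ := tChart x₀ v with hw₀
  have hw₀U : w₀ ∈ coordDomain A x₀ := mem_coordDomain hp hvA
  set z₀ := cChart x₀ (coLegendre L v) with hz₀
  have hz₀l : z₀ = legendreMap l w₀ := cChart_coLegendre hL hp hvA
  have hz₀1 : z₀.1 = w₀.1 := by rw [hz₀l]; rfl
  have hu₀ := coLegendre_mem_dualBoundary hL hC hs hv
  have hsymm₀ : (cChart x₀).symm z₀ = coLegendre L v :=
    (cChart x₀).left_inv (mem_cChart_source.2 hp)
  have hx₀ : z₀.1 ∈ (extChartAt 𝓘(ℝ, E) x₀).target := by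
    have h := hw₀U.1
    rw [tChart_target] at h
    rw [hz₀1]; exact h.1
  have hv2 : vec v ≠ 0 := hv.2
  have hy₀ : w₀.2 ≠ 0 := fun h => hv2 ((toCoord_eq_zero_iff hp).1 h)
  have hq₀ : z₀.2 ≠ 0 := by
    intro h
    have h1 : fderiv ℝ (onFibre L v.proj) (vec v) = 0 := by
      rw [(hasFDerivAt_fibre hL.isOpen hL.smooth hp (y := vec v) hvA).fderiv]
      ext η
      have h2 : -((fderiv ℝ l w₀).comp (ContinuousLinearMap.inr ℝ E E)) = 0 := by
        rw [hz₀l] at h; exact h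
      have h3 := congrArg (fun u : E →L[ℝ] ℝ => u (toCoord x₀ v.proj η)) (neg_eq_zero.1 h2)
      exact h3
    exact hL.fderiv_ne_zero hvA hv2 h1
  -- A null vector `y` of a covector `q` is a multiple of the vector with Legendre transform `q`; by
  -- homogeneity, the factor is the quotient of the norms of `q` and of the Legendre transform of
  -- `y`.
  set m : (E × (E →L[ℝ] ℝ)) × E → E × E := fun b =>
    (b.1.1, (‖b.1.2‖ / ‖(fderiv ℝ l (b.1.1, b.2)).comp (ContinuousLinearMap.inr ℝ E E)‖) • b.2)
    with hm
  have hz₀2 : ‖z₀.2‖ = ‖(fderiv ℝ l w₀).comp (ContinuousLinearMap.inr ℝ E E)‖ := by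
    rw [hz₀l]; exact norm_neg _
  have hm₀ : m (z₀, w₀.2) = w₀ := by
    have h1 : (z₀.1, w₀.2) = w₀ := by rw [hz₀1]
    simp only [hm]
    rw [h1, ← hz₀2, div_self (norm_ne_zero_iff.2 hq₀), one_smul, hz₀1]
  have hmc : ContinuousAt m (z₀, w₀.2) := by
    have h1 : ContinuousAt (fun b : (E × (E →L[ℝ] ℝ)) × E => fderiv ℝ l (b.1.1, b.2))
        (z₀, w₀.2) := by
      refine ContinuousAt.comp (g := fderiv ℝ l)
        (f := fun b : (E × (E →L[ℝ] ℝ)) × E => (b.1.1, b.2)) ?_ (by fun_prop)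
      change ContinuousAt (fderiv ℝ l) (z₀.1, w₀.2)
      rw [hz₀1]
      exact (contDiffAt_localLagrangian hL.isOpen hL.smooth hw₀U.1 hw₀U.2).continuousAt_fderiv
        (by simp)
    have h2 : ContinuousAt (fun b : (E × (E →L[ℝ] ℝ)) × E =>
        ‖(fderiv ℝ l (b.1.1, b.2)).comp (ContinuousLinearMap.inr ℝ E E)‖) (z₀, w₀.2) :=
      (h1.clm_comp continuousAt_const).norm
    have h3 : ContinuousAt (fun b : (E × (E →L[ℝ] ℝ)) × E => ‖b.1.2‖) (z₀, w₀.2) := by fun_prop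
    refine (by fun_prop : ContinuousAt (fun b : (E × (E →L[ℝ] ℝ)) × E => b.1.1) (z₀, w₀.2)).prodMk
      ((h3.div h2 ?_).smul continuousAt_snd)
    change ‖(fderiv ℝ l (z₀.1, w₀.2)).comp (ContinuousLinearMap.inr ℝ E E)‖ ≠ 0
    rw [hz₀1]
    change ‖(fderiv ℝ l w₀).comp (ContinuousLinearMap.inr ℝ E E)‖ ≠ 0
    rw [← hz₀2]
    exact norm_ne_zero_iff.2 hq₀
  have hmN : m ⁻¹' N ∈ 𝓝 z₀ ×ˢ 𝓝 w₀.2 := by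
    rw [← nhds_prod_eq]
    exact hmc.preimage_mem_nhds (by rwa [hm₀])
  obtain ⟨N₁, hN₁, N₂, hN₂, hsub⟩ := Filter.mem_prod_iff.1 hmN
  obtain ⟨ε, hε, hball⟩ := Metric.mem_nhds_iff.1 hN₂
  -- covectors near `z₀` are positive on the directions in `C` that are not close to the null
  -- direction of `z₀`
  set S : Set E := Metric.sphere 0 ‖w₀.2‖ \ Metric.ball w₀.2 ε with hS
  have hSc : IsCompact S := (isCompact_sphere _ _).diff Metric.isOpen_ball
  have hS0 : (0 : E) ∉ S := fun h => by
    have h1 := h.1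
    rw [mem_sphere_zero_iff_norm, norm_zero] at h1
    exact hy₀ (norm_eq_zero.1 h1.symm)
  have hform : ∀ z : E × (E →L[ℝ] ℝ), z.1 ∈ (extChartAt 𝓘(ℝ, E) x₀).target → ∀ y : E,
      z.2 y = ((cChart x₀).symm z).form
        (ofCoord x₀ ((extChartAt 𝓘(ℝ, E) x₀).symm z.1) y) := by
    intro z hz y
    rw [show z = (z.1, z.2) from rfl, cChart_symm_apply hz]
    change z.2 y = z.2 (toCoord x₀ _ (ofCoord x₀ _ y))
    rw [toCoord_ofCoord (symm_mem_source hz)]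
  have hp₀ : (extChartAt 𝓘(ℝ, E) x₀).symm z₀.1 = v.proj := by
    rw [hz₀1]
    exact (extChartAt 𝓘(ℝ, E) x₀).left_inv (by rwa [extChartAt_source])
  have hpos : ∀ y ∈ S, (tChart x₀).symm (z₀.1, y) ∈ C → 0 < z₀.2 y := by
    intro y hy hyC
    rw [tChart_symm_apply hx₀, hp₀] at hyC
    have h1 := hform z₀ hx₀ y
    rw [hsymm₀, hp₀] at h1
    obtain ⟨-, hnn, -⟩ := (mem_dualBoundary_iff hC).1 hu₀
    refine lt_of_le_of_ne (by rw [h1]; exact hnn _ hyC) fun h2 => hy.2 ?_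
    have h3 : (coLegendre L v).form (vec v) = 0 := by
      have := hL.fderiv_self hvA
      rw [hv0, mul_zero] at this
      exact neg_eq_zero.2 this
    obtain ⟨r, hr, hry⟩ := null_unique hL hC hs hu₀ (y := vec v)
      (w := ofCoord x₀ v.proj y) (mem_of_mem_boundary hC hv) h3 hyC (by rw [← h1, ← h2])
    have h4 : y = r • w₀.2 := by
      rw [← toCoord_ofCoord hp y, hry, map_smul]; rfl
    have h5 : ‖y‖ = ‖w₀.2‖ := mem_sphere_zero_iff_norm.1 hy.1
    rw [h4, norm_smul, Real.norm_of_nonneg hr.le] at h5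
    have h6 : r = 1 := mul_right_cancel₀ (norm_ne_zero_iff.2 hy₀) (by rw [h5, one_mul])
    rw [h4, h6, one_smul]
    exact Metric.mem_ball_self hε
  have htar : ∀ᶠ z : E × (E →L[ℝ] ℝ) in 𝓝 z₀, z.1 ∈ (extChartAt 𝓘(ℝ, E) x₀).target :=
    continuousAt_fst.eventually ((isOpen_extChartAt_target x₀).mem_nhds hx₀)
  filter_upwards [eventually_pos_on_compact hC hx₀ hSc hS0 hpos, hN₁, htar] with z h1 h2 h3 hzP
  set p := (extChartAt 𝓘(ℝ, E) x₀).symm z.1 with hpdef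
  have hps : p ∈ (chartAt E x₀).source := symm_mem_source h3
  have hxp : extChartAt 𝓘(ℝ, E) x₀ p = z.1 := (extChartAt 𝓘(ℝ, E) x₀).right_inv h3
  set u := (cChart x₀).symm z with hu
  have huc : u = covector p (z.2.comp (toCoord x₀ p)) := cChart_symm_apply h3 z.2
  have hcu : cChart x₀ u = z := (cChart x₀).right_inv (by
    rw [cChart_target]; exact ⟨h3, mem_univ _⟩)
  clear_value u
  subst huc
  set u : CotangentBundle E M := covector p (z.2.comp (toCoord x₀ p)) with hu
  -- hence the null vectors of nearby covectors, rescaled to the norm of `w₀.2`, are close to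
  -- `w₀.2`
  obtain ⟨hu0, hnn, y, hy, huy⟩ := (mem_dualBoundary_iff hC).1 hzP
  have hy : y ∈ fibre C p := hy
  have hy0 : y ≠ 0 := (hC.fibre_cone p).ne_zero hy
  have hDy0 : toCoord x₀ p y ≠ 0 := fun h => hy0 ((toCoord_eq_zero_iff hps).1 h)
  set r : ℝ := ‖w₀.2‖ / ‖toCoord x₀ p y‖ with hr
  have hr0 : 0 < r := div_pos (norm_pos_iff.2 hy₀) (norm_pos_iff.2 hDy0)
  have hryC : r • y ∈ fibre C p := (hC.fibre_cone p).smul_mem y hy r hr0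
  have hury : u.form (r • y) = 0 := by rw [map_smul, huy, smul_zero]
  set η := toCoord x₀ p (r • y) with hη
  have hηn : ‖η‖ = ‖w₀.2‖ := by
    rw [hη, map_smul, norm_smul, Real.norm_of_nonneg hr0.le, hr,
      div_mul_cancel₀ _ (norm_ne_zero_iff.2 hDy0)]
  have hηball : η ∈ Metric.ball w₀.2 ε := by
    by_contra hnb
    have hηS : η ∈ S := ⟨mem_sphere_zero_iff_norm.2 hηn, hnb⟩
    have h4 := h1 η hηS (by
      rw [tChart_symm_apply h3, hη, ofCoord_toCoord hps]
      exact hryC)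
    have h5 : z.2 η = u.form (r • y) := rfl
    rw [h5, hury] at h4
    exact lt_irrefl _ h4
  have hmem : m (z, η) ∈ N := hsub ⟨h2, hball hηball⟩
  obtain ⟨c, hc, hcu'⟩ := exists_coLegendre_eq hL hC hs hzP hryC hury
  have hbA := (hL.mem_of_boundary (mem_boundary_of_null hC hu0 hnn hryC hury)).1
  have hbA : (⟨p, r • y⟩ : TangentBundle 𝓘(ℝ, E) M) ∈ A := hbA
  have hq : z.2 = -(c • (fderiv ℝ l (z.1, η)).comp (ContinuousLinearMap.inr ℝ E E)) := by
    ext θ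
    have h6 := congrArg (fun k : E →L[ℝ] ℝ => k (ofCoord x₀ p θ)) hcu'
    have h7 : u.form (ofCoord x₀ p θ) = z.2 (toCoord x₀ p (ofCoord x₀ p θ)) := rfl
    rw [toCoord_ofCoord hps] at h7
    rw [← h7]
    refine h6.trans ?_
    change c * -(fderiv ℝ (onFibre L p) (r • y) (ofCoord x₀ p θ)) =
      -(c * (fderiv ℝ l (z.1, η) (0, θ)))
    rw [(hasFDerivAt_fibre hL.isOpen hL.smooth hps hbA).fderiv, mul_neg, ← hxp, hη]
    change -(c * (fderiv ℝ l (_, _) (0, toCoord x₀ p (ofCoord x₀ p θ)))) = _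
    rw [toCoord_ofCoord hps]
  have hq0 : z.2 ≠ 0 := by
    intro h
    apply hu0
    ext θ
    change z.2 (toCoord x₀ p θ) = 0
    rw [h]; rfl
  have hcn : c = ‖z.2‖ / ‖(fderiv ℝ l (z.1, η)).comp (ContinuousLinearMap.inr ℝ E E)‖ := by
    have h8 : ‖z.2‖ = c * ‖(fderiv ℝ l (z.1, η)).comp (ContinuousLinearMap.inr ℝ E E)‖ := by
      rw [hq, norm_neg, norm_smul, Real.norm_of_nonneg hc.le]
    have h9 : ‖(fderiv ℝ l (z.1, η)).comp (ContinuousLinearMap.inr ℝ E E)‖ ≠ 0 := by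
      intro h
      rw [h, mul_zero] at h8
      exact hq0 (norm_eq_zero.1 h8)
    rw [h8, mul_div_cancel_right₀ _ h9]
  have hmeq : m (z, η) = tChart x₀ (⟨p, c • r • y⟩ : TangentBundle 𝓘(ℝ, E) M) := by
    rw [tChart_apply, hxp, map_smul, ← hη]
    simp only [hm]
    rw [← hcn]
  have hcb : (⟨p, c • r • y⟩ : TangentBundle 𝓘(ℝ, E) M) ∈ boundary C :=
    mem_boundary_of_null hC hu0 hnn ((hC.fibre_cone p).smul_mem _ hryC c hc)
      (by rw [map_smul, hury, smul_zero])
  refine ⟨m (z, η), hmem, ?_, ?_⟩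
  · rw [hmeq, (tChart x₀).left_inv (mem_tChart_source.2 hps)]
    exact hcb
  · rw [hmeq, ← cChart_coLegendre hL hps (hL.mem_of_boundary hcb).1]
    rw [← hcu]
    congr 1
    have h10 := hL.coLegendre_scale hbA hc
    have h11 : u = covector p u.form := rfl
    rw [h11, hcu']
    exact h10

/-- The local picture of `∂C*`: in the chart at `x₀`, the Legendre transform has a local inverse
`g`, and `∂C*` is the zero set of the Hamiltonian `L ∘ g`. -/
theorem exists_hamiltonian_chart [FiniteDimensional ℝ E] {x₀ : M}
    {v : TangentBundle 𝓘(ℝ, E) M} (hv : v ∈ boundary C) (hp : v.proj ∈ (chartAt E x₀).source) :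
    ∃ (g : E × (E →L[ℝ] ℝ) → E × E) (O : Set (E × (E →L[ℝ] ℝ))), IsOpen O ∧
      cChart x₀ (coLegendre L v) ∈ O ∧ ContDiffOn ℝ ∞ g O ∧
      (∀ z ∈ O, legendreMap (localLagrangian L x₀) (g z) = z ∧ g z ∈ coordDomain A x₀) ∧
      (∀ᶠ w in 𝓝 (tChart x₀ v), g (legendreMap (localLagrangian L x₀) w) = w ∧
        legendreMap (localLagrangian L x₀) w ∈ O) ∧
      (∀ z ∈ O, (cChart x₀).symm z ∈ dualBoundary C ↔ localLagrangian L x₀ (g z) = 0) := by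
  obtain ⟨hvA, hv0⟩ := hL.mem_of_boundary hv
  have hw₀U := mem_coordDomain hp hvA
  obtain ⟨g, O, hO, hzO, hg, hgO, hinv⟩ := exists_legendre_inverse
    (isOpen_coordDomain hL.isOpen x₀) (hL.contDiffOn_local x₀) hw₀U
    (fun η hη => hL.nondegenerate_local hw₀U hη)
  rw [← cChart_coLegendre hL hp hvA] at hzO
  have hN := eventually_exists_legendreMap_eq hL hC hs hv hp hinv
  obtain ⟨O', hO'sub, hO', hzO'⟩ := mem_nhds_iff.1 (Filter.inter_mem hN (hO.mem_nhds hzO))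
  have hcont : ContinuousAt (legendreMap (localLagrangian L x₀)) (tChart x₀ v) :=
    ((contDiffOn_legendreMap (isOpen_coordDomain hL.isOpen x₀)
      (hL.contDiffOn_local x₀)).contDiffAt
      ((isOpen_coordDomain hL.isOpen x₀).mem_nhds hw₀U)).continuousAt
  refine ⟨g, O', hO', hzO', hg.mono fun z hz => (hO'sub hz).2, fun z hz => hgO z (hO'sub hz).2,
    ?_, fun z hz => ⟨fun h => ?_, fun h => ?_⟩⟩
  · filter_upwards [hinv, hcont.eventually (hO'.mem_nhds (by
      rwa [← cChart_coLegendre hL hp hvA]))] with w h1 h2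
    exact ⟨h1.1, h2⟩
  · obtain ⟨w, hw, hwb, hwz⟩ := (hO'sub hz).1 h
    rw [← hwz, hw.1]
    exact (hL.mem_of_boundary hwb).2
  · obtain ⟨hz1, hzU⟩ := hgO z (hO'sub hz).2
    obtain ⟨v', hv'A, hv'p, hv't, hv'L⟩ := exists_of_mem_coordDomain hL hzU
    have hv'b : v' ∈ boundary C := by
      rw [hL.boundary_eq]
      exact ⟨hv'A, by rw [← hv'L, h]⟩
    have h1 := cChart_coLegendre hL hv'p hv'A
    rw [hv't, hz1] at h1
    rw [← h1, (cChart x₀).left_inv (mem_cChart_source.2 hv'p)]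
    exact coLegendre_mem_dualBoundary hL hC hs hv'b

end DualBoundary

/-! ### Null geodesics and integral curves -/

section Geodesics

variable {E : Type*} [NormedAddCommGroup E] [NormedSpace ℝ E]
  {M : Type*} [TopologicalSpace M] [ChartedSpace E M] [IsManifold 𝓘(ℝ, E) ∞ M]
  {C A : Set (TangentBundle 𝓘(ℝ, E) M)} {L : TangentBundle 𝓘(ℝ, E) M → ℝ}

/-- The change of coordinates from the chart at `x₁` to the chart at `x₀`. -/
def transition (x₀ x₁ : M) (x : E) : E := extChartAt 𝓘(ℝ, E) x₀ ((extChartAt 𝓘(ℝ, E) x₁).symm x)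

theorem contDiffAt_transition {x₀ x₁ p : M} (h₀ : p ∈ (chartAt E x₀).source)
    (h₁ : p ∈ (chartAt E x₁).source) :
    ContDiffAt ℝ ∞ (transition x₀ x₁) (extChartAt 𝓘(ℝ, E) x₁ p) := by
  have hx : extChartAt 𝓘(ℝ, E) x₁ p ∈ (extChartAt 𝓘(ℝ, E) x₁).target :=
    (extChartAt 𝓘(ℝ, E) x₁).map_source (by rwa [extChartAt_source])
  have h2 : ContMDiffAt 𝓘(ℝ, E) 𝓘(ℝ, E) ∞ (extChartAt 𝓘(ℝ, E) x₁).symm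
      (extChartAt 𝓘(ℝ, E) x₁ p) :=
    (contMDiffOn_extChartAt_symm (I := 𝓘(ℝ, E)) (n := ∞) x₁).contMDiffAt
      ((isOpen_extChartAt_target x₁).mem_nhds hx)
  have h3 : (extChartAt 𝓘(ℝ, E) x₁).symm (extChartAt 𝓘(ℝ, E) x₁ p) = p :=
    (extChartAt 𝓘(ℝ, E) x₁).left_inv (by rwa [extChartAt_source])
  have h4 : ContMDiffAt 𝓘(ℝ, E) 𝓘(ℝ, E) ∞ (extChartAt 𝓘(ℝ, E) x₀)
      ((extChartAt 𝓘(ℝ, E) x₁).symm (extChartAt 𝓘(ℝ, E) x₁ p)) := by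
    rw [h3]; exact contMDiffAt_extChartAt' h₀
  exact contMDiffAt_iff_contDiffAt.1 (h4.comp _ h2)

theorem toCoord_ofCoord_eq_fderiv {x₀ x₁ p : M} (h₀ : p ∈ (chartAt E x₀).source)
    (h₁ : p ∈ (chartAt E x₁).source) (y : E) :
    toCoord x₀ p (ofCoord x₁ p y) =
      fderiv ℝ (transition x₀ x₁) (extChartAt 𝓘(ℝ, E) x₁ p) y := by
  have h2 := tangentCoordChange_comp (I := 𝓘(ℝ, E)) (w := x₁) (x := p) (y := x₀) (z := p) (v := y)
    ⟨⟨by rwa [extChartAt_source], by rw [extChartAt_source]; exact mem_chart_source E p⟩,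
      by rwa [extChartAt_source]⟩
  refine h2.trans ?_
  rw [tangentCoordChange_def]
  simp only [modelWithCornersSelf_coe, range_id, fderivWithin_univ]
  rfl

/-- The Euler-Lagrange equation does not depend on the chart. -/
theorem eulerLagrange_chart_change (hA : IsOpen A)
    (hL : ContMDiffOn 𝓘(ℝ, E).tangent 𝓘(ℝ, ℝ) ∞ L A) {γ : ℝ → M} {a b t : ℝ}
    (hγ : ContMDiffOn 𝓘(ℝ, ℝ) 𝓘(ℝ, E) ∞ γ (Ioo a b))
    (hγA : ∀ s ∈ Ioo a b, velocity 𝓘(ℝ, E) γ s ∈ A) (ht : t ∈ Ioo a b) {x₀ x₁ : M}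
    (h₀ : γ t ∈ (chartAt E x₀).source) (h₁ : γ t ∈ (chartAt E x₁).source)
    (hEL : HasDerivAt
      (fun s => (fderiv ℝ (localLagrangian L x₀) (localVelocity γ x₀ s)).comp
        (ContinuousLinearMap.inr ℝ E E))
      ((fderiv ℝ (localLagrangian L x₀) (localVelocity γ x₀ t)).comp
        (ContinuousLinearMap.inl ℝ E E)) t) :
    HasDerivAt
      (fun s => (fderiv ℝ (localLagrangian L x₁) (localVelocity γ x₁ s)).comp
        (ContinuousLinearMap.inr ℝ E E))
      ((fderiv ℝ (localLagrangian L x₁) (localVelocity γ x₁ t)).comp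
        (ContinuousLinearMap.inl ℝ E E)) t := by
  have hd : ∀ s ∈ Ioo a b, MDifferentiableAt 𝓘(ℝ, ℝ) 𝓘(ℝ, E) γ s := fun s hs =>
    (hγ.contMDiffAt (Ioo_mem_nhds hs.1 hs.2)).mdifferentiableAt (by simp)
  set ψ : E → E := transition (E := E) x₀ x₁ with hψ
  -- the chain rule for the transition map `(x, y) ↦ (ψ x, dψ_x y)` of the tangent bundle
  have key : ∀ s ∈ Ioo a b, γ s ∈ (chartAt E x₀).source → γ s ∈ (chartAt E x₁).source →
      ∀ ξ η : E, fderiv ℝ (localLagrangian L x₁) (localVelocity γ x₁ s) (ξ, η) =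
        fderiv ℝ (localLagrangian L x₀) (localVelocity γ x₀ s)
          (fderiv ℝ ψ (extChartAt 𝓘(ℝ, E) x₁ (γ s)) ξ,
            fderiv ℝ (fderiv ℝ ψ) (extChartAt 𝓘(ℝ, E) x₁ (γ s)) ξ (localVelocity γ x₁ s).2 +
            fderiv ℝ ψ (extChartAt 𝓘(ℝ, E) x₁ (γ s)) η) := by
    intro s hs hs₀ hs₁ ξ η
    set x := extChartAt 𝓘(ℝ, E) x₁ (γ s) with hx
    set y : E := (localVelocity γ x₁ s).2 with hy
    have hV : localVelocity γ x₁ s = (x, y) := rfl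
    have hψs : ContDiffAt ℝ ∞ ψ x := contDiffAt_transition hs₀ hs₁
    let Ψ : E × E → E × E := fun z => (ψ z.1, fderiv ℝ ψ z.1 z.2)
    have hΨV : Ψ (x, y) = localVelocity γ x₀ s := by
      refine Prod.ext ?_ ?_
      · change extChartAt 𝓘(ℝ, E) x₀ ((extChartAt 𝓘(ℝ, E) x₁).symm x) = _
        rw [hx, (extChartAt 𝓘(ℝ, E) x₁).left_inv (by rwa [extChartAt_source])]
        rfl
      · change fderiv ℝ ψ x y = _
        have h2 : y = toCoord (E := E) x₁ (γ s) (vec (velocity 𝓘(ℝ, E) γ s)) := rfl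
        rw [hx, hψ, ← toCoord_ofCoord_eq_fderiv hs₀ hs₁, h2, ofCoord_toCoord hs₁]
        rfl
    have hψ1 : HasFDerivAt (fun z : E × E => ψ z.1)
        ((fderiv ℝ ψ x).comp (ContinuousLinearMap.fst ℝ E E)) (x, y) :=
      HasFDerivAt.comp (g := ψ) (f := Prod.fst) (x, y)
        (hψs.differentiableAt (by simp)).hasFDerivAt hasFDerivAt_fst
    have hψ2 : HasFDerivAt (fun z : E × E => fderiv ℝ ψ z.1)
        ((fderiv ℝ (fderiv ℝ ψ) x).comp (ContinuousLinearMap.fst ℝ E E)) (x, y) :=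
      HasFDerivAt.comp (g := fderiv ℝ ψ) (f := Prod.fst) (x, y)
        ((hψs.fderiv_right (m := 1) (by norm_cast)).differentiableAt one_ne_zero).hasFDerivAt
        hasFDerivAt_fst
    have hΨd : HasFDerivAt Ψ _ (x, y) := hψ1.prodMk (hψ2.clm_apply hasFDerivAt_snd)
    have hv : localVelocity γ x₀ s ∈ coordDomain A x₀ :=
      mem_coordDomain (v := velocity 𝓘(ℝ, E) γ s) hs₀ (hγA s hs)
    have hld := (contDiffAt_localLagrangian hA hL hv.1 hv.2).differentiableAt
      (by simp : (∞ : WithTop ℕ∞) ≠ 0)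
    rw [← hΨV] at hld
    have hcomp := hld.hasFDerivAt.comp (x, y) hΨd
    have hxt : x ∈ (extChartAt 𝓘(ℝ, E) x₁).target :=
      (extChartAt 𝓘(ℝ, E) x₁).map_source (by rwa [extChartAt_source])
    have hpx : (extChartAt 𝓘(ℝ, E) x₁).symm x = γ s :=
      (extChartAt 𝓘(ℝ, E) x₁).left_inv (by rwa [extChartAt_source])
    have heq : localLagrangian L x₁ =ᶠ[𝓝 (x, y)] localLagrangian L x₀ ∘ Ψ := by
      have h2 : ∀ᶠ z : E × E in 𝓝 (x, y), z.1 ∈ (extChartAt 𝓘(ℝ, E) x₁).target :=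
        continuousAt_fst.eventually ((isOpen_extChartAt_target x₁).mem_nhds hxt)
      have h3 : ∀ᶠ z : E × E in 𝓝 (x, y),
          (extChartAt 𝓘(ℝ, E) x₁).symm z.1 ∈ (chartAt E x₀).source := by
        have hc : ContinuousAt (fun z : E × E => (extChartAt 𝓘(ℝ, E) x₁).symm z.1) (x, y) :=
          ContinuousAt.comp (g := (extChartAt 𝓘(ℝ, E) x₁).symm) (f := Prod.fst)
            (continuousAt_extChartAt_symm'' hxt) continuousAt_fst
        exact hc.eventually ((chartAt E x₀).open_source.mem_nhds (by
          change (extChartAt 𝓘(ℝ, E) x₁).symm x ∈ _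
          rwa [hpx]))
      filter_upwards [h2, h3] with z hz2 hz3
      have hz1 := symm_mem_source hz2
      have h4 := localLagrangian_apply L hz3
        (ofCoord x₁ ((extChartAt 𝓘(ℝ, E) x₁).symm z.1) z.2)
      rw [toCoord_ofCoord_eq_fderiv hz3 hz1, (extChartAt 𝓘(ℝ, E) x₁).right_inv hz2] at h4
      have h5 : localLagrangian L x₁ z = L ((tChart x₁).symm (z.1, z.2)) := rfl
      rw [h5, tChart_symm_apply hz2]
      exact h4.symm
    rw [hV, (hcomp.congr_of_eventuallyEq heq).fderiv]
    have h6 : fderiv ℝ (localLagrangian L x₀) (Ψ (x, y)) =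
      fderiv ℝ (localLagrangian L x₀) (localVelocity γ x₀ s) := by rw [hΨV]
    rw [← h6]
    simp only [ContinuousLinearMap.comp_apply]
    congr 1
    refine Prod.ext rfl ?_
    simp [add_comm]
  have hcont : ContinuousAt γ t := (hd t ht).continuousAt
  have hnear : ∀ᶠ s in 𝓝 t, s ∈ Ioo a b ∧ γ s ∈ (chartAt E x₀).source ∧
      γ s ∈ (chartAt E x₁).source :=
    (Filter.Eventually.and (Ioo_mem_nhds ht.1 ht.2)
      ((hcont.eventually ((chartAt E x₀).open_source.mem_nhds h₀)).and
        (hcont.eventually ((chartAt E x₁).open_source.mem_nhds h₁))))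
  have hψt : ContDiffAt ℝ ∞ ψ (extChartAt 𝓘(ℝ, E) x₁ (γ t)) := contDiffAt_transition h₀ h₁
  have hx' : HasDerivAt (fun s => extChartAt 𝓘(ℝ, E) x₁ (γ s)) (localVelocity γ x₁ t).2 t :=
    hasDerivAt_chart (hd t ht) h₁
  have hDψ : HasDerivAt (fun s => fderiv ℝ ψ (extChartAt 𝓘(ℝ, E) x₁ (γ s)))
      (fderiv ℝ (fderiv ℝ ψ) (extChartAt 𝓘(ℝ, E) x₁ (γ t)) (localVelocity γ x₁ t).2) t :=
    ((hψt.fderiv_right (m := 1) (by norm_cast)).differentiableAt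
      one_ne_zero).hasFDerivAt.comp_hasDerivAt t hx'
  -- the terms with second derivatives of `ψ` cancel by their symmetry
  have hprod := hEL.clm_comp hDψ
  have hprod' := hprod.congr_of_eventuallyEq (f₁ := fun s =>
      (fderiv ℝ (localLagrangian L x₁) (localVelocity γ x₁ s)).comp
        (ContinuousLinearMap.inr ℝ E E)) (by
    filter_upwards [hnear] with s hs
    ext η
    have h2 := key s hs.1 hs.2.1 hs.2.2 0 η
    rw [map_zero, map_zero, _root_.zero_apply, zero_add] at h2
    exact h2)
  refine hprod'.congr_deriv ?_
  ext ξ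
  have h2 := key t ht h₀ h₁ ξ 0
  rw [map_zero, add_zero] at h2
  have hsymm := ((hψt.of_le (m := 2) (by norm_cast)).isSymmSndFDerivAt (by simp)).eq ξ
    (localVelocity γ x₁ t).2
  rw [hsymm] at h2
  refine Eq.trans ?_ h2.symm
  have h3 : ∀ (l : E × E →L[ℝ] ℝ) (y z : E), l (y, z) = l (y, 0) + l (0, z) := fun l y z => by
    rw [← map_add, Prod.mk_add_mk, add_zero, zero_add]
  rw [h3]
  rfl

theorem IsNullGeodesic.mdifferentiableAt {γ : ℝ → M} {a b t : ℝ} (hγ : IsNullGeodesic C L γ a b)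
    (ht : t ∈ Ioo a b) : MDifferentiableAt 𝓘(ℝ, ℝ) 𝓘(ℝ, E) γ t :=
  (hγ.smooth.contMDiffAt (Ioo_mem_nhds ht.1 ht.2)).mdifferentiableAt (by simp)

/-- The Legendre lift of a null geodesic satisfies Hamilton's equations. -/
theorem IsNullGeodesic.hasDerivAt_lift {γ : ℝ → M} {a b t : ℝ} (hγ : IsNullGeodesic C L γ a b)
    (ht : t ∈ Ioo a b) {x₀ : M} (hp : γ t ∈ (chartAt E x₀).source) :
    HasDerivAt (fun s => legendreMap (localLagrangian L x₀) (localVelocity γ x₀ s))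
      ((localVelocity γ x₀ t).2, -(fderiv ℝ (localLagrangian L x₀) (localVelocity γ x₀ t)).comp
        (ContinuousLinearMap.inl ℝ E E)) t :=
  HasDerivAt.prodMk (hasDerivAt_chart (hγ.mdifferentiableAt ht) hp)
    (hγ.eulerLagrange t ht x₀ hp).neg

variable (hL : IsLorentzFinslerMetric C A L)
include hL

/-- Integral curves of the Hamiltonian vector field in `∂C*` are lifts of null geodesics. -/
theorem isNullGeodesic_of_integral_curve {x₀ : M} {g : E × (E →L[ℝ] ℝ) → E × E}
    {O : Set (E × (E →L[ℝ] ℝ))} (hO : IsOpen O) (hg : ContDiffOn ℝ ∞ g O)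
    (hgO : ∀ z ∈ O, legendreMap (localLagrangian L x₀) (g z) = z ∧ g z ∈ coordDomain A x₀)
    {δ : ℝ → E × (E →L[ℝ] ℝ)} {a b : ℝ} (hδs : ContDiffOn ℝ ∞ δ (Ioo a b))
    (hδ : ∀ t ∈ Ioo a b, δ t ∈ O ∧ HasDerivAt δ (hamField (localLagrangian L x₀) g (δ t)) t)
    {t₀ : ℝ} (ht₀ : t₀ ∈ Ioo a b) (h0 : localLagrangian L x₀ (g (δ t₀)) = 0) :
    IsNullGeodesic C L (fun t => (extChartAt 𝓘(ℝ, E) x₀).symm (δ t).1) a b ∧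
    ∀ t ∈ Ioo a b, (extChartAt 𝓘(ℝ, E) x₀).symm (δ t).1 ∈ (chartAt E x₀).source ∧
      localVelocity (fun t => (extChartAt 𝓘(ℝ, E) x₀).symm (δ t).1) x₀ t = g (δ t) := by
  set l := localLagrangian L x₀ with hl
  set γ : ℝ → M := fun t => (extChartAt 𝓘(ℝ, E) x₀).symm (δ t).1 with hγ
  have hg1 : ∀ z ∈ O, (g z).1 = z.1 := fun z hz => congrArg Prod.fst (hgO z hz).1
  have htar : ∀ t ∈ Ioo a b, (δ t).1 ∈ (extChartAt 𝓘(ℝ, E) x₀).target := fun t ht => by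
    have h1 := (hgO _ (hδ t ht).1).2.1
    rw [tChart_target] at h1
    rw [← hg1 _ (hδ t ht).1]; exact h1.1
  have hsrc : ∀ t ∈ Ioo a b, γ t ∈ (chartAt E x₀).source := fun t ht =>
    symm_mem_source (htar t ht)
  have hsm : ContMDiffOn 𝓘(ℝ, ℝ) 𝓘(ℝ, E) ∞ γ (Ioo a b) := by
    refine (contMDiffOn_extChartAt_symm (I := 𝓘(ℝ, E)) (n := ∞) x₀).comp
      (contMDiffOn_iff_contDiffOn.2 (contDiff_fst.comp_contDiffOn hδs)) htar
  have hd : ∀ t ∈ Ioo a b, MDifferentiableAt 𝓘(ℝ, ℝ) 𝓘(ℝ, E) γ t := fun t ht =>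
    (hsm.contMDiffAt (Ioo_mem_nhds ht.1 ht.2)).mdifferentiableAt (by simp)
  have hchart : ∀ t ∈ Ioo a b, extChartAt 𝓘(ℝ, E) x₀ (γ t) = (δ t).1 := fun t ht =>
    (extChartAt 𝓘(ℝ, E) x₀).right_inv (htar t ht)
  have hvel : ∀ t ∈ Ioo a b, localVelocity γ x₀ t = g (δ t) := by
    intro t ht
    refine Prod.ext ((hchart t ht).trans (hg1 _ (hδ t ht).1).symm) ?_
    have h1 : HasDerivAt (fun s => extChartAt 𝓘(ℝ, E) x₀ (γ s)) (localVelocity γ x₀ t).2 t :=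
      hasDerivAt_chart (hd t ht) (hsrc t ht)
    have h2 : HasDerivAt (fun s => (δ s).1) (hamField l g (δ t)).1 t :=
      (hδ t ht).2.fst
    refine h1.unique (h2.congr_of_eventuallyEq ?_)
    filter_upwards [Ioo_mem_nhds ht.1 ht.2] with s hs
    exact hchart s hs
  -- conservation of energy
  have hzero : ∀ t ∈ Ioo a b, l (g (δ t)) = 0 := by
    have hder : ∀ t ∈ Ioo a b, HasDerivAt (fun s => l (g (δ s))) 0 t := by
      intro t ht
      obtain ⟨H', hH', hval⟩ := hasFDerivAt_hamiltonian (isOpen_coordDomain hL.isOpen x₀)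
        (hL.contDiffOn_local x₀) hO hg hgO (fun w hw => hL.euler_local hw) (hδ t ht).1
      have h1 := hH'.comp_hasDerivAt t (hδ t ht).2
      rw [hval, sub_self] at h1
      exact h1
    intro t ht
    rw [← h0]
    exact isOpen_Ioo.is_const_of_deriv_eq_zero isPreconnected_Ioo
      (fun s hs => (hder s hs).differentiableAt.differentiableWithinAt)
      (fun s hs => (hder s hs).deriv) ht ht₀
  have hvelA : ∀ t ∈ Ioo a b, velocity 𝓘(ℝ, E) γ t ∈ A ∧ L (velocity 𝓘(ℝ, E) γ t) = 0 := by
    intro t ht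
    have h1 := tChart_symm_localVelocity (hsrc t ht)
    rw [hvel t ht] at h1
    rw [← h1]
    exact ⟨(hgO _ (hδ t ht).1).2.2, hzero t ht⟩
  have hEL : ∀ t ∈ Ioo a b, HasDerivAt
      (fun s => (fderiv ℝ l (localVelocity γ x₀ s)).comp (ContinuousLinearMap.inr ℝ E E))
      ((fderiv ℝ l (localVelocity γ x₀ t)).comp (ContinuousLinearMap.inl ℝ E E)) t := by
    intro t ht
    have h1 : HasDerivAt (fun s => -(δ s).2) (-(hamField l g (δ t)).2) t :=
      ((ContinuousLinearMap.snd ℝ E (E →L[ℝ] ℝ)).hasFDerivAt.comp_hasDerivAt t (hδ t ht).2).neg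
    have h2 := h1.congr_of_eventuallyEq (f₁ := fun s =>
      (fderiv ℝ l (localVelocity γ x₀ s)).comp (ContinuousLinearMap.inr ℝ E E)) (by
      filter_upwards [Ioo_mem_nhds ht.1 ht.2] with s hs
      have h3 := congrArg Prod.snd (hgO _ (hδ s hs).1).1
      rw [← h3, hvel s hs]
      exact (neg_neg _).symm)
    refine h2.congr_deriv ?_
    rw [hvel t ht]
    exact neg_neg _
  refine ⟨⟨hsm, fun t ht => ?_, fun t ht x₁ hx₁ => ?_⟩, fun t ht => ⟨hsrc t ht, hvel t ht⟩⟩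
  · rw [hL.boundary_eq]; exact hvelA t ht
  · exact eulerLagrange_chart_change hL.isOpen hL.smooth hsm (fun s hs => (hvelA s hs).1) ht
      (hsrc t ht) hx₁ (hEL t ht)

end Geodesics

/-! ### Orbits of null geodesics -/

section Orbits

variable {E : Type*} [NormedAddCommGroup E] [NormedSpace ℝ E]
  {M : Type*} [TopologicalSpace M] [ChartedSpace E M] [IsManifold 𝓘(ℝ, E) ∞ M]
  {C A : Set (TangentBundle 𝓘(ℝ, E) M)} {L : TangentBundle 𝓘(ℝ, E) M → ℝ}

theorem velocity_congr {γ γ' : ℝ → M} {t : ℝ} (h : γ =ᶠ[𝓝 t] γ') :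
    velocity 𝓘(ℝ, E) γ t = velocity 𝓘(ℝ, E) γ' t := by
  have h1 : γ t = γ' t := h.self_of_nhds
  have h2 : (mfderiv 𝓘(ℝ, ℝ) 𝓘(ℝ, E) γ t : ℝ →L[ℝ] E) = mfderiv 𝓘(ℝ, ℝ) 𝓘(ℝ, E) γ' t :=
    h.mfderiv_eq
  have key : ∀ (p q : M) (y z : E), p = q → y = z →
      (⟨p, y⟩ : TangentBundle 𝓘(ℝ, E) M) = ⟨q, z⟩ := by rintro p _ y _ rfl rfl; rfl
  exact key _ _ _ _ h1 (congrArg (fun l : ℝ →L[ℝ] E => l 1) h2)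

theorem localVelocity_congr {γ γ' : ℝ → M} {t : ℝ} (h : γ =ᶠ[𝓝 t] γ') (x₀ : M) :
    localVelocity (E := E) γ x₀ t = localVelocity γ' x₀ t := by
  rw [localVelocity, velocity_congr h, localVelocity]

theorem continuousAt_localVelocity {γ : ℝ → M} {a b t : ℝ}
    (hγ : ContMDiffOn 𝓘(ℝ, ℝ) 𝓘(ℝ, E) ∞ γ (Ioo a b)) (ht : t ∈ Ioo a b) {x₀ : M}
    (hp : γ t ∈ (chartAt E x₀).source) : ContinuousAt (localVelocity (E := E) γ x₀) t := by
  have h1 : ContMDiffAt 𝓘(ℝ, ℝ) 𝓘(ℝ, E) ∞ γ t := hγ.contMDiffAt (Ioo_mem_nhds ht.1 ht.2)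
  have h2 : ContDiffAt ℝ ∞ (fun s => extChartAt 𝓘(ℝ, E) x₀ (γ s)) t :=
    contMDiffAt_iff_contDiffAt.1 ((contMDiffAt_extChartAt' hp).comp t h1)
  have h3 : ContinuousAt (deriv fun s => extChartAt 𝓘(ℝ, E) x₀ (γ s)) t := by
    have := (h2.continuousAt_fderiv (by simp)).clm_apply (continuousAt_const (y := (1 : ℝ)))
    exact this
  refine (h2.continuousAt.prodMk h3).congr ?_
  filter_upwards [Ioo_mem_nhds ht.1 ht.2,
    h1.continuousAt.eventually ((chartAt E x₀).open_source.mem_nhds hp)] with s hs hsp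
  exact (localVelocity_eq ((hγ.contMDiffAt (Ioo_mem_nhds hs.1 hs.2)).mdifferentiableAt (by simp))
    hsp).symm

/-- Being a null geodesic is a local property. -/
theorem isNullGeodesic_of_eventuallyEq {γ : ℝ → M} {a b : ℝ}
    (h : ∀ t ∈ Ioo a b, ∃ (γ' : ℝ → M) (a' b' : ℝ), IsNullGeodesic C L γ' a' b' ∧ t ∈ Ioo a' b' ∧
      γ =ᶠ[𝓝 t] γ') : IsNullGeodesic C L γ a b := by
  refine ⟨fun t ht => ?_, fun t ht => ?_, fun t ht x₀ hp => ?_⟩ <;>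
    obtain ⟨γ', a', b', hγ', ht', heq⟩ := h t ht
  · exact ((hγ'.smooth.contMDiffAt (Ioo_mem_nhds ht'.1 ht'.2)).congr_of_eventuallyEq
      heq).contMDiffWithinAt
  · rw [velocity_congr heq]; exact hγ'.null t ht'
  · have h1 := hγ'.eulerLagrange t ht' x₀ (by rw [← heq.self_of_nhds]; exact hp)
    rw [← localVelocity_congr heq] at h1
    refine h1.congr_of_eventuallyEq ?_
    filter_upwards [heq.eventuallyEq_nhds] with s hs
    rw [localVelocity_congr hs]

theorem velocity_comp_affine {γ : ℝ → M} {k t₀ s : ℝ}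
    (hγ : MDifferentiableAt 𝓘(ℝ, ℝ) 𝓘(ℝ, E) γ (k * s + t₀)) :
    velocity 𝓘(ℝ, E) (fun s => γ (k * s + t₀)) s =
      scale k (velocity 𝓘(ℝ, E) γ (k * s + t₀)) := by
  have h1 : HasDerivAt (fun s : ℝ => k * s + t₀) k s := by
    simpa using ((hasDerivAt_id' s).const_mul k).add_const t₀
  have h2 : HasMFDerivAt 𝓘(ℝ, ℝ) 𝓘(ℝ, ℝ) (fun s : ℝ => k * s + t₀) s
      (ContinuousLinearMap.toSpanSingleton ℝ k) := h1.hasFDerivAt.hasMFDerivAt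
  have h3 := (hγ.hasMFDerivAt.comp s h2).mfderiv
  let B : ℝ →L[ℝ] E := mfderiv 𝓘(ℝ, ℝ) 𝓘(ℝ, E) γ (k * s + t₀)
  have h4 : (mfderiv 𝓘(ℝ, ℝ) 𝓘(ℝ, E) (fun s => γ (k * s + t₀)) s : ℝ →L[ℝ] E) =
      B.comp (ContinuousLinearMap.toSpanSingleton ℝ k) := h3
  have h5 : (mfderiv 𝓘(ℝ, ℝ) 𝓘(ℝ, E) (fun s => γ (k * s + t₀)) s : ℝ →L[ℝ] E) (1 : ℝ) =
      k • B 1 := by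
    refine (congrArg (fun T : ℝ →L[ℝ] E => T 1) h4).trans ?_
    change B ((1 : ℝ) • k) = k • B 1
    rw [← map_smul, smul_eq_mul, smul_eq_mul, mul_comm]
  exact congrArg (fun y : E => (⟨γ (k * s + t₀), y⟩ : TangentBundle 𝓘(ℝ, E) M)) h5

variable (hL : IsLorentzFinslerMetric C A L)
include hL

/-- Homogeneity of a metric in a chart: the fibre derivatives have degree one, the base derivatives
degree two. -/
theorem IsLorentzFinslerMetric.fderiv_local_smul {x₀ : M} {w : E × E}
    (hw : w ∈ coordDomain A x₀) {k : ℝ} (hk : 0 < k) :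
    (w.1, k • w.2) ∈ coordDomain A x₀ ∧
    (∀ η, fderiv ℝ (localLagrangian L x₀) (w.1, k • w.2) (0, η) =
      k * fderiv ℝ (localLagrangian L x₀) w (0, η)) ∧
    ∀ ξ, fderiv ℝ (localLagrangian L x₀) (w.1, k • w.2) (ξ, 0) =
      k ^ 2 * fderiv ℝ (localLagrangian L x₀) w (ξ, 0) := by
  have hmem : ∀ w ∈ coordDomain A x₀, (w.1, k • w.2) ∈ coordDomain A x₀ ∧
      localLagrangian L x₀ (w.1, k • w.2) = k ^ 2 * localLagrangian L x₀ w := by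
    intro w hw
    obtain ⟨v, hv, hp, rfl, hLv⟩ := exists_of_mem_coordDomain hL hw
    have h1 : ((tChart x₀ v).1, k • (tChart x₀ v).2) = tChart x₀ (scale k v) := by
      refine Prod.ext rfl ?_
      change k • toCoord x₀ v.proj (vec v) = toCoord x₀ v.proj (k • vec v)
      rw [map_smul]
    have h2 : scale k v ∈ A := hL.conic v.proj (vec v) k hk hv
    rw [h1]
    refine ⟨mem_coordDomain (v := scale k v) hp h2, ?_⟩
    have h3 : L (scale k v) = k ^ 2 * L v := hL.homogeneous v.proj (vec v) k hk hv
    rw [hLv]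
    exact (localLagrangian_apply L hp (k • vec v)).trans h3
  have hU := isOpen_coordDomain hL.isOpen x₀
  obtain ⟨hkw, -⟩ := hmem w hw
  have hd : ∀ w ∈ coordDomain A x₀, HasFDerivAt (localLagrangian L x₀)
      (fderiv ℝ (localLagrangian L x₀) w) w := fun w hw =>
    (((hL.contDiffOn_local x₀).contDiffAt (hU.mem_nhds hw)).differentiableAt (by simp)).hasFDerivAt
  let m : E × E →L[ℝ] E × E :=
    (ContinuousLinearMap.fst ℝ E E).prod (k • ContinuousLinearMap.snd ℝ E E)
  have h1 : HasFDerivAt (fun w => localLagrangian L x₀ (m w))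
      ((fderiv ℝ (localLagrangian L x₀) (w.1, k • w.2)).comp m) w :=
    HasFDerivAt.comp (g := localLagrangian L x₀) (f := m) w (hd _ hkw) m.hasFDerivAt
  have h2 := h1.unique (((hd w hw).const_mul (k ^ 2)).congr_of_eventuallyEq (by
    filter_upwards [hU.mem_nhds hw] with w' hw'
    exact (hmem w' hw').2))
  refine ⟨hkw, fun η => ?_, fun ξ => ?_⟩
  · have h3 := congrArg (fun T : E × E →L[ℝ] ℝ => T (0, η)) h2
    have h4 : m (0, η) = k • (0, η) := Prod.ext (smul_zero k).symm rfl
    simp only [ContinuousLinearMap.comp_apply, h4, map_smul, _root_.smul_apply, smul_eq_mul] at h3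
    have h5 : k * (fderiv ℝ (localLagrangian L x₀) (w.1, k • w.2) (0, η) -
      k * fderiv ℝ (localLagrangian L x₀) w (0, η)) = 0 := by linear_combination h3
    exact sub_eq_zero.1 ((mul_eq_zero.1 h5).resolve_left hk.ne')
  · have h3 := congrArg (fun T : E × E →L[ℝ] ℝ => T (ξ, 0)) h2
    have h4 : m (ξ, 0) = (ξ, 0) := Prod.ext rfl (smul_zero k)
    simpa only [ContinuousLinearMap.comp_apply, h4, _root_.smul_apply, smul_eq_mul] using h3

theorem IsNullGeodesic.localVelocity_mem {γ : ℝ → M} {a b t : ℝ} (hγ : IsNullGeodesic C L γ a b)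
    (ht : t ∈ Ioo a b) {x₀ : M} (hp : γ t ∈ (chartAt E x₀).source) :
    localVelocity γ x₀ t ∈ coordDomain A x₀ :=
  mem_coordDomain (v := velocity 𝓘(ℝ, E) γ t) hp (hL.mem_of_boundary (hγ.null t ht)).1

/-- An affine change of parameter maps null geodesics to null geodesics, as both sides of the Euler-
Lagrange equation are homogeneous of degree two. -/
theorem IsNullGeodesic.rescale (hC : IsStronglyConvexConeStructure C) {γ : ℝ → M} {a b : ℝ}
    (hγ : IsNullGeodesic C L γ a b) {k : ℝ} (hk : 0 < k) (t₀ : ℝ) :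
    IsNullGeodesic C L (fun s => γ (k * s + t₀)) ((a - t₀) / k) ((b - t₀) / k) ∧
    ∀ s ∈ Ioo ((a - t₀) / k) ((b - t₀) / k), k * s + t₀ ∈ Ioo a b ∧
      velocity 𝓘(ℝ, E) (fun s => γ (k * s + t₀)) s =
        scale k (velocity 𝓘(ℝ, E) γ (k * s + t₀)) := by
  have hmem : ∀ s ∈ Ioo ((a - t₀) / k) ((b - t₀) / k), k * s + t₀ ∈ Ioo a b := by
    rintro s ⟨h1, h2⟩
    rw [div_lt_iff₀' hk] at h1
    rw [lt_div_iff₀' hk] at h2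
    exact ⟨by linarith, by linarith⟩
  have hvel : ∀ s ∈ Ioo ((a - t₀) / k) ((b - t₀) / k),
      velocity 𝓘(ℝ, E) (fun s => γ (k * s + t₀)) s =
        scale k (velocity 𝓘(ℝ, E) γ (k * s + t₀)) := fun s hs =>
    velocity_comp_affine (hγ.mdifferentiableAt (hmem s hs))
  refine ⟨⟨?_, fun s hs => ?_, fun s hs x₀ hp => ?_⟩, fun s hs => ⟨hmem s hs, hvel s hs⟩⟩
  · refine hγ.smooth.comp (contMDiffOn_iff_contDiffOn.2 (ContDiff.contDiffOn ?_)) hmem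
    exact (contDiff_const.mul contDiff_id).add contDiff_const
  · rw [hvel s hs]
    exact scale_mem_boundary hC (hγ.null _ (hmem s hs)) hk
  · have hlv : ∀ s ∈ Ioo ((a - t₀) / k) ((b - t₀) / k),
        localVelocity (E := E) (fun s => γ (k * s + t₀)) x₀ s =
          ((localVelocity γ x₀ (k * s + t₀)).1, k • (localVelocity γ x₀ (k * s + t₀)).2) := by
      intro s hs
      rw [localVelocity, hvel s hs]
      refine Prod.ext rfl ?_
      change toCoord x₀ (γ (k * s + t₀)) (k • vec (velocity 𝓘(ℝ, E) γ (k * s + t₀))) = _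
      rw [map_smul]
      rfl
    have h1 : HasDerivAt (fun s : ℝ => k * s + t₀) k s := by
      simpa using ((hasDerivAt_id' s).const_mul k).add_const t₀
    have h2 := (HasDerivAt.scomp (𝕜' := ℝ) s (hγ.eulerLagrange _ (hmem s hs) x₀ hp) h1).const_smul k
    have hc : ContinuousAt (fun s => γ (k * s + t₀)) s :=
      ContinuousAt.comp (g := γ) (f := fun s : ℝ => k * s + t₀)
        (hγ.mdifferentiableAt (hmem s hs)).continuousAt h1.continuousAt
    have h3 := h2.congr_of_eventuallyEq (f₁ := fun s =>
      (fderiv ℝ (localLagrangian L x₀) (localVelocity (fun s => γ (k * s + t₀)) x₀ s)).comp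
        (ContinuousLinearMap.inr ℝ E E)) (by
      filter_upwards [Ioo_mem_nhds hs.1 hs.2,
        hc.eventually ((chartAt E x₀).open_source.mem_nhds hp)] with s' hs' hp'
      ext η
      rw [hlv s' hs']
      exact (hL.fderiv_local_smul (hγ.localVelocity_mem hL (hmem s' hs') hp') hk).2.1 η)
    refine h3.congr_deriv ?_
    ext ξ
    rw [hlv s hs]
    refine Eq.trans ?_
      ((hL.fderiv_local_smul (hγ.localVelocity_mem hL (hmem s hs) hp) hk).2.2 ξ).symm
    change k * (k * _) = k ^ 2 * _
    rw [sq, mul_assoc]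
    rfl

variable [FiniteDimensional ℝ E] (hC : IsStronglyConvexConeStructure C)
  (hs : ∀ v ∈ A, v ∈ C ↔ L v ≤ 0)
include hC hs

/-- The Hamiltonian vector field in a chart has an integral curve through the covector of `v`. -/
theorem exists_nullGeodesic {v : TangentBundle 𝓘(ℝ, E) M} (hv : v ∈ boundary C) :
    ∃ (γ : ℝ → M) (ε : ℝ), 0 < ε ∧ IsNullGeodesic C L γ (-ε) ε ∧ velocity 𝓘(ℝ, E) γ 0 = v := by
  have hp : v.proj ∈ (chartAt E v.proj).source := mem_chart_source E v.proj
  obtain ⟨hvA, hv0⟩ := hL.mem_of_boundary hv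
  obtain ⟨g, O, hO, hzO, hg, hgO, hinv, -⟩ := exists_hamiltonian_chart hL hC hs hv hp
  have hX := contDiffOn_hamField (isOpen_coordDomain hL.isOpen v.proj)
    (hL.contDiffOn_local v.proj) hO hg hgO
  obtain ⟨δ, ε, hε, hδ0, hδ⟩ := exists_integral_curve hO hX hzO
  have h0 : (0 : ℝ) ∈ Ioo (-ε) ε := ⟨by linarith, hε⟩
  have hg0 : g (δ 0) = tChart v.proj v := by
    rw [hδ0, cChart_coLegendre hL hp hvA]; exact hinv.self_of_nhds.1
  have hsymm : (tChart v.proj).symm (tChart v.proj v) = v :=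
    (tChart v.proj).left_inv (mem_tChart_source.2 hp)
  obtain ⟨h1, h2⟩ := isNullGeodesic_of_integral_curve hL hO hg hgO
    (contDiffOn_integral_curve hO hX hδ) hδ h0 (by rw [hg0, localLagrangian, hsymm, hv0])
  refine ⟨_, ε, hε, h1, ?_⟩
  rw [← tChart_symm_localVelocity (h2 0 h0).1, (h2 0 h0).2, hg0, hsymm]

/-- The lifts of both curves to the cotangent bundle are integral curves of the Hamiltonian vector
field. -/
theorem nullGeodesic_unique_local {γ₁ γ₂ : ℝ → M} {a₁ b₁ a₂ b₂ t : ℝ}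
    (h₁ : IsNullGeodesic C L γ₁ a₁ b₁) (h₂ : IsNullGeodesic C L γ₂ a₂ b₂) (ht₁ : t ∈ Ioo a₁ b₁)
    (ht₂ : t ∈ Ioo a₂ b₂) (hv : velocity 𝓘(ℝ, E) γ₁ t = velocity 𝓘(ℝ, E) γ₂ t) :
    ∀ᶠ s in 𝓝 t, velocity 𝓘(ℝ, E) γ₁ s = velocity 𝓘(ℝ, E) γ₂ s := by
  set v := velocity 𝓘(ℝ, E) γ₁ t with hvdef
  set x₀ := v.proj with hx₀
  have hp : v.proj ∈ (chartAt E x₀).source := mem_chart_source E v.proj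
  have hp₁ : γ₁ t ∈ (chartAt E x₀).source := hp
  have hp₂ : γ₂ t ∈ (chartAt E x₀).source := by
    have : γ₂ t = v.proj := by rw [hv]; rfl
    rw [this]; exact hp
  have hvb : v ∈ boundary C := h₁.null t ht₁
  obtain ⟨g, O, hO, hzO, hg, hgO, hinv, -⟩ := exists_hamiltonian_chart hL hC hs hvb hp
  have hX := contDiffOn_hamField (isOpen_coordDomain hL.isOpen x₀) (hL.contDiffOn_local x₀)
    hO hg hgO
  set l := localLagrangian L x₀
  have key : ∀ {γ : ℝ → M} {a b : ℝ}, IsNullGeodesic C L γ a b → t ∈ Ioo a b →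
      velocity 𝓘(ℝ, E) γ t = v → γ t ∈ (chartAt E x₀).source →
      ∀ᶠ s in 𝓝 t, HasDerivAt (fun s => legendreMap l (localVelocity γ x₀ s))
        ((1 : ℝ) • hamField l g (legendreMap l (localVelocity γ x₀ s))) s ∧
        g (legendreMap l (localVelocity γ x₀ s)) = localVelocity γ x₀ s ∧
        γ s ∈ (chartAt E x₀).source := by
    intro γ a b hγ ht hγv hγp
    have hc := continuousAt_localVelocity hγ.smooth ht hγp
    have hv0 : localVelocity γ x₀ t = tChart x₀ v := by rw [localVelocity, hγv]
    rw [ContinuousAt, hv0] at hc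
    filter_upwards [hc.eventually hinv, Ioo_mem_nhds ht.1 ht.2,
      (hγ.mdifferentiableAt ht).continuousAt.eventually
        ((chartAt E x₀).open_source.mem_nhds hγp)] with s hs1 hs2 hs3
    refine ⟨?_, hs1.1, hs3⟩
    rw [one_smul, hamField, hs1.1]
    exact hγ.hasDerivAt_lift hs2 hs3
  have k₁ := key h₁ ht₁ rfl hp₁
  have k₂ := key h₂ ht₂ hv.symm hp₂
  have h0 : legendreMap l (localVelocity γ₁ x₀ t) = legendreMap l (localVelocity γ₂ x₀ t) := by
    have : localVelocity (E := E) γ₁ x₀ t = localVelocity γ₂ x₀ t := by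
      rw [localVelocity, localVelocity, ← hv]
    rw [this]
  have huniq := integral_curve_unique hO hX (k := fun _ => 1) continuousAt_const
    (k₁.mono fun s hs => hs.1) (k₂.mono fun s hs => hs.1) h0 (by
      have h3 : localVelocity (E := E) γ₁ x₀ t = tChart x₀ v := rfl
      rw [h3]
      exact hinv.self_of_nhds.2)
  filter_upwards [huniq, k₁, k₂] with s h3 h4 h5
  have h6 : localVelocity (E := E) γ₁ x₀ s = localVelocity γ₂ x₀ s := by rw [← h4.2.1, h3, h5.2.1]
  rw [← tChart_symm_localVelocity h4.2.2, h6, tChart_symm_localVelocity h5.2.2]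

/-- Null geodesics that agree to first order at one parameter agree wherever both are defined: the
set of such parameters is open and closed. -/
theorem nullGeodesic_unique [T2Space M] {γ₁ γ₂ : ℝ → M} {a₁ b₁ a₂ b₂ t₀ : ℝ}
    (h₁ : IsNullGeodesic C L γ₁ a₁ b₁) (h₂ : IsNullGeodesic C L γ₂ a₂ b₂) (ht₁ : t₀ ∈ Ioo a₁ b₁)
    (ht₂ : t₀ ∈ Ioo a₂ b₂) (hv : velocity 𝓘(ℝ, E) γ₁ t₀ = velocity 𝓘(ℝ, E) γ₂ t₀) :
    ∀ t ∈ Ioo a₁ b₁ ∩ Ioo a₂ b₂, velocity 𝓘(ℝ, E) γ₁ t = velocity 𝓘(ℝ, E) γ₂ t := by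
  set I := Ioo a₁ b₁ ∩ Ioo a₂ b₂ with hI
  set S := {t | t ∈ I ∧ velocity 𝓘(ℝ, E) γ₁ t = velocity 𝓘(ℝ, E) γ₂ t} with hS
  have hIo : IsOpen I := isOpen_Ioo.inter isOpen_Ioo
  have hIc : IsPreconnected I := by
    rw [hI, Ioo_inter_Ioo]; exact isPreconnected_Ioo
  have hSo : IsOpen S := by
    rw [isOpen_iff_mem_nhds]
    rintro t ⟨ht, hvt⟩
    exact Filter.inter_mem (hIo.mem_nhds ht)
      (nullGeodesic_unique_local hL hC hs h₁ h₂ ht.1 ht.2 hvt)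
  have hsub : I ⊆ S := by
    refine hIc.subset_of_closure_inter_subset hSo ⟨t₀, ⟨ht₁, ht₂⟩, ⟨ht₁, ht₂⟩, hv⟩ ?_
    rintro t ⟨htc, htI⟩
    refine ⟨htI, ?_⟩
    have hfr : ∃ᶠ s in 𝓝 t, velocity 𝓘(ℝ, E) γ₁ s = velocity 𝓘(ℝ, E) γ₂ s :=
      (mem_closure_iff_frequently.1 htc).mono fun s hs => hs.2
    have hpt : γ₁ t = γ₂ t := tendsto_nhds_unique_of_frequently_eq
      (h₁.mdifferentiableAt htI.1).continuousAt (h₂.mdifferentiableAt htI.2).continuousAt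
      (hfr.mono fun s hs => congrArg TotalSpace.proj hs)
    have hp₁ : γ₁ t ∈ (chartAt E (γ₁ t)).source := mem_chart_source E _
    have hp₂ : γ₂ t ∈ (chartAt E (γ₁ t)).source := by rw [← hpt]; exact hp₁
    have hlv : localVelocity γ₁ (γ₁ t) t = localVelocity γ₂ (γ₁ t) t :=
      tendsto_nhds_unique_of_frequently_eq (continuousAt_localVelocity h₁.smooth htI.1 hp₁)
        (continuousAt_localVelocity h₂.smooth htI.2 hp₂)
        (hfr.mono fun s hs => by rw [localVelocity, hs, localVelocity])
    rw [← tChart_symm_localVelocity hp₁, hlv, tChart_symm_localVelocity hp₂]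
  exact fun t ht => (hsub ht).2

open Classical in
/-- Two null geodesics that agree to first order at one parameter have a common extension. -/
theorem nullGeodesic_glue [T2Space M] {γ₁ γ₂ : ℝ → M} {a₁ b₁ a₂ b₂ t₀ : ℝ}
    (h₁ : IsNullGeodesic C L γ₁ a₁ b₁) (h₂ : IsNullGeodesic C L γ₂ a₂ b₂) (ht₁ : t₀ ∈ Ioo a₁ b₁)
    (ht₂ : t₀ ∈ Ioo a₂ b₂) (hv : velocity 𝓘(ℝ, E) γ₁ t₀ = velocity 𝓘(ℝ, E) γ₂ t₀) :
    ∃ γ : ℝ → M, IsNullGeodesic C L γ (min a₁ a₂) (max b₁ b₂) ∧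
      (∀ t ∈ Ioo a₁ b₁, velocity 𝓘(ℝ, E) γ t = velocity 𝓘(ℝ, E) γ₁ t) ∧
      ∀ t ∈ Ioo a₂ b₂, velocity 𝓘(ℝ, E) γ t = velocity 𝓘(ℝ, E) γ₂ t := by
  have huniq := nullGeodesic_unique hL hC hs h₁ h₂ ht₁ ht₂ hv
  set γ : ℝ → M := fun t => if t ∈ Ioo a₁ b₁ then γ₁ t else γ₂ t with hγ
  have e₁ : ∀ t ∈ Ioo a₁ b₁, γ =ᶠ[𝓝 t] γ₁ := fun t ht => by
    filter_upwards [Ioo_mem_nhds ht.1 ht.2] with s hs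
    exact if_pos hs
  have e₂ : ∀ t ∈ Ioo a₂ b₂, γ =ᶠ[𝓝 t] γ₂ := fun t ht => by
    filter_upwards [Ioo_mem_nhds ht.1 ht.2] with s hs
    by_cases h : s ∈ Ioo a₁ b₁
    · have : γ s = γ₁ s := if_pos h
      rw [this]
      exact congrArg TotalSpace.proj (huniq s ⟨h, hs⟩)
    · exact if_neg h
  refine ⟨γ, isNullGeodesic_of_eventuallyEq fun t ht => ?_, fun t ht => velocity_congr (e₁ t ht),
    fun t ht => velocity_congr (e₂ t ht)⟩
  by_cases h : t ∈ Ioo a₁ b₁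
  · exact ⟨γ₁, a₁, b₁, h₁, h, e₁ t h⟩
  · have h' : t ∈ Ioo a₂ b₂ := by
      rcases min_lt_iff.1 ht.1 with h3 | h3 <;> rcases lt_max_iff.1 ht.2 with h4 | h4
      · exact absurd ⟨h3, h4⟩ h
      · refine ⟨?_, h4⟩
        have : b₁ ≤ t := not_lt.1 fun h5 => h ⟨h3, h5⟩
        linarith [ht₁.2, ht₂.1]
      · refine ⟨h3, ?_⟩
        have : t ≤ a₁ := not_lt.1 fun h5 => h ⟨h5, h4⟩
        linarith [ht₁.1, ht₂.2]
      · exact ⟨h3, h4⟩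
    exact ⟨γ₂, a₂, b₂, h₂, h', e₂ t h'⟩

end Orbits

section SameOrbit

variable {E : Type*} [NormedAddCommGroup E] [NormedSpace ℝ E] [FiniteDimensional ℝ E]
  {M : Type*} [TopologicalSpace M] [ChartedSpace E M] [IsManifold 𝓘(ℝ, E) ∞ M]
  {C A : Set (TangentBundle 𝓘(ℝ, E) M)} {L : TangentBundle 𝓘(ℝ, E) M → ℝ}

/-- `v` is the initial velocity of a null geodesic of `L`, and `v'` is a positive multiple of
another velocity of it. -/
def SameOrbit (C : Set (TangentBundle 𝓘(ℝ, E) M)) (L : TangentBundle 𝓘(ℝ, E) M → ℝ)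
    (v v' : TangentBundle 𝓘(ℝ, E) M) : Prop :=
  ∃ (γ : ℝ → M) (a b t r : ℝ), (0 : ℝ) ∈ Ioo a b ∧ t ∈ Ioo a b ∧ 0 < r ∧
    IsNullGeodesic C L γ a b ∧ velocity 𝓘(ℝ, E) γ 0 = v ∧ v' = scale r (velocity 𝓘(ℝ, E) γ t)

variable (hL : IsLorentzFinslerMetric C A L) (hC : IsStronglyConvexConeStructure C)
include hL hC

/-- Velocities of one null geodesic, up to positive factors, lie on one orbit. -/
theorem sameOrbit_of_isNullGeodesic {γ : ℝ → M} {a b t t' r r' : ℝ}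
    (hγ : IsNullGeodesic C L γ a b) (ht : t ∈ Ioo a b) (ht' : t' ∈ Ioo a b) (hr : 0 < r)
    (hr' : 0 < r') :
    SameOrbit C L (scale r (velocity 𝓘(ℝ, E) γ t)) (scale r' (velocity 𝓘(ℝ, E) γ t')) := by
  obtain ⟨h1, h2⟩ := hγ.rescale hL hC hr t
  have hmem : ∀ s ∈ Ioo a b, (s - t) / r ∈ Ioo ((a - t) / r) ((b - t) / r) := fun s hs =>
    ⟨by gcongr; exact hs.1, by gcongr; exact hs.2⟩
  have h0 := hmem t ht
  rw [sub_self, zero_div] at h0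
  have e1 := (h2 0 h0).2
  have e2 := (h2 _ (hmem t' ht')).2
  rw [mul_zero, zero_add] at e1
  rw [mul_div_cancel₀ _ hr.ne', sub_add_cancel] at e2
  refine ⟨_, _, _, (t' - t) / r, r' / r, h0, hmem t' ht', div_pos hr' hr, h1, e1, ?_⟩
  rw [e2, scale_scale, div_mul_cancel₀ _ hr.ne']

theorem SameOrbit.symm {v v' : TangentBundle 𝓘(ℝ, E) M} (h : SameOrbit C L v v') :
    SameOrbit C L v' v := by
  obtain ⟨γ, a, b, t, r, h0, ht, hr, hγ, rfl, rfl⟩ := h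
  have := sameOrbit_of_isNullGeodesic hL hC hγ ht h0 hr one_pos
  rwa [scale_one] at this

variable (hs : ∀ v ∈ A, v ∈ C ↔ L v ≤ 0)
include hs

theorem sameOrbit_scale {v : TangentBundle 𝓘(ℝ, E) M} (hv : v ∈ boundary C) {r : ℝ} (hr : 0 < r) :
    SameOrbit C L v (scale r v) := by
  obtain ⟨γ, ε, hε, hγ, rfl⟩ := exists_nullGeodesic hL hC hs hv
  exact ⟨γ, -ε, ε, 0, r, ⟨by linarith, hε⟩, ⟨by linarith, hε⟩, hr, hγ, rfl, rfl⟩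

theorem SameOrbit.refl {v : TangentBundle 𝓘(ℝ, E) M} (hv : v ∈ boundary C) :
    SameOrbit C L v v := by
  have := sameOrbit_scale hL hC hs hv one_pos
  rwa [scale_one] at this

theorem SameOrbit.trans [T2Space M] {v₁ v₂ v₃ : TangentBundle 𝓘(ℝ, E) M}
    (h : SameOrbit C L v₁ v₂) (h' : SameOrbit C L v₂ v₃) : SameOrbit C L v₁ v₃ := by
  obtain ⟨γ, a, b, t, r, h0, ht, hr, hγ, rfl, rfl⟩ := h
  obtain ⟨γ', a', b', t', r', h0', ht', hr', hγ', hv, rfl⟩ := h'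
  -- reparametrise the second geodesic such that it continues the first one
  obtain ⟨h1, h2⟩ := hγ'.rescale hL hC (inv_pos.2 hr) (-(r⁻¹ * t))
  have hmem : ∀ s ∈ Ioo a' b',
      r * s + t ∈ Ioo ((a' - -(r⁻¹ * t)) / r⁻¹) ((b' - -(r⁻¹ * t)) / r⁻¹) := by
    intro s hs
    have e : ∀ x : ℝ, (x - -(r⁻¹ * t)) / r⁻¹ = r * x + t := fun x => by field_simp; ring
    rw [e, e]
    constructor
    · gcongr; exact hs.1
    · gcongr; exact hs.2
  have e : ∀ s, r⁻¹ * (r * s + t) + -(r⁻¹ * t) = s := fun s => by field_simp; ring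
  have m0 := hmem 0 h0'
  have e0 := (h2 _ m0).2
  have m1 := hmem t' ht'
  have e1 := (h2 _ m1).2
  rw [e] at e0 e1
  rw [mul_zero, zero_add] at m0 e0
  rw [hv, scale_scale, inv_mul_cancel₀ hr.ne', scale_one] at e0
  obtain ⟨δ, hδ, hδ1, hδ2⟩ := nullGeodesic_glue hL hC hs hγ h1 ht m0 e0.symm
  refine ⟨δ, _, _, r * t' + t, r' * r, ⟨(min_le_left _ _).trans_lt h0.1,
    h0.2.trans_le (le_max_left _ _)⟩, ⟨(min_le_right _ _).trans_lt m1.1,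
    m1.2.trans_le (le_max_right _ _)⟩, mul_pos hr' hr, hδ, hδ1 0 h0, ?_⟩
  rw [hδ2 _ m1, e1, scale_scale, mul_assoc, mul_inv_cancel₀ hr.ne', mul_one]

theorem SameOrbit.mem_boundary {v v' : TangentBundle 𝓘(ℝ, E) M} (h : SameOrbit C L v v') :
    v ∈ boundary C ∧ v' ∈ boundary C := by
  obtain ⟨γ, a, b, t, r, h0, ht, hr, hγ, rfl, rfl⟩ := h
  exact ⟨hγ.null 0 h0, scale_mem_boundary hC (hγ.null t ht) hr⟩

end SameOrbit

/-! ### Independence of the choice of the metric -/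

section MetricChange

/-- A function that is continuous near `t₀` has an antiderivative near `t₀`. -/
theorem exists_antiderivative {κ : ℝ → ℝ} {t₀ : ℝ} (h : ∀ᶠ t in 𝓝 t₀, ContinuousAt κ t) :
    ∃ τ : ℝ → ℝ, τ t₀ = 0 ∧ ∀ᶠ t in 𝓝 t₀, HasDerivAt τ (κ t) t := by
  obtain ⟨ε, hε, hball⟩ := Metric.eventually_nhds_iff_ball.1 h
  rw [Real.ball_eq_Ioo] at hball
  have hle : t₀ - ε / 2 ≤ t₀ + ε / 2 := by linarith
  have hc : ContinuousOn κ (Icc (t₀ - ε / 2) (t₀ + ε / 2)) := fun t ht =>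
    (hball t ⟨by linarith [ht.1], by linarith [ht.2]⟩).continuousWithinAt
  have hc' : Continuous (IccExtend hle ((Icc (t₀ - ε / 2) (t₀ + ε / 2)).domRestrict κ)) :=
    (continuousOn_iff_continuous_domRestrict.1 hc).Icc_extend'
  refine ⟨fun t => ∫ s in t₀..t, IccExtend hle ((Icc (t₀ - ε / 2) (t₀ + ε / 2)).domRestrict κ) s,
    intervalIntegral.integral_same, ?_⟩
  filter_upwards [Icc_mem_nhds (by linarith : t₀ - ε / 2 < t₀) (by linarith : t₀ < t₀ + ε / 2)]
    with t ht
  have h1 := (hc'.integral_hasStrictDerivAt t₀ t).hasDerivAt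
  rwa [IccExtend_of_mem _ _ ht] at h1

variable {E : Type*} [NormedAddCommGroup E] [NormedSpace ℝ E] [FiniteDimensional ℝ E]
  {M : Type*} [TopologicalSpace M] [ChartedSpace E M] [IsManifold 𝓘(ℝ, E) ∞ M]
  {C A A₁ : Set (TangentBundle 𝓘(ℝ, E) M)} {L L₁ : TangentBundle 𝓘(ℝ, E) M → ℝ}

/-- The differentials of two metrics defining the same cone structure are proportional on `∂C`. -/
theorem exists_fderiv_localLagrangian_eq_smul (hL : IsLorentzFinslerMetric C A L)
    (hL₁ : IsLorentzFinslerMetric C A₁ L₁) {v : TangentBundle 𝓘(ℝ, E) M} (hv : v ∈ boundary C)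
    {x₀ : M} (hp : v.proj ∈ (chartAt E x₀).source) :
    ∃ h : ℝ, h ≠ 0 ∧ fderiv ℝ (localLagrangian L₁ x₀) (tChart x₀ v) =
      h • fderiv ℝ (localLagrangian L x₀) (tChart x₀ v) := by
  have hne : ∀ {A : Set (TangentBundle 𝓘(ℝ, E) M)} {L : TangentBundle 𝓘(ℝ, E) M → ℝ},
      IsLorentzFinslerMetric C A L → fderiv ℝ (localLagrangian L x₀) (tChart x₀ v) ≠ 0 := by
    intro A L hL h
    obtain ⟨hvA, -⟩ := hL.mem_of_boundary hv
    refine hL.fderiv_ne_zero hvA hv.2 ?_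
    rw [(hasFDerivAt_fibre hL.isOpen hL.smooth hp (y := vec v) hvA).fderiv]
    change ((fderiv ℝ (localLagrangian L x₀) (tChart x₀ v)).comp _).comp _ = 0
    rw [h]
    rfl
  have hstrict : ∀ {A : Set (TangentBundle 𝓘(ℝ, E) M)} {L : TangentBundle 𝓘(ℝ, E) M → ℝ},
      IsLorentzFinslerMetric C A L → HasStrictFDerivAt (localLagrangian L x₀)
        (fderiv ℝ (localLagrangian L x₀) (tChart x₀ v)) (tChart x₀ v) := fun hL =>
    ((hL.contDiffOn_local x₀).contDiffAt ((isOpen_coordDomain hL.isOpen x₀).mem_nhds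
      (mem_coordDomain hp (hL.mem_of_boundary hv).1))).hasStrictFDerivAt (by simp)
  have hval : ∀ {A : Set (TangentBundle 𝓘(ℝ, E) M)} {L : TangentBundle 𝓘(ℝ, E) M → ℝ},
      IsLorentzFinslerMetric C A L → localLagrangian L x₀ (tChart x₀ v) = 0 := by
    intro A L hL
    rw [localLagrangian]
    have h1 := (hL.mem_of_boundary hv).2
    have h2 := (tChart x₀).left_inv (mem_tChart_source.2 hp)
    exact (congrArg L h2).trans h1
  -- `L₁` vanishes on the zero set of `L`, so it has a local extremum there, and the differentials
  -- are proportional by Lagrange's multiplier rule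
  have hext : IsLocalExtrOn (localLagrangian L₁ x₀)
      {w | localLagrangian L x₀ w = localLagrangian L x₀ (tChart x₀ v)} (tChart x₀ v) := by
    refine Or.inl ?_
    have hw := (isOpen_coordDomain hL.isOpen x₀).mem_nhds
      (mem_coordDomain hp (hL.mem_of_boundary hv).1)
    filter_upwards [self_mem_nhdsWithin, mem_nhdsWithin_of_mem_nhds hw] with w h1 h2
    have h3 : localLagrangian L x₀ w = 0 := h1.trans (hval hL)
    obtain ⟨v', hv', hp', rfl, hLv'⟩ := exists_of_mem_coordDomain hL h2
    have hb : v' ∈ boundary C := by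
      rw [hL.boundary_eq]; exact ⟨hv', hLv'.symm.trans h3⟩
    obtain ⟨v'', -, hp'', h4, h5⟩ := exists_of_mem_coordDomain hL₁
      (mem_coordDomain hp' (hL₁.mem_of_boundary hb).1)
    have h6 : v'' = v' :=
      (tChart x₀).injOn (mem_tChart_source.2 hp'') (mem_tChart_source.2 hp') h4
    rw [hval hL₁, h5, h6, (hL₁.mem_of_boundary hb).2]
  obtain ⟨a, b, hab, h⟩ := hext.exists_multipliers_of_hasStrictFDerivAt_1d (hstrict hL)
    (hstrict hL₁)
  have hb : b ≠ 0 := by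
    rintro rfl
    rw [zero_smul, add_zero] at h
    rcases smul_eq_zero.1 h with h1 | h1
    · exact hab (by rw [h1]; rfl)
    · exact hne hL h1
  have h1 : fderiv ℝ (localLagrangian L₁ x₀) (tChart x₀ v) =
      (-(b⁻¹ * a)) • fderiv ℝ (localLagrangian L x₀) (tChart x₀ v) := by
    refine ContinuousLinearMap.ext fun ζ => ?_
    have key : ∀ x y : ℝ, a * x + b * y = 0 → y = -(b⁻¹ * a) * x := fun x y hxy => by
      field_simp
      linarith
    exact key _ _ (congrArg (fun T : E × E →L[ℝ] ℝ => T ζ) h)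
  refine ⟨_, fun h0 => hne hL₁ ?_, h1⟩
  rw [h1, h0, zero_smul]

variable (hL : IsLorentzFinslerMetric C A L) (hC : IsStronglyConvexConeStructure C)
  (hs : ∀ v ∈ A, v ∈ C ↔ L v ≤ 0)
include hL hC hs

/-- Up to a change of parameter, null geodesics do not depend on the metric: the differentials of
two metrics are proportional on `∂C`, hence so are their Hamiltonian vector fields. -/
theorem eventually_sameOrbit (hL₁ : IsLorentzFinslerMetric C A₁ L₁) {γ : ℝ → M} {a b t₀ : ℝ}
    (hγ : IsNullGeodesic C L₁ γ a b) (ht₀ : t₀ ∈ Ioo a b) :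
    ∀ᶠ t in 𝓝 t₀, SameOrbit C L (velocity 𝓘(ℝ, E) γ t₀) (velocity 𝓘(ℝ, E) γ t) := by
  set x₀ := γ t₀ with hx₀
  have hp : γ t₀ ∈ (chartAt E x₀).source := mem_chart_source E _
  set l := localLagrangian L x₀ with hl
  set l₁ := localLagrangian L₁ x₀ with hl₁
  set w : ℝ → E × E := localVelocity γ x₀ with hw
  have hU := isOpen_coordDomain hL.isOpen x₀
  have hlU := hL.contDiffOn_local x₀
  have hU₁ := isOpen_coordDomain hL₁.isOpen x₀
  have hlU₁ := hL₁.contDiffOn_local x₀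
  have hnear : ∀ᶠ t in 𝓝 t₀, t ∈ Ioo a b ∧ γ t ∈ (chartAt E x₀).source :=
    Filter.Eventually.and (Ioo_mem_nhds ht₀.1 ht₀.2)
      ((hγ.mdifferentiableAt ht₀).continuousAt.eventually ((chartAt E x₀).open_source.mem_nhds hp))
  have hwU : ∀ t ∈ Ioo a b, γ t ∈ (chartAt E x₀).source → w t ∈ coordDomain A x₀ :=
    fun t ht hpt => mem_coordDomain (v := velocity 𝓘(ℝ, E) γ t) hpt
      (hL.mem_of_boundary (hγ.null t ht)).1
  have hwU₁ : ∀ t ∈ Ioo a b, γ t ∈ (chartAt E x₀).source → w t ∈ coordDomain A₁ x₀ :=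
    fun t ht hpt => mem_coordDomain (v := velocity 𝓘(ℝ, E) γ t) hpt
      (hL₁.mem_of_boundary (hγ.null t ht)).1
  have hwc : ∀ t ∈ Ioo a b, γ t ∈ (chartAt E x₀).source → ContinuousAt w t := fun t ht hpt =>
    continuousAt_localVelocity hγ.smooth ht hpt
  have hmult : ∀ t ∈ Ioo a b, γ t ∈ (chartAt E x₀).source →
      ∃ h : ℝ, h ≠ 0 ∧ fderiv ℝ l₁ (w t) = h • fderiv ℝ l (w t) := fun t ht hpt =>
    exists_fderiv_localLagrangian_eq_smul hL hL₁ (hγ.null t ht) hpt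
  -- a direction in which the fibre derivative of `l` does not vanish
  obtain ⟨e, he⟩ : ∃ e : E, fderiv ℝ l (w t₀) (0, e) ≠ 0 := by
    by_contra! hcon
    have h1 := (hL.mem_of_boundary (hγ.null t₀ ht₀)).1
    refine hL.fderiv_ne_zero h1 (hγ.null t₀ ht₀).2 ?_
    refine (hasFDerivAt_fibre hL.isOpen hL.smooth hp (y := vec (velocity 𝓘(ℝ, E) γ t₀))
      h1).fderiv.trans ?_
    ext η
    exact hcon _
  set D : ℝ → ℝ := fun t => fderiv ℝ l (w t) (0, e) with hD
  set D₁ : ℝ → ℝ := fun t => fderiv ℝ l₁ (w t) (0, e) with hD₁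
  have hDc : ∀ t ∈ Ioo a b, γ t ∈ (chartAt E x₀).source → ContinuousAt D t := fun t ht hpt =>
    (ContinuousAt.comp (g := fderiv ℝ l) ((hlU.contDiffAt
      (hU.mem_nhds (hwU t ht hpt))).continuousAt_fderiv (by simp))
      (hwc t ht hpt)).clm_apply continuousAt_const
  have hDc₁ : ∀ t ∈ Ioo a b, γ t ∈ (chartAt E x₀).source → ContinuousAt D₁ t := fun t ht hpt =>
    (ContinuousAt.comp (g := fderiv ℝ l₁) ((hlU₁.contDiffAt
      (hU₁.mem_nhds (hwU₁ t ht hpt))).continuousAt_fderiv (by simp))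
      (hwc t ht hpt)).clm_apply continuousAt_const
  set h : ℝ → ℝ := fun t => D₁ t / D t with hh
  have hDne : ∀ᶠ t in 𝓝 t₀, D t ≠ 0 := (hDc t₀ ht₀ hp).eventually_ne he
  have hhc : ∀ᶠ t in 𝓝 t₀, ContinuousAt h t := by
    filter_upwards [hnear, hDne] with t ht hDt
    exact (hDc₁ t ht.1 ht.2).div (hDc t ht.1 ht.2) hDt
  have hhmult : ∀ᶠ t in 𝓝 t₀, h t ≠ 0 ∧ fderiv ℝ l₁ (w t) = h t • fderiv ℝ l (w t) := by
    filter_upwards [hnear, hDne] with t ht hDt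
    obtain ⟨c, hc, hc'⟩ := hmult t ht.1 ht.2
    have h1 : h t = c := by
      have h2 : D₁ t = c * D t := congrArg (fun T : E × E →L[ℝ] ℝ => T (0, e)) hc'
      rw [hh]
      exact (div_eq_iff hDt).2 h2
    rw [h1]
    exact ⟨hc, hc'⟩
  have hh0 := hhmult.self_of_nhds.1
  -- the sign of `h` is locally constant
  obtain ⟨σ, hσ⟩ : ∃ σ : ℝ, ∀ᶠ t in 𝓝 t₀, |h t| = σ * h t := by
    rcases lt_or_gt_of_ne hh0 with h1 | h1
    · refine ⟨-1, (hhc.self_of_nhds.eventually (gt_mem_nhds h1)).mono fun t ht => ?_⟩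
      rw [abs_of_neg ht, neg_one_mul]
    · refine ⟨1, (hhc.self_of_nhds.eventually (lt_mem_nhds h1)).mono fun t ht => ?_⟩
      rw [abs_of_pos ht, one_mul]
  set k : ℝ → ℝ := fun t => |h t| with hk
  have hkpos : ∀ᶠ t in 𝓝 t₀, 0 < k t := hhmult.mono fun t ht => abs_pos.2 ht.1
  have hkc : ∀ᶠ t in 𝓝 t₀, ContinuousAt k t := hhc.mono fun t ht => ht.abs
  -- the lift of the geodesic, with the speed for which it is a reparametrised integral curve
  set c : ℝ → E × (E →L[ℝ] ℝ) := fun t =>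
    ((legendreMap l₁ (w t)).1, σ • (legendreMap l₁ (w t)).2) with hc
  have hceq : ∀ᶠ t in 𝓝 t₀, c t = legendreMap l ((w t).1, k t • (w t).2) := by
    filter_upwards [hnear, hhmult, hσ, hkpos] with t ht h1 h2 h3
    refine Prod.ext rfl ?_
    ext η
    change σ * -(fderiv ℝ l₁ (w t) (0, η)) = -(fderiv ℝ l ((w t).1, k t • (w t).2) (0, η))
    rw [(hL.fderiv_local_smul (hwU t ht.1 ht.2) h3).2.1, h1.2]
    change σ * -(h t * (fderiv ℝ l (w t) (0, η))) = -(|h t| * (fderiv ℝ l (w t) (0, η)))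
    rw [h2]; ring
  set v := scale (k t₀) (velocity 𝓘(ℝ, E) γ t₀) with hv
  have hvb : v ∈ boundary C := scale_mem_boundary hC (hγ.null t₀ ht₀) hkpos.self_of_nhds
  have hvt : ∀ r t, tChart x₀ (scale r (velocity 𝓘(ℝ, E) γ t)) = ((w t).1, r • (w t).2) := by
    intro r t
    refine Prod.ext rfl ?_
    change toCoord x₀ (γ t) (r • vec (velocity 𝓘(ℝ, E) γ t)) = _
    rw [map_smul]
    rfl
  obtain ⟨g, O, hO, hzO, hg, hgO, hinv, -⟩ := exists_hamiltonian_chart hL hC hs hvb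
    (x₀ := x₀) hp
  have hX := contDiffOn_hamField hU hlU hO hg hgO
  have hcont : ContinuousAt (fun t => ((w t).1, k t • (w t).2)) t₀ :=
    (hwc t₀ ht₀ hp).fst.prodMk (hkc.self_of_nhds.smul (hwc t₀ ht₀ hp).snd)
  rw [hvt] at hinv
  have hgc : ∀ᶠ t in 𝓝 t₀, g (c t) = ((w t).1, k t • (w t).2) ∧ c t ∈ O := by
    filter_upwards [hcont.eventually hinv, hceq] with t h1 h2
    rw [h2]; exact h1
  have hcder : ∀ᶠ t in 𝓝 t₀, HasDerivAt c ((k t)⁻¹ • hamField l g (c t)) t := by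
    filter_upwards [hnear, hgc, hhmult, hσ, hkpos] with t ht h1 h2 h3 h4
    have h5 := hγ.hasDerivAt_lift ht.1 ht.2
    have h6 : HasDerivAt c ((w t).2, σ • -(fderiv ℝ l₁ (w t)).comp
        (ContinuousLinearMap.inl ℝ E E)) t :=
      h5.fst.prodMk (((ContinuousLinearMap.snd ℝ E (E →L[ℝ] ℝ)).hasFDerivAt.comp_hasDerivAt t
        h5).const_smul σ)
    refine h6.congr_deriv ?_
    refine Prod.ext ?_ ?_
    · change (w t).2 = (k t)⁻¹ • (g (c t)).2
      rw [h1.1, smul_smul, inv_mul_cancel₀ h4.ne', one_smul]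
    · ext ξ
      change σ * -(fderiv ℝ l₁ (w t) (ξ, 0)) = (k t)⁻¹ * -(fderiv ℝ l (g (c t)) (ξ, 0))
      rw [h1.1, (hL.fderiv_local_smul (hwU t ht.1 ht.2) h4).2.2, h2.2]
      change σ * -(h t * (fderiv ℝ l (w t) (ξ, 0))) =
        (k t)⁻¹ * -(k t ^ 2 * (fderiv ℝ l (w t) (ξ, 0)))
      have h7 : k t = σ * h t := h3
      rw [mul_neg, mul_neg, ← mul_assoc, ← h7, ← mul_assoc, sq, ← mul_assoc,
        inv_mul_cancel₀ h4.ne', one_mul]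
  -- compare with an integral curve
  obtain ⟨τ, hτ0, hτ⟩ := exists_antiderivative (κ := fun t => (k t)⁻¹) (t₀ := t₀)
    (hkc.and hkpos |>.mono fun t ht => ht.1.inv₀ ht.2.ne')
  obtain ⟨δ, ε, hε, hδ0, hδ⟩ := exists_integral_curve hO hX hgc.self_of_nhds.2
  have h0 : (0 : ℝ) ∈ Ioo (-ε) ε := ⟨by linarith, hε⟩
  have hτε : ∀ᶠ t in 𝓝 t₀, τ t ∈ Ioo (-ε) ε :=
    hτ.self_of_nhds.continuousAt.eventually (by rw [hτ0]; exact Ioo_mem_nhds h0.1 h0.2)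
  -- `δ ∘ τ` and `c` solve the same initial value problem
  have huniq := integral_curve_unique hO hX (k := fun t => (k t)⁻¹) (f := fun t => δ (τ t)) (g := c)
    (t₀ := t₀) (hkc.self_of_nhds.inv₀ hkpos.self_of_nhds.ne') (by
      filter_upwards [hτ, hτε] with t h1 h2
      exact (hδ _ h2).2.scomp t h1) hcder (by rw [hτ0, hδ0]) (by
      rw [hτ0, hδ0]; exact hgc.self_of_nhds.2)
  have hzero : l (g (δ 0)) = 0 := by
    rw [hδ0, hgc.self_of_nhds.1, ← hvt, hl, localLagrangian]
    have h1 := (hL.mem_of_boundary hvb).2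
    have h2 := (tChart x₀).left_inv ((mem_tChart_source (v := v)).2 hp)
    exact (congrArg L h2).trans h1
  obtain ⟨n1, n2⟩ := isNullGeodesic_of_integral_curve hL hO hg hgO
    (contDiffOn_integral_curve hO hX hδ) hδ h0 hzero
  have hvel : ∀ᶠ t in 𝓝 t₀, velocity 𝓘(ℝ, E)
      (fun t => (extChartAt 𝓘(ℝ, E) x₀).symm (δ t).1) (τ t) =
      scale (k t) (velocity 𝓘(ℝ, E) γ t) := by
    filter_upwards [huniq, hgc, hτε, hnear] with t h1 h2 h3 h4
    rw [← tChart_symm_localVelocity (n2 _ h3).1, (n2 _ h3).2]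
    have h5 : δ (τ t) = c t := h1
    rw [h5, h2.1, ← hvt]
    exact (tChart x₀).left_inv
      ((mem_tChart_source (v := scale (k t) (velocity 𝓘(ℝ, E) γ t))).2 h4.2)
  filter_upwards [hvel, hkpos, hτε] with t h1 h2 h3
  have h4 := sameOrbit_of_isNullGeodesic hL hC n1 h0 h3 (inv_pos.2 hkpos.self_of_nhds)
    (inv_pos.2 h2)
  have h5 := hvel.self_of_nhds
  rw [hτ0] at h5
  rwa [h1, h5, scale_scale, scale_scale, inv_mul_cancel₀ hkpos.self_of_nhds.ne',
    inv_mul_cancel₀ h2.ne', scale_one, scale_one] at h4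

/-- Null geodesics of any metric defining the cone structure lie on one orbit of `L`, as they do
locally. -/
theorem sameOrbit_of_isNullGeodesic' [T2Space M] (hL₁ : IsLorentzFinslerMetric C A₁ L₁)
    {γ : ℝ → M} {a b t t' : ℝ} (hγ : IsNullGeodesic C L₁ γ a b) (ht : t ∈ Ioo a b)
    (ht' : t' ∈ Ioo a b) : SameOrbit C L (velocity 𝓘(ℝ, E) γ t) (velocity 𝓘(ℝ, E) γ t') :=
  isPreconnected_Ioo.induction₂
    (fun t t' => SameOrbit C L (velocity 𝓘(ℝ, E) γ t) (velocity 𝓘(ℝ, E) γ t'))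
    (fun _ hx => mem_nhdsWithin_of_mem_nhds (eventually_sameOrbit hL hC hs hL₁ hγ hx))
    (fun _ _ _ _ _ _ h h' => SameOrbit.trans hL hC hs h h')
    (fun _ _ _ _ h => SameOrbit.symm hL hC h) ht ht'

end MetricChange

/-! ### The classes of covectors on one cone geodesic -/

section Classes

variable {E : Type*} [NormedAddCommGroup E] [NormedSpace ℝ E] [FiniteDimensional ℝ E]
  {M : Type*} [TopologicalSpace M] [ChartedSpace E M] [IsManifold 𝓘(ℝ, E) ∞ M]
  {C A A₁ : Set (TangentBundle 𝓘(ℝ, E) M)} {L L₁ : TangentBundle 𝓘(ℝ, E) M → ℝ}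

variable (hL : IsLorentzFinslerMetric C A L) (hC : IsStronglyConvexConeStructure C)
  (hs : ∀ v ∈ A, v ∈ C ↔ L v ≤ 0)
include hL hC hs

/-- The Legendre transform maps `∂C` onto `∂C*`. -/
theorem exists_eq_coLegendre {u : CotangentBundle E M} (hu : u ∈ dualBoundary C) :
    ∃ v ∈ boundary C, u = coLegendre L v := by
  obtain ⟨hu0, hnn, y, hy, huy⟩ := (mem_dualBoundary_iff hC).1 hu
  obtain ⟨c, hc, h⟩ := exists_coLegendre_eq' hL hC hs hu hy huy
  exact ⟨_, scale_mem_boundary hC (mem_boundary_of_null hC hu0 hnn hy huy) hc, h⟩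

/-- The covectors that another metric assigns to a null vector `v` are Legendre transforms of
multiples of `v`. -/
theorem exists_legendre_eq_coLegendre (hL₁ : IsLorentzFinslerMetric C A₁ L₁) {r : ℝ}
    {v : TangentBundle 𝓘(ℝ, E) M} (hv : v ∈ boundary C)
    (hu : legendre L₁ r v ∈ dualBoundary C) :
    ∃ c : ℝ, 0 < c ∧ legendre L₁ r v = coLegendre L (scale c v) := by
  obtain ⟨hvA, hv0⟩ := hL₁.mem_of_boundary hv
  refine exists_coLegendre_eq' hL hC hs hu (y := vec v) (mem_of_mem_boundary hC hv) ?_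
  rw [hL₁.legendre_eq hvA]
  have h1 := hL₁.fderiv_self hvA
  rw [hv0, mul_zero] at h1
  change r * fderiv ℝ (onFibre L₁ v.proj) (vec v) (vec v) = 0
  rw [h1, mul_zero]

theorem geodesicProj_eq_of_sameOrbit {v v' : TangentBundle 𝓘(ℝ, E) M} (h : SameOrbit C L v v')
    {u u' : dualBoundary C} (hu : (u : CotangentBundle E M) = coLegendre L v)
    (hu' : (u' : CotangentBundle E M) = coLegendre L v') :
    geodesicProj C u = geodesicProj C u' := by
  obtain ⟨γ, a, b, t, r, h0, ht, hr, hγ, rfl, rfl⟩ := h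
  have h1 := (hL.mem_of_boundary (hγ.null 0 h0)).1
  have h2 := (hL.mem_of_boundary (hγ.null t ht)).1
  refine Quot.sound ⟨A, L, γ, a, b, hL, hγ, 0, h0, t, ht, -1, -r, ?_, ?_⟩
  · rw [hu, hL.coLegendre_eq h1]
  · rw [hu', hL.coLegendre_scale h2 hr, hL.legendre_eq h2]
    congr 1
    rw [neg_smul, ← smul_neg]
    rfl

/-- If two covectors in `∂C*` project to the same point of the space of cone geodesics, then the
corresponding null vectors lie on one orbit: the generating relation implies this for every metric,
and lying on one orbit is an equivalence relation. -/
theorem sameOrbit_of_geodesicProj_eq [T2Space M] {u u' : dualBoundary C}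
    (h : geodesicProj C u = geodesicProj C u') {v v' : TangentBundle 𝓘(ℝ, E) M}
    (hv : v ∈ boundary C) (hv' : v' ∈ boundary C) (hu : (u : CotangentBundle E M) = coLegendre L v)
    (hu' : (u' : CotangentBundle E M) = coLegendre L v') : SameOrbit C L v v' := by
  have key : ∀ u u' : dualBoundary C, Relation.EqvGen (SameConeGeodesic C) u u' →
      ∀ v ∈ boundary C, ∀ v' ∈ boundary C, (u : CotangentBundle E M) = coLegendre L v →
      (u' : CotangentBundle E M) = coLegendre L v' → SameOrbit C L v v' := by
    intro u u' h
    induction h with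
    | rel u u' h =>
      intro v hv v' hv' hu hu'
      obtain ⟨A₁, L₁, γ, a, b, hL₁, hγ, s, hsab, s', hs', r, r', h1, h2⟩ := h
      have hb := hγ.null s hsab
      have hb' := hγ.null s' hs'
      obtain ⟨c, hc, e⟩ := exists_legendre_eq_coLegendre hL hC hs hL₁ hb (h1 ▸ u.2)
      obtain ⟨c', hc', e'⟩ := exists_legendre_eq_coLegendre hL hC hs hL₁ hb' (h2 ▸ u'.2)
      have hv1 : v = scale c (velocity 𝓘(ℝ, E) γ s) := coLegendre_injective hL hC hs hv
        (scale_mem_boundary hC hb hc) (by rw [← hu, h1, e])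
      have hv2 : v' = scale c' (velocity 𝓘(ℝ, E) γ s') := coLegendre_injective hL hC hs hv'
        (scale_mem_boundary hC hb' hc') (by rw [← hu', h2, e'])
      rw [hv1, hv2]
      refine SameOrbit.trans hL hC hs (SameOrbit.symm hL hC (sameOrbit_scale hL hC hs hb hc))
        (SameOrbit.trans hL hC hs (sameOrbit_of_isNullGeodesic' hL hC hs hL₁ hγ hsab hs')
          (sameOrbit_scale hL hC hs hb' hc'))
    | refl u =>
      intro v hv v' hv' hu hu'
      rw [coLegendre_injective hL hC hs hv hv' (by rw [← hu, hu'])]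
      exact SameOrbit.refl hL hC hs hv'
    | symm u u' _ ih => exact fun v hv v' hv' hu hu' => SameOrbit.symm hL hC (ih v' hv' v hv hu' hu)
    | trans u₁ u₂ u₃ _ _ ih ih' =>
      intro v hv v' hv' hu hu'
      obtain ⟨w, hw, hw'⟩ := exists_eq_coLegendre hL hC hs u₂.2
      exact SameOrbit.trans hL hC hs (ih v hv w hw hu hw') (ih' w hw v' hv' hw' hu')
  exact key u u' (Quot.eqvGen_exact h) v hv v' hv' hu hu'

open Classical in
/-- The maximal null geodesic with a given initial velocity, as a curve in `∂C`. -/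
theorem exists_maximal_orbit [T2Space M] {v : TangentBundle 𝓘(ℝ, E) M} :
    ∃ (J : Set ℝ) (Φ : ℝ → TangentBundle 𝓘(ℝ, E) M),
      (∀ t ∈ J, ∃ (γ : ℝ → M) (a b : ℝ), IsNullGeodesic C L γ a b ∧ t ∈ Ioo a b ∧
        ∀ᶠ s in 𝓝 t, Φ s = velocity 𝓘(ℝ, E) γ s) ∧
      ∀ v', SameOrbit C L v v' → ∃ t ∈ J, ∃ r : ℝ, 0 < r ∧ v' = scale r (Φ t) := by
  set G : ℝ → (ℝ → M) × ℝ × ℝ → Prop := fun t q => IsNullGeodesic C L q.1 q.2.1 q.2.2 ∧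
    (0 : ℝ) ∈ Ioo q.2.1 q.2.2 ∧ t ∈ Ioo q.2.1 q.2.2 ∧ velocity 𝓘(ℝ, E) q.1 0 = v with hG
  set Φ : ℝ → TangentBundle 𝓘(ℝ, E) M := fun t =>
    if h : ∃ q, G t q then velocity 𝓘(ℝ, E) h.choose.1 t else v with hΦ
  have hval : ∀ t q, G t q → Φ t = velocity 𝓘(ℝ, E) q.1 t := by
    intro t q hq
    have h : ∃ q, G t q := ⟨q, hq⟩
    have h1 : Φ t = velocity 𝓘(ℝ, E) h.choose.1 t := dif_pos h
    obtain ⟨g1, g2, g3, g4⟩ := h.choose_spec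
    obtain ⟨k1, k2, k3, k4⟩ := hq
    rw [h1]
    exact nullGeodesic_unique hL hC hs g1 k1 g2 k2 (g4.trans k4.symm) t ⟨g3, k3⟩
  refine ⟨{t | ∃ q, G t q}, Φ, ?_, ?_⟩
  · rintro t ⟨q, hq⟩
    refine ⟨q.1, q.2.1, q.2.2, hq.1, hq.2.2.1, ?_⟩
    filter_upwards [Ioo_mem_nhds hq.2.2.1.1 hq.2.2.1.2] with s hs'
    exact hval s q ⟨hq.1, hq.2.1, hs', hq.2.2.2⟩
  · rintro v' ⟨γ, a, b, t, r, h0, ht, hr, hγ, hv, rfl⟩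
    have hq : G t (γ, a, b) := ⟨hγ, h0, ht, hv⟩
    exact ⟨t, ⟨_, hq⟩, r, hr, by rw [hval t _ hq]⟩

omit [FiniteDimensional ℝ E] hC hs in
theorem contDiffAt_legendreMap_localVelocity {γ : ℝ → M} {a b t : ℝ}
    (hγ : IsNullGeodesic C L γ a b) (ht : t ∈ Ioo a b) {x₀ : M}
    (hp : γ t ∈ (chartAt E x₀).source) :
    ContDiffAt ℝ ∞ (fun s => legendreMap (localLagrangian L x₀) (localVelocity γ x₀ s)) t := by
  have h1 : ContMDiffAt 𝓘(ℝ, ℝ) 𝓘(ℝ, E) ∞ γ t := hγ.smooth.contMDiffAt (Ioo_mem_nhds ht.1 ht.2)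
  have h2 : ContDiffAt ℝ ∞ (fun s => extChartAt 𝓘(ℝ, E) x₀ (γ s)) t :=
    contMDiffAt_iff_contDiffAt.1 ((contMDiffAt_extChartAt' hp).comp t h1)
  have h3 : ContDiffAt ℝ ∞ (deriv fun s => extChartAt 𝓘(ℝ, E) x₀ (γ s)) t :=
    (h2.fderiv_right (m := ∞) (by simp)).clm_apply contDiffAt_const
  have h4 : ContDiffAt ℝ ∞ (localVelocity (E := E) γ x₀) t := by
    refine (h2.prodMk h3).congr_of_eventuallyEq ?_
    filter_upwards [Ioo_mem_nhds ht.1 ht.2,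
      h1.continuousAt.eventually ((chartAt E x₀).open_source.mem_nhds hp)] with s hs hsp
    exact localVelocity_eq (hγ.mdifferentiableAt hs) hsp
  have hU := isOpen_coordDomain hL.isOpen x₀
  exact ((contDiffOn_legendreMap hU (hL.contDiffOn_local x₀)).contDiffAt
    (hU.mem_nhds (hγ.localVelocity_mem hL ht hp))).comp t h4

/-- The fibres of the projection to the space of cone geodesics have dimension at most two. -/
theorem dimH_geodesicProj_fibre_le [T2Space M] (x₀ : M) (n : GeodesicSpace C) :
    dimH {z : E × (E →L[ℝ] ℝ) | z.1 ∈ (extChartAt 𝓘(ℝ, E) x₀).target ∧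
      ∃ h : (cChart x₀).symm z ∈ dualBoundary C,
        geodesicProj C ⟨(cChart x₀).symm z, h⟩ = n} ≤ 2 := by
  set S := {z : E × (E →L[ℝ] ℝ) | z.1 ∈ (extChartAt 𝓘(ℝ, E) x₀).target ∧
      ∃ h : (cChart x₀).symm z ∈ dualBoundary C,
        geodesicProj C ⟨(cChart x₀).symm z, h⟩ = n} with hS
  rcases S.eq_empty_or_nonempty with h0 | ⟨z₀, hz₀, hz₀b, hz₀n⟩
  · rw [h0, dimH_empty]; exact zero_le
  obtain ⟨v, hv, hzv⟩ := exists_eq_coLegendre hL hC hs hz₀b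
  obtain ⟨J, Φ, hJ, hΦ⟩ := exists_maximal_orbit hL hC hs (v := v)
  -- in the chart, the class is the image of a subset of the plane under the map `f` that sends a
  -- time and a scale to the corresponding covector
  set D : Set (ℝ × ℝ) := {q | q.1 ∈ J ∧ (Φ q.1).proj ∈ (chartAt E x₀).source} with hD
  set f : ℝ × ℝ → E × (E →L[ℝ] ℝ) := fun q =>
    ((legendreMap (localLagrangian L x₀) (tChart x₀ (Φ q.1))).1,
      q.2 • (legendreMap (localLagrangian L x₀) (tChart x₀ (Φ q.1))).2) with hf
  have hsub : S ⊆ f '' D := by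
    rintro z ⟨hz, hzb, hzn⟩
    obtain ⟨v', hv', hzv'⟩ := exists_eq_coLegendre hL hC hs hzb
    obtain ⟨t, htJ, r, hr, rfl⟩ := hΦ v' (sameOrbit_of_geodesicProj_eq hL hC hs
      (hz₀n.trans hzn.symm) hv hv' hzv hzv')
    have hpz : ((cChart x₀).symm z).proj ∈ (chartAt E x₀).source :=
      mem_cChart_source.1 ((cChart x₀).map_target (by rw [cChart_target]; exact ⟨hz, mem_univ _⟩))
    rw [hzv'] at hpz
    have hp : (Φ t).proj ∈ (chartAt E x₀).source := hpz
    refine ⟨(t, r), ⟨htJ, hp⟩, ?_⟩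
    have h1 : cChart x₀ ((cChart x₀).symm z) = z :=
      (cChart x₀).right_inv (by rw [cChart_target]; exact ⟨hz, mem_univ _⟩)
    obtain ⟨γ, a, b, hγ, ht, heq⟩ := hJ t htJ
    have hA : Φ t ∈ A := by
      rw [heq.self_of_nhds]; exact (hL.mem_of_boundary (hγ.null t ht)).1
    rw [← h1, hzv', hL.coLegendre_scale hA hr, cChart_apply hp]
    have h2 := cChart_coLegendre hL hp hA
    rw [cChart_eq hp] at h2
    simp only [hf]
    rw [← h2]
    rfl
  -- this map is locally the restriction of a smooth one
  have hlip : ∀ q ∈ D, ∃ K, ∃ t ∈ 𝓝[D] q, LipschitzOnWith K f t := by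
    rintro ⟨t, r⟩ ⟨htJ, hp⟩
    obtain ⟨γ, a, b, hγ, ht, heq⟩ := hJ t htJ
    have hp' : γ t ∈ (chartAt E x₀).source := by
      have : (Φ t).proj = γ t := by rw [heq.self_of_nhds]; rfl
      rw [← this]; exact hp
    have h1 : ContDiffAt ℝ ∞ (fun s => legendreMap (localLagrangian L x₀) (tChart x₀ (Φ s))) t :=
      (contDiffAt_legendreMap_localVelocity hL hγ ht hp').congr_of_eventuallyEq
        (heq.mono fun s hs => congrArg
          (fun v => legendreMap (localLagrangian L x₀) (tChart x₀ v)) hs)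
    have h2 : ContDiffAt ℝ ∞ (fun q : ℝ × ℝ =>
        legendreMap (localLagrangian L x₀) (tChart x₀ (Φ q.1))) (t, r) :=
      ContDiffAt.comp (g := fun s => legendreMap (localLagrangian L x₀) (tChart x₀ (Φ s)))
        (f := Prod.fst) (t, r) h1 contDiffAt_fst
    have h3 : ContDiffAt ℝ ∞ f (t, r) := h2.fst.prodMk (contDiffAt_snd.smul h2.snd)
    obtain ⟨K, U, hU, hK⟩ := (h3.of_le (by norm_cast : (1 : WithTop ℕ∞) ≤ ∞)).exists_lipschitzOnWith
    exact ⟨K, U, mem_nhdsWithin_of_mem_nhds hU, hK⟩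
  calc dimH S ≤ dimH (f '' D) := dimH_mono hsub
    _ ≤ dimH D := dimH_image_le_of_locally_lipschitzOn hlip
    _ ≤ dimH (univ : Set (ℝ × ℝ)) := dimH_mono (subset_univ _)
    _ = 2 := by rw [Real.dimH_univ_eq_finrank]; simp

end Classes

/-! ### Reduction of the Liouville form, in coordinates -/

section AdaptedCoordinates

variable {Z : Type*} [NormedAddCommGroup Z] [NormedSpace ℝ Z] [FiniteDimensional ℝ Z]
  {F : Type*} [NormedAddCommGroup F] [NormedSpace ℝ F] [FiniteDimensional ℝ F]
  {f : Z → F} {H : Z → ℝ}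

/-- The common kernel of the differentials of `f` and `H`. -/
def kerDiff (f : Z → F) (H : Z → ℝ) (z : Z) : Submodule ℝ Z :=
  LinearMap.ker ((fderiv ℝ f z).prod (fderiv ℝ H z)).toLinearMap

theorem mem_kerDiff {z w : Z} : w ∈ kerDiff f H z ↔ fderiv ℝ f z w = 0 ∧ fderiv ℝ H z w = 0 := by
  rw [kerDiff, LinearMap.mem_ker]
  exact Prod.mk_eq_zero

variable {z₀ : Z}
  (hsurj : ∀ (η : F) (r : ℝ), ∃ w, fderiv ℝ f z₀ w = η ∧ fderiv ℝ H z₀ w = r)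
include hsurj

theorem finrank_kerDiff : Module.finrank ℝ F + 1 + Module.finrank ℝ (kerDiff f H z₀) =
    Module.finrank ℝ Z := by
  rw [← LinearMap.finrank_range_add_finrank_ker
    ((fderiv ℝ f z₀).prod (fderiv ℝ H z₀)).toLinearMap, LinearMap.range_eq_top.2,
    finrank_top, Module.finrank_prod, Module.finrank_self]
  · rfl
  · rintro ⟨η, r⟩
    obtain ⟨w, h1, h2⟩ := hsurj η r
    exact ⟨w, Prod.ext h1 h2⟩

/-- If `f` and `H` have independent differentials, they are part of a coordinate system. -/
theorem exists_adapted_coordinates {Q : Set Z} (hQ : IsOpen Q) (hf : ContDiffOn ℝ ∞ f Q)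
    (hH : ContDiffOn ℝ ∞ H Q) (hz₀ : z₀ ∈ Q) :
    ∃ (κ : Z →L[ℝ] kerDiff f H z₀) (s : F × ℝ × kerDiff f H z₀ → Z)
      (O : Set (F × ℝ × kerDiff f H z₀)), IsOpen O ∧ (f z₀, H z₀, κ z₀) ∈ O ∧
      ContDiffOn ℝ ∞ s O ∧
      (∀ y ∈ O, f (s y) = y.1 ∧ H (s y) = y.2.1 ∧ κ (s y) = y.2.2 ∧ s y ∈ Q) ∧
      ∀ᶠ z in 𝓝 z₀, s (f z, H z, κ z) = z ∧ (f z, H z, κ z) ∈ O := by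
  obtain ⟨k, hk⟩ := (kerDiff f H z₀).subtype.exists_leftInverse_of_injective
    (Submodule.ker_subtype _)
  let κ : Z →L[ℝ] kerDiff f H z₀ := LinearMap.toContinuousLinearMap k
  have hκ : ∀ w (hw : w ∈ kerDiff f H z₀), κ w = ⟨w, hw⟩ := fun w hw =>
    congrArg (fun l : kerDiff f H z₀ →ₗ[ℝ] kerDiff f H z₀ => l ⟨w, hw⟩) hk
  have hG : ContDiffOn ℝ ∞ (fun z => (f z, H z, κ z)) Q :=
    hf.prodMk (hH.prodMk κ.contDiff.contDiffOn)
  have hd : HasFDerivAt (fun z => (f z, H z, κ z))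
      ((fderiv ℝ f z₀).prod ((fderiv ℝ H z₀).prod κ)) z₀ :=
    (((hf.contDiffAt (hQ.mem_nhds hz₀)).differentiableAt (by simp)).hasFDerivAt).prodMk
      ((((hH.contDiffAt (hQ.mem_nhds hz₀)).differentiableAt (by simp)).hasFDerivAt).prodMk
        κ.hasFDerivAt)
  obtain ⟨s, O, hO, hzO, hs, hsO, hinv⟩ := exists_smooth_local_inverse hQ hG hz₀ (by
    intro w hw
    rw [hd.fderiv] at hw
    have h1 : fderiv ℝ f z₀ w = 0 := congrArg Prod.fst hw
    have h2 : fderiv ℝ H z₀ w = 0 := congrArg (fun q => q.2.1) hw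
    have h3 : κ w = 0 := congrArg (fun q => q.2.2) hw
    have h4 := mem_kerDiff.2 ⟨h1, h2⟩
    rw [hκ w h4] at h3
    exact congrArg Subtype.val h3) (by
    rw [Module.finrank_prod, Module.finrank_prod, Module.finrank_self, ← add_assoc,
      finrank_kerDiff hsurj])
  refine ⟨κ, s, O, hO, hzO, hs, fun y hy => ?_, hinv⟩
  obtain ⟨h1, h2⟩ := hsO y hy
  exact ⟨congrArg Prod.fst h1, congrArg (fun q => q.2.1) h1, congrArg (fun q => q.2.2) h1, h2⟩

/-- In adapted coordinates, the common fibres of `f` and `H` are open subsets of the common kernel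
of the differentials, so a bound for their dimension bounds the dimension of this kernel. -/
theorem finrank_kerDiff_le {Q : Set Z} (hQ : IsOpen Q) (hf : ContDiffOn ℝ ∞ f Q)
    (hH : ContDiffOn ℝ ∞ H Q) (hz₀ : z₀ ∈ Q) {d : ℕ}
    (hdim : dimH {z | z ∈ Q ∧ f z = f z₀ ∧ H z = H z₀} ≤ d) :
    Module.finrank ℝ (kerDiff f H z₀) ≤ d := by
  obtain ⟨κ, s, O, hO, hzO, -, hsO, -⟩ := exists_adapted_coordinates hsurj hQ hf hH hz₀
  have h1 : {k | (f z₀, H z₀, k) ∈ O} ⊆ κ '' {z | z ∈ Q ∧ f z = f z₀ ∧ H z = H z₀} := by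
    intro k hk
    obtain ⟨h1, h2, h3, h4⟩ := hsO _ hk
    exact ⟨_, ⟨h4, h1, h2⟩, h3⟩
  have h2 : {k | (f z₀, H z₀, k) ∈ O} ∈ 𝓝 (κ z₀) :=
    (hO.preimage (by fun_prop)).mem_nhds hzO
  have h3 := (dimH_mono h1).trans (κ.lipschitz.dimH_image_le _) |>.trans hdim
  rw [Real.dimH_of_mem_nhds h2] at h3
  exact_mod_cast h3

end AdaptedCoordinates

section Reduction

variable {E F : Type*} [NormedAddCommGroup E] [NormedSpace ℝ E]
  [NormedAddCommGroup F] [NormedSpace ℝ F]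

theorem exists_fderiv_eq_of_surjective {H : E × (E →L[ℝ] ℝ) → ℝ} {f : E × (E →L[ℝ] ℝ) → F}
    {x z : E × (E →L[ℝ] ℝ)} (hH : ∀ ζ, fderiv ℝ H z ζ = x.2 ζ.1 - ζ.2 x.1) (hx : x.1 ≠ 0)
    (hs : ∀ η, ∃ w, fderiv ℝ H z w = 0 ∧ fderiv ℝ f z w = η) (η : F) (r : ℝ) :
    ∃ w, fderiv ℝ f z w = η ∧ fderiv ℝ H z w = r := by
  have hn : ‖x.1‖ ≠ 0 := norm_ne_zero_iff.2 hx
  obtain ⟨l, -, hl⟩ := exists_dual_vector ℝ x.1 hn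
  have h1 : fderiv ℝ H z (0, (-(r / ‖x.1‖)) • l) = r := by
    rw [hH, map_zero]
    change 0 - (-(r / ‖x.1‖)) * l x.1 = r
    rw [hl]
    simp [div_mul_cancel₀ _ hn]
  obtain ⟨w, hw, hfw⟩ := hs (η - fderiv ℝ f z (0, (-(r / ‖x.1‖)) • l))
  exact ⟨w + (0, (-(r / ‖x.1‖)) • l), by rw [map_add, hfw, sub_add_cancel],
    by rw [map_add, hw, h1, zero_add]⟩

/-- A local model of a submersion `f` of the hypersurface `H = 0` of `E × E*` onto an open subset of
`F`: the fibres are tangent to the Hamiltonian vector field `X` of `H` and to the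
radial vector field `(0, p)`, and are at most two-dimensional. -/
structure IsReduction (Q : Set (E × (E →L[ℝ] ℝ))) (H : E × (E →L[ℝ] ℝ) → ℝ)
    (X : E × (E →L[ℝ] ℝ) → E × (E →L[ℝ] ℝ)) (f : E × (E →L[ℝ] ℝ) → F) : Prop where
  isOpen : IsOpen Q
  smooth_H : ContDiffOn ℝ ∞ H Q
  smooth_f : ContDiffOn ℝ ∞ f Q
  fderiv_H : ∀ z ∈ Q, ∀ ζ, fderiv ℝ H z ζ = (X z).2 ζ.1 - ζ.2 (X z).1
  fst_X_ne_zero : ∀ z ∈ Q, H z = 0 → (X z).1 ≠ 0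
  snd_ne_zero : ∀ z ∈ Q, H z = 0 → z.2 ≠ 0
  liouville_X : ∀ z ∈ Q, H z = 0 → z.2 (X z).1 = 0
  surjective : ∀ z ∈ Q, H z = 0 → ∀ η, ∃ w, fderiv ℝ H z w = 0 ∧ fderiv ℝ f z w = η
  fderiv_f_X : ∀ z ∈ Q, H z = 0 → fderiv ℝ f z (X z) = 0
  fderiv_f_radial : ∀ z ∈ Q, H z = 0 → fderiv ℝ f z (0, z.2) = 0
  finrank_ker_le : ∀ z ∈ Q, H z = 0 → Module.finrank ℝ (kerDiff f H z) ≤ 2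

/-- The form `b` is the push-forward of the Liouville form at `z` under the restriction of `f` to
the hypersurface `H = 0`. -/
def IsReducedForm (H : E × (E →L[ℝ] ℝ) → ℝ) (f : E × (E →L[ℝ] ℝ) → F) (z : E × (E →L[ℝ] ℝ))
    (b : F →L[ℝ] ℝ) : Prop :=
  ∀ w, fderiv ℝ H z w = 0 → b (fderiv ℝ f z w) = z.2 w.1

/-- The exterior derivative of the pull-back of the Liouville form. -/
theorem hasFDerivAt_pullback_liouville {Y : Type*} [NormedAddCommGroup Y] [NormedSpace ℝ Y]
    {σ : Y → E × (E →L[ℝ] ℝ)} {q : Y} (hσ : ContDiffAt ℝ ∞ σ q) (a b : Y) :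
    DifferentiableAt ℝ (fun q => (σ q).2 (fderiv ℝ σ q a).1) q ∧
    fderiv ℝ (fun q => (σ q).2 (fderiv ℝ σ q a).1) q b -
      fderiv ℝ (fun q => (σ q).2 (fderiv ℝ σ q b).1) q a =
      (fderiv ℝ σ q b).2 (fderiv ℝ σ q a).1 - (fderiv ℝ σ q a).2 (fderiv ℝ σ q b).1 := by
  have h1 := (hσ.differentiableAt (by simp)).hasFDerivAt
  have h2 := ((hσ.fderiv_right (m := 1) (by norm_cast)).differentiableAt one_ne_zero).hasFDerivAt
  have key : ∀ a, HasFDerivAt (fun q => (σ q).2 (fderiv ℝ σ q a).1) _ q := fun a =>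
    h1.snd.clm_apply (h2.clm_apply (hasFDerivAt_const a q)).fst
  have hsymm := ((hσ.of_le (m := 2) (by norm_cast)).isSymmSndFDerivAt (by simp)).eq a b
  refine ⟨(key a).differentiableAt, ?_⟩
  rw [(key a).fderiv, (key b).fderiv]
  simp [hsymm]

variable {Q : Set (E × (E →L[ℝ] ℝ))} {H : E × (E →L[ℝ] ℝ) → ℝ}
  {X : E × (E →L[ℝ] ℝ) → E × (E →L[ℝ] ℝ)} {f : E × (E →L[ℝ] ℝ) → F}
variable (hR : IsReduction Q H X f)
include hR

theorem IsReduction.fderiv_H_X {z : E × (E →L[ℝ] ℝ)} (hz : z ∈ Q) : fderiv ℝ H z (X z) = 0 := by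
  rw [hR.fderiv_H z hz, sub_self]

theorem IsReduction.fderiv_H_radial {z : E × (E →L[ℝ] ℝ)} (hz : z ∈ Q) (h0 : H z = 0) :
    fderiv ℝ H z (0, z.2) = 0 := by
  rw [hR.fderiv_H z hz, map_zero]
  change 0 - z.2 (X z).1 = 0
  rw [hR.liouville_X z hz h0, sub_zero]

theorem IsReduction.fderiv_surjective {z : E × (E →L[ℝ] ℝ)} (hz : z ∈ Q) (h0 : H z = 0) (η : F)
    (r : ℝ) : ∃ w, fderiv ℝ f z w = η ∧ fderiv ℝ H z w = r :=
  exists_fderiv_eq_of_surjective (hR.fderiv_H z hz) (hR.fst_X_ne_zero z hz h0)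
    (hR.surjective z hz h0) η r

/-- The tangent spaces of the fibres of `f` in `H = 0` are spanned by `X` and the radial
vector field. -/
theorem IsReduction.kerDiff_eq_span [FiniteDimensional ℝ E] [FiniteDimensional ℝ F]
    {z : E × (E →L[ℝ] ℝ)} (hz : z ∈ Q) (h0 : H z = 0) :
    Module.finrank ℝ (kerDiff f H z) = 2 ∧ kerDiff f H z = Submodule.span ℝ {X z, (0, z.2)} := by
  have h3 : LinearIndependent ℝ ![X z, (0, z.2)] := by
    refine LinearIndependent.pair_iff.2 fun a b h => ?_
    have e1 := congrArg Prod.fst h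
    have e2 := congrArg Prod.snd h
    simp only [Prod.fst_add, Prod.smul_fst, smul_zero, add_zero, Prod.fst_zero] at e1
    have ha := (smul_eq_zero.1 e1).resolve_right (hR.fst_X_ne_zero z hz h0)
    simp only [ha, zero_smul, Prod.smul_snd, zero_add, Prod.snd_zero] at e2
    exact ⟨ha, (smul_eq_zero.1 e2).resolve_right (hR.snd_ne_zero z hz h0)⟩
  have h4 := finrank_span_eq_card h3
  rw [Matrix.range_cons, Matrix.range_cons, Matrix.range_empty, union_empty, singleton_union,
    Fintype.card_fin] at h4
  have h5 : Submodule.span ℝ {X z, (0, z.2)} ≤ kerDiff f H z := by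
    rw [Submodule.span_le]
    rintro w (rfl | rfl)
    · exact mem_kerDiff.2 ⟨hR.fderiv_f_X z hz h0, hR.fderiv_H_X hz⟩
    · exact mem_kerDiff.2 ⟨hR.fderiv_f_radial z hz h0, hR.fderiv_H_radial hz h0⟩
  have h6 := Submodule.eq_of_le_of_finrank_le h5 (by rw [h4]; exact hR.finrank_ker_le z hz h0)
  exact ⟨by rw [← h6, h4], h6.symm⟩

theorem IsReduction.ker [FiniteDimensional ℝ E] [FiniteDimensional ℝ F]
    {z w : E × (E →L[ℝ] ℝ)} (hz : z ∈ Q) (h0 : H z = 0) (hH : fderiv ℝ H z w = 0)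
    (hf : fderiv ℝ f z w = 0) : ∃ a b : ℝ, w = a • X z + b • (0, z.2) := by
  have h1 := mem_kerDiff.2 ⟨hf, hH⟩
  rw [(hR.kerDiff_eq_span hz h0).2, Submodule.mem_span_pair] at h1
  obtain ⟨a, b, h⟩ := h1
  exact ⟨a, b, h.symm⟩

/-- The Liouville form vanishes on the kernel of the differential. -/
theorem IsReduction.liouville_of_ker [FiniteDimensional ℝ E] [FiniteDimensional ℝ F]
    {z w : E × (E →L[ℝ] ℝ)} (hz : z ∈ Q) (h0 : H z = 0) (hH : fderiv ℝ H z w = 0)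
    (hf : fderiv ℝ f z w = 0) : z.2 w.1 = 0 := by
  obtain ⟨a, b, rfl⟩ := hR.ker hz h0 hH hf
  simp [hR.liouville_X z hz h0]

theorem IsReduction.reducedForm_unique {z : E × (E →L[ℝ] ℝ)} (hz : z ∈ Q) (h0 : H z = 0)
    {b b' : F →L[ℝ] ℝ} (hb : IsReducedForm H f z b) (hb' : IsReducedForm H f z b') : b = b' := by
  ext η
  obtain ⟨w, hw, rfl⟩ := hR.surjective z hz h0 η
  rw [hb w hw, hb' w hw]

/-- The Liouville form does not vanish on the hypersurface `H = 0`: as the base component of `X` is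
nonzero, every base vector is the base component of a tangent vector. -/
theorem IsReduction.reducedForm_ne_zero {z : E × (E →L[ℝ] ℝ)} (hz : z ∈ Q) (h0 : H z = 0)
    {b : F →L[ℝ] ℝ} (hb : IsReducedForm H f z b) : b ≠ 0 := by
  rintro rfl
  obtain ⟨ξ, hξ⟩ : ∃ ξ, z.2 ξ ≠ 0 := by
    by_contra! h
    exact hR.snd_ne_zero z hz h0 (ContinuousLinearMap.ext h)
  have hn : ‖(X z).1‖ ≠ 0 := norm_ne_zero_iff.2 (hR.fst_X_ne_zero z hz h0)
  obtain ⟨l, -, hl⟩ := exists_dual_vector ℝ (X z).1 hn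
  refine hξ (hb (ξ, ((X z).2 ξ / ‖(X z).1‖) • l) ?_).symm
  rw [hR.fderiv_H z hz]
  change (X z).2 ξ - ((X z).2 ξ / ‖(X z).1‖) * l (X z).1 = 0
  rw [hl]
  simp [div_mul_cancel₀ _ hn]

variable [FiniteDimensional ℝ E] [FiniteDimensional ℝ F]

omit hR [FiniteDimensional ℝ F] in
/-- The canonical symplectic form is nondegenerate. -/
theorem eq_zero_of_symplectic {w : E × (E →L[ℝ] ℝ)} (h : ∀ ζ : E × (E →L[ℝ] ℝ),
    w.2 ζ.1 - ζ.2 w.1 = 0) : w = 0 := by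
  have h1 : w.2 = 0 := by
    ext ξ
    simpa using h (ξ, 0)
  refine Prod.ext ?_ h1
  by_contra hne
  obtain ⟨l, -, hl⟩ := exists_dual_vector ℝ w.1 (norm_ne_zero_iff.2 hne)
  have h2 := h (0, l)
  change w.2 0 - l w.1 = 0 at h2
  rw [map_zero, hl, zero_sub, neg_eq_zero] at h2
  exact hne (norm_eq_zero.1 (by simpa using h2))

/-- A vector tangent to `H = 0` in the kernel of the Liouville form that is orthogonal to all such
vectors with respect to the symplectic form is tangent to a fibre of `f`. -/
theorem IsReduction.fderiv_f_eq_zero {z w : E × (E →L[ℝ] ℝ)} (hz : z ∈ Q) (h0 : H z = 0)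
    (hort : ∀ ζ, fderiv ℝ H z ζ = 0 → z.2 ζ.1 = 0 → w.2 ζ.1 - ζ.2 w.1 = 0) :
    fderiv ℝ f z w = 0 := by
  let Ω : E × (E →L[ℝ] ℝ) → E × (E →L[ℝ] ℝ) →ₗ[ℝ] ℝ := fun w =>
    { toFun := fun ζ => w.2 ζ.1 - ζ.2 w.1
      map_add' := fun a b => by simp; ring
      map_smul' := fun r a => by simp; ring }
  -- `Ω w` vanishes on the common kernel of `Ω (X z) = dH` and of `Ω (0, p)`, the Liouville form,
  -- so it is a combination of the two; as `Ω` is injective, `w` is the same combination of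
  -- `X z` and `(0, p)`
  have h1 : Ω w ∈ Submodule.span ℝ (Set.range ![Ω (X z), Ω (0, z.2)]) := by
    refine mem_span_of_iInf_ker_le_ker fun ζ hζ => ?_
    rw [Submodule.mem_iInf] at hζ
    have e1 : (X z).2 ζ.1 - ζ.2 (X z).1 = 0 := hζ 0
    have e2 : z.2 ζ.1 - ζ.2 0 = 0 := hζ 1
    rw [map_zero, sub_zero] at e2
    exact hort ζ (by rw [hR.fderiv_H z hz, e1]) e2
  rw [Matrix.range_cons, Matrix.range_cons, Matrix.range_empty, union_empty,
    singleton_union, Submodule.mem_span_pair] at h1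
  obtain ⟨a, b, hab⟩ := h1
  have h2 : w = a • X z + b • (0, z.2) := by
    refine sub_eq_zero.1 (eq_zero_of_symplectic fun ζ => ?_)
    have h3 := congrArg (fun T : E × (E →L[ℝ] ℝ) →ₗ[ℝ] ℝ => T ζ) hab
    change a * ((X z).2 ζ.1 - ζ.2 (X z).1) + b * (z.2 ζ.1 - ζ.2 0) = w.2 ζ.1 - ζ.2 w.1 at h3
    simp only [Prod.snd_sub, Prod.fst_sub, Prod.snd_add, Prod.fst_add, Prod.smul_snd,
      Prod.smul_fst, _root_.sub_apply, _root_.add_apply, _root_.smul_apply, map_sub, map_add,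
      map_smul, smul_eq_mul, smul_zero, map_zero] at h3 ⊢
    linarith
  rw [h2, map_add, map_smul, map_smul, hR.fderiv_f_X z hz h0, hR.fderiv_f_radial z hz h0,
    smul_zero, smul_zero, add_zero]

/-- The base of the reduction has dimension `2n - 3`: the hypersurface has dimension `2n - 1` and
the fibres have dimension two. -/
theorem IsReduction.finrank_eq {z : E × (E →L[ℝ] ℝ)} (hz : z ∈ Q) (h0 : H z = 0) :
    Module.finrank ℝ F + 3 = 2 * Module.finrank ℝ E := by
  have h1 := finrank_kerDiff (hR.fderiv_surjective hz h0)
  rw [(hR.kerDiff_eq_span hz h0).1, Module.finrank_prod, finrank_dual] at h1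
  omega

end Reduction

section ReducedForm

variable {E F : Type*} [NormedAddCommGroup E] [NormedSpace ℝ E] [FiniteDimensional ℝ E]
  [NormedAddCommGroup F] [NormedSpace ℝ F] [FiniteDimensional ℝ F]
  {Q : Set (E × (E →L[ℝ] ℝ))} {H : E × (E →L[ℝ] ℝ) → ℝ}
  {X : E × (E →L[ℝ] ℝ) → E × (E →L[ℝ] ℝ)} {f : E × (E →L[ℝ] ℝ) → F}
variable (hR : IsReduction Q H X f)
include hR

/-- A parametrisation of the hypersurface `H = 0` by the values of `f` and a parameter along the
fibres. -/
theorem IsReduction.exists_parametrisation {z₀ : E × (E →L[ℝ] ℝ)} (hz₀ : z₀ ∈ Q) (h0 : H z₀ = 0) :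
    ∃ (κ : E × (E →L[ℝ] ℝ) →L[ℝ] kerDiff f H z₀) (σ : F × kerDiff f H z₀ → E × (E →L[ℝ] ℝ))
      (O : Set (F × kerDiff f H z₀)), IsOpen O ∧ (f z₀, κ z₀) ∈ O ∧ ContDiffOn ℝ ∞ σ O ∧
      (∀ q ∈ O, f (σ q) = q.1 ∧ H (σ q) = 0 ∧ σ q ∈ Q) ∧
      (∀ᶠ z in 𝓝 z₀, H z = 0 → σ (f z, κ z) = z ∧ (f z, κ z) ∈ O) ∧
      (∀ q ∈ O, ∀ a, fderiv ℝ f (σ q) (fderiv ℝ σ q a) = a.1 ∧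
        fderiv ℝ H (σ q) (fderiv ℝ σ q a) = 0) ∧
      ∀ w ∈ kerDiff f H z₀, fderiv ℝ σ (f z₀, κ z₀) (0, κ w) = w := by
  obtain ⟨κ, s, O, hO, hzO, hs, hsO, hinv⟩ := exists_adapted_coordinates
    (hR.fderiv_surjective hz₀ h0) hR.isOpen hR.smooth_f hR.smooth_H hz₀
  let j : F × kerDiff f H z₀ →L[ℝ] F × ℝ × kerDiff f H z₀ :=
    (ContinuousLinearMap.fst ℝ F _).prod
      ((0 : F × kerDiff f H z₀ →L[ℝ] ℝ).prod (ContinuousLinearMap.snd ℝ F _))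
  have hOo : IsOpen (j ⁻¹' O) := hO.preimage j.continuous
  have hσ : ContDiffOn ℝ ∞ (fun q => s (j q)) (j ⁻¹' O) :=
    hs.comp j.contDiff.contDiffOn fun q hq => hq
  have hd : ∀ q ∈ j ⁻¹' O, HasFDerivAt (fun q => s (j q)) (fderiv ℝ (fun q => s (j q)) q) q :=
    fun q hq => ((hσ.contDiffAt (hOo.mem_nhds hq)).differentiableAt (by simp)).hasFDerivAt
  have hfd : ∀ z ∈ Q, HasFDerivAt f (fderiv ℝ f z) z := fun z hz =>
    ((hR.smooth_f.contDiffAt (hR.isOpen.mem_nhds hz)).differentiableAt (by simp)).hasFDerivAt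
  have hHd : ∀ z ∈ Q, HasFDerivAt H (fderiv ℝ H z) z := fun z hz =>
    ((hR.smooth_H.contDiffAt (hR.isOpen.mem_nhds hz)).differentiableAt (by simp)).hasFDerivAt
  have hq₀ : j (f z₀, κ z₀) = (f z₀, H z₀, κ z₀) := by rw [h0]; rfl
  have hq₀O : (f z₀, κ z₀) ∈ j ⁻¹' O := by rw [mem_preimage, hq₀]; exact hzO
  refine ⟨κ, fun q => s (j q), j ⁻¹' O, hOo, hq₀O, hσ, fun q hq => ?_, ?_, fun q hq a => ⟨?_, ?_⟩,
    fun w hw => ?_⟩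
  · obtain ⟨h1, h2, -, h4⟩ := hsO _ hq
    exact ⟨h1, h2, h4⟩
  · filter_upwards [hinv] with z hz hHz
    have : j (f z, κ z) = (f z, H z, κ z) := by rw [hHz]; rfl
    rw [mem_preimage, this]
    exact hz
  · have h1 := (hfd _ (hsO _ hq).2.2.2).comp q (hd q hq)
    have h2 := h1.unique ((hasFDerivAt_fst (𝕜 := ℝ) (p := q)).congr_of_eventuallyEq (by
      filter_upwards [hOo.mem_nhds hq] with q' hq'
      exact (hsO _ hq').1))
    exact congrArg (fun T : F × kerDiff f H z₀ →L[ℝ] F => T a) h2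
  · have h1 := (hHd _ (hsO _ hq).2.2.2).comp q (hd q hq)
    have h2 := h1.unique ((hasFDerivAt_const (𝕜 := ℝ) (0 : ℝ) q).congr_of_eventuallyEq (by
      filter_upwards [hOo.mem_nhds hq] with q' hq'
      exact (hsO _ hq').2.1))
    exact congrArg (fun T : F × kerDiff f H z₀ →L[ℝ] ℝ => T a) h2
  · obtain ⟨hw1, hw2⟩ := mem_kerDiff.1 hw
    have hsd : HasFDerivAt s (fderiv ℝ s (f z₀, H z₀, κ z₀)) (f z₀, H z₀, κ z₀) :=
      ((hs.contDiffAt (hO.mem_nhds hzO)).differentiableAt (by simp)).hasFDerivAt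
    have h1 := HasFDerivAt.comp (g := s) (f := fun z => (f z, H z, κ z)) z₀ hsd
      ((hfd z₀ hz₀).prodMk ((hHd z₀ hz₀).prodMk κ.hasFDerivAt))
    have h2 := h1.unique ((hasFDerivAt_id z₀).congr_of_eventuallyEq
      (hinv.mono fun z hz => hz.1))
    have h3 := congrArg (fun T : E × (E →L[ℝ] ℝ) →L[ℝ] E × (E →L[ℝ] ℝ) => T w) h2
    change fderiv ℝ s (f z₀, H z₀, κ z₀) (fderiv ℝ f z₀ w, fderiv ℝ H z₀ w, κ w) = w at h3
    rw [hw1, hw2] at h3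
    have h4 := HasFDerivAt.comp (g := s) (f := j) (f z₀, κ z₀) (by rw [hq₀]; exact hsd)
      j.hasFDerivAt
    rw [show (fun q => s (j q)) = s ∘ j from rfl, h4.fderiv]
    exact h3

/-- The push-forward of the Liouville form exists and depends smoothly on the point `z` of the
hypersurface, that is, on its image `f z` and on the parameter `κ z` along the fibre. It is
stationary in the direction of the Hamiltonian vector field. Its differential in the directions of
`F` is nondegenerate on its kernel, since a vector that lies in the kernel of the Liouville form on
the hypersurface and is symplectically orthogonal to this kernel is tangent to the fibre. -/
theorem IsReduction.exists_reducedForm {z₀ : E × (E →L[ℝ] ℝ)} (hz₀ : z₀ ∈ Q) (h0 : H z₀ = 0) :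
    ∃ (κ : E × (E →L[ℝ] ℝ) →L[ℝ] kerDiff f H z₀) (σ : F × kerDiff f H z₀ → E × (E →L[ℝ] ℝ))
      (B : F × kerDiff f H z₀ → F →L[ℝ] ℝ) (O : Set (F × kerDiff f H z₀)),
      IsOpen O ∧ (f z₀, κ z₀) ∈ O ∧ ContDiffOn ℝ ∞ σ O ∧ ContDiffOn ℝ ∞ B O ∧
      (∀ q ∈ O, f (σ q) = q.1 ∧ H (σ q) = 0 ∧ σ q ∈ Q ∧ IsReducedForm H f (σ q) (B q)) ∧
      (∀ᶠ z in 𝓝 z₀, H z = 0 → (f z, κ z) ∈ O ∧ IsReducedForm H f z (B (f z, κ z))) ∧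
      fderiv ℝ B (f z₀, κ z₀) (0, κ (X z₀)) = 0 ∧
      ∀ η, B (f z₀, κ z₀) η = 0 → (∀ η', B (f z₀, κ z₀) η' = 0 →
        fderiv ℝ B (f z₀, κ z₀) (η, 0) η' - fderiv ℝ B (f z₀, κ z₀) (η', 0) η = 0) → η = 0 := by
  obtain ⟨κ, σ, O, hO, hzO, hσ, hσO, hinv, hdσ, hdκ⟩ := hR.exists_parametrisation hz₀ h0
  have hDσ : ContDiffOn ℝ ∞ (fderiv ℝ σ) O := hσ.fderiv_of_isOpen hO (by simp)
  -- the value of the Liouville form on lifts by the parametrisation; all lifts have the same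
  -- value, since the Liouville form vanishes on the kernel of `df`
  let B : F × kerDiff f H z₀ → F →L[ℝ] ℝ := fun q =>
    (σ q).2.comp ((ContinuousLinearMap.fst ℝ E (E →L[ℝ] ℝ)).comp ((fderiv ℝ σ q).comp
      (ContinuousLinearMap.inl ℝ F (kerDiff f H z₀))))
  have hB : ContDiffOn ℝ ∞ B O := by
    refine (contDiff_snd.comp_contDiffOn hσ).clm_comp
      (contDiffOn_const.clm_comp (hDσ.clm_comp contDiffOn_const))
  have hred : ∀ q ∈ O, IsReducedForm H f (σ q) (B q) := by
    intro q hq w hw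
    obtain ⟨h1, h2, h3⟩ := hσO q hq
    obtain ⟨h4, h5⟩ := hdσ q hq (fderiv ℝ f (σ q) w, 0)
    have h6 := hR.liouville_of_ker (w := w - fderiv ℝ σ q (fderiv ℝ f (σ q) w, 0)) h3 h2
      (by rw [map_sub, hw, h5, sub_zero]) (by rw [map_sub, h4, sub_self])
    rw [Prod.fst_sub, map_sub, sub_eq_zero] at h6
    exact h6.symm
  set q₀ := (f z₀, κ z₀) with hq₀
  have hσ0 : σ q₀ = z₀ := (hinv.self_of_nhds h0).1
  have hσd : ContDiffAt ℝ ∞ σ q₀ := hσ.contDiffAt (hO.mem_nhds hzO)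
  have hBd : HasFDerivAt B (fderiv ℝ B q₀) q₀ :=
    ((hB.contDiffAt (hO.mem_nhds hzO)).differentiableAt (by simp)).hasFDerivAt
  have hBη : ∀ η b, fderiv ℝ (fun q => (σ q).2 (fderiv ℝ σ q (η, 0)).1) q₀ b =
      fderiv ℝ B q₀ b η := by
    intro η b
    have h1 := hBd.clm_apply (hasFDerivAt_const η q₀)
    have h2 : (fun q => (σ q).2 (fderiv ℝ σ q (η, 0)).1) = fun q => B q η := rfl
    rw [h2, h1.fderiv]
    simp
  -- the Liouville form vanishes on the vectors tangent to the fibres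
  have hvert : ∀ k a, fderiv ℝ (fun q => (σ q).2 (fderiv ℝ σ q (0, k)).1) q₀ a = 0 := by
    intro k a
    have h1 : (fun q => (σ q).2 (fderiv ℝ σ q (0, k)).1) =ᶠ[𝓝 q₀] fun _ => (0 : ℝ) := by
      filter_upwards [hO.mem_nhds hzO] with q hq
      obtain ⟨h1, h2, h3⟩ := hσO q hq
      exact hR.liouville_of_ker h3 h2 (hdσ q hq (0, k)).2 (hdσ q hq (0, k)).1
    rw [h1.fderiv_eq, fderiv_fun_const]
    rfl
  refine ⟨κ, σ, B, O, hO, hzO, hσ, hB, fun q hq => ⟨(hσO q hq).1, (hσO q hq).2.1, (hσO q hq).2.2,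
    hred q hq⟩, hinv.mono fun z hz hHz => ?_, ?_, fun η hη hort => ?_⟩
  · obtain ⟨h1, h2⟩ := hz hHz
    have h3 := hred _ h2
    rw [h1] at h3
    exact ⟨h2, h3⟩
  · ext η
    -- `dλ(X, w) = dH(w) = 0` for the lift `w` of `η`, where `λ` is the Liouville form
    have h1 := (hasFDerivAt_pullback_liouville hσd (η, 0) (0, κ (X z₀))).2
    rw [hBη, hvert, hdκ (X z₀) (mem_kerDiff.2 ⟨hR.fderiv_f_X z₀ hz₀ h0, hR.fderiv_H_X hz₀⟩),
      ← hR.fderiv_H z₀ hz₀] at h1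
    have h2 := (hdσ q₀ hzO (η, 0)).2
    rw [hσ0] at h2
    rw [h2, sub_zero] at h1
    exact h1
  -- the lift `w` of `η` is orthogonal to the kernel of the Liouville form in the hypersurface,
  -- hence tangent to the fibre
  · set w := fderiv ℝ σ q₀ (η, 0) with hw
    have hwf : fderiv ℝ f z₀ w = η := by rw [← hσ0]; exact (hdσ q₀ hzO (η, 0)).1
    have hwH : fderiv ℝ H z₀ w = 0 := by rw [← hσ0]; exact (hdσ q₀ hzO (η, 0)).2
    have hB0 := hred q₀ hzO
    rw [hσ0] at hB0
    have hwθ : z₀.2 w.1 = 0 := by rw [← hB0 w hwH, hwf, hη]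
    rw [← hwf]
    refine hR.fderiv_f_eq_zero hz₀ h0 fun ζ hζH hζθ => ?_
    -- split `ζ` into a lift of `η'` and a vertical part
    set η' := fderiv ℝ f z₀ ζ with hη'
    have hη'0 : B q₀ η' = 0 := by rw [hB0 ζ hζH, hζθ]
    have h1 := hort η' hη'0
    have h2 := (hasFDerivAt_pullback_liouville hσd (η', 0) (η, 0)).2
    rw [hBη, hBη, h1, ← hw] at h2
    set w' := fderiv ℝ σ q₀ (η', 0) with hw'
    have hwf' : fderiv ℝ f z₀ w' = η' := by rw [← hσ0]; exact (hdσ q₀ hzO (η', 0)).1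
    have hwH' : fderiv ℝ H z₀ w' = 0 := by rw [← hσ0]; exact (hdσ q₀ hzO (η', 0)).2
    obtain ⟨a, b, hab⟩ := hR.ker hz₀ h0 (w := ζ - w') (by rw [map_sub, hζH, hwH', sub_zero])
      (by rw [map_sub, ← hη', hwf', sub_self])
    have h3 : ζ = w' + (a • X z₀ + b • (0, z₀.2)) := by rw [← hab, add_sub_cancel]
    have h4 := hR.fderiv_H z₀ hz₀ w
    rw [hwH] at h4
    rw [h3]
    simp only [Prod.fst_add, Prod.snd_add, Prod.smul_fst, Prod.smul_snd, smul_zero, add_zero,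
      map_add, map_smul, smul_eq_mul, _root_.add_apply, _root_.smul_apply, hwθ, mul_zero]
    linear_combination (-1 : ℝ) * h2 + a * h4

/-- The push-forward of the Liouville form is stationary along the Hamiltonian vector field. -/
theorem IsReduction.exists_hasDerivAt_reducedForm {δ : ℝ → E × (E →L[ℝ] ℝ)} {t₀ : ℝ}
    (hδ : HasDerivAt δ (X (δ t₀)) t₀) (hQ : δ t₀ ∈ Q) (h0 : ∀ᶠ t in 𝓝 t₀, H (δ t) = 0) :
    ∃ β : ℝ → F →L[ℝ] ℝ, (∀ᶠ t in 𝓝 t₀, IsReducedForm H f (δ t) (β t)) ∧ HasDerivAt β 0 t₀ := by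
  obtain ⟨κ, σ, B, O, hO, hzO, -, hB, -, hinv, hX, -⟩ := hR.exists_reducedForm hQ h0.self_of_nhds
  refine ⟨fun t => B (f (δ t), κ (δ t)), ?_, ?_⟩
  · filter_upwards [hδ.continuousAt.eventually hinv, h0] with t h1 h2
    exact (h1 h2).2
  · have h1 : HasFDerivAt f (fderiv ℝ f (δ t₀)) (δ t₀) :=
      ((hR.smooth_f.contDiffAt (hR.isOpen.mem_nhds hQ)).differentiableAt (by simp)).hasFDerivAt
    have h2 := (h1.comp_hasDerivAt t₀ hδ).prodMk (κ.hasFDerivAt.comp_hasDerivAt t₀ hδ)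
    have h3 : HasFDerivAt B (fderiv ℝ B (f (δ t₀), κ (δ t₀))) (f (δ t₀), κ (δ t₀)) :=
      ((hB.contDiffAt (hO.mem_nhds hzO)).differentiableAt (by simp)).hasFDerivAt
    have h4 := HasFDerivAt.comp_hasDerivAt (f := fun t => (f (δ t), κ (δ t))) t₀ h3 h2
    rw [hR.fderiv_f_X _ hQ h0.self_of_nhds, hX] at h4
    exact h4

end ReducedForm

/-! ### The projection to the space of cone geodesics, in charts -/

section ReductionChart

variable {E : Type*} [NormedAddCommGroup E] [NormedSpace ℝ E]
  {M : Type*} [TopologicalSpace M] [ChartedSpace E M] [IsManifold 𝓘(ℝ, E) ∞ M]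
  {F : Type*} [NormedAddCommGroup F] [NormedSpace ℝ F]
  {C A : Set (TangentBundle 𝓘(ℝ, E) M)} {L : TangentBundle 𝓘(ℝ, E) M → ℝ}
  [ChartedSpace F (GeodesicSpace C)] [IsManifold 𝓘(ℝ, F) ∞ (GeodesicSpace C)]

/-- In the chart of `T*M` at `x₀` and the chart of the space of cone geodesics at `n₀`, the set
`∂C*` is the hypersurface `H = 0` and the projection is `f`, up to the choice of extensions. -/
structure IsReductionChart (C : Set (TangentBundle 𝓘(ℝ, E) M)) [ChartedSpace F (GeodesicSpace C)]
    (x₀ : M) (n₀ : GeodesicSpace C) (Q : Set (E × (E →L[ℝ] ℝ))) (H : E × (E →L[ℝ] ℝ) → ℝ)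
    (f : E × (E →L[ℝ] ℝ) → F) : Prop where
  isOpen : IsOpen Q
  smooth_H : ContDiffOn ℝ ∞ H Q
  smooth_f : ContDiffOn ℝ ∞ f Q
  mem_target : ∀ z ∈ Q, z.1 ∈ (extChartAt 𝓘(ℝ, E) x₀).target
  mem_iff : ∀ z ∈ Q, (cChart x₀).symm z ∈ dualBoundary C ↔ H z = 0
  proj : ∀ z ∈ Q, ∀ h : (cChart x₀).symm z ∈ dualBoundary C,
    geodesicProj C ⟨(cChart x₀).symm z, h⟩ ∈ (chartAt F n₀).source ∧
      f z = extChartAt 𝓘(ℝ, F) n₀ (geodesicProj C ⟨(cChart x₀).symm z, h⟩)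

theorem IsSmoothCurve.contDiffAt {c : ℝ → dualBoundary C} (hc : IsSmoothCurve c) {t : ℝ} {x₀ : M}
    (hp : (c t : CotangentBundle E M).proj ∈ (chartAt E x₀).source) :
    ContDiffAt ℝ ∞ (fun s => cChart x₀ (c s : CotangentBundle E M)) t := by
  have h1 := mem_cChart_source.2 hp
  rw [cChart, extChartAt_source] at h1
  exact contMDiffAt_iff_contDiffAt.1 ((contMDiffAt_extChartAt' h1).comp t hc.contMDiffAt)

theorem IsSubmersion.mdifferentiableAt_comp (hπ : IsSubmersion (F := F) (geodesicProj C))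
    {c : ℝ → dualBoundary C} (hc : IsSmoothCurve c) (t : ℝ) :
    MDifferentiableAt 𝓘(ℝ, ℝ) 𝓘(ℝ, F) (geodesicProj C ∘ c) t := by
  obtain ⟨U, g, hU, hcU, hg, hgU⟩ := hπ.smooth (c t)
  have h1 : ContMDiffAt 𝓘(ℝ, ℝ) 𝓘(ℝ, F) ∞ (fun s => g (c s : CotangentBundle E M)) t :=
    (hg.contMDiffAt (hU.mem_nhds hcU)).comp t hc.contMDiffAt
  refine (h1.mdifferentiableAt (by simp)).congr_of_eventuallyEq ?_
  filter_upwards [hc.contMDiffAt.continuousAt.eventually (hU.mem_nhds hcU)] with s hs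
  exact (hgU _ hs).symm

theorem cChart_symm_cChart {x₀ : M} {u : CotangentBundle E M}
    (hp : u.proj ∈ (chartAt E x₀).source) : (cChart x₀).symm (cChart x₀ u) = u :=
  (cChart x₀).left_inv (mem_cChart_source.2 hp)

/-- The coordinate expressions of the velocity of a curve in `∂C*`, of its projection, and of the
value of the Liouville form. -/
theorem IsReductionChart.velocity {x₀ : M} {n₀ : GeodesicSpace C} {Q : Set (E × (E →L[ℝ] ℝ))}
    {H : E × (E →L[ℝ] ℝ) → ℝ} {f : E × (E →L[ℝ] ℝ) → F} (hR : IsReductionChart C x₀ n₀ Q H f)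
    (hπ : IsSubmersion (F := F) (geodesicProj C)) {c : ℝ → dualBoundary C} (hc : IsSmoothCurve c)
    (hp : (c 0 : CotangentBundle E M).proj ∈ (chartAt E x₀).source)
    (hQ : cChart x₀ (c 0 : CotangentBundle E M) ∈ Q) :
    ∃ w, fderiv ℝ H (cChart x₀ (c 0 : CotangentBundle E M)) w = 0 ∧
      fderiv ℝ f (cChart x₀ (c 0 : CotangentBundle E M)) w =
        toCoord n₀ (geodesicProj C (c 0)) (vec (velocity 𝓘(ℝ, F) (geodesicProj C ∘ c) 0)) ∧
      liouville (velocity (cotangentModel E) (fun t => (c t : CotangentBundle E M)) 0) =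
        (cChart x₀ (c 0 : CotangentBundle E M)).2 w.1 := by
  set ĉ : ℝ → E × (E →L[ℝ] ℝ) := fun s => cChart x₀ (c s : CotangentBundle E M) with hĉ
  have h1 : HasDerivAt ĉ (deriv ĉ 0) 0 :=
    ((hc.contDiffAt hp).differentiableAt (by simp)).hasDerivAt
  have hcc : ContinuousAt (fun s => (c s : CotangentBundle E M)) 0 :=
    hc.contMDiffAt.continuousAt
  have hev : ∀ᶠ s in 𝓝 0, ĉ s ∈ Q ∧ (cChart x₀).symm (ĉ s) = c s := by
    filter_upwards [h1.continuousAt.eventually (hR.isOpen.mem_nhds hQ),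
      hcc.eventually (eventually_proj_mem hp)] with s hs hs'
    exact ⟨hs, cChart_symm_cChart hs'⟩
  have hproj : ∀ s, ĉ s ∈ Q → (cChart x₀).symm (ĉ s) = c s →
      geodesicProj C (c s) ∈ (chartAt F n₀).source ∧
        f (ĉ s) = extChartAt 𝓘(ℝ, F) n₀ (geodesicProj C (c s)) := by
    intro s hs hs'
    have h2 : (cChart x₀).symm (ĉ s) ∈ dualBoundary C := by rw [hs']; exact (c s).2
    have h3 : (⟨(cChart x₀).symm (ĉ s), h2⟩ : dualBoundary C) = c s := Subtype.ext hs'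
    have h4 := hR.proj _ hs h2
    rwa [h3] at h4
  refine ⟨deriv ĉ 0, ?_, ?_, ?_⟩
  · have h2 : HasFDerivAt H (fderiv ℝ H (ĉ 0)) (ĉ 0) :=
      ((hR.smooth_H.contDiffAt (hR.isOpen.mem_nhds hQ)).differentiableAt (by simp)).hasFDerivAt
    refine (h2.comp_hasDerivAt 0 h1).unique ((hasDerivAt_const 0 0).congr_of_eventuallyEq ?_)
    filter_upwards [hev] with s hs
    exact (hR.mem_iff _ hs.1).1 (by rw [hs.2]; exact (c s).2)
  · have h2 : HasFDerivAt f (fderiv ℝ f (ĉ 0)) (ĉ 0) :=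
      ((hR.smooth_f.contDiffAt (hR.isOpen.mem_nhds hQ)).differentiableAt (by simp)).hasFDerivAt
    refine (h2.comp_hasDerivAt 0 h1).unique ((hasDerivAt_chart (x₀ := n₀)
      (hπ.mdifferentiableAt_comp hc 0) ?_).congr_of_eventuallyEq ?_)
    · exact (hproj 0 hev.self_of_nhds.1 hev.self_of_nhds.2).1
    · filter_upwards [hev] with s hs
      exact (hproj s hs.1 hs.2).2
  · have h2 : HasDerivAt (fun s => (ĉ s).1) (deriv ĉ 0).1 0 := h1.fst
    rw [liouville_velocity (hc.contMDiffAt.mdifferentiableAt (by simp)) hp, h2.deriv]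

variable [FiniteDimensional ℝ E] [FiniteDimensional ℝ F]
variable (hL : IsLorentzFinslerMetric C A L) (hC : IsStronglyConvexConeStructure C)
  (hs : ∀ v ∈ A, v ∈ C ↔ L v ≤ 0) (hπ : IsSubmersion (F := F) (geodesicProj C))
include hL hC hs hπ

/-- In charts, the projection from `∂C*` to the space of cone geodesics is a local model
`IsReduction`: it is constant along the lifts of null geodesics, which are integral curves of the
Hamiltonian vector field, and along rays of covectors, and its fibres have dimension at most two. -/
theorem exists_isReductionChart [T2Space M] {x₀ : M} {n₀ : GeodesicSpace C}
    {v : TangentBundle 𝓘(ℝ, E) M} (hv : v ∈ boundary C) (hp : v.proj ∈ (chartAt E x₀).source)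
    (hn : geodesicProj C ⟨coLegendre L v, coLegendre_mem_dualBoundary hL hC hs hv⟩ ∈
      (chartAt F n₀).source) :
    ∃ (Q : Set (E × (E →L[ℝ] ℝ))) (g : E × (E →L[ℝ] ℝ) → E × E) (f : E × (E →L[ℝ] ℝ) → F),
      IsReductionChart C x₀ n₀ Q (fun z => localLagrangian L x₀ (g z)) f ∧
      IsReduction Q (fun z => localLagrangian L x₀ (g z)) (hamField (localLagrangian L x₀) g) f ∧
      cChart x₀ (coLegendre L v) ∈ Q ∧
      ∀ᶠ w in 𝓝 (tChart x₀ v), g (legendreMap (localLagrangian L x₀) w) = w := by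
  set l := localLagrangian L x₀ with hl
  obtain ⟨g, O, hO, hzO, hg, hgO, hinv, hP⟩ := exists_hamiltonian_chart hL hC hs hv hp
  have hU := isOpen_coordDomain hL.isOpen x₀
  have hlU := hL.contDiffOn_local x₀
  obtain ⟨U, G, hUo, huU, hG, hGU⟩ := hπ.smooth
    ⟨coLegendre L v, coLegendre_mem_dualBoundary hL hC hs hv⟩
  have hGn : G (coLegendre L v) ∈ (chartAt F n₀).source := by
    have h1 := hGU ⟨coLegendre L v, coLegendre_mem_dualBoundary hL hC hs hv⟩ huU
    rw [h1]; exact hn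
  have hVo : IsOpen (U ∩ G ⁻¹' (chartAt F n₀).source) :=
    hG.continuousOn.isOpen_inter_preimage hUo (chartAt F n₀).open_source
  set T := (cChart x₀ : PartialEquiv (CotangentBundle E M) _).target with hT
  have hTo : IsOpen T := by
    rw [hT, cChart_target]; exact (isOpen_extChartAt_target x₀).prod isOpen_univ
  have hT1 : ∀ z ∈ T, z.1 ∈ (extChartAt 𝓘(ℝ, E) x₀).target := fun z hz => by
    rw [hT, cChart_target] at hz; exact hz.1
  have hWo : IsOpen (T ∩ (cChart x₀).symm ⁻¹' (U ∩ G ⁻¹' (chartAt F n₀).source)) :=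
    ContinuousOn.isOpen_inter_preimage
      (fun z hz => (continuousAt_cChart_symm (hT1 z hz)).continuousWithinAt) hTo hVo
  -- the part of the chart where the Hamiltonian is defined, the projection has a smooth extension
  -- `G`, and this extension takes values in the chart at `n₀`
  set Q := O ∩ (T ∩ (cChart x₀).symm ⁻¹' (U ∩ G ⁻¹' (chartAt F n₀).source)) with hQ
  have hQo : IsOpen Q := hO.inter hWo
  set f : E × (E →L[ℝ] ℝ) → F := fun z => extChartAt 𝓘(ℝ, F) n₀ (G ((cChart x₀).symm z)) with hf
  have hzQ : cChart x₀ (coLegendre L v) ∈ Q := by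
    refine ⟨hzO, (cChart x₀).map_source (mem_cChart_source.2 hp), ?_⟩
    rw [mem_preimage, cChart_symm_cChart hp]
    exact ⟨huU, hGn⟩
  have hHs : ContDiffOn ℝ ∞ (fun z => l (g z)) Q :=
    hlU.comp (hg.mono inter_subset_left) fun z hz => (hgO z hz.1).2
  have hfs : ContDiffOn ℝ ∞ f Q := by
    intro z hz
    have h1 : ContMDiffAt 𝓘(ℝ, E × (E →L[ℝ] ℝ)) (cotangentModel E) ∞
        (cChart x₀ : PartialEquiv (CotangentBundle E M) _).symm z :=
      (contMDiffOn_extChartAt_symm (I := cotangentModel E) (n := ∞)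
        (⟨x₀, 0⟩ : CotangentBundle E M)).contMDiffAt (hTo.mem_nhds hz.2.1)
    have h2 : ContMDiffAt (cotangentModel E) 𝓘(ℝ, F) ∞ G ((cChart x₀).symm z) :=
      hG.contMDiffAt (hUo.mem_nhds hz.2.2.1)
    exact (contMDiffAt_iff_contDiffAt.1 ((contMDiffAt_extChartAt' hz.2.2.2).comp z
      (h2.comp z h1))).contDiffWithinAt
  have hproj : ∀ z ∈ Q, ∀ h : (cChart x₀).symm z ∈ dualBoundary C,
      geodesicProj C ⟨(cChart x₀).symm z, h⟩ ∈ (chartAt F n₀).source ∧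
        f z = extChartAt 𝓘(ℝ, F) n₀ (geodesicProj C ⟨(cChart x₀).symm z, h⟩) := by
    intro z hz h
    have h1 := hGU ⟨_, h⟩ hz.2.2.1
    rw [← h1]
    exact ⟨hz.2.2.2, rfl⟩
  have hRC : IsReductionChart C x₀ n₀ Q (fun z => l (g z)) f :=
    ⟨hQo, hHs, hfs, fun z hz => hT1 z hz.2.1, fun z hz => hP z hz.1, hproj⟩
  refine ⟨Q, g, f, hRC, ?_, hzQ, hinv.mono fun w hw => hw.1⟩
  have hfH : ∀ z ∈ Q, ∀ ζ, fderiv ℝ (fun z => l (g z)) z ζ =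
      (hamField l g z).2 ζ.1 - ζ.2 (hamField l g z).1 := by
    intro z hz ζ
    obtain ⟨H', hH', hval⟩ := hasFDerivAt_hamiltonian hU hlU hO hg hgO
      (fun w hw => hL.euler_local hw) hz.1
    rw [hH'.fderiv, hval]
  -- points of `H = 0` are Legendre transforms of null vectors
  have hvec : ∀ z ∈ Q, l (g z) = 0 → ∃ v' ∈ boundary C, v'.proj ∈ (chartAt E x₀).source ∧
      g z = tChart x₀ v' ∧ (cChart x₀).symm z = coLegendre L v' := by
    intro z hz h0
    obtain ⟨v', hv'A, hv'p, hv't, hv'L⟩ := exists_of_mem_coordDomain hL (hgO z hz.1).2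
    have hv'b : v' ∈ boundary C := by
      rw [hL.boundary_eq]; exact ⟨hv'A, by rw [← hv'L]; exact h0⟩
    refine ⟨v', hv'b, hv'p, hv't.symm, ?_⟩
    rw [← (hgO z hz.1).1, ← hv't, ← cChart_coLegendre hL hv'p hv'A, cChart_symm_cChart hv'p]
  have hX0 : ∀ z ∈ Q, l (g z) = 0 → (hamField l g z).1 ≠ 0 := by
    intro z hz h0 h
    obtain ⟨v', hv'b, hv'p, hv't, -⟩ := hvec z hz h0
    have h1 : (g z).2 = 0 := h
    rw [hv't] at h1
    exact hv'b.2 ((toCoord_eq_zero_iff hv'p).1 h1)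
  -- lift a tangent vector by the submersion property, and read the lift in the chart
  have hsurj : ∀ z ∈ Q, l (g z) = 0 → ∀ η, ∃ w, fderiv ℝ (fun z => l (g z)) z w = 0 ∧
      fderiv ℝ f z w = η := by
    intro z hz h0 η
    have hb := (hP z hz.1).2 h0
    obtain ⟨c, hc, hc0, hcv⟩ := hπ.surjective ⟨_, hb⟩
      ⟨geodesicProj C ⟨_, hb⟩, ofCoord (E := F) n₀ (geodesicProj C ⟨_, hb⟩) η⟩ rfl
    have hcz : (c 0 : CotangentBundle E M) = (cChart x₀).symm z := by rw [hc0]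
    have hcp : (c 0 : CotangentBundle E M).proj ∈ (chartAt E x₀).source := by
      rw [hcz]; exact mem_cChart_source.1 ((cChart x₀).map_target hz.2.1)
    have hcz' : cChart x₀ (c 0 : CotangentBundle E M) = z := by
      rw [hcz]; exact (cChart x₀).right_inv hz.2.1
    obtain ⟨w, h1, h2, -⟩ := hRC.velocity hπ hc hcp (by rw [hcz']; exact hz)
    rw [hcz'] at h1 h2
    refine ⟨w, h1, h2.trans ?_⟩
    rw [hcv, hc0]
    exact toCoord_ofCoord (hproj z hz hb).1 η
  have hfconst : ∀ z ∈ Q, ∀ z' ∈ Q, ∀ v' v'', SameOrbit C L v' v'' →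
      (cChart x₀).symm z = coLegendre L v' → (cChart x₀).symm z' = coLegendre L v'' →
      f z' = f z := by
    intro z hz z' hz' v' v'' hvv h1 h2
    obtain ⟨hb1, hb2⟩ := SameOrbit.mem_boundary hL hC hs hvv
    have hm1 : (cChart x₀).symm z ∈ dualBoundary C := by
      rw [h1]; exact coLegendre_mem_dualBoundary hL hC hs hb1
    have hm2 : (cChart x₀).symm z' ∈ dualBoundary C := by
      rw [h2]; exact coLegendre_mem_dualBoundary hL hC hs hb2
    rw [(hproj z hz hm1).2, (hproj z' hz' hm2).2,
      geodesicProj_eq_of_sameOrbit hL hC hs hvv (u := ⟨_, hm1⟩) (u' := ⟨_, hm2⟩) h1 h2]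
  have hfd : ∀ z ∈ Q, HasFDerivAt f (fderiv ℝ f z) z := fun z hz =>
    ((hfs.contDiffAt (hQo.mem_nhds hz)).differentiableAt (by simp)).hasFDerivAt
  refine ⟨hQo, hHs, hfs, hfH, hX0, fun z hz h0 => ?_, fun z hz h0 => ?_, hsurj,
    fun z hz h0 => ?_, fun z hz h0 => ?_, fun z hz h0 => ?_⟩
  · intro h
    have hb := (hP z hz.1).2 h0
    refine ((mem_dualBoundary_iff hC).1 hb).1 ?_
    rw [show z = (z.1, z.2) from rfl, cChart_symm_apply (hT1 z hz.2.1), h]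
    rfl
  -- Euler's identity: the Liouville form is `-2L` on the Hamiltonian vector field
  · have h1 := congrArg Prod.snd (hgO z hz.1).1
    rw [← h1]
    change -(fderiv ℝ l (g z) (0, (g z).2)) = 0
    rw [hL.euler_local (hgO z hz.1).2]
    change -(2 * l (g z)) = 0
    rw [h0, mul_zero, neg_zero]
  -- integral curves of the Hamiltonian vector field are lifts of null geodesics
  · obtain ⟨v', hv'b, hv'p, hv't, hv'c⟩ := hvec z hz h0
    have hX := contDiffOn_hamField hU hlU hO hg hgO
    obtain ⟨δ, ε, hε, hδ0, hδ⟩ := exists_integral_curve hO hX hz.1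
    have h00 : (0 : ℝ) ∈ Ioo (-ε) ε := ⟨by linarith, hε⟩
    obtain ⟨n1, n2⟩ := isNullGeodesic_of_integral_curve hL hO hg hgO
      (contDiffOn_integral_curve hO hX hδ) hδ h00 (by rw [hδ0]; exact h0)
    set γ : ℝ → M := fun t => (extChartAt 𝓘(ℝ, E) x₀).symm (δ t).1 with hγ
    have hlift : ∀ t ∈ Ioo (-ε) ε, (cChart x₀).symm (δ t) =
        coLegendre L (velocity 𝓘(ℝ, E) γ t) := by
      intro t ht
      have h1 : cChart x₀ (coLegendre L (velocity 𝓘(ℝ, E) γ t)) = δ t := by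
        have h2 : (velocity 𝓘(ℝ, E) γ t).proj ∈ (chartAt E x₀).source := (n2 t ht).1
        rw [cChart_coLegendre hL h2 (hL.mem_of_boundary (n1.null t ht)).1]
        have h3 : tChart x₀ (velocity 𝓘(ℝ, E) γ t) = g (δ t) := (n2 t ht).2
        rw [h3, (hgO _ (hδ t ht).1).1]
      rw [← h1]
      exact cChart_symm_cChart (u := coLegendre L (velocity 𝓘(ℝ, E) γ t)) (n2 t ht).1
    have h1 := (hδ 0 h00).2
    have h2 : HasFDerivAt f (fderiv ℝ f z) (δ 0) := by rw [hδ0]; exact hfd z hz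
    rw [hδ0] at h1
    refine (h2.comp_hasDerivAt 0 h1).unique ((hasDerivAt_const 0 (f z)).congr_of_eventuallyEq ?_)
    filter_upwards [Ioo_mem_nhds h00.1 h00.2,
      h1.continuousAt.eventually (by rw [hδ0]; exact hQo.mem_nhds hz)] with t ht htQ
    have h3 := sameOrbit_of_isNullGeodesic hL hC n1 h00 ht one_pos one_pos
    rw [scale_one, scale_one] at h3
    exact hfconst z hz (δ t) htQ _ _ h3 (by rw [← hlift 0 h00, hδ0]) (hlift t ht)
  -- positive multiples of a covector have the same projection
  · obtain ⟨v', hv'b, hv'p, hv't, hv'c⟩ := hvec z hz h0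
    have hv'A := (hL.mem_of_boundary hv'b).1
    set δ : ℝ → E × (E →L[ℝ] ℝ) := fun r => (z.1, r • z.2) with hδ
    have hδ1 : δ 1 = z := by simp only [hδ, one_smul]
    have h1 : HasDerivAt δ (0, z.2) 1 := by
      refine (hasDerivAt_const 1 z.1).prodMk ?_
      simpa using (hasDerivAt_id (1 : ℝ)).smul_const z.2
    have h2 : HasFDerivAt f (fderiv ℝ f z) (δ 1) := by rw [hδ1]; exact hfd z hz
    refine (h2.comp_hasDerivAt 1 h1).unique ((hasDerivAt_const 1 (f z)).congr_of_eventuallyEq ?_)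
    filter_upwards [lt_mem_nhds (zero_lt_one' ℝ),
      h1.continuousAt.eventually (by rw [hδ1]; exact hQo.mem_nhds hz)] with r hr hrQ
    refine hfconst z hz (δ r) hrQ v' (scale r v') (sameOrbit_scale hL hC hs hv'b hr) hv'c ?_
    have h3 : cChart x₀ (coLegendre L (scale r v')) = δ r := by
      rw [hL.coLegendre_scale hv'A hr, cChart_apply hv'p]
      have h4 := cChart_eq (u := coLegendre L v') hv'p
      rw [← hv'c, (cChart x₀).right_inv hz.2.1] at h4
      rw [hδ]
      rw [hv'c] at h4
      simp only [h4]
      rfl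
    rw [← h3]
    exact cChart_symm_cChart (u := coLegendre L (scale r v')) hv'p
  -- the fibres of `f` in `H = 0` lie in the fibres of the projection
  · refine finrank_kerDiff_le (exists_fderiv_eq_of_surjective (hfH z hz) (hX0 z hz h0)
      (hsurj z hz h0)) hQo hfs hHs hz ((dimH_mono ?_).trans (dimH_geodesicProj_fibre_le hL hC hs x₀
        (geodesicProj C ⟨_, (hP z hz.1).2 h0⟩)))
    rintro z' ⟨hz', hfz', hHz'⟩
    have hb' := (hP z' hz'.1).2 (hHz'.trans h0)
    refine ⟨hT1 z' hz'.2.1, hb', ?_⟩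
    have h1 := hproj z' hz' hb'
    have h2 := hproj z hz ((hP z hz.1).2 h0)
    rw [h1.2, h2.2] at hfz'
    exact (extChartAt 𝓘(ℝ, F) n₀).injOn (by rw [extChartAt_source]; exact h1.1)
      (by rw [extChartAt_source]; exact h2.1) hfz'

end ReductionChart

/-! ### The one-forms induced by the Liouville form on the space of cone geodesics -/

section ProjForm

variable {E : Type*} [NormedAddCommGroup E] [NormedSpace ℝ E]
  {M : Type*} [TopologicalSpace M] [ChartedSpace E M] [IsManifold 𝓘(ℝ, E) ∞ M]
  {F : Type*} [NormedAddCommGroup F] [NormedSpace ℝ F]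
  {C A : Set (TangentBundle 𝓘(ℝ, E) M)} {L : TangentBundle 𝓘(ℝ, E) M → ℝ}
  [ChartedSpace F (GeodesicSpace C)] [IsManifold 𝓘(ℝ, F) ∞ (GeodesicSpace C)]

/-- The form `a` on the tangent space of the space of cone geodesics is the push-forward of the
Liouville form at `u ∈ ∂C*`. -/
def IsProjForm (C : Set (TangentBundle 𝓘(ℝ, E) M)) [ChartedSpace F (GeodesicSpace C)]
    (u : CotangentBundle E M) (a : F →L[ℝ] ℝ) : Prop :=
  ∀ c : ℝ → dualBoundary C, IsSmoothCurve c → (c 0 : CotangentBundle E M) = u →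
    a (vec (velocity 𝓘(ℝ, F) (geodesicProj C ∘ c) 0)) =
      liouville (velocity (cotangentModel E) (fun t => (c t : CotangentBundle E M)) 0)

variable (hπ : IsSubmersion (F := F) (geodesicProj C))
include hπ

/-- The projection is a submersion, so a push-forward is determined by its values on velocities. -/
theorem IsProjForm.unique {u : CotangentBundle E M} (hu : u ∈ dualBoundary C) {a a' : F →L[ℝ] ℝ}
    (ha : IsProjForm C u a) (ha' : IsProjForm C u a') : a = a' := by
  ext η
  obtain ⟨c, hc, hc0, hcv⟩ := hπ.surjective ⟨u, hu⟩ ⟨geodesicProj C ⟨u, hu⟩, η⟩ rfl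
  have hcu : (c 0 : CotangentBundle E M) = u := by rw [hc0]
  have h1 := (ha c hc hcu).trans (ha' c hc hcu).symm
  rw [hcv] at h1
  exact h1

/-- A push-forward in the charts is a push-forward. -/
theorem IsReductionChart.isProjForm {x₀ : M} {n₀ : GeodesicSpace C} {Q : Set (E × (E →L[ℝ] ℝ))}
    {H : E × (E →L[ℝ] ℝ) → ℝ} {f : E × (E →L[ℝ] ℝ) → F} (hR : IsReductionChart C x₀ n₀ Q H f)
    {z : E × (E →L[ℝ] ℝ)} (hz : z ∈ Q) {b : F →L[ℝ] ℝ} (hb : IsReducedForm H f z b)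
    (h : (cChart x₀).symm z ∈ dualBoundary C) :
    IsProjForm C ((cChart x₀).symm z)
      (b.comp (toCoord n₀ (geodesicProj C ⟨(cChart x₀).symm z, h⟩))) := by
  intro c hc hcz
  have hzt : z ∈ (cChart x₀ : PartialEquiv (CotangentBundle E M) _).target := by
    rw [cChart_target]; exact ⟨hR.mem_target z hz, mem_univ _⟩
  have hcz' : cChart x₀ (c 0 : CotangentBundle E M) = z := by
    rw [hcz]; exact (cChart x₀).right_inv hzt
  obtain ⟨w, h1, h2, h3⟩ := hR.velocity hπ hc
    (by rw [hcz]; exact mem_cChart_source.1 ((cChart x₀).map_target hzt)) (by rw [hcz']; exact hz)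
  rw [hcz'] at h1 h2 h3
  have h4 : c 0 = ⟨(cChart x₀).symm z, h⟩ := Subtype.ext hcz
  rw [h3, ← hb w h1, h2, h4]
  rfl

variable [FiniteDimensional ℝ E] [FiniteDimensional ℝ F]
variable (hL : IsLorentzFinslerMetric C A L) (hC : IsStronglyConvexConeStructure C)
  (hs : ∀ v ∈ A, v ∈ C ↔ L v ≤ 0)
include hL hC hs

omit [FiniteDimensional ℝ F] [ChartedSpace F (GeodesicSpace C)]
  [IsManifold 𝓘(ℝ, F) ∞ (GeodesicSpace C)] hπ in
theorem geodesicProj_scale {u : CotangentBundle E M} (hu : u ∈ dualBoundary C) {r : ℝ}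
    (hr : 0 < r) : covector u.proj (r • u.form) ∈ dualBoundary C ∧
      ∀ h : covector u.proj (r • u.form) ∈ dualBoundary C,
        geodesicProj C ⟨_, h⟩ = geodesicProj C ⟨u, hu⟩ := by
  obtain ⟨v, hv, rfl⟩ := exists_eq_coLegendre hL hC hs hu
  have h1 : covector (coLegendre L v).proj (r • (coLegendre L v).form) =
      coLegendre L (ConeStr.scale r v) :=
    (hL.coLegendre_scale (hL.mem_of_boundary hv).1 hr).symm
  refine ⟨?_, fun h => ?_⟩
  · rw [h1]
    exact coLegendre_mem_dualBoundary hL hC hs (scale_mem_boundary hC hv hr)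
  · exact (geodesicProj_eq_of_sameOrbit hL hC hs (sameOrbit_scale hL hC hs hv hr) rfl h1).symm

omit [IsManifold 𝓘(ℝ, F) ∞ (GeodesicSpace C)] hπ in
/-- The push-forward of the Liouville form scales with the covector: multiplication with `r` maps
`∂C*` to itself, preserves the projection, and multiplies the Liouville form with `r`. -/
theorem IsProjForm.scale {u : CotangentBundle E M} {a : F →L[ℝ] ℝ} (ha : IsProjForm C u a) {r : ℝ}
    (hr : 0 < r) : IsProjForm C (covector u.proj (r • u.form)) (r • a) := by
  intro c hc hc0
  have hri : 0 < r⁻¹ := inv_pos.2 hr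
  have hmem := fun t => geodesicProj_scale hL hC hs (c t).2 hri
  -- a curve at `r • u` is divided by `r` to obtain a curve at `u`
  set c' : ℝ → dualBoundary C := fun t => ⟨_, (hmem t).1⟩ with hc'
  have hc'c : geodesicProj C ∘ c' = geodesicProj C ∘ c := funext fun t => (hmem t).2 _
  have hcoord : ∀ {x₀ : M} (t : ℝ), (c t : CotangentBundle E M).proj ∈ (chartAt E x₀).source →
      cChart x₀ (c' t : CotangentBundle E M) = ((cChart x₀ (c t : CotangentBundle E M)).1,
        r⁻¹ • (cChart x₀ (c t : CotangentBundle E M)).2) := by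
    intro x₀ t ht
    rw [cChart_eq ht]
    exact cChart_apply ht (r⁻¹ • (c t : CotangentBundle E M).form)
  have hcont : ∀ t, ContinuousAt (fun s => (c s : CotangentBundle E M)) t :=
    fun t => hc.contMDiffAt.continuousAt
  have hsm : IsSmoothCurve c' := by
    intro t
    set x₀ := (c t : CotangentBundle E M).proj with hx₀
    have hp : (c t : CotangentBundle E M).proj ∈ (chartAt E x₀).source := mem_chart_source E _
    have h1 := hc.contDiffAt hp
    have h2 : ContDiffAt ℝ ∞ (fun s => ((cChart x₀ (c s : CotangentBundle E M)).1,
        r⁻¹ • (cChart x₀ (c s : CotangentBundle E M)).2)) t :=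
      h1.fst.prodMk (h1.snd.const_smul r⁻¹)
    have htar : ∀ s, (c s : CotangentBundle E M).proj ∈ (chartAt E x₀).source →
        cChart x₀ (c' s : CotangentBundle E M) ∈
          (cChart x₀ : PartialEquiv (CotangentBundle E M) _).target := fun s hs =>
      (cChart x₀).map_source (mem_cChart_source.2 hs)
    have hTo : IsOpen (cChart x₀ : PartialEquiv (CotangentBundle E M) _).target := by
      rw [cChart_target]; exact (isOpen_extChartAt_target x₀).prod isOpen_univ
    have h3 : ContMDiffAt 𝓘(ℝ, E × (E →L[ℝ] ℝ)) (cotangentModel E) ∞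
        (cChart x₀ : PartialEquiv (CotangentBundle E M) _).symm
        ((cChart x₀ (c t : CotangentBundle E M)).1,
          r⁻¹ • (cChart x₀ (c t : CotangentBundle E M)).2) := by
      rw [← hcoord t hp]
      exact (contMDiffOn_extChartAt_symm (I := cotangentModel E) (n := ∞)
        (⟨x₀, 0⟩ : CotangentBundle E M)).contMDiffAt (hTo.mem_nhds (htar t hp))
    refine (h3.comp t (contMDiffAt_iff_contDiffAt.2 h2)).congr_of_eventuallyEq ?_
    filter_upwards [(hcont t).eventually (eventually_proj_mem hp)] with s hs
    change (c' s : CotangentBundle E M) = (cChart x₀).symm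
      ((cChart x₀ (c s : CotangentBundle E M)).1, r⁻¹ • (cChart x₀ (c s : CotangentBundle E M)).2)
    rw [← hcoord s hs]
    exact (cChart_symm_cChart (u := (c' s : CotangentBundle E M)) hs).symm
  have h0 : (c' 0 : CotangentBundle E M) = u := by
    change covector (c 0 : CotangentBundle E M).proj (r⁻¹ • (c 0 : CotangentBundle E M).form) = u
    rw [hc0]
    change covector u.proj (r⁻¹ • r • u.form) = u
    rw [smul_smul, inv_mul_cancel₀ hr.ne', one_smul]
    rfl
  have h1 := ha c' hsm h0
  rw [hc'c] at h1
  have hp : (c 0 : CotangentBundle E M).proj ∈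
    (chartAt E (c 0 : CotangentBundle E M).proj).source := mem_chart_source E _
  set x₀ := (c 0 : CotangentBundle E M).proj with hx₀
  have e1 := liouville_velocity (c := fun t => (c t : CotangentBundle E M)) (t := 0) (x₀ := x₀)
    (hc.contMDiffAt.mdifferentiableAt (by simp)) hp
  have e2 := liouville_velocity (c := fun t => (c' t : CotangentBundle E M)) (t := 0) (x₀ := x₀)
    (hsm.contMDiffAt.mdifferentiableAt (by simp)) hp
  have e3 : (fun s => (cChart x₀ (c' s : CotangentBundle E M)).1) =ᶠ[𝓝 0]
      fun s => (cChart x₀ (c s : CotangentBundle E M)).1 := by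
    filter_upwards [(hcont 0).eventually (eventually_proj_mem hp)] with s hs
    rw [hcoord s hs]
  rw [e3.deriv_eq, hcoord 0 hp] at e2
  rw [e1]
  change r * a _ = _
  rw [h1, e2]
  change r * (r⁻¹ * _) = _
  rw [← mul_assoc, mul_inv_cancel₀ hr.ne', one_mul]
  rfl

/-- Every point of `∂C*` is covered by a reduction chart, since it is the Legendre transform of a
null vector. -/
theorem exists_isReductionChart' [T2Space M] {u : CotangentBundle E M} (hu : u ∈ dualBoundary C)
    {x₀ : M} {n₀ : GeodesicSpace C} (hp : u.proj ∈ (chartAt E x₀).source)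
    (hn : geodesicProj C ⟨u, hu⟩ ∈ (chartAt F n₀).source) :
    ∃ Q H X f, IsReductionChart (F := F) C x₀ n₀ Q H f ∧ IsReduction Q H X f ∧ cChart x₀ u ∈ Q := by
  obtain ⟨v, hv, rfl⟩ := exists_eq_coLegendre hL hC hs hu
  obtain ⟨Q, g, f, h1, h2, h3, -⟩ := exists_isReductionChart hL hC hs hπ hv hp hn
  exact ⟨Q, _, _, f, h1, h2, h3⟩

/-- The push-forward of the Liouville form is locally constant along the lift of a null geodesic: in
a reduction chart, the lift is an integral curve of the Hamiltonian vector field. -/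
theorem eventually_isProjForm_iff [T2Space M] {γ : ℝ → M} {a b t₀ : ℝ}
    (hγ : IsNullGeodesic C L γ a b) (ht₀ : t₀ ∈ Ioo a b) :
    ∀ᶠ t in 𝓝 t₀, ∀ θ : F →L[ℝ] ℝ, IsProjForm C (coLegendre L (velocity 𝓘(ℝ, E) γ t₀)) θ ↔
      IsProjForm C (coLegendre L (velocity 𝓘(ℝ, E) γ t)) θ := by
  set x₀ := γ t₀ with hx₀
  have hp : γ t₀ ∈ (chartAt E x₀).source := mem_chart_source E _
  have hb : ∀ t ∈ Ioo a b, coLegendre L (velocity 𝓘(ℝ, E) γ t) ∈ dualBoundary C := fun t ht =>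
    coLegendre_mem_dualBoundary hL hC hs (hγ.null t ht)
  set n₀ := geodesicProj C ⟨_, hb t₀ ht₀⟩ with hn₀
  have hconst : ∀ t (ht : t ∈ Ioo a b), geodesicProj C ⟨_, hb t ht⟩ = n₀ := fun t ht => by
    have h1 := sameOrbit_of_isNullGeodesic hL hC hγ ht₀ ht one_pos one_pos
    rw [scale_one, scale_one] at h1
    exact (geodesicProj_eq_of_sameOrbit hL hC hs h1 rfl rfl).symm
  obtain ⟨Q, g, f, hRC, hR, hQ, hinv⟩ := exists_isReductionChart (x₀ := x₀) (n₀ := n₀) hL hC hs hπ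
    (hγ.null t₀ ht₀) hp (mem_chart_source F n₀)
  set l := localLagrangian L x₀ with hl
  -- the lift of the geodesic in the chart
  set δ : ℝ → E × (E →L[ℝ] ℝ) := fun t => legendreMap l (localVelocity γ x₀ t) with hδ
  have hδc : ∀ t ∈ Ioo a b, γ t ∈ (chartAt E x₀).source →
      δ t = cChart x₀ (coLegendre L (velocity 𝓘(ℝ, E) γ t)) := fun t ht hpt =>
    (cChart_coLegendre hL (v := velocity 𝓘(ℝ, E) γ t) hpt
      (hL.mem_of_boundary (hγ.null t ht)).1).symm
  have hnear : ∀ᶠ t in 𝓝 t₀, t ∈ Ioo a b ∧ γ t ∈ (chartAt E x₀).source ∧ δ t ∈ Q ∧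
      g (δ t) = localVelocity γ x₀ t := by
    have h1 : ContinuousAt δ t₀ :=
      (contDiffAt_legendreMap_localVelocity hL hγ ht₀ hp).continuousAt
    filter_upwards [Ioo_mem_nhds ht₀.1 ht₀.2, (hγ.mdifferentiableAt ht₀).continuousAt.eventually
      ((chartAt E x₀).open_source.mem_nhds hp), h1.eventually (hR.isOpen.mem_nhds (by
        rw [hδc t₀ ht₀ hp]; exact hQ)),
      (continuousAt_localVelocity hγ.smooth ht₀ hp).eventually hinv] with t h1 h2 h3 h4
    exact ⟨h1, h2, h3, h4⟩
  have hsymm : ∀ t ∈ Ioo a b, γ t ∈ (chartAt E x₀).source →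
      (cChart x₀).symm (δ t) = coLegendre L (velocity 𝓘(ℝ, E) γ t) := fun t ht hpt => by
    rw [hδc t ht hpt]
    exact cChart_symm_cChart (u := coLegendre L (velocity 𝓘(ℝ, E) γ t)) hpt
  obtain ⟨ε, hε, hball⟩ := Metric.eventually_nhds_iff_ball.1 hnear
  rw [Real.ball_eq_Ioo] at hball
  set I := Ioo (t₀ - ε) (t₀ + ε) with hI
  have ht₀I : t₀ ∈ I := ⟨by linarith, by linarith⟩
  have hH : ∀ t ∈ I, l (g (δ t)) = 0 := fun t ht => by
    obtain ⟨h1, h2, h3, -⟩ := hball t ht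
    refine (hRC.mem_iff _ h3).1 ?_
    rw [hsymm t h1 h2]
    exact hb t h1
  have hder : ∀ t ∈ I, HasDerivAt δ (hamField l g (δ t)) t := fun t ht => by
    obtain ⟨h1, h2, -, h4⟩ := hball t ht
    rw [hamField, h4]
    exact hγ.hasDerivAt_lift h1 h2
  have hex : ∀ t, ∃ β : F →L[ℝ] ℝ, t ∈ I → IsReducedForm (fun z => l (g z)) f (δ t) β := by
    intro t
    by_cases ht : t ∈ I
    · obtain ⟨κ, σ, B, O, -, -, -, -, -, h1, -⟩ :=
        hR.exists_reducedForm (hball t ht).2.2.1 (hH t ht)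
      exact ⟨_, fun _ => (h1.self_of_nhds (hH t ht)).2⟩
    · exact ⟨0, fun h => absurd h ht⟩
  choose β hβ using hex
  have hβd : ∀ t ∈ I, HasDerivAt β 0 t := by
    intro t ht
    obtain ⟨β', h1, h2⟩ := hR.exists_hasDerivAt_reducedForm (hder t ht) (hball t ht).2.2.1
      (Filter.Eventually.mono (Ioo_mem_nhds ht.1 ht.2) fun s hs => hH s hs)
    refine h2.congr_of_eventuallyEq ?_
    filter_upwards [h1, Ioo_mem_nhds ht.1 ht.2] with s hs1 hs2
    exact hR.reducedForm_unique (hball s hs2).2.2.1 (hH s hs2) (hβ s hs2) hs1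
  have hβc : ∀ t ∈ I, β t = β t₀ := fun t ht =>
    isOpen_Ioo.is_const_of_deriv_eq_zero isPreconnected_Ioo
      (fun s hs => (hβd s hs).differentiableAt.differentiableWithinAt)
      (fun s hs => (hβd s hs).deriv) ht ht₀I
  have hform : ∀ t ∈ I, IsProjForm C (coLegendre L (velocity 𝓘(ℝ, E) γ t))
      ((β t₀).comp (toCoord n₀ n₀)) := by
    intro t ht
    obtain ⟨h1, h2, h3, -⟩ := hball t ht
    have h4 : (cChart x₀).symm (δ t) ∈ dualBoundary C := by rw [hsymm t h1 h2]; exact hb t h1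
    have h5 := hRC.isProjForm hπ h3 (hβ t ht) h4
    have h6 : geodesicProj C ⟨(cChart x₀).symm (δ t), h4⟩ = n₀ := by
      rw [← hconst t h1]
      congr 1
      exact Subtype.ext (hsymm t h1 h2)
    rwa [h6, hβc t ht, hsymm t h1 h2] at h5
  filter_upwards [Ioo_mem_nhds ht₀I.1 ht₀I.2] with t ht θ
  constructor
  · intro h
    rw [IsProjForm.unique hπ (hb t₀ ht₀) h (hform t₀ ht₀I)]
    exact hform t ht
  · intro h
    rw [IsProjForm.unique hπ (hb t (hball t ht).1) h (hform t ht)]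
    exact hform t₀ ht₀I

/-- The push-forwards of the Liouville form at two points of one cone geodesic are positive
multiples of each other. -/
theorem IsProjForm.exists_smul [T2Space M] {u u' : dualBoundary C}
    (h : geodesicProj C u = geodesicProj C u') {θ : F →L[ℝ] ℝ} (hθ : IsProjForm C u θ) :
    ∃ r : ℝ, 0 < r ∧ IsProjForm C u' (r • θ) := by
  obtain ⟨v, hv, huv⟩ := exists_eq_coLegendre hL hC hs u.2
  obtain ⟨v', hv', huv'⟩ := exists_eq_coLegendre hL hC hs u'.2
  obtain ⟨γ, a, b, t, r, h0, ht, hr, hγ, rfl, rfl⟩ :=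
    sameOrbit_of_geodesicProj_eq hL hC hs h hv hv' huv huv'
  have h1 : ∀ θ : F →L[ℝ] ℝ, IsProjForm C (coLegendre L (velocity 𝓘(ℝ, E) γ 0)) θ ↔
      IsProjForm C (coLegendre L (velocity 𝓘(ℝ, E) γ t)) θ :=
    isPreconnected_Ioo.induction₂ (fun t t' => ∀ θ : F →L[ℝ] ℝ,
      IsProjForm C (coLegendre L (velocity 𝓘(ℝ, E) γ t)) θ ↔
        IsProjForm C (coLegendre L (velocity 𝓘(ℝ, E) γ t')) θ)
      (fun _ hx => mem_nhdsWithin_of_mem_nhds (eventually_isProjForm_iff hπ hL hC hs hγ hx))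
      (fun _ _ _ _ _ _ h h' θ => (h θ).trans (h' θ)) (fun _ _ _ _ h θ => (h θ).symm) h0 ht
  refine ⟨r, hr, ?_⟩
  rw [huv', hL.coLegendre_scale (hL.mem_of_boundary (hγ.null t ht)).1 hr]
  rw [huv] at hθ
  exact IsProjForm.scale hL hC hs ((h1 θ).1 hθ) hr

end ProjForm

/-! ### Symplectic bases and the volume form -/

section Symplectic

/-- The standard symplectic form on the basis indexed by `ι × Fin 2`. -/
def stdSymplectic {ι : Type*} [DecidableEq ι] (i : ι) (s : Fin 2) (j : ι) (t : Fin 2) : ℝ :=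
  if i = j ∧ t = 1 + s then (if s = 0 then 1 else -1) else 0

variable {V : Type*} [AddCommGroup V] [Module ℝ V] [FiniteDimensional ℝ V]

/-- An alternating form that is nondegenerate on a subspace of dimension at least `2m` has `m`
orthogonal symplectic pairs in this subspace. -/
theorem exists_symplectic_pairs (B : V →ₗ[ℝ] V →ₗ[ℝ] ℝ) (hB : ∀ x, B x x = 0) (m : ℕ) :
    ∀ W : Submodule ℝ V, 2 * m ≤ Module.finrank ℝ W →
      (∀ x ∈ W, (∀ y ∈ W, B x y = 0) → x = 0) →
      ∃ w : Fin m → Fin 2 → V, (∀ i s, w i s ∈ W) ∧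
        ∀ i s j t, B (w i s) (w j t) = stdSymplectic i s j t := by
  have hneg : ∀ x y, B x y = -B y x := fun x y => by
    have h := hB (x + y)
    simp only [map_add, LinearMap.add_apply, hB] at h
    linarith
  induction m with
  | zero => exact fun W _ _ => ⟨fun i => i.elim0, fun i => i.elim0, fun i => i.elim0⟩
  | succ m ih =>
    intro W hW hnd
    obtain ⟨x, hx, hx0⟩ : ∃ x ∈ W, x ≠ 0 := by
      refine (Submodule.ne_bot_iff W).1 fun h => ?_
      rw [h, finrank_bot] at hW
      omega
    obtain ⟨y', hy', hxy'⟩ : ∃ y ∈ W, B x y ≠ 0 := by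
      by_contra! h
      exact hx0 (hnd x hx h)
    -- split off the hyperbolic pair `x`, `y`; the form is nondegenerate on the orthogonal
    -- complement `W'` of `x` and `y` in `W`
    set y := (B x y')⁻¹ • y' with hy
    have hyW : y ∈ W := W.smul_mem _ hy'
    have hxy : B x y = 1 := by rw [hy, map_smul, smul_eq_mul, inv_mul_cancel₀ hxy']
    have hyx : B y x = -1 := by rw [hneg, hxy]
    let T : W →ₗ[ℝ] ℝ × ℝ := ((B x).prod (B y)).comp W.subtype
    set W' : Submodule ℝ V := (LinearMap.ker T).map W.subtype with hW'
    have hmem : ∀ z, z ∈ W' ↔ z ∈ W ∧ B x z = 0 ∧ B y z = 0 := by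
      intro z
      rw [hW', Submodule.mem_map]
      constructor
      · rintro ⟨⟨z, hz⟩, hzT, rfl⟩
        exact ⟨hz, congrArg Prod.fst hzT, congrArg Prod.snd hzT⟩
      · rintro ⟨hz, h1, h2⟩
        exact ⟨⟨z, hz⟩, Prod.ext h1 h2, rfl⟩
    have hdim : 2 * m ≤ Module.finrank ℝ W' := by
      have h1 := LinearMap.finrank_range_add_finrank_ker T
      have h2 := Submodule.finrank_le (LinearMap.range T)
      rw [Module.finrank_prod, Module.finrank_self] at h2
      have h3 : Module.finrank ℝ W' = Module.finrank ℝ (LinearMap.ker T) :=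
        Submodule.finrank_map_subtype_eq W _
      omega
    obtain ⟨w, hwW, hw⟩ := ih W' hdim (by
      intro z hz hort
      obtain ⟨hzW, h1, h2⟩ := (hmem z).1 hz
      refine hnd z hzW fun u hu => ?_
      have h3 := hort (u - B x u • y + B y u • x) ((hmem _).2 ⟨W.add_mem (W.sub_mem hu
        (W.smul_mem _ hyW)) (W.smul_mem _ hx), by simp [hxy, hB], by simp [hyx, hB]⟩)
      have h4 : B z y = 0 := by rw [hneg, h2, neg_zero]
      have h5 : B z x = 0 := by rw [hneg, h1, neg_zero]
      clear_value y
      simpa [h4, h5] using h3)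
    refine ⟨Fin.cons ![x, y] w, fun i s => ?_, fun i s j t => ?_⟩
    · refine Fin.cases ?_ (fun i => ?_) i
      · fin_cases s
        · exact hx
        · exact hyW
      · exact ((hmem _).1 (hwW i s)).1
    · refine Fin.cases ?_ (fun i => ?_) i <;> refine Fin.cases ?_ (fun j => ?_) j
      · fin_cases s <;> fin_cases t <;> simp [stdSymplectic, hB, hxy, hyx]
      · have h1 := (hmem _).1 (hwW j t)
        have h2 : (0 : Fin (m + 1)) ≠ j.succ := (Fin.succ_ne_zero j).symm
        fin_cases s <;> simp [stdSymplectic, h1.2.1, h1.2.2, h2]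
      · have h1 := (hmem _).1 (hwW i s)
        have h2 : i.succ ≠ (0 : Fin (m + 1)) := Fin.succ_ne_zero i
        rw [hneg]
        fin_cases t <;> simp [stdSymplectic, h1.2.1, h1.2.2, h2]
      · rw [Fin.cons_succ, Fin.cons_succ, hw]
        simp [stdSymplectic]

/-- The positions of the arguments of `wedgePow`: the argument of the one-form, and the pairs of
arguments of the two-forms. -/
def wedgeIndex (m : ℕ) : Option (Fin m × Fin 2) → Fin (2 * m + 1)
  | none => 0
  | some (i, s) => ⟨2 * i + 1 + s, by omega⟩

theorem wedgeIndex_bijective (m : ℕ) : Function.Bijective (wedgeIndex m) := by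
  refine (Fintype.bijective_iff_injective_and_card _).2 ⟨?_, by simp; ring⟩
  rintro (_ | ⟨i, s⟩) (_ | ⟨j, t⟩) h
  · rfl
  · have := congrArg Fin.val h
    simp only [wedgeIndex, Fin.val_zero] at this
    omega
  · have := congrArg Fin.val h
    simp only [wedgeIndex, Fin.val_zero] at this
    omega
  · have h1 := congrArg Fin.val h
    simp only [wedgeIndex] at h1
    have h2 : i = j := Fin.ext (by omega)
    have h3 : s = t := Fin.ext (by subst h2; omega)
    rw [h2, h3]

/-- A permutation that contributes to `wedgePow` on a symplectic basis permutes the symplectic pairs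
and flips some of them; as permuting pairs is even, its sign is the product of the signs of the
flips. -/
theorem sign_mul_prod_stdSymplectic {m : ℕ} (σ : Equiv.Perm (Option (Fin m × Fin 2)))
    (hσ : σ none = none) {p q : Fin m → Fin m × Fin 2} (hp : ∀ i, σ (some (i, 0)) = some (p i))
    (hq : ∀ i, σ (some (i, 1)) = some (q i)) :
    0 ≤ ((Equiv.Perm.sign σ : ℤ) : ℝ) *
      ∏ i, stdSymplectic (p i).1 (p i).2 (q i).1 (q i).2 := by
  -- otherwise the permutation separates a symplectic pair, and the product vanishes
  by_cases h : ∀ i, (p i).1 = (q i).1 ∧ (q i).2 = 1 + (p i).2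
  swap
  · push Not at h
    obtain ⟨i, hi⟩ := h
    rw [Finset.prod_eq_zero (Finset.mem_univ i) (if_neg fun h => hi h.1 h.2), mul_zero]
  have hσp : ∀ i x, σ (some (i, x)) = some ((p i).1, x + (p i).2) := by
    intro i x
    fin_cases x
    · change σ (some (i, 0)) = _
      rw [hp]; simp
    · change σ (some (i, 1)) = _
      rw [hq]
      change _ = some ((p i).1, 1 + (p i).2)
      rw [← (h i).2, (h i).1]
  have hinj : Function.Injective fun i => (p i).1 := by
    intro i i' hii
    have h1 : σ (some (i, 0)) = σ (some (i', (p i).2 - (p i').2)) := by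
      rw [hσp, hσp, zero_add, sub_add_cancel]
      exact congrArg (fun j => some (j, (p i).2)) hii
    exact congrArg Prod.fst (Option.some_injective _ (σ.injective h1))
  let τ : Equiv.Perm (Fin m) := Equiv.ofBijective _ (Finite.injective_iff_bijective.1 hinj)
  let P : Equiv.Perm (Fin m × Fin 2) :=
    (Equiv.prodCongrRight fun i => Equiv.addRight (p i).2).trans (Equiv.prodCongrLeft fun _ => τ)
  have hσP : σ = Equiv.optionCongr P := by
    ext1 o
    rcases o with _ | ⟨i, x⟩
    · exact hσ
    · rw [hσp]; rfl
  have hadd : ∀ s : Fin 2, Equiv.Perm.sign (Equiv.addRight s) = if s = 0 then 1 else -1 := by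
    decide
  have hsign : Equiv.Perm.sign σ = ∏ i, if (p i).2 = 0 then (1 : ℤˣ) else -1 := by
    rw [hσP, Equiv.optionCongr_sign, Equiv.Perm.sign_trans, Equiv.Perm.sign_prodCongrLeft,
      Equiv.Perm.sign_prodCongrRight, Fin.prod_univ_two, Int.units_mul_self, one_mul]
    exact Finset.prod_congr rfl fun i _ => hadd _
  have hprod : ∏ i, stdSymplectic (p i).1 (p i).2 (q i).1 (q i).2 =
      ∏ i, if (p i).2 = 0 then (1 : ℝ) else -1 :=
    Finset.prod_congr rfl fun i _ => if_pos (h i)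
  have hcast : ((Equiv.Perm.sign σ : ℤ) : ℝ) = ∏ i, if (p i).2 = 0 then (1 : ℝ) else -1 := by
    rw [hsign, Units.coe_prod, Int.cast_prod]
    refine Finset.prod_congr rfl fun i _ => ?_
    split_ifs <;> simp
  rw [hprod, hcast]
  exact mul_self_nonneg _

/-- If `b` is nondegenerate on the kernel of `a ≠ 0`, then `a ∧ b^m` is a volume form: on a vector
complementary to `ker a` and a symplectic basis of `ker a`, all terms are nonnegative. -/
theorem exists_wedgePow_ne_zero {m : ℕ} (hm : Module.finrank ℝ V = 2 * m + 1) (a : V →ₗ[ℝ] ℝ)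
    (ha : a ≠ 0) (B : V →ₗ[ℝ] V →ₗ[ℝ] ℝ) (hB : ∀ x, B x x = 0)
    (hnd : ∀ x, a x = 0 → (∀ y, a y = 0 → B x y = 0) → x = 0) :
    ∃ v : Fin (2 * m + 1) → V, wedgePow m (fun x => a x) (fun x y => B x y) v ≠ 0 := by
  obtain ⟨r, hr⟩ : ∃ r, a r ≠ 0 := by
    by_contra! h
    exact ha (LinearMap.ext h)
  set R := (a r)⁻¹ • r with hR
  have haR : a R = 1 := by rw [hR, map_smul, smul_eq_mul, inv_mul_cancel₀ hr]
  have hker : 2 * m ≤ Module.finrank ℝ (LinearMap.ker a) := by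
    have h1 := LinearMap.finrank_range_add_finrank_ker a
    have h2 := Submodule.finrank_le (LinearMap.range a)
    rw [Module.finrank_self] at h2
    omega
  obtain ⟨w, hwa, hw⟩ := exists_symplectic_pairs B hB m (LinearMap.ker a) hker hnd
  let e : Option (Fin m × Fin 2) ≃ Fin (2 * m + 1) := Equiv.ofBijective _ (wedgeIndex_bijective m)
  let u : Option (Fin m × Fin 2) → V := fun o => o.elim R fun q => w q.1 q.2
  have hterm : ∀ σ : Equiv.Perm (Fin (2 * m + 1)), ∀ o, (u ∘ e.symm) (σ (e o)) =
      u (((e.trans σ).trans e.symm) o) := fun σ o => rfl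
  have hodd : ∀ i : Fin m, (⟨2 * i + 1, by omega⟩ : Fin (2 * m + 1)) = e (some (i, 0)) :=
    fun i => rfl
  have heven : ∀ i : Fin m, (⟨2 * i + 2, by omega⟩ : Fin (2 * m + 1)) = e (some (i, 1)) :=
    fun i => rfl
  have hzero : (0 : Fin (2 * m + 1)) = e none := rfl
  refine ⟨u ∘ e.symm, ne_of_gt ?_⟩
  rw [wedgePow]
  refine Finset.sum_pos' (fun σ _ => ?_) ⟨1, Finset.mem_univ _, ?_⟩
  -- only the permutations that fix the argument of `a` contribute, as `a` vanishes on the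
  -- symplectic basis; the term of the identity is positive
  · set σ' : Equiv.Perm (Option (Fin m × Fin 2)) := (e.trans σ).trans e.symm with hσ'
    have hsign : Equiv.Perm.sign σ' = Equiv.Perm.sign σ :=
      Equiv.Perm.sign_trans_trans_symm σ e
    simp only [hodd, heven, hzero, hterm]
    rw [← hσ', ← hsign]
    rcases hn : σ' none with _ | q
    · have hsome : ∀ q, ∃ q', σ' (some q) = some q' := by
        intro q
        refine Option.ne_none_iff_exists'.1 fun h => ?_
        exact Option.some_ne_none q (σ'.injective (h.trans hn.symm))
      choose g hg using hsome
      simp only [hg]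
      have h1 : ∀ i, B (u (some (g (i, 0)))) (u (some (g (i, 1)))) =
          stdSymplectic (g (i, 0)).1 (g (i, 0)).2 (g (i, 1)).1 (g (i, 1)).2 := fun i => hw _ _ _ _
      simp only [h1]
      have h2 : a (u none) = 1 := haR
      rw [h2, mul_one]
      exact sign_mul_prod_stdSymplectic σ' hn (p := fun i => g (i, 0)) (q := fun i => g (i, 1))
        (fun i => hg _) (fun i => hg _)
    · have h1 : a (u (some q)) = 0 := hwa q.1 q.2
      rw [h1, mul_zero, zero_mul]
  · have h1 : ∀ i : Fin m, B (u (some (i, 0))) (u (some (i, 1))) = 1 := fun i => by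
      change B (w i 0) (w i 1) = 1
      rw [hw]
      simp [stdSymplectic]
    have h2 : ∀ o, (u ∘ e.symm) ((1 : Equiv.Perm (Fin (2 * m + 1))) (e o)) = u o := fun o => by
      simp
    have h3 : a (u none) = 1 := haR
    simp only [hodd, heven, hzero, h2, h1, h3]
    simp

end Symplectic

/-! ### The one-form on the space of cone geodesics -/

section GlobalForm

variable {E : Type*} [NormedAddCommGroup E] [NormedSpace ℝ E] [FiniteDimensional ℝ E]
  {M : Type*} [TopologicalSpace M] [ChartedSpace E M] [IsManifold 𝓘(ℝ, E) ∞ M]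
  {F : Type*} [NormedAddCommGroup F] [NormedSpace ℝ F] [FiniteDimensional ℝ F]
  {C A : Set (TangentBundle 𝓘(ℝ, E) M)} {L : TangentBundle 𝓘(ℝ, E) M → ℝ}
  [ChartedSpace F (GeodesicSpace C)]

omit [FiniteDimensional ℝ E] in
theorem continuous_geodesicProj (C : Set (TangentBundle 𝓘(ℝ, E) M)) :
    Continuous (geodesicProj C) := continuous_quot_mk

omit [FiniteDimensional ℝ E] in
theorem geodesicProj_surjective (C : Set (TangentBundle 𝓘(ℝ, E) M)) :
    Function.Surjective (geodesicProj C) := Quot.exists_rep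

/-- The charts of the cotangent bundle are indexed by those of `M`, so countably many suffice. -/
theorem secondCountableTopology_cotangentBundle [SecondCountableTopology M] :
    SecondCountableTopology (CotangentBundle E M) := by
  have hE : ProperSpace E := FiniteDimensional.proper ℝ E
  have hE' : ProperSpace (E →L[ℝ] ℝ) := FiniteDimensional.proper ℝ _
  have : SecondCountableTopology (ModelProd E (E →L[ℝ] ℝ)) :=
    inferInstanceAs (SecondCountableTopology (E × (E →L[ℝ] ℝ)))
  obtain ⟨s, hs, hsM⟩ :=
    TopologicalSpace.countable_cover_nhds fun x : M => chart_source_mem_nhds E x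
  refine ChartedSpace.secondCountable_of_countable_cover (ModelProd E (E →L[ℝ] ℝ))
    (s := (fun x => (⟨x, 0⟩ : CotangentBundle E M)) '' s) ?_ (hs.image _)
  refine eq_univ_of_forall fun u => ?_
  obtain ⟨x, hx, hux⟩ := mem_iUnion₂.1 (hsM.symm ▸ mem_univ u.proj)
  refine mem_iUnion₂.2 ⟨_, mem_image_of_mem _ hx, ?_⟩
  have h1 := (mem_cChart_source (u := u)).2 hux
  rwa [cChart, extChartAt_source] at h1

/-- The space of cone geodesics is a Lindelöf space, hence second countable if it is a manifold. -/
theorem secondCountableTopology_geodesicSpace (F : Type*) [NormedAddCommGroup F] [NormedSpace ℝ F]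
    [FiniteDimensional ℝ F] [ChartedSpace F (GeodesicSpace C)] [SecondCountableTopology M] :
    SecondCountableTopology (GeodesicSpace C) := by
  have hF : ProperSpace F := FiniteDimensional.proper ℝ F
  have := secondCountableTopology_cotangentBundle (E := E) (M := M)
  have : LindelofSpace (GeodesicSpace C) := by
    refine ⟨?_⟩
    rw [← (geodesicProj_surjective C).range_eq]
    exact isLindelof_range (continuous_geodesicProj C)
  obtain ⟨s, hs, hsN⟩ := _root_.countable_cover_nhds
    (X := GeodesicSpace C) fun x : GeodesicSpace C => chart_source_mem_nhds F x
  exact ChartedSpace.secondCountable_of_countable_cover F hsN hs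

variable [IsManifold 𝓘(ℝ, F) ∞ (GeodesicSpace C)]
variable (hπ : IsSubmersion (F := F) (geodesicProj C))
  (hL : IsLorentzFinslerMetric C A L) (hC : IsStronglyConvexConeStructure C)
  (hs : ∀ v ∈ A, v ∈ C ↔ L v ≤ 0)
include hπ hL hC hs

/-- Near each point, the space of cone geodesics carries a smooth one-form that is at each point a
push-forward of the Liouville form; its differential is nondegenerate on its kernel. -/
theorem exists_local_projForm [T2Space M] (n₀ : GeodesicSpace C) :
    ∃ (V : Set F) (b : F → F →L[ℝ] ℝ), IsOpen V ∧ extChartAt 𝓘(ℝ, F) n₀ n₀ ∈ V ∧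
      V ⊆ (extChartAt 𝓘(ℝ, F) n₀).target ∧ ContDiffOn ℝ ∞ b V ∧
      (∀ y ∈ V, ∃ u : dualBoundary C, geodesicProj C u = (extChartAt 𝓘(ℝ, F) n₀).symm y ∧
        IsProjForm C u ((b y).comp (toCoord n₀ ((extChartAt 𝓘(ℝ, F) n₀).symm y)))) ∧
      b (extChartAt 𝓘(ℝ, F) n₀ n₀) ≠ 0 ∧
      (∀ η, b (extChartAt 𝓘(ℝ, F) n₀ n₀) η = 0 →
        (∀ η', b (extChartAt 𝓘(ℝ, F) n₀ n₀) η' = 0 →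
          fderiv ℝ b (extChartAt 𝓘(ℝ, F) n₀ n₀) η η' -
            fderiv ℝ b (extChartAt 𝓘(ℝ, F) n₀ n₀) η' η = 0) → η = 0) ∧
      Module.finrank ℝ F + 3 = 2 * Module.finrank ℝ E := by
  obtain ⟨u, rfl⟩ := geodesicProj_surjective C n₀
  have hp : (u : CotangentBundle E M).proj ∈
      (chartAt E (u : CotangentBundle E M).proj).source := mem_chart_source E _
  obtain ⟨Q, H, X, f, hRC, hR, hQ⟩ := exists_isReductionChart' hπ hL hC hs u.2 hp
    (mem_chart_source F (geodesicProj C u))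
  have hsymm := cChart_symm_cChart hp
  set x₀ := (u : CotangentBundle E M).proj
  set z₀ := cChart x₀ (u : CotangentBundle E M)
  have hb : (cChart x₀).symm z₀ ∈ dualBoundary C := by rw [hsymm]; exact u.2
  have h0 := (hRC.mem_iff _ hQ).1 hb
  have hfz : f z₀ = extChartAt 𝓘(ℝ, F) (geodesicProj C u) (geodesicProj C u) := by
    rw [(hRC.proj z₀ hQ hb).2]
    congr 2
    exact Subtype.ext hsymm
  -- the form is the push-forward along the section of `f` with constant fibre parameter `κ z₀`
  obtain ⟨κ, σ, B, O, hO, hzO, -, hB, hσO, -, -, hnd⟩ := hR.exists_reducedForm hQ h0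
  rw [hfz] at hzO hnd
  have hι : ∀ y : F, HasFDerivAt (fun y => (y, κ z₀)) (ContinuousLinearMap.inl ℝ F _) y :=
    fun y => hasFDerivAt_prodMk_left y (κ z₀)
  have hder : fderiv ℝ (fun y => B (y, κ z₀))
      (extChartAt 𝓘(ℝ, F) (geodesicProj C u) (geodesicProj C u)) =
      (fderiv ℝ B (extChartAt 𝓘(ℝ, F) (geodesicProj C u) (geodesicProj C u), κ z₀)).comp
        (ContinuousLinearMap.inl ℝ F _) :=
    (((hB.contDiffAt (hO.mem_nhds hzO)).differentiableAt (by simp)).hasFDerivAt.comp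
      (f := fun y => (y, κ z₀)) _ (hι _)).fderiv
  have hι' : ContDiff ℝ ∞ fun y : F => (y, κ z₀) := contDiff_id.prodMk contDiff_const
  -- the section `y ↦ σ (y, κ z₀)` of the projection meets one covector over every point near `n₀`
  have key : ∀ y, (y, κ z₀) ∈ O → y ∈ (extChartAt 𝓘(ℝ, F) (geodesicProj C u)).target ∧
      ∃ u' : dualBoundary C,
        geodesicProj C u' = (extChartAt 𝓘(ℝ, F) (geodesicProj C u)).symm y ∧
        IsProjForm C u' ((B (y, κ z₀)).comp
          (toCoord (geodesicProj C u) ((extChartAt 𝓘(ℝ, F) (geodesicProj C u)).symm y))) := by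
    intro y hy
    obtain ⟨h1, h2, h3, h4⟩ := hσO _ hy
    have hb' := (hRC.mem_iff _ h3).2 h2
    obtain ⟨h5, h6⟩ := hRC.proj _ h3 hb'
    have h7 : geodesicProj C ⟨_, hb'⟩ ∈ (extChartAt 𝓘(ℝ, F) (geodesicProj C u)).source := by
      rwa [extChartAt_source]
    have h8 : (extChartAt 𝓘(ℝ, F) (geodesicProj C u)).symm y = geodesicProj C ⟨_, hb'⟩ := by
      rw [← (extChartAt 𝓘(ℝ, F) (geodesicProj C u)).left_inv h7, ← h6, h1]
    refine ⟨?_, ⟨_, hb'⟩, h8.symm, ?_⟩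
    · have h9 : y = f (σ (y, κ z₀)) := h1.symm
      rw [h9, h6]
      exact (extChartAt 𝓘(ℝ, F) (geodesicProj C u)).map_source h7
    · rw [h8]
      exact hRC.isProjForm hπ h3 h4 hb'
  refine ⟨(fun y => (y, κ z₀)) ⁻¹' O, fun y => B (y, κ z₀), hO.preimage hι'.continuous, hzO,
    fun y hy => (key y hy).1, hB.comp hι'.contDiffOn fun y hy => hy,
    fun y hy => (key y hy).2, ?_, ?_, hR.finrank_eq hQ h0⟩
  · obtain ⟨-, h2, h3, h4⟩ := hσO _ hzO
    exact hR.reducedForm_ne_zero h3 h2 h4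
  · rw [hder]
    exact hnd

/-- The push-forwards of the Liouville form to one point of the space of cone geodesics form an open
ray, so they form a convex set. -/
theorem convex_projForm [T2Space M] (x : GeodesicSpace C) :
    Convex ℝ {a : F →L[ℝ] ℝ |
      ∃ u : dualBoundary C, geodesicProj C u = x ∧ IsProjForm (F := F) C u a} := by
  rintro a ⟨u, rfl, ha⟩ a' ⟨u', hu', ha'⟩ s t hs0 ht0 hst
  obtain ⟨r, hr, har⟩ := IsProjForm.exists_smul hπ hL hC hs hu'.symm ha
  obtain rfl := ha'.unique hπ u'.2 har
  have hpos : 0 < s + t * r := by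
    rcases hs0.eq_or_lt with h | h
    · have : t = 1 := by linarith
      rw [← h, this]; linarith
    · positivity
  obtain ⟨h1, h2⟩ := geodesicProj_scale hL hC hs u.2 hpos
  refine ⟨⟨_, h1⟩, h2 h1, ?_⟩
  rw [smul_smul, ← add_smul]
  exact ha.scale hL hC hs hpos

/-- A smooth global choice of push-forwards of the Liouville form, by a partition of unity. -/
theorem exists_global_projForm [T2Space M] [SecondCountableTopology M] [T2Space (GeodesicSpace C)] :
    ∃ α : ∀ x : GeodesicSpace C, TangentSpace 𝓘(ℝ, F) x →L[ℝ] ℝ,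
      ContMDiff 𝓘(ℝ, F) (cotangentModel F) ∞
        (fun x => (⟨x, α x⟩ : CotangentBundle F (GeodesicSpace C))) ∧
      ∀ x, ∃ u : dualBoundary C, geodesicProj C u = x ∧ IsProjForm (F := F) C u (α x) := by
  have hF : ProperSpace F := FiniteDimensional.proper ℝ F
  have := secondCountableTopology_geodesicSpace (C := C) F
  have : LocallyCompactSpace (GeodesicSpace C) := ChartedSpace.locallyCompactSpace F _
  obtain ⟨α, hα⟩ := exists_contMDiffSection_forall_mem_convex_of_local (n := ⊤) 𝓘(ℝ, F)
    (fun x : GeodesicSpace C => TangentSpace 𝓘(ℝ, F) x →L[ℝ] Trivial (GeodesicSpace C) ℝ x)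
    (fun x => {a | ∃ u : dualBoundary C, geodesicProj C u = x ∧ IsProjForm (F := F) C u a})
    (fun x => convex_projForm hπ hL hC hs x) (fun n₀ => by
      obtain ⟨V, b, hV, hn, hVt, hb, hbV, -⟩ := exists_local_projForm hπ hL hC hs n₀
      have hU : IsOpen ((extChartAt 𝓘(ℝ, F) n₀).source ∩ extChartAt 𝓘(ℝ, F) n₀ ⁻¹' V) :=
        (continuousOn_extChartAt n₀).isOpen_inter_preimage (isOpen_extChartAt_source n₀) hV
      refine ⟨(extChartAt 𝓘(ℝ, F) n₀).source ∩ extChartAt 𝓘(ℝ, F) n₀ ⁻¹' V,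
        hU.mem_nhds ⟨mem_extChartAt_source n₀, hn⟩,
        fun x => (b (extChartAt 𝓘(ℝ, F) n₀ x)).comp (toCoord (E := F) n₀ x), ?_, ?_⟩
      · have h1 : ContMDiffOn 𝓘(ℝ, F) 𝓘(ℝ, F × (F →L[ℝ] ℝ)) ∞
            (fun x => (extChartAt 𝓘(ℝ, F) n₀ x, b (extChartAt 𝓘(ℝ, F) n₀ x)))
            ((extChartAt 𝓘(ℝ, F) n₀).source ∩ extChartAt 𝓘(ℝ, F) n₀ ⁻¹' V) := by
          have h2 : ContMDiffOn 𝓘(ℝ, F) 𝓘(ℝ, F × (F →L[ℝ] ℝ)) ∞ (fun y => (y, b y)) V :=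
            contMDiffOn_iff_contDiffOn.2 (contDiffOn_id.prodMk hb)
          refine h2.comp (t := V)
            ((contMDiffOn_extChartAt (I := 𝓘(ℝ, F)) (n := ∞) (x := n₀)).mono ?_)
            fun x hx => hx.2
          rw [extChartAt_source]; exact inter_subset_left
        have h3 := (contMDiffOn_extChartAt_symm (I := cotangentModel F) (n := ∞)
          (⟨n₀, 0⟩ : CotangentBundle F (GeodesicSpace C))).comp h1 (fun x hx => by
            change _ ∈ (cChart n₀ : PartialEquiv (CotangentBundle F (GeodesicSpace C)) _).target
            rw [cChart_target]
            exact ⟨(extChartAt 𝓘(ℝ, F) n₀).map_source hx.1, mem_univ _⟩)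
        refine h3.congr fun x hx => ?_
        have h4 := cChart_symm_apply ((extChartAt 𝓘(ℝ, F) n₀).map_source hx.1)
          (b (extChartAt 𝓘(ℝ, F) n₀ x))
        rw [(extChartAt 𝓘(ℝ, F) n₀).left_inv hx.1] at h4
        exact h4.symm
      · rintro x ⟨hx, hxV⟩
        obtain ⟨u, hu, hu'⟩ := hbV _ hxV
        rw [(extChartAt 𝓘(ℝ, F) n₀).left_inv hx] at hu hu'
        exact ⟨u, hu, hu'⟩)
  exact ⟨fun x => α x, α.contMDiff, hα⟩

end GlobalForm

/-! ### The contact condition -/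

section ContactCondition

/-- Nondegeneracy of the differential on the kernel is invariant under multiplication of a one-form
with positive functions. -/
theorem nondegenerate_of_eventually_smul {F : Type*} [NormedAddCommGroup F] [NormedSpace ℝ F]
    {a b : F → F →L[ℝ] ℝ} {y₀ : F} (ha : DifferentiableAt ℝ a y₀) (hb : DifferentiableAt ℝ b y₀)
    (h : ∀ᶠ y in 𝓝 y₀, ∃ r : ℝ, 0 < r ∧ a y = r • b y) (h0 : b y₀ ≠ 0)
    (hnd : ∀ η, b y₀ η = 0 →
      (∀ η', b y₀ η' = 0 → fderiv ℝ b y₀ η η' - fderiv ℝ b y₀ η' η = 0) → η = 0) :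
    a y₀ ≠ 0 ∧ ∀ η, a y₀ η = 0 →
      (∀ η', a y₀ η' = 0 → fderiv ℝ a y₀ η η' - fderiv ℝ a y₀ η' η = 0) → η = 0 := by
  obtain ⟨e, he⟩ : ∃ e, b y₀ e ≠ 0 := by
    by_contra! h1
    exact h0 (ContinuousLinearMap.ext h1)
  have hae : DifferentiableAt ℝ (fun y => a y e) y₀ := ha.clm_apply (differentiableAt_const e)
  have hbe : DifferentiableAt ℝ (fun y => b y e) y₀ := hb.clm_apply (differentiableAt_const e)
  have hρ : DifferentiableAt ℝ (fun y => a y e / b y e) y₀ := by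
    simpa only [div_eq_mul_inv] using hae.fun_mul (hbe.fun_inv he)
  have heq : a =ᶠ[𝓝 y₀] fun y => (a y e / b y e) • b y := by
    filter_upwards [h, hbe.continuousAt.eventually_ne he]
    rintro y ⟨r, -, hr⟩ hy
    have h1 : a y e / b y e = r := by
      rw [hr, _root_.smul_apply, smul_eq_mul, mul_div_cancel_right₀ _ hy]
    rw [h1, hr]
  obtain ⟨r, hr, har⟩ := h.self_of_nhds
  have h1 : a y₀ e / b y₀ e = r := by
    rw [har, _root_.smul_apply, smul_eq_mul, mul_div_cancel_right₀ _ he]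
  have hker : ∀ η, a y₀ η = 0 ↔ b y₀ η = 0 := fun η => by
    rw [har, _root_.smul_apply, smul_eq_mul, mul_eq_zero, or_iff_right hr.ne']
  -- the derivative of the factor does not contribute on the kernel of `b y₀`
  have hder : ∀ η η', b y₀ η' = 0 → fderiv ℝ a y₀ η η' = r * fderiv ℝ b y₀ η η' := by
    intro η η' hη'
    rw [heq.fderiv_eq, (hρ.hasFDerivAt.fun_smul hb.hasFDerivAt).fderiv, h1]
    simp [hη']
  refine ⟨fun h2 => he ((hker e).1 (by rw [h2]; rfl)), fun η hη h2 => hnd η ((hker η).1 hη) ?_⟩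
  intro η' hη'
  have h3 := h2 η' ((hker η').2 hη')
  rw [hder η η' hη', hder η' η ((hker η).1 hη), ← mul_sub] at h3
  exact (mul_eq_zero.1 h3).resolve_left hr.ne'

variable {F : Type*} [NormedAddCommGroup F] [NormedSpace ℝ F]
  {N : Type*} [TopologicalSpace N] [ChartedSpace F N] [IsManifold 𝓘(ℝ, F) ∞ N]

/-- The local expression of a one-form in terms of the coordinate change of the tangent bundle. -/
theorem localForm_eq (α : ∀ x : N, TangentSpace 𝓘(ℝ, F) x →L[ℝ] ℝ) {x₀ : N} {y : F}
    (hy : y ∈ (extChartAt 𝓘(ℝ, F) x₀).target) :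
    localForm α x₀ y = (α ((extChartAt 𝓘(ℝ, F) x₀).symm y)).comp
      (ofCoord (E := F) x₀ ((extChartAt 𝓘(ℝ, F) x₀).symm y)) := by
  have hs := symm_mem_source hy
  have h1 := (TangentBundle.symmL_trivializationAt (I := 𝓘(ℝ, F)) hs).symm.trans
    (TangentBundle.symmL_trivializationAt_eq_core hs)
  rw [(extChartAt 𝓘(ℝ, F) x₀).right_inv hy, ModelWithCorners.range_eq_univ,
    mfderivWithin_univ] at h1
  exact congrArg (fun l => (α ((extChartAt 𝓘(ℝ, F) x₀).symm y)).comp l) h1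

theorem localForm_self (α : ∀ x : N, TangentSpace 𝓘(ℝ, F) x →L[ℝ] ℝ) (x : N) :
    localForm α x (extChartAt 𝓘(ℝ, F) x x) = α x := by
  rw [localForm_eq α (mem_extChartAt_target x)]
  have key : ∀ x', x' = x → ∀ η : F, α x' (ofCoord (E := F) x x' η) = α x η := by
    rintro _ rfl η
    rw [ofCoord_self]; rfl
  exact ContinuousLinearMap.ext (key _ (extChartAt_to_inv x))

theorem contDiffOn_localForm {α : ∀ x : N, TangentSpace 𝓘(ℝ, F) x →L[ℝ] ℝ}
    (hα : ContMDiff 𝓘(ℝ, F) (cotangentModel F) ∞ (fun x => (⟨x, α x⟩ : CotangentBundle F N)))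
    (x : N) : ContDiffOn ℝ ∞ (localForm α x) (extChartAt 𝓘(ℝ, F) x).target := by
  have h1 : ContMDiffOn 𝓘(ℝ, F) 𝓘(ℝ, F × (F →L[ℝ] ℝ)) ∞
      (fun y => cChart x (⟨(extChartAt 𝓘(ℝ, F) x).symm y, α ((extChartAt 𝓘(ℝ, F) x).symm y)⟩ :
        CotangentBundle F N)) (extChartAt 𝓘(ℝ, F) x).target := by
    refine (contMDiffOn_extChartAt (I := cotangentModel F) (n := ∞)
      (x := (⟨x, 0⟩ : CotangentBundle F N))).comp
      (hα.comp_contMDiffOn (contMDiffOn_extChartAt_symm (I := 𝓘(ℝ, F)) (n := ∞) x)) fun y hy => ?_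
    rw [← extChartAt_source (cotangentModel F)]
    exact mem_cChart_source.2 (symm_mem_source hy)
  refine (contMDiffOn_iff_contDiffOn.1 h1).snd.congr fun y hy => ?_
  rw [localForm_eq α hy]
  exact (congrArg Prod.snd (cChart_apply (symm_mem_source hy) _)).symm

end ContactCondition

section MainResult

variable {E : Type*} [NormedAddCommGroup E] [NormedSpace ℝ E] [FiniteDimensional ℝ E]
  {M : Type*} [TopologicalSpace M] [ChartedSpace E M] [IsManifold 𝓘(ℝ, E) ∞ M]
  {F : Type*} [NormedAddCommGroup F] [NormedSpace ℝ F] [FiniteDimensional ℝ F]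
  {C A : Set (TangentBundle 𝓘(ℝ, E) M)} {L : TangentBundle 𝓘(ℝ, E) M → ℝ}

omit [FiniteDimensional ℝ E] in
/-- A nonzero vector `x` of `C` and its negative, which is not in `C`, are joined in the complement
of the origin, as the dimension is at least two. -/
theorem IsStronglyConvexConeStructure.boundary_nonempty (hC : IsStronglyConvexConeStructure C)
    (hE : 2 ≤ Module.finrank ℝ E) [Nonempty M] : (boundary C).Nonempty := by
  obtain ⟨p⟩ := ‹Nonempty M›
  have hK := hC.fibre_cone p
  obtain ⟨x, hx⟩ := hK.interior_nonempty
  have hxK := interior_subset hx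
  have hx0 : x ≠ 0 := by rintro rfl; exact hK.zero_notMem hxK
  have hconn : IsPreconnected ({0}ᶜ : Set E) := (isConnected_compl_singleton_of_one_lt_rank
    (Module.one_lt_rank_of_one_lt_finrank (by omega)) 0).isPreconnected
  obtain ⟨y, hy0, hy⟩ : ∃ y, y ≠ 0 ∧ y ∈ frontier (fibre C p) := by
    by_contra! h
    obtain ⟨z, -, hz, hz'⟩ := hconn (interior (fibre C p)) (closure (fibre C p))ᶜ isOpen_interior
      isClosed_closure.isOpen_compl
      (fun y hy => or_iff_not_imp_right.2 fun h1 => by_contra fun h2 => h y hy ⟨not_not.1 h1, h2⟩)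
      ⟨x, hx0, hx⟩ ⟨-x, neg_ne_zero.2 hx0, fun h1 =>
        hK.neg_notMem x hxK (hK.closed _ h1 (neg_ne_zero.2 hx0))⟩
    exact hz' (subset_closure (interior_subset hz))
  exact ⟨⟨p, y⟩, (mem_boundary_iff hC).2 ⟨hy, hy0⟩⟩

variable [ChartedSpace F (GeodesicSpace C)] [IsManifold 𝓘(ℝ, F) ∞ (GeodesicSpace C)]
  (hπ : IsSubmersion (F := F) (geodesicProj C))
  (hL : IsLorentzFinslerMetric C A L) (hC : IsStronglyConvexConeStructure C)
  (hs : ∀ v ∈ A, v ∈ C ↔ L v ≤ 0)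
include hπ hL hC hs

/-- A smooth choice of push-forwards of the Liouville form is a contact form: near each point it is
a positive multiple of the form of `exists_local_projForm`. -/
theorem isContactForm_of_isProjForm [T2Space M] [Nonempty (GeodesicSpace C)]
    {α : ∀ x : GeodesicSpace C, TangentSpace 𝓘(ℝ, F) x →L[ℝ] ℝ}
    (hα : ContMDiff 𝓘(ℝ, F) (cotangentModel F) ∞
      (fun x => (⟨x, α x⟩ : CotangentBundle F (GeodesicSpace C))))
    (hαu : ∀ x, ∃ u : dualBoundary C, geodesicProj C u = x ∧ IsProjForm (F := F) C u (α x)) :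
    IsContactForm α := by
  obtain ⟨m, hm⟩ : ∃ m, Module.finrank ℝ F = 2 * m + 1 := by
    obtain ⟨-, -, -, -, -, -, -, -, -, h⟩ :=
      exists_local_projForm hπ hL hC hs (Classical.arbitrary (GeodesicSpace C))
    exact ⟨Module.finrank ℝ E - 2, by omega⟩
  refine ⟨hα, m, hm, fun x => ?_⟩
  obtain ⟨V, b, hV, hxV, hVt, hb, hbV, hb0, hnd, -⟩ := exists_local_projForm hπ hL hC hs x
  have hVn := hV.mem_nhds hxV
  have hdiff : DifferentiableAt ℝ (localForm α x) (extChartAt 𝓘(ℝ, F) x x) :=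
    (((contDiffOn_localForm hα x).mono hVt).contDiffAt hVn).differentiableAt (by simp)
  have hsmul : ∀ᶠ y in 𝓝 (extChartAt 𝓘(ℝ, F) x x), ∃ r : ℝ, 0 < r ∧ localForm α x y = r • b y := by
    filter_upwards [hVn] with y hy
    obtain ⟨u, hu, hub⟩ := hbV y hy
    obtain ⟨u', hu', hub'⟩ := hαu ((extChartAt 𝓘(ℝ, F) x).symm y)
    obtain ⟨r, hr, h1⟩ := hub.exists_smul hπ hL hC hs (hu.trans hu'.symm)
    refine ⟨r, hr, ?_⟩
    rw [localForm_eq α (hVt hy), hub'.unique hπ u'.2 h1]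
    refine ContinuousLinearMap.ext fun η => ?_
    exact congrArg (fun ζ => r * b y ζ) (toCoord_ofCoord (symm_mem_source (hVt hy)) η)
  obtain ⟨ha0, hnd'⟩ := nondegenerate_of_eventually_smul hdiff
    ((hb.contDiffAt hVn).differentiableAt (by simp)) hsmul hb0 hnd
  rw [localForm_self] at ha0 hnd'
  set D := fderiv ℝ (localForm α x) (extChartAt 𝓘(ℝ, F) x x) with hD
  let B : F →ₗ[ℝ] F →ₗ[ℝ] ℝ := LinearMap.mk₂ ℝ (fun v w => D v w - D w v)
    (fun v v' w => by simp only [map_add, _root_.add_apply]; ring)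
    (fun c v w => by simp only [map_smul, _root_.smul_apply, smul_eq_mul]; ring)
    (fun v w w' => by simp only [map_add, _root_.add_apply]; ring)
    (fun c v w => by simp only [map_smul, _root_.smul_apply, smul_eq_mul]; ring)
  have ha0' : (α x : F →L[ℝ] ℝ).toLinearMap ≠ 0 := fun h =>
    ha0 (ContinuousLinearMap.ext fun η => congrArg (fun l : F →ₗ[ℝ] ℝ => l η) h)
  exact exists_wedgePow_ne_zero hm (α x : F →L[ℝ] ℝ).toLinearMap ha0' B (fun v => sub_self _)
    fun η h1 h2 => hnd' η h1 h2

/-- The value of the one-form on the projection of a tangent vector of `∂C*` is a positive multiple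
of the value of the Liouville form. -/
theorem exists_pos_mul_liouville [T2Space M]
    {α : ∀ x : GeodesicSpace C, TangentSpace 𝓘(ℝ, F) x →L[ℝ] ℝ}
    (hαu : ∀ x, ∃ u : dualBoundary C, geodesicProj C u = x ∧ IsProjForm (F := F) C u (α x))
    {c : ℝ → dualBoundary C} (hc : IsSmoothCurve c) :
    ∃ r : ℝ, 0 < r ∧
      liouville (velocity (cotangentModel E) (fun t => (c t : CotangentBundle E M)) 0) =
        r * α (velocity 𝓘(ℝ, F) (geodesicProj C ∘ c) 0).proj
          (velocity 𝓘(ℝ, F) (geodesicProj C ∘ c) 0).2 := by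
  obtain ⟨u, hu, hu'⟩ := hαu (geodesicProj C (c 0))
  obtain ⟨r, hr, h⟩ := hu'.exists_smul hπ hL hC hs hu
  exact ⟨r, hr, (h c hc rfl).symm⟩

omit [FiniteDimensional ℝ E] [FiniteDimensional ℝ F]
  [IsManifold 𝓘(ℝ, F) ∞ (GeodesicSpace C)] hL hC hs in
theorem mem_geodesicDistribution_of_isProjForm
    {α : ∀ x : GeodesicSpace C, TangentSpace 𝓘(ℝ, F) x →L[ℝ] ℝ}
    (hαu : ∀ x, ∃ u : dualBoundary C, geodesicProj C u = x ∧ IsProjForm (F := F) C u (α x))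
    {y : TangentBundle 𝓘(ℝ, F) (GeodesicSpace C)} (hy : α y.proj y.2 = 0) :
    y ∈ geodesicDistribution C := by
  obtain ⟨u, hu, hu'⟩ := hαu y.proj
  obtain ⟨c, hc, rfl, h⟩ := hπ.surjective u y hu.symm
  refine ⟨c, hc, ?_, h.symm⟩
  rw [← hu' c hc rfl, h]
  exact hy

end MainResult

end ConeStr

end

theorem mainTheorem6
    {E : Type*} [NormedAddCommGroup E] [NormedSpace ℝ E] [FiniteDimensional ℝ E]
    (hE : 2 ≤ Module.finrank ℝ E)
    {M : Type*} [TopologicalSpace M] [ChartedSpace E M] [IsManifold 𝓘(ℝ, E) ∞ M]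
    [T2Space M] [SecondCountableTopology M] [Nonempty M]
    (C : Set (TangentBundle 𝓘(ℝ, E) M))
    (hC : IsStronglyConvexConeStructure C) (hsc : IsStronglyCausal C)
    {F : Type*} [NormedAddCommGroup F] [NormedSpace ℝ F] [FiniteDimensional ℝ F]
    [ChartedSpace F (GeodesicSpace C)] [IsManifold 𝓘(ℝ, F) ∞ (GeodesicSpace C)]
    [T2Space (GeodesicSpace C)]
    (hπ : IsSubmersion (F := F) (geodesicProj C)) :
    ∃ α : ∀ x : GeodesicSpace C, TangentSpace 𝓘(ℝ, F) x →L[ℝ] ℝ,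
      IsContactForm α ∧
      (∀ y : TangentBundle 𝓘(ℝ, F) (GeodesicSpace C),
        y ∈ geodesicDistribution C ↔ α y.proj y.2 = 0) ∧
      (∀ c : ℝ → dualBoundary C, IsSmoothCurve c →
        (0 < α (velocity 𝓘(ℝ, F) (geodesicProj C ∘ c) 0).proj
            (velocity 𝓘(ℝ, F) (geodesicProj C ∘ c) 0).2 ↔
          0 < liouville
            (velocity (cotangentModel E) (fun t => (c t : CotangentBundle E M)) 0))) := by
  obtain ⟨A, L, hL, hs⟩ := exists_lorentzFinslerMetric hC
  obtain ⟨v, hv⟩ := hC.boundary_nonempty hE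
  have : Nonempty (GeodesicSpace C) :=
    ⟨geodesicProj C ⟨coLegendre L v, coLegendre_mem_dualBoundary hL hC hs hv⟩⟩
  obtain ⟨α, hα, hαu⟩ := exists_global_projForm hπ hL hC hs
  refine ⟨α, isContactForm_of_isProjForm hπ hL hC hs hα hαu, fun y =>
    ⟨?_, mem_geodesicDistribution_of_isProjForm hπ hαu⟩, fun c hc => ?_⟩
  · rintro ⟨c, hc, hc0, rfl⟩
    obtain ⟨r, hr, h⟩ := exists_pos_mul_liouville hπ hL hC hs hαu hc
    exact (mul_eq_zero.1 (h.symm.trans hc0)).resolve_left hr.ne'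
  · obtain ⟨r, hr, h⟩ := exists_pos_mul_liouville hπ hL hC hs hαu hc
    rw [h]
    exact (mul_pos_iff_of_pos_left hr).symm
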